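/- **Setting.** Let $\beta>0$, $\beta'=\beta/2$, $n\ge 1$ and $\delta\in\mathbb C$ with $\Re\delta>-1/2$. Under $\mathrm{CJ}^{(n)}_{\beta,\delta}$, $\mu=\sum_{j=1}^n\pi_j\,\delta_{e^{i\theta_j}}$ is a random probability measure on the unit circle such that $(\theta_1,\dots,\theta_n)$ has a density on $[0,2\pi)^n$ proportional to $$\prod_{j<k}|e^{i\theta_j}-e^{i\theta_k}|^{\beta}\prod_{j=1}^n(1-e^{-i\theta_j})^{\delta}(1-e^{i\theta_j})^{\bar\delta},$$ $(\pi_1,\dots,\pi_n)$ follows the symmetric Dirichlet law of parameter $\beta'$ on the simplex, and these two vectors are independent. Let $\Phi_{0,n}=1,\Phi_{1,n},\dots,\Phi_{n,n}$ be the monic orthogonal polynomials obtained from $1,z,\dots,z^n$ by the Gram–Schmidt procedure in $L^2(\mu)$, so that $\Phi_n:=\Phi_{n,n}=\prod_{j}(z-e^{i\theta_j})$. Put $\log\Phi_{k,n}(1):=\sum_{\lambda}\log(1-\lambda)$, where $\lambda$ runs through the zeros of $\Phi_{k,n}$ counted with multiplicity and $\log$ is the principal logarithm. Write $\log\Phi_{\lfloor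 nt\rfloor,n}(1)-\mathbb E\log\Phi_{\lfloor nt\rfloor,n}(1)=\xi_n(t)+i\eta_n(t)$, with $\xi_n,\eta_n$ real, and $\zeta_n(t)=(\xi_n(t),\eta_n(t))^{T}$. For $\mathsf d\in\mathbb C$ with $\Re \mathsf d>0$ and $0\le t\le1$ put, with principal logarithms, $\mathcal J(u)=u\log u-u+1$ and $$\mathcal E_{\mathsf d}(t)=\mathcal J(1+2\Re \mathsf d)-\mathcal J(1+2\Re \mathsf d-t)-\mathcal J(1+\bar{\mathsf d})+\mathcal J(1+\bar{\mathsf d}-t),$$ $$\mathcal F_{\mathsf d}(t)=\log(1+2\Re \mathsf d)-\log(1+\bar{\mathsf d})-\log(1-t+2\Re \mathsf d)+\log(1-t+\bar{\mathsf d}),$$ $$\mathcal Z^{\mathsf d}_t=\frac1{\beta'}\begin{pmatrix}\frac1{1-t+2\Re \mathsf d}-\Re\frac1{2(1-t+\mathsf d)}&\Im\frac1{2(1-t+\mathsf d)}\\ \Im\frac1{2(1-t+\mathsf d)}&\Re\frac1{2(1-t+\mathsf d)}\end{pmatrix},$$ and let $\mathcal Z^0_t=\frac1{\beta(1-t)}I_2$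 for $0\le t<1$, where $I_2$ is the $2\times2$ identity matrix. **Theorem 2.1.** In both regimes below, for all $0\le k\le n$, $n\ge1$, the random variable $\log\Phi_{k,n}(1)$ is square integrable. *First regime: $\delta$ is fixed, $\Re\delta>-1/2$, and $n\to\infty$ under $\mathrm{CJ}^{(n)}_{\beta,\delta}$.* 1. There is a constant $C\in\mathbb C$ (depending on $\beta,\delta$) such that $\mathbb E\log\Phi_n(1)=\frac{\delta}{\beta'}\log n+C+o(1)$; and for $0<t<1$, $\mathbb E\log\Phi_{\lfloor nt\rfloor,n}(1)=-\frac{\delta}{\beta'}\log(1-t)+o(1)$. 2. $\lim_{n}\frac1{\log n}\operatorname{cov}\zeta_n(1)=\frac1\beta I_2$; and for $0<t<1$, $\lim_n\operatorname{cov}\zeta_n(t)=\int_0^t\mathcal Z^0_s\,ds$. *Second regime: $\mathsf d\in\mathbb C$ is fixed, $\Re \mathsf d>0$, and $n\to\infty$ under $\mathrm{CJ}^{(n)}_{\beta,\delta}$ with $\delta=\beta'\mathsf d\,n$.* 3. Uniformly in $t\in(0,1]$, $$\lim_{n\to\infty}\Big(\mathbb E\log\Phi_{\lfloor nt\rfloor,n}(1)-n\,\mathcal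 E_{\mathsf d}\big(\tfrac{\lfloor nt\rfloor}n\big)\Big)=\Big(\frac1\beta-\frac12\Big)\mathcal F_{\mathsf d}(t).$$ 4. For $0<t\le1$, $\lim_n\operatorname{cov}\zeta_n(t)=\int_0^t\mathcal Z^{\mathsf d}_s\,ds$. 5. $\sup_{t\in[0,1]}\big|\frac1n\log\Phi_{\lfloor nt\rfloor,n}(1)-\mathcal E_{\mathsf d}(t)\big|\to0$ as $n\to\infty$, in $L^2$ and in probability. -/

import Mathlib

noncomputable section

namespace CircularJacobi

open MeasureTheory Polynomial
open scoped ENNReal ComplexConjugate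

/-! ### The law of the random spectral measure -/

/-- A measure divided by its total mass. -/
def normalize {Ω : Type*} [MeasurableSpace Ω] (μ : Measure Ω) : Measure Ω :=
  (μ Set.univ)⁻¹ • μ

/-- The point of the unit circle with angle `θ`. -/
def circlePoint (θ : ℝ) : ℂ := Complex.exp (θ * Complex.I)

/-- The unnormalized joint density of the angles,
`|Δ(e^{iθ₁}, …, e^{iθₙ})|^β ∏ⱼ (1 - e^{-iθⱼ})^δ (1 - e^{iθⱼ})^{conj δ}`.
Each factor of the last product is `|(1 - e^{-iθ})^δ|²`, a nonnegative real number
(principal branch), and we record it as the real part of the complex expression. -/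
def angleDensity (β : ℝ) (δ : ℂ) {n : ℕ} (θ : Fin n → ℝ) : ℝ :=
  ‖∏ i, ∏ j ∈ Finset.Ioi i, (circlePoint (θ j) - circlePoint (θ i))‖ ^ β *
    ∏ j, ((1 - circlePoint (-θ j)) ^ δ * (1 - circlePoint (θ j)) ^ (conj δ)).re

/-- The law of the angles `(θ₁, …, θₙ)` on `[0, 2π)ⁿ`. -/
def angleLaw (β : ℝ) (δ : ℂ) (n : ℕ) : Measure (Fin n → ℝ) :=
  normalize
    ((volume.restrict (Set.univ.pi fun _ : Fin n => Set.Ico 0 (2 * Real.pi))).withDensity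
      fun θ => ENNReal.ofReal (angleDensity β δ θ))

/-- The symmetric Dirichlet law of parameter `a` on the simplex
`π₁ + ⋯ + πₙ = 1`, `πⱼ > 0`: its density with respect to the Lebesgue measure in the first
`n - 1` coordinates is proportional to `∏ⱼ πⱼ ^ (a - 1)`, the last coordinate being
`1 - π₁ - ⋯ - πₙ₋₁`. (For `n = 0` the value is irrelevant.) -/
def dirichletLaw (a : ℝ) : (n : ℕ) → Measure (Fin n → ℝ)
  | 0 => Measure.dirac 0
  | m + 1 =>
    (normalize
      ((volume.restrict {x : Fin m → ℝ | (∀ i, 0 < x i) ∧ ∑ i, x i < 1}).withDensity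
        fun x => ENNReal.ofReal ((∏ i, x i ^ (a - 1)) * (1 - ∑ i, x i) ^ (a - 1)))).map
      fun x => Fin.snoc (α := fun _ => ℝ) x (1 - ∑ i, x i)

/-- The distribution `CJ_{β,δ}^{(n)}`, as the joint law of the angles and of the weights, which
are independent, the weights being Dirichlet of parameter `β' = β / 2`. -/
def cjLaw (β : ℝ) (δ : ℂ) (n : ℕ) : Measure ((Fin n → ℝ) × (Fin n → ℝ)) :=
  (angleLaw β δ n).prod (dirichletLaw (β / 2) n)

/-- The random measure `∑ⱼ πⱼ δ_{e^{iθⱼ}}`, where `ω = (θ, π)`. -/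
def spectralMeasure {n : ℕ} (ω : (Fin n → ℝ) × (Fin n → ℝ)) : Measure ℂ :=
  ∑ j, ENNReal.ofReal (ω.2 j) • Measure.dirac (circlePoint (ω.1 j))

/-! ### Monic orthogonal polynomials -/

/-- The scalar product of two polynomials in `L²(μ)`, conjugate-linear in the first one. -/
def innerL2 (μ : Measure ℂ) (P Q : ℂ[X]) : ℂ :=
  ∫ z, conj (P.eval z) * Q.eval z ∂μ

/-- The monic orthogonal polynomials of `μ`, by the Gram-Schmidt procedure applied to
`1, z, z², …`. If `μ` is supported by exactly `n` points, this is meaningful up to degree `n`: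
the polynomials of degree `< n` are nonzero in `L²(μ)`, and the one of degree `n` vanishes on
the support of `μ`, that is, it equals `∏ⱼ (z - e^{iθⱼ})`. -/
def monicOP (μ : Measure ℂ) : ℕ → ℂ[X]
  | k => X ^ k - ∑ j : Fin k,
      C (innerL2 μ (monicOP μ j) (X ^ k) / innerL2 μ (monicOP μ j) (monicOP μ j)) *
        monicOP μ j
  termination_by k => k
  decreasing_by all_goals exact j.2

/-- `Φ_{k,n}`, the monic orthogonal polynomial of degree `k` of the random measure. -/
def Phi {n : ℕ} (k : ℕ) (ω : (Fin n → ℝ) × (Fin n → ℝ)) : ℂ[X] :=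
  monicOP (spectralMeasure ω) k

/-- `log Φ_{k,n}(1) = ∑ log (1 - λ)` with the principal logarithm, where `λ` runs through the zeros
of `Φ_{k,n}` with multiplicity. These zeros are the eigenvalues of the `k × k` top left block of
the unitary matrix of multiplication by `z` in an orthonormal basis of polynomials, so that this is
the continuous determination of `log det (1 - ·)` at that block. Almost surely they all lie in the
closed unit disc and differ from `1`. -/
def logPhi {n : ℕ} (k : ℕ) (ω : (Fin n → ℝ) × (Fin n → ℝ)) : ℂ :=
  ((Phi k ω).roots.map fun z => Complex.log (1 - z)).sum

/-- `𝔼 log Φ_{⌊nt⌋,n}(1)` under `CJ_{β,δ}^{(n)}`. -/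
def meanLogPhi (β : ℝ) (δ : ℂ) (n : ℕ) (t : ℝ) : ℂ :=
  ∫ ω, logPhi (n := n) ⌊(n : ℝ) * t⌋₊ ω ∂(cjLaw β δ n)

/-- The vector `ζₙ(t) = (ξₙ(t), ηₙ(t))` of the real and imaginary parts of
`log Φ_{⌊nt⌋,n}(1) - 𝔼 log Φ_{⌊nt⌋,n}(1)`. -/
def zeta (β : ℝ) (δ : ℂ) (n : ℕ) (t : ℝ) (ω : (Fin n → ℝ) × (Fin n → ℝ)) : Fin 2 → ℝ :=
  ![(logPhi ⌊(n : ℝ) * t⌋₊ ω - meanLogPhi β δ n t).re,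
    (logPhi ⌊(n : ℝ) * t⌋₊ ω - meanLogPhi β δ n t).im]

/-- The covariance matrix of `ζₙ(t)` under `CJ_{β,δ}^{(n)}`. -/
def covZeta (β : ℝ) (δ : ℂ) (n : ℕ) (t : ℝ) : Matrix (Fin 2) (Fin 2) ℝ :=
  Matrix.of fun i j =>
    ProbabilityTheory.covariance (fun ω => zeta β δ n t ω i) (fun ω => zeta β δ n t ω j)
      (cjLaw β δ n)

/-! ### The limits -/

/-- The entropy function `𝒥(u) = u log u - u + 1`, principal logarithm. -/
def entropyJ (u : ℂ) : ℂ := u * Complex.log u - u + 1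

/-- The function `ℰ_d`. -/
def limE (d : ℂ) (t : ℝ) : ℂ :=
  entropyJ (1 + 2 * d.re) - entropyJ (1 + 2 * d.re - t) - entropyJ (1 + conj d)
    + entropyJ (1 + conj d - t)

/-- The function `ℱ_d`. -/
def limF (d : ℂ) (t : ℝ) : ℂ :=
  Complex.log (1 + 2 * d.re) - Complex.log (1 + conj d) - Complex.log (1 - t + 2 * d.re)
    + Complex.log (1 - t + conj d)

/-- The matrix `𝒵⁰_t = I₂ / (β (1 - t))`. -/
def limZ0 (β : ℝ) (t : ℝ) : Matrix (Fin 2) (Fin 2) ℝ :=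
  (1 / (β * (1 - t))) • (1 : Matrix (Fin 2) (Fin 2) ℝ)

/-- The matrix `𝒵^d_t`, for `Re d > 0`. -/
def limZ (β : ℝ) (d : ℂ) (t : ℝ) : Matrix (Fin 2) (Fin 2) ℝ :=
  (1 / (β / 2)) •
    !![1 / (1 - t + 2 * d.re) - (1 / (2 * (1 - t + d))).re, (1 / (2 * (1 - t + d))).im;
       (1 / (2 * (1 - t + d))).im, (1 / (2 * (1 - t + d))).re]

/-- The entrywise integral over `[0, t]` of a matrix-valued function. -/
def matrixIntegral (Z : ℝ → Matrix (Fin 2) (Fin 2) ℝ) (t : ℝ) : Matrix (Fin 2) (Fin 2) ℝ :=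
  Matrix.of fun i j => ∫ s in (0 : ℝ)..t, Z s i j

/-- `sup_{t ∈ [0,1]} |n⁻¹ log Φ_{⌊nt⌋,n}(1) - ℰ_d(t)|`, as an extended nonnegative real. -/
def supDeviation (d : ℂ) (n : ℕ) (ω : (Fin n → ℝ) × (Fin n → ℝ)) : ℝ≥0∞ :=
  ⨆ t ∈ Set.Icc (0 : ℝ) 1, ‖logPhi ⌊(n : ℝ) * t⌋₊ ω / (n : ℂ) - limE d t‖ₑ

end CircularJacobi

end

/-!
Evaluate the Szegő recursion at `1`. With the deformed Verblunsky coefficients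
`γ_k = 1 - Φ_{k+1}(1) / Φ_k(1)` (`verb`) one has `Φ_k(1) = ∏_{i<k} (1 - γ_i)`, and this
factorization holds for the logarithms as they are normalized here:
`log Φ_k(1) = ∑_{i<k} log (1 - γ_i)` (`logPhi_eq_sum`), by uniqueness of a continuous logarithm
along `∏_λ (1 - λ s)`, `0 ≤ s ≤ 1`. Under the circular Jacobi law the `γ_k` are independent with
explicit densities (`lintegral_cjLaw_prod_verb`), so that `log Φ_k(1)` is a sum of independent
variables, whose first two moments can be computed.

*Independence.* Take `β = 2` and uniform weights first. The map from the angles and the weights to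
the moments `c_1, …, c_{n-1}` and the product of the nodes has an explicit Jacobian
(`abs_det_momentMapDeriv`), and the moments are a triangular function of `γ_0, …, γ_{n-2}`
(`setLIntegral_momentsToVerb`). Instead of the surjectivity of this parametrization, only the
inclusion of its image in the polydisc is used: it gives an inequality between two finite measures
(`lintegral_sector_le`), and they are equal because they have the same total mass
(`setLIntegral_coordBox_verbMap`). For general `β` and `δ`, the density with respect to this case
factorizes over the `γ_k` (`angleDensity_mul_dirichletDensity`), since
`|Δ|² ∏ π_j = ∏ (1 - |γ_j|²)^{n-1-j}` and `log Φ_n(1) = ∑ log (1 - γ_j)`.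

*Moments.* The law of `γ_k` has the weight `(1 - |z|²)^{l-1} |(1 - z)^{conj δ}|²` with
`l = β' (n - 1 - k)`, and for `l = 0` it lives on the circle. Its normalization constant is, up to a
factor which does not depend on `δ`, the value at `1` of a hypergeometric series
(`verbIntegral_of_pos`, `verbIntegral_zero`), which the contiguity relation turns into an infinite
product (`hasSum_log_gaussSum`). Tilting by a real linear functional of `log Φ_k(1)` amounts to a
shift of `δ`; hence the cumulant generating functions of these functionals are differences of
logarithms of such products, and their derivatives give the mean as a sum of differences of values
of the digamma function, and the covariance as a sum of values of the trigamma function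
(`integral_logPhi`, `covZeta_eq`).

*Asymptotics.* For fixed `δ` these sums are harmonic sums up to summable errors
(`tendsto_sum_reverse`, `exists_tendsto_sum_reverse_sub_log`). For `δ` proportional to `n`, each
term is the decrement of an explicit function up to `O(n⁻²)`, and the sums telescope
(`norm_sum_logHalf_sub_le`, `norm_sum_trigamma_sub_le`). The second moments of the fluctuations of
`log Φ_k(1)` are then bounded uniformly in `k ≤ n`; their sum over `k`, divided by `n²`, tends to
zero, which controls the uniform deviation (`exists_majorant_supDeviation`).
-/

noncomputable section

namespace CircularJacobi

open MeasureTheory Polynomial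
open scoped ENNReal ComplexConjugate

/-! ### Orthogonal polynomials of a finitely supported measure on the circle -/

/-- The point configurations for which `∑ⱼ πⱼ δ_{e^{iθⱼ}}` is a probability measure with exactly
`n` atoms. -/
structure IsGeneric {n : ℕ} (ω : (Fin n → ℝ) × (Fin n → ℝ)) : Prop where
  inj : Function.Injective fun j => circlePoint (ω.1 j)
  pos : ∀ j, 0 < ω.2 j
  sum_eq_one : ∑ j, ω.2 j = 1

theorem norm_circlePoint (θ : ℝ) : ‖circlePoint θ‖ = 1 := Complex.norm_exp_ofReal_mul_I θ

theorem circlePoint_ne_zero (θ : ℝ) : circlePoint θ ≠ 0 := Complex.exp_ne_zero _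

theorem conj_circlePoint (θ : ℝ) : conj (circlePoint θ) = (circlePoint θ)⁻¹ := by
  rw [Complex.inv_def, Complex.normSq_eq_norm_sq, norm_circlePoint]; simp

theorem circlePoint_mul_conj (θ : ℝ) : circlePoint θ * conj (circlePoint θ) = 1 := by
  rw [conj_circlePoint, mul_inv_cancel₀ (circlePoint_ne_zero θ)]

section OPUC

variable {n : ℕ} (ω : (Fin n → ℝ) × (Fin n → ℝ))

/-- The scalar product of `L²(μ)` on polynomials, for `μ = ∑ⱼ πⱼ δ_{e^{iθⱼ}}`, as a finite sum. -/
def ip (P Q : ℂ[X]) : ℂ :=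
  ∑ j, (ω.2 j : ℂ) * (conj (P.eval (circlePoint (ω.1 j))) * Q.eval (circlePoint (ω.1 j)))

/-- The square of the norm of a polynomial in `L²(μ)`. -/
def nrm (P : ℂ[X]) : ℝ := ∑ j, ω.2 j * ‖P.eval (circlePoint (ω.1 j))‖ ^ 2

variable {ω}

theorem innerL2_spectralMeasure (h : ∀ j, 0 ≤ ω.2 j) (P Q : ℂ[X]) :
    innerL2 (spectralMeasure ω) P Q = ip ω P Q := by
  unfold innerL2 spectralMeasure ip
  rw [integral_finsetSum_measure]
  · refine Finset.sum_congr rfl fun j _ => ?_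
    rw [integral_smul_measure, integral_dirac, ENNReal.toReal_ofReal (h j)]
    simp
  · intro j _
    exact (integrable_dirac (by simp [enorm_mul, ENNReal.mul_lt_top_iff])).smul_measure (by simp)

theorem ip_conj_symm (P Q : ℂ[X]) : conj (ip ω P Q) = ip ω Q P := by
  simp only [ip, map_sum, map_mul, Complex.conj_ofReal, Complex.conj_conj]
  exact Finset.sum_congr rfl fun j _ => by ring

theorem ip_add_right (P Q R : ℂ[X]) : ip ω P (Q + R) = ip ω P Q + ip ω P R := by
  simp [ip, mul_add, Finset.sum_add_distrib]

theorem ip_sub_right (P Q R : ℂ[X]) : ip ω P (Q - R) = ip ω P Q - ip ω P R := by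
  simp [ip, mul_sub, Finset.sum_sub_distrib]

theorem ip_C_mul_right (P Q : ℂ[X]) (a : ℂ) : ip ω P (C a * Q) = a * ip ω P Q := by
  simp only [ip, eval_mul, eval_C, Finset.mul_sum]
  exact Finset.sum_congr rfl fun j _ => by ring

theorem ip_sum_right {ι : Type*} (s : Finset ι) (P : ℂ[X]) (Q : ι → ℂ[X]) :
    ip ω P (∑ i ∈ s, Q i) = ∑ i ∈ s, ip ω P (Q i) := by
  simp only [ip, eval_finsetSum, Finset.mul_sum]
  exact Finset.sum_comm

theorem ip_add_left (P Q R : ℂ[X]) : ip ω (P + Q) R = ip ω P R + ip ω Q R := by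
  simp [ip, add_mul, mul_add, Finset.sum_add_distrib]

theorem ip_sub_left (P Q R : ℂ[X]) : ip ω (P - Q) R = ip ω P R - ip ω Q R := by
  simp [ip, sub_mul, mul_sub, Finset.sum_sub_distrib]

theorem ip_C_mul_left (P Q : ℂ[X]) (a : ℂ) : ip ω (C a * P) Q = conj a * ip ω P Q := by
  simp only [ip, eval_mul, eval_C, Finset.mul_sum, map_mul]
  exact Finset.sum_congr rfl fun j _ => by ring

theorem ip_X_mul_X_mul (P Q : ℂ[X]) : ip ω (X * P) (X * Q) = ip ω P Q := by
  refine Finset.sum_congr rfl fun j _ => ?_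
  simp only [eval_mul, eval_X, map_mul]
  linear_combination (ω.2 j : ℂ) * conj (P.eval (circlePoint (ω.1 j))) *
    Q.eval (circlePoint (ω.1 j)) * circlePoint_mul_conj (ω.1 j)

theorem ip_self (P : ℂ[X]) : ip ω P P = nrm ω P := by
  simp only [ip, nrm, Complex.ofReal_sum, Complex.ofReal_mul]
  refine Finset.sum_congr rfl fun j _ => ?_
  rw [Complex.conj_mul', Complex.ofReal_pow]

theorem nrm_pos (h : IsGeneric ω) {P : ℂ[X]} (h0 : P ≠ 0) (hd : P.natDegree < n) :
    0 < nrm ω P := by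
  by_contra hle
  apply h0
  have h1 : ∀ j, 0 ≤ ω.2 j * ‖P.eval (circlePoint (ω.1 j))‖ ^ 2 := fun j =>
    mul_nonneg (h.pos j).le (by positivity)
  have h2 : nrm ω P = 0 := le_antisymm (not_lt.1 hle) (Finset.sum_nonneg fun j _ => h1 j)
  have h3 := (Finset.sum_eq_zero_iff_of_nonneg fun j _ => h1 j).1 h2
  refine Polynomial.eq_zero_of_natDegree_lt_card_of_eval_eq_zero P h.inj (fun j => ?_)
    (by simpa using hd)
  have := h3 j (Finset.mem_univ j)
  simpa [(h.pos j).ne'] using this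

theorem eq_zero_of_ip_self (h : IsGeneric ω) {P : ℂ[X]} (h0 : ip ω P P = 0)
    (hd : P.natDegree < n) : P = 0 := by
  by_contra hP
  rw [ip_self] at h0
  exact (nrm_pos h hP hd).ne' (by exact_mod_cast h0)

theorem Phi_monic_natDegree (k : ℕ) : (Phi k ω).Monic ∧ (Phi k ω).natDegree = k := by
  induction k using Nat.strong_induction_on with
  | _ k ih =>
    unfold Phi at *
    rw [monicOP]
    set S := ∑ j : Fin k, C (innerL2 (spectralMeasure ω) (monicOP (spectralMeasure ω) j) (X ^ k) /
      innerL2 (spectralMeasure ω) (monicOP (spectralMeasure ω) j)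
        (monicOP (spectralMeasure ω) j)) * monicOP (spectralMeasure ω) j with hS
    have hdeg : S.degree < k := by
      refine (Polynomial.degree_sum_le _ _).trans_lt ?_
      rw [Finset.sup_lt_iff (by exact WithBot.bot_lt_coe k)]
      intro j _
      refine degree_le_natDegree.trans_lt ?_
      have := natDegree_C_mul_le (innerL2 (spectralMeasure ω) (monicOP (spectralMeasure ω) j)
        (X ^ k) / innerL2 (spectralMeasure ω) (monicOP (spectralMeasure ω) j)
        (monicOP (spectralMeasure ω) j)) (monicOP (spectralMeasure ω) j)
      rw [(ih j j.2).2] at this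
      exact_mod_cast this.trans_lt j.2
    refine ⟨monic_X_pow_sub hdeg, ?_⟩
    refine natDegree_eq_of_degree_eq_some ?_
    rw [degree_sub_eq_left_of_degree_lt (by rwa [degree_X_pow]), degree_X_pow]

theorem Phi_monic (k : ℕ) : (Phi k ω).Monic := (Phi_monic_natDegree k).1

theorem natDegree_Phi (k : ℕ) : (Phi k ω).natDegree = k := (Phi_monic_natDegree k).2

theorem Phi_ne_zero (k : ℕ) : Phi k ω ≠ 0 := (Phi_monic k).ne_zero

theorem Phi_zero : Phi 0 ω = 1 := by
  unfold Phi; rw [monicOP]; simp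

theorem nrm_Phi_pos (h : IsGeneric ω) {k : ℕ} (hk : k < n) : 0 < nrm ω (Phi k ω) :=
  nrm_pos h (Phi_ne_zero k) (by rwa [natDegree_Phi])

/-- A conjugate-linear functional which kills `Φ₀, …, Φ_{k-1}` kills the polynomials of degree
`< k`. -/
theorem ip_eq_zero_of_degree_lt {Q : ℂ[X]} {k : ℕ} (hQ : ∀ i < k, ip ω (Phi i ω) Q = 0)
    {P : ℂ[X]} (hP : P.degree < k) : ip ω P Q = 0 := by
  induction k generalizing P with
  | zero =>
    have : P = 0 := by simpa using hP
    subst this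
    simp [ip]
  | succ k ih =>
    have hsub : (P - C (P.coeff k) * Phi k ω).degree < k := by
      rw [degree_lt_iff_coeff_zero]
      intro m hm
      rcases hm.eq_or_lt with rfl | hm
      · have := (Phi_monic (ω := ω) k).coeff_natDegree
        rw [natDegree_Phi] at this
        simp [this]
      · rw [coeff_sub, coeff_C_mul, coeff_eq_zero_of_natDegree_lt (p := Phi k ω)
          (by rw [natDegree_Phi]; exact hm)]
        rw [degree_lt_iff_coeff_zero] at hP
        rw [hP m hm]; simp
    have h1 := ih (fun i hi => hQ i (hi.trans k.lt_succ_self)) hsub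
    rw [ip_sub_left, ip_C_mul_left, hQ k k.lt_succ_self] at h1
    simpa using h1

/-- Orthogonality. The case `k = n` is included: the Gram-Schmidt procedure only divides by the
norms of `Φ_0, …, Φ_{k-1}`, which are positive. -/
theorem ip_Phi_eq_zero (h : IsGeneric ω) {k : ℕ} (hk : k ≤ n) {P : ℂ[X]} (hP : P.degree < k) :
    ip ω P (Phi k ω) = 0 := by
  induction k using Nat.strong_induction_on generalizing P with
  | _ k ih =>
    refine ip_eq_zero_of_degree_lt (fun i hi => ?_) hP
    have hort : ∀ j : Fin k, (j : ℕ) ≠ i → ip ω (Phi i ω) (Phi j ω) = 0 := by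
      intro j hj
      rcases lt_or_gt_of_ne hj with hj | hj
      · rw [← ip_conj_symm, ih i hi (hi.le.trans hk), map_zero]
        exact degree_le_natDegree.trans_lt (by rw [natDegree_Phi]; exact_mod_cast hj)
      · exact ih j j.2 (j.2.le.trans hk)
          (degree_le_natDegree.trans_lt (by rw [natDegree_Phi]; exact_mod_cast hj))
    have hne : ip ω (Phi i ω) (Phi i ω) ≠ 0 := by
      rw [ip_self]
      exact_mod_cast (nrm_Phi_pos h (hi.trans_le hk)).ne'
    have hrec : Phi k ω = X ^ k - ∑ j : Fin k,
        C (ip ω (Phi j ω) (X ^ k) / ip ω (Phi j ω) (Phi j ω)) * Phi j ω := by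
      simp only [← innerL2_spectralMeasure fun j => (h.pos j).le]
      unfold Phi
      conv_lhs => rw [monicOP]
    rw [hrec, ip_sub_right, ip_sum_right, Finset.sum_eq_single ⟨i, hi⟩]
    · rw [ip_C_mul_right, div_mul_cancel₀ _ hne, sub_self]
    · intro j _ hj
      rw [ip_C_mul_right, hort j (fun h => hj (Fin.ext h)), mul_zero]
    · simp

/-- By orthogonality, only the coefficient of index `k` of `P` contributes to its pairing with
`Φ_k`. -/
theorem ip_Phi_of_natDegree_le (h : IsGeneric ω) {k : ℕ} (hk : k ≤ n) {P : ℂ[X]}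
    (hP : P.natDegree ≤ k) :
    ip ω P (Phi k ω) = conj (P.coeff k) * nrm ω (Phi k ω) := by
  have hsub : (P - C (P.coeff k) * Phi k ω).degree < k := by
    rw [degree_lt_iff_coeff_zero]
    intro m hm
    rcases hm.eq_or_lt with rfl | hm
    · have := (Phi_monic (ω := ω) k).coeff_natDegree
      rw [natDegree_Phi] at this
      simp [this]
    · rw [coeff_sub, coeff_C_mul, coeff_eq_zero_of_natDegree_lt (p := Phi k ω)
        (by rw [natDegree_Phi]; exact hm), coeff_eq_zero_of_natDegree_lt (hP.trans_lt hm)]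
      simp
  have h1 := ip_Phi_eq_zero h hk hsub
  rw [ip_sub_left, ip_C_mul_left, ip_self] at h1
  exact sub_eq_zero.1 h1

/-- The node polynomial `∏ⱼ (X - e^{iθⱼ})`. -/
def nodePoly (θ : Fin n → ℝ) : ℂ[X] := ∏ j, (X - C (circlePoint (θ j)))

theorem nodePoly_monic (θ : Fin n → ℝ) : (nodePoly θ).Monic :=
  monic_prod_of_monic _ _ fun _ _ => monic_X_sub_C _

theorem natDegree_nodePoly (θ : Fin n → ℝ) : (nodePoly θ).natDegree = n := by
  rw [nodePoly, natDegree_prod_of_monic _ _ fun j _ => monic_X_sub_C _]; simp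

theorem eval_nodePoly_node (θ : Fin n → ℝ) (j : Fin n) :
    (nodePoly θ).eval (circlePoint (θ j)) = 0 := by
  rw [nodePoly, eval_prod]
  exact Finset.prod_eq_zero (Finset.mem_univ j) (by simp)

theorem degree_sub_lt_of_monic {P Q : ℂ[X]} {k : ℕ} (hP : P.Monic) (hQ : Q.Monic)
    (hPk : P.natDegree = k) (hQk : Q.natDegree = k) : (P - Q).degree < k := by
  have := degree_sub_lt_left (p := P) (q := Q)
    (by rw [degree_eq_natDegree hP.ne_zero, degree_eq_natDegree hQ.ne_zero, hPk, hQk])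
    hP.ne_zero (by rw [hP.leadingCoeff, hQ.leadingCoeff])
  rwa [degree_eq_natDegree hP.ne_zero, hPk] at this

/-- `Φ_n` minus the node polynomial has degree `< n` and zero norm, since the node polynomial
vanishes in `L²(μ)` and `Φ_n` is orthogonal to that difference. -/
theorem Phi_eq_nodePoly (h : IsGeneric ω) : Phi n ω = nodePoly ω.1 := by
  have hdeg := degree_sub_lt_of_monic (Phi_monic (ω := ω) n) (nodePoly_monic ω.1)
    (natDegree_Phi n) (natDegree_nodePoly ω.1)
  rw [← sub_eq_zero]
  have h1 : ip ω (Phi n ω - nodePoly ω.1) (Phi n ω - nodePoly ω.1) = 0 := by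
    rw [ip_sub_right, ip_Phi_eq_zero h le_rfl hdeg, zero_sub, neg_eq_zero]
    exact Finset.sum_eq_zero fun j _ => by rw [eval_nodePoly_node]; ring
  by_contra hne
  exact hne (eq_zero_of_ip_self h h1 ((natDegree_lt_iff_degree_lt hne).2 hdeg))

/-! ### The Szegő recursion -/

/-- The reversed polynomial `P*(z) = z ^ k conj (P (1 / conj z))`. -/
def starPoly (k : ℕ) (P : ℂ[X]) : ℂ[X] := (P.map (starRingEnd ℂ)).reflect k

theorem coeff_starPoly {k i : ℕ} (hi : i ≤ k) (P : ℂ[X]) :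
    (starPoly k P).coeff i = conj (P.coeff (k - i)) := by
  rw [starPoly, coeff_reflect, revAt_le hi, coeff_map]

theorem natDegree_starPoly {k : ℕ} {P : ℂ[X]} (hP : P.natDegree ≤ k) :
    (starPoly k P).natDegree ≤ k := by
  rw [natDegree_le_iff_coeff_eq_zero]
  intro i hi
  rw [starPoly, coeff_reflect, revAt_eq_self_of_lt hi, coeff_map,
    coeff_eq_zero_of_natDegree_lt (hP.trans_lt hi), map_zero]

theorem eval_starPoly {k : ℕ} {P : ℂ[X]} (hP : P.natDegree ≤ k) {z : ℂ} (hz : z ≠ 0) :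
    (starPoly k P).eval z = z ^ k * conj (P.eval (conj z)⁻¹) := by
  have hinv : Invertible (z⁻¹) := invertibleOfNonzero (inv_ne_zero hz)
  have h1 := eval₂_reflect_mul_pow (RingHom.id ℂ) z⁻¹ k (P.map (starRingEnd ℂ))
    ((natDegree_map_le).trans hP)
  rw [invOf_eq_inv, inv_inv] at h1
  have h2 : eval₂ (RingHom.id ℂ) z⁻¹ (P.map (starRingEnd ℂ)) = conj (P.eval (conj z)⁻¹) := by
    rw [eval₂_id, eval_map, ← Complex.conj_conj (z⁻¹), eval₂_hom, map_inv₀]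
  rw [h2] at h1
  rw [← h1, starPoly, eval₂_id, mul_comm, mul_assoc, ← mul_pow, inv_mul_cancel₀ hz, one_pow,
    mul_one]

theorem eval_starPoly_circlePoint {k : ℕ} {P : ℂ[X]} (hP : P.natDegree ≤ k) (θ : ℝ) :
    (starPoly k P).eval (circlePoint θ) = circlePoint θ ^ k * conj (P.eval (circlePoint θ)) := by
  rw [eval_starPoly hP (circlePoint_ne_zero θ), conj_circlePoint, inv_inv]

theorem eval_one_starPoly {k : ℕ} {P : ℂ[X]} (hP : P.natDegree ≤ k) :
    (starPoly k P).eval 1 = conj (P.eval 1) := by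
  rw [eval_starPoly hP one_ne_zero]; simp

theorem ip_X_pow_starPoly {k i : ℕ} (hi : i ≤ k) {P : ℂ[X]} (hP : P.natDegree ≤ k) :
    ip ω (X ^ i) (starPoly k P) = conj (ip ω (X ^ (k - i)) P) := by
  simp only [ip, map_sum, map_mul, Complex.conj_conj, Complex.conj_ofReal]
  refine Finset.sum_congr rfl fun j _ => ?_
  rw [eval_starPoly_circlePoint hP]
  simp only [eval_pow, eval_X, map_pow]
  obtain ⟨l, rfl⟩ := Nat.exists_eq_add_of_le hi
  have : conj (circlePoint (ω.1 j)) ^ i * circlePoint (ω.1 j) ^ i = 1 := by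
    rw [← mul_pow, mul_comm, circlePoint_mul_conj, one_pow]
  rw [Nat.add_sub_cancel_left, pow_add]
  linear_combination (ω.2 j : ℂ) * circlePoint (ω.1 j) ^ l *
    conj (P.eval (circlePoint (ω.1 j))) * this

theorem nrm_starPoly {k : ℕ} {P : ℂ[X]} (hP : P.natDegree ≤ k) :
    nrm ω (starPoly k P) = nrm ω P := by
  refine Finset.sum_congr rfl fun j _ => ?_
  rw [eval_starPoly_circlePoint hP, norm_mul, norm_pow, norm_circlePoint, RCLike.norm_conj]; simp

/-- A polynomial without constant term orthogonal to `X, …, X ^ k` vanishes, if its degree is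
at most `k < n + 1`. -/
theorem eq_zero_of_ip_X_pow (h : IsGeneric ω) {k : ℕ} (hk : k ≤ n) {R : ℂ[X]}
    (hR : R.natDegree ≤ k) (h0 : R.coeff 0 = 0)
    (hort : ∀ i, 1 ≤ i → i ≤ k → ip ω (X ^ i) R = 0) : R = 0 := by
  obtain ⟨q, rfl⟩ := X_dvd_iff.2 h0
  by_contra hne
  have hq : q ≠ 0 := right_ne_zero_of_mul hne
  rw [natDegree_X_mul hq] at hR
  refine hq (eq_zero_of_ip_self h ?_ (by lia))
  have h1 : ip ω (∑ i ∈ Finset.range (q.natDegree + 1), C (q.coeff i) * X ^ i) q = 0 := by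
    rw [← ip_conj_symm, ip_sum_right]
    rw [Finset.sum_eq_zero, map_zero]
    intro i hi
    rw [ip_C_mul_right, ← ip_conj_symm, ← ip_X_mul_X_mul, ← pow_succ',
      hort (i + 1) (by lia) (by have := Finset.mem_range.1 hi; lia)]
    simp
  rwa [← as_sum_range_C_mul_X_pow] at h1

/-- The Szegő recursion, with Verblunsky coefficient `-Φ_{k+1}(0)`. The difference of the two
sides has degree at most `k`, no constant term, and is orthogonal to `X, …, X ^ k`. -/
theorem Phi_succ_szego (h : IsGeneric ω) {k : ℕ} (hk : k < n) :
    Phi (k + 1) ω = X * Phi k ω - C (-(Phi (k + 1) ω).coeff 0) * starPoly k (Phi k ω) := by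
  set a := -(Phi (k + 1) ω).coeff 0
  have hdP : (Phi k ω).natDegree ≤ k := (natDegree_Phi k).le
  have hXd : (X * Phi k ω).natDegree = k + 1 := by
    rw [natDegree_X_mul (Phi_ne_zero k), natDegree_Phi]
  have hR : X * Phi k ω - Phi (k + 1) ω - C a * starPoly k (Phi k ω) = 0 := by
    refine eq_zero_of_ip_X_pow h hk.le ?_ ?_ ?_
    · refine (natDegree_sub_le _ _).trans (max_le ?_ ((natDegree_C_mul_le _ _).trans
        (natDegree_starPoly hdP)))
      have := degree_sub_lt_of_monic (monic_X.mul (Phi_monic (ω := ω) k)) (Phi_monic (ω := ω) (k+1))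
        hXd (natDegree_Phi (k+1))
      exact natDegree_le_of_degree_le (Order.le_of_lt_succ (by exact_mod_cast this))
    · have h1 : (Phi k ω).coeff k = 1 := by
        have := (Phi_monic (ω := ω) k).coeff_natDegree
        rwa [natDegree_Phi] at this
      rw [coeff_sub, coeff_sub, coeff_C_mul, coeff_starPoly (Nat.zero_le k)]
      simp [h1, a]
    · intro i hi hik
      obtain ⟨l, rfl⟩ := Nat.exists_eq_add_of_le hi
      rw [ip_sub_right, ip_sub_right, ip_C_mul_right, ip_X_pow_starPoly hik hdP,
        ip_Phi_eq_zero h hk.le, ip_Phi_eq_zero h hk, add_comm 1 l, pow_succ', ip_X_mul_X_mul,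
        ip_Phi_eq_zero h hk.le]
      · simp
      · rw [degree_X_pow]; exact_mod_cast (by lia)
      · rw [degree_X_pow]; exact_mod_cast (by lia)
      · rw [degree_X_pow]; exact_mod_cast (by lia)
  linear_combination -hR

/-- Pythagoras' theorem in the Szegő recursion: `X Φ_k`, `Φ_k` and `Φ_k*` have the same norm. -/
theorem nrm_Phi_succ (h : IsGeneric ω) {k : ℕ} (hk : k < n) :
    nrm ω (Phi (k + 1) ω) = (1 - ‖(Phi (k + 1) ω).coeff 0‖ ^ 2) * nrm ω (Phi k ω) := by
  have hdP : (Phi k ω).natDegree ≤ k := (natDegree_Phi k).le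
  have hs := Phi_succ_szego h hk
  set a := -(Phi (k + 1) ω).coeff 0 with ha
  have h1 : X * Phi k ω = Phi (k + 1) ω + C a * starPoly k (Phi k ω) := by
    linear_combination -hs
  have hort : ip ω (starPoly k (Phi k ω)) (Phi (k + 1) ω) = 0 :=
    ip_Phi_eq_zero h hk (degree_le_natDegree.trans_lt
      (by exact_mod_cast Nat.lt_succ_of_le (natDegree_starPoly hdP)))
  have hort' : ip ω (Phi (k + 1) ω) (starPoly k (Phi k ω)) = 0 := by
    rw [← ip_conj_symm, hort, map_zero]
  have h2 := ip_X_mul_X_mul (ω := ω) (Phi k ω) (Phi k ω)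
  rw [h1, ip_add_right, ip_add_left, ip_add_left, ip_C_mul_left, ip_C_mul_right, ip_C_mul_left,
    ip_C_mul_right, hort, hort', ip_self, ip_self, ip_self, nrm_starPoly hdP] at h2
  have h3 : conj a * a = ((‖a‖ ^ 2 : ℝ) : ℂ) := by
    rw [Complex.conj_mul', Complex.ofReal_pow]
  have h4 : ((nrm ω (Phi (k + 1) ω) : ℝ) : ℂ) =
      (((1 - ‖a‖ ^ 2) * nrm ω (Phi k ω) : ℝ) : ℂ) := by
    push_cast at h3 ⊢
    linear_combination h2 - (nrm ω (Phi k ω) : ℂ) * h3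
  rw [ha, norm_neg] at h4
  exact_mod_cast h4

theorem norm_coeff_zero_lt_one (h : IsGeneric ω) {k : ℕ} (hk : k + 1 < n) :
    ‖(Phi (k + 1) ω).coeff 0‖ < 1 := by
  have h1 := nrm_Phi_succ h (Nat.lt_of_succ_lt hk)
  have h2 := nrm_Phi_pos h hk
  have h3 := nrm_Phi_pos h (Nat.lt_of_succ_lt hk)
  rw [h1] at h2
  have h4 := (mul_pos_iff_of_pos_right h3).1 h2
  nlinarith [norm_nonneg ((Phi (k + 1) ω).coeff 0)]

/-- The zeros of `Φ_k` lie in the open unit disc, `k < n`. -/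
theorem norm_lt_one_of_isRoot (h : IsGeneric ω) {k : ℕ} (hk : k < n) {l : ℂ}
    (hl : (Phi k ω).IsRoot l) : ‖l‖ < 1 := by
  obtain ⟨q, hq⟩ := dvd_iff_isRoot.2 hl
  have hq0 : q ≠ 0 := by
    rintro rfl
    exact Phi_ne_zero (ω := ω) k (by rw [hq, mul_zero])
  have hdq : q.natDegree + 1 = k := by
    rw [← natDegree_Phi (ω := ω) k, hq, natDegree_mul (X_sub_C_ne_zero l) hq0, natDegree_X_sub_C,
      add_comm]
  have h1 : X * q = Phi k ω + C l * q := by rw [hq]; ring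
  have hort : ip ω q (Phi k ω) = 0 :=
    ip_Phi_eq_zero h hk.le (degree_le_natDegree.trans_lt (by exact_mod_cast (by lia)))
  have hort' : ip ω (Phi k ω) q = 0 := by rw [← ip_conj_symm, hort, map_zero]
  have h2 := ip_X_mul_X_mul (ω := ω) q q
  rw [h1, ip_add_right, ip_add_left, ip_add_left, ip_C_mul_left, ip_C_mul_right, ip_C_mul_left,
    ip_C_mul_right, hort, hort', ip_self, ip_self] at h2
  have h3 : conj l * l = ((‖l‖ ^ 2 : ℝ) : ℂ) := by
    rw [Complex.conj_mul', Complex.ofReal_pow]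
  have h4 : ((nrm ω (Phi k ω) : ℝ) : ℂ) = (((1 - ‖l‖ ^ 2) * nrm ω q : ℝ) : ℂ) := by
    push_cast at h3 ⊢
    linear_combination h2 - (nrm ω q : ℂ) * h3
  have h5 : nrm ω (Phi k ω) = (1 - ‖l‖ ^ 2) * nrm ω q := by exact_mod_cast h4
  have h6 := nrm_Phi_pos h hk
  rw [h5] at h6
  have h7 := (mul_pos_iff_of_pos_right (nrm_pos h hq0 (by lia))).1 h6
  nlinarith [norm_nonneg l]

end OPUC

/-! ### Deformed Verblunsky coefficients -/

section Verblunsky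

variable {n : ℕ} {ω : (Fin n → ℝ) × (Fin n → ℝ)}

/-- The deformed Verblunsky coefficient `γ_k = 1 - Φ_{k+1}(1) / Φ_k(1)`. It is the Verblunsky
coefficient of index `k`, up to a phase depending on `Φ_k`. -/
def verb (ω : (Fin n → ℝ) × (Fin n → ℝ)) (k : ℕ) : ℂ :=
  1 - (Phi (k + 1) ω).eval 1 / (Phi k ω).eval 1

theorem eval_one_Phi_ne_zero (h : IsGeneric ω) {k : ℕ} (hk : k < n) : (Phi k ω).eval 1 ≠ 0 := by
  intro h0
  have := norm_lt_one_of_isRoot h hk h0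
  simp at this

theorem eval_one_Phi_ne_zero' (h : IsGeneric ω) (h1 : ∀ j, circlePoint (ω.1 j) ≠ 1) {k : ℕ}
    (hk : k ≤ n) : (Phi k ω).eval 1 ≠ 0 := by
  rcases hk.lt_or_eq with hk | rfl
  · exact eval_one_Phi_ne_zero h hk
  · rw [Phi_eq_nodePoly h, nodePoly, eval_prod]
    refine Finset.prod_ne_zero_iff.2 fun j _ => ?_
    simpa [sub_eq_zero] using (h1 j).symm

theorem eval_one_Phi_succ (h : IsGeneric ω) {k : ℕ} (hk : k < n) :
    (Phi (k + 1) ω).eval 1 = (Phi k ω).eval 1 * (1 - verb ω k) := by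
  have := eval_one_Phi_ne_zero h hk
  rw [verb]
  field_simp
  ring

theorem eval_one_Phi (h : IsGeneric ω) {k : ℕ} (hk : k ≤ n) :
    (Phi k ω).eval 1 = ∏ i ∈ Finset.range k, (1 - verb ω i) := by
  induction k with
  | zero => simp [Phi_zero]
  | succ k ih => rw [eval_one_Phi_succ h hk, Finset.prod_range_succ, ih (Nat.le_of_succ_le hk)]

/-- The phase relating `γ_k` to the constant term of `Φ_{k+1}`. -/
def phase (g : ℕ → ℂ) (k : ℕ) : ℂ :=
  (∏ i ∈ Finset.range k, (1 - g i)) / conj (∏ i ∈ Finset.range k, (1 - g i))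

theorem norm_phase {g : ℕ → ℂ} {k : ℕ} (h : ∀ i < k, g i ≠ 1) : ‖phase g k‖ = 1 := by
  have : ∏ i ∈ Finset.range k, (1 - g i) ≠ 0 :=
    Finset.prod_ne_zero_iff.2 fun i hi => sub_ne_zero.2 (h i (Finset.mem_range.1 hi)).symm
  rw [phase, norm_div, RCLike.norm_conj, div_self (norm_ne_zero_iff.2 this)]

/-- The Szegő recursion evaluated at `1`: `Φ_k*(1)` is the conjugate of `Φ_k(1)`, and the quotient
of the two is the phase. -/
theorem verb_mul_phase (h : IsGeneric ω) {k : ℕ} (hk : k < n) :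
    verb ω k * phase (verb ω) k = -(Phi (k + 1) ω).coeff 0 := by
  have hP := eval_one_Phi_ne_zero h hk
  have hP' : conj ((Phi k ω).eval 1) ≠ 0 := by simpa using hP
  have hs := congrArg (eval 1) (Phi_succ_szego h hk)
  rw [eval_sub, eval_mul, eval_mul, eval_X, eval_C, eval_one_starPoly (natDegree_Phi k).le,
    one_mul] at hs
  rw [verb, hs, phase, ← eval_one_Phi h hk.le]
  field_simp
  ring

theorem norm_verb (h : IsGeneric ω) {k : ℕ} (hk : k < n) :
    ‖verb ω k‖ = ‖(Phi (k + 1) ω).coeff 0‖ := by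
  have h1 := congrArg norm (verb_mul_phase h hk)
  rwa [norm_mul, norm_neg, norm_phase, mul_one] at h1
  intro i hi h1
  have := eval_one_Phi_succ h (hi.trans hk)
  rw [h1, sub_self, mul_zero] at this
  exact eval_one_Phi_ne_zero h (lt_of_le_of_lt (Nat.succ_le_of_lt hi) hk) this

theorem norm_verb_lt_one (h : IsGeneric ω) {k : ℕ} (hk : k + 1 < n) : ‖verb ω k‖ < 1 := by
  rw [norm_verb h (Nat.lt_of_succ_lt hk)]
  exact norm_coeff_zero_lt_one h hk

theorem norm_coeff_zero_le_one (h : IsGeneric ω) {k : ℕ} (hk : k < n) :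
    ‖(Phi (k + 1) ω).coeff 0‖ ≤ 1 := by
  rcases (Nat.succ_le_of_lt hk).lt_or_eq with hk' | hk'
  · exact (norm_coeff_zero_lt_one h hk').le
  · rw [← Nat.succ_eq_add_one, hk', Phi_eq_nodePoly h, nodePoly, coeff_zero_prod, norm_prod]
    refine Finset.prod_le_one (fun _ _ => norm_nonneg _) fun j _ => ?_
    simp [norm_circlePoint]

theorem Phi_succ_eq (h : IsGeneric ω) {k : ℕ} (hk : k < n) :
    Phi (k + 1) ω =
      X * Phi k ω - C (verb ω k * phase (verb ω) k) * starPoly k (Phi k ω) := by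
  rw [verb_mul_phase h hk]; exact Phi_succ_szego h hk

theorem nrm_Phi_succ' (h : IsGeneric ω) {k : ℕ} (hk : k < n) :
    nrm ω (Phi (k + 1) ω) = (1 - ‖verb ω k‖ ^ 2) * nrm ω (Phi k ω) := by
  rw [norm_verb h hk]; exact nrm_Phi_succ h hk

theorem nrm_Phi_eq (h : IsGeneric ω) {k : ℕ} (hk : k ≤ n) :
    nrm ω (Phi k ω) = ∏ i ∈ Finset.range k, (1 - ‖verb ω i‖ ^ 2) := by
  induction k with
  | zero => simp [Phi_zero, nrm, h.sum_eq_one]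
  | succ k ih =>
    rw [nrm_Phi_succ' h hk, Finset.prod_range_succ, ih (Nat.le_of_succ_le hk), mul_comm]

/-! ### The logarithm of `Φ_k(1)` -/

theorem one_sub_mem_slitPlane {w : ℂ} (hw : ‖w‖ ≤ 1) (h1 : w ≠ 1) : 1 - w ∈ Complex.slitPlane := by
  left
  by_contra hle
  have hre : 1 ≤ w.re := by simpa using hle
  have h2 : w.re ^ 2 + w.im ^ 2 ≤ 1 := by
    have := Complex.sq_norm w
    rw [Complex.normSq_apply] at this
    nlinarith [norm_nonneg w]
  exact h1 (Complex.ext (by simp; nlinarith) (by simp; nlinarith))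

theorem one_sub_mul_mem_slitPlane {w : ℂ} (hw : ‖w‖ ≤ 1) (h1 : w ≠ 1) {s : ℝ}
    (hs : s ∈ Set.Icc (0 : ℝ) 1) : 1 - w * s ∈ Complex.slitPlane := by
  have hn : ‖w * s‖ = ‖w‖ * s := by rw [norm_mul, Complex.norm_real, Real.norm_of_nonneg hs.1]
  refine one_sub_mem_slitPlane (by rw [hn]; nlinarith [hs.1, hs.2, norm_nonneg w]) fun h => ?_
  have h2 : ‖w‖ * s = 1 := by rw [← hn, h, norm_one]
  have h3 : s = 1 := le_antisymm hs.2 (by nlinarith [hs.1])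
  rw [h3, Complex.ofReal_one, mul_one] at h
  exact h1 h

/-- `∑ log (1 - λ s)` over a multiset. -/
def logSum (S : Multiset ℂ) (s : ℝ) : ℂ := (S.map fun l => Complex.log (1 - l * s)).sum

theorem continuousOn_logSum {S : Multiset ℂ} (hS : ∀ l ∈ S, ‖l‖ ≤ 1 ∧ l ≠ 1) :
    ContinuousOn (logSum S) (Set.Icc 0 1) := by
  induction S using Multiset.induction_on with
  | empty =>
    have : logSum 0 = fun _ => 0 := by ext s; simp [logSum]
    rw [this]
    exact continuousOn_const
  | cons a S ih =>
    have h1 := ih fun l hl => hS l (Multiset.mem_cons_of_mem hl)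
    have h2 := hS a (Multiset.mem_cons_self a S)
    have : logSum (a ::ₘ S) = fun s : ℝ => Complex.log (1 - a * (s : ℂ)) + logSum S s := by
      ext s; simp [logSum]
    rw [this]
    refine ContinuousOn.add (ContinuousOn.clog (by fun_prop) fun s hs => ?_) h1
    exact one_sub_mul_mem_slitPlane h2.1 h2.2 hs

theorem exp_logSum {S : Multiset ℂ} (hS : ∀ l ∈ S, ‖l‖ ≤ 1 ∧ l ≠ 1) {s : ℝ}
    (hs : s ∈ Set.Icc (0 : ℝ) 1) :
    Complex.exp (logSum S s) = (S.map fun l => 1 - l * (s : ℂ)).prod := by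
  rw [logSum, Complex.exp_multiset_sum, Multiset.map_map]
  refine congrArg _ (Multiset.map_congr rfl fun l hl => ?_)
  exact Complex.exp_log (Complex.slitPlane_ne_zero
    (one_sub_mul_mem_slitPlane (hS l hl).1 (hS l hl).2 hs))

theorem eval_eq_prod_roots {P : ℂ[X]} (hP : P.Monic) (z : ℂ) :
    P.eval z = (P.roots.map fun l => z - l).prod := by
  conv_lhs => rw [(IsAlgClosed.splits P).eq_prod_roots_of_monic hP]
  rw [eval_multiset_prod, Multiset.map_map]
  simp

theorem prod_one_sub_mul_eq {P : ℂ[X]} (hP : P.Monic) {s : ℂ} (hs : s ≠ 0) :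
    (P.roots.map fun l => 1 - l * s).prod = s ^ P.natDegree * P.eval s⁻¹ := by
  rw [eval_eq_prod_roots hP, (IsAlgClosed.splits P).natDegree_eq_card_roots]
  induction P.roots using Multiset.induction_on with
  | empty => simp
  | cons a S ih =>
    simp only [Multiset.map_cons, Multiset.prod_cons, Multiset.card_cons, ih, pow_succ]
    field_simp

/-- A continuous determination of the logarithm is unique on an interval. -/
theorem eq_zero_of_exp_eq_one {D : ℝ → ℂ} (hD : ContinuousOn D (Set.Icc 0 1)) (h0 : D 0 = 0)
    (hexp : ∀ s ∈ Set.Icc (0 : ℝ) 1, Complex.exp (D s) = 1) : D 1 = 0 := by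
  obtain ⟨N, hN⟩ := Complex.exp_eq_one_iff.1 (hexp 1 (by simp))
  suffices N = 0 by rw [hN, this]; simp
  by_contra hne
  set f : ℝ → ℝ := fun s => (D s).im / (2 * Real.pi) with hf
  have hfc : ContinuousOn f (Set.uIcc 0 1) := by
    rw [Set.uIcc_of_le zero_le_one]
    exact (Complex.continuous_im.comp_continuousOn hD).div_const _
  have hpi := Real.pi_pos
  have him : ∀ M : ℤ, ((M : ℂ) * (2 * Real.pi * Complex.I)).im / (2 * Real.pi) = M := by
    intro M
    have : ((M : ℂ) * (2 * Real.pi * Complex.I)).im = M * (2 * Real.pi) := by simp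
    rw [this]
    field_simp
  have hf0 : f 0 = 0 := by simp [hf, h0]
  have hf1 : f 1 = N := by rw [hf]; simp only [hN, him]
  have hiv := intermediate_value_uIcc hfc
  rw [hf0, hf1, Set.uIcc_of_le (zero_le_one' ℝ)] at hiv
  have key : ∀ M : ℤ, ∀ s ∈ Set.Icc (0:ℝ) 1, f s ≠ M + 1 / 2 := by
    intro M s hs hfs
    obtain ⟨K, hK⟩ := Complex.exp_eq_one_iff.1 (hexp s hs)
    simp only [hf, hK, him] at hfs
    have : (2 * K : ℤ) = 2 * M + 1 := by exact_mod_cast (by linarith : (2 * K : ℝ) = 2 * M + 1)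
    omega
  rcases lt_or_gt_of_ne hne with hlt | hgt
  · have : (N : ℝ) ≤ -1 := by exact_mod_cast Int.le_sub_one_of_lt hlt
    obtain ⟨s, hs, hfs⟩ := hiv (show (-1 / 2 : ℝ) ∈ Set.uIcc 0 (N : ℝ) by
      rw [Set.uIcc_of_ge (by linarith)]; constructor <;> linarith)
    exact key (-1) s hs (by rw [hfs]; norm_num)
  · have : (1 : ℝ) ≤ N := by exact_mod_cast hgt
    obtain ⟨s, hs, hfs⟩ := hiv (show (1 / 2 : ℝ) ∈ Set.uIcc 0 (N : ℝ) by
      rw [Set.uIcc_of_le (by linarith)]; constructor <;> linarith)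
    exact key 0 s hs (by rw [hfs]; norm_num)

/-- Each factor satisfies `|s - l| ≤ |1 - l s|`, as for a Blaschke product. -/
theorem norm_eval_le {S : Multiset ℂ} (hS : ∀ l ∈ S, ‖l‖ ≤ 1) {s : ℝ}
    (hs : s ∈ Set.Icc (0 : ℝ) 1) :
    ‖(S.map fun l => (s : ℂ) - l).prod‖ ≤ ‖(S.map fun l => 1 - l * (s : ℂ)).prod‖ := by
  induction S using Multiset.induction_on with
  | empty => simp
  | cons a S ih =>
    have h1 := ih fun l hl => hS l (Multiset.mem_cons_of_mem hl)
    have h2 := hS a (Multiset.mem_cons_self a S)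
    simp only [Multiset.map_cons, Multiset.prod_cons, norm_mul]
    refine mul_le_mul ?_ h1 (norm_nonneg _) (norm_nonneg _)
    refine le_of_sq_le_sq ?_ (norm_nonneg _)
    have h3 : a.re ^ 2 + a.im ^ 2 ≤ 1 := by
      have := Complex.sq_norm a
      rw [Complex.normSq_apply] at this
      nlinarith [norm_nonneg a]
    rw [Complex.sq_norm, Complex.sq_norm, Complex.normSq_apply, Complex.normSq_apply]
    simp only [Complex.sub_re, Complex.sub_im, Complex.ofReal_re, Complex.ofReal_im,
      Complex.mul_re, Complex.mul_im, Complex.one_re, Complex.one_im]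
    nlinarith [mul_nonneg (sub_nonneg.2 h3) (show 0 ≤ 1 - s ^ 2 by nlinarith [hs.1, hs.2])]

theorem roots_Phi_spec (h : IsGeneric ω) (h1 : ∀ j, circlePoint (ω.1 j) ≠ 1) {k : ℕ}
    (hk : k ≤ n) : ∀ l ∈ (Phi k ω).roots, ‖l‖ ≤ 1 ∧ l ≠ 1 := by
  intro l hl
  have hl' := (mem_roots (Phi_ne_zero k)).1 hl
  refine ⟨?_, fun hl1 => eval_one_Phi_ne_zero' h h1 hk (hl1 ▸ hl')⟩
  rcases hk.lt_or_eq with hk | rfl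
  · exact (norm_lt_one_of_isRoot h hk hl').le
  · rw [Phi_eq_nodePoly h, nodePoly, IsRoot.def, eval_prod, Finset.prod_eq_zero_iff] at hl'
    obtain ⟨j, -, hj⟩ := hl'
    rw [eval_sub, eval_X, eval_C, sub_eq_zero] at hj
    rw [hj, norm_circlePoint]

/-- The principal logarithms add up because of a homotopy. Over the zeros `l` of `Φ_{k+1}`, the
Szegő recursion gives `∏ (1 - l s) = R(s) (1 - W(s))` for `0 ≤ s ≤ 1`, where `R(s)` is the same
product over the zeros of `Φ_k` and `|W| ≤ 1`, `W ≠ 1`. All the principal logarithms involved are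
therefore continuous in `s`, and `∑ log (1 - l s)` over the zeros of `Φ_{k+1}` is the same sum for
`Φ_k` plus `log (1 - W(s))`, since this is so at `s = 0`. At `s = 1`, `W(1) = γ_k`. -/
theorem logPhi_succ (h : IsGeneric ω) (h1 : ∀ j, circlePoint (ω.1 j) ≠ 1) {k : ℕ} (hk : k < n) :
    logPhi (k + 1) ω = logPhi k ω + Complex.log (1 - verb ω k) := by
  have hr := roots_Phi_spec h h1 hk.le
  have hr' := roots_Phi_spec h h1 (Nat.succ_le_of_lt hk)
  set R : ℝ → ℂ := fun s => ((Phi k ω).roots.map fun l => 1 - l * (s : ℂ)).prod with hR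
  set a := -(Phi (k + 1) ω).coeff 0 with ha
  have ha1 : ‖a‖ ≤ 1 := by rw [ha, norm_neg]; exact norm_coeff_zero_le_one h hk
  set W : ℝ → ℂ := fun s => a * s * conj ((Phi k ω).eval (s : ℂ)) / R s with hW
  have hR0 : ∀ s ∈ Set.Icc (0 : ℝ) 1, R s ≠ 0 := fun s hs => by
    rw [hR]; simp only; rw [← exp_logSum hr hs]; exact Complex.exp_ne_zero _
  have hrec : ∀ s ∈ Set.Icc (0 : ℝ) 1,
      ((Phi (k + 1) ω).roots.map fun l => 1 - l * (s : ℂ)).prod = R s * (1 - W s) := by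
    intro s hs
    have : R s * (1 - W s) = R s - a * s * conj ((Phi k ω).eval (s : ℂ)) := by
      rw [hW]; field_simp [hR0 s hs]
    rw [this]
    rcases eq_or_ne s 0 with rfl | hs0
    · simp [hR]
    have hsC : (s : ℂ) ≠ 0 := by exact_mod_cast hs0
    rw [hR]
    simp only
    rw [prod_one_sub_mul_eq (Phi_monic _) hsC, prod_one_sub_mul_eq (Phi_monic _) hsC,
      natDegree_Phi, natDegree_Phi, Phi_succ_szego h hk, eval_sub, eval_mul, eval_mul, eval_X,
      eval_C,
      eval_starPoly (natDegree_Phi k).le (inv_ne_zero hsC), map_inv₀, inv_inv,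
      Complex.conj_ofReal, pow_succ, inv_pow, ← ha]
    field_simp
  have hWle : ∀ s ∈ Set.Icc (0 : ℝ) 1, ‖W s‖ ≤ 1 := by
    intro s hs
    have h3 := norm_eval_le (fun l hl => (hr l hl).1) hs
    rw [← eval_eq_prod_roots (Phi_monic k)] at h3
    have hRp := norm_pos_iff.2 (hR0 s hs)
    rw [hW]
    simp only
    rw [norm_div, norm_mul, norm_mul, RCLike.norm_conj, Complex.norm_real,
      Real.norm_of_nonneg hs.1, div_le_one hRp]
    calc ‖a‖ * s * ‖(Phi k ω).eval (s : ℂ)‖ ≤ 1 * 1 * ‖R s‖ := by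
          refine mul_le_mul (mul_le_mul ha1 hs.2 hs.1 zero_le_one) h3 (norm_nonneg _) (by simp)
      _ = ‖R s‖ := by ring
  have hW1 : ∀ s ∈ Set.Icc (0 : ℝ) 1, W s ≠ 1 := by
    intro s hs hs1
    have h3 := hrec s hs
    rw [hs1, sub_self, mul_zero, ← exp_logSum hr' hs] at h3
    exact Complex.exp_ne_zero _ h3
  have hRc : Continuous R := by
    have : R = fun s : ℝ => ((Phi k ω).roots.map fun l => 1 - l * (s : ℂ)).prod := rfl
    rw [this]
    exact continuous_multiset_prod _ fun l _ => by fun_prop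
  have hWc : ContinuousOn W (Set.Icc 0 1) := by
    refine ContinuousOn.div (Continuous.continuousOn ?_) hRc.continuousOn hR0
    have := (Phi k ω).continuous
    fun_prop
  have hD := eq_zero_of_exp_eq_one
    (D := fun s => logSum (Phi (k + 1) ω).roots s - logSum (Phi k ω).roots s -
      Complex.log (1 - W s))
    (((continuousOn_logSum hr').sub (continuousOn_logSum hr)).sub
      ((continuousOn_const.sub hWc).clog fun s hs => one_sub_mem_slitPlane (hWle s hs) (hW1 s hs)))
    (by simp [logSum, hW]) (by
      intro s hs
      rw [Complex.exp_sub, Complex.exp_sub, exp_logSum hr' hs, exp_logSum hr hs, hrec s hs,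
        Complex.exp_log (sub_ne_zero.2 (hW1 s hs).symm)]
      have h4 := hR0 s hs
      have h5 := sub_ne_zero.2 (hW1 s hs).symm
      rw [div_div]
      exact div_self (mul_ne_zero h4 h5))
  have hW1' : 1 - W 1 = 1 - verb ω k := by
    have h3 := hrec 1 (by simp)
    have h4 : R 1 = (Phi k ω).eval 1 := by
      rw [eval_eq_prod_roots (Phi_monic k)]; simp [hR]
    have h5 : ((Phi (k + 1) ω).roots.map fun l => 1 - l * ((1 : ℝ) : ℂ)).prod =
        (Phi (k + 1) ω).eval 1 := by
      rw [eval_eq_prod_roots (Phi_monic (k + 1))]; simp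
    rw [h5, h4, eval_one_Phi_succ h hk] at h3
    exact (mul_left_cancel₀ (eval_one_Phi_ne_zero h hk) h3).symm
  have h6 : ∀ i, logSum (Phi i ω).roots 1 = logPhi i ω := fun i => by
    simp [logSum, logPhi]
  simp only [h6, hW1'] at hD
  linear_combination hD

/-- `log Φ_k(1)` is the sum of the principal logarithms of the factors of
`Φ_k(1) = ∏ (1 - γ_i)`. -/
theorem logPhi_eq_sum (h : IsGeneric ω) (h1 : ∀ j, circlePoint (ω.1 j) ≠ 1) {k : ℕ} (hk : k ≤ n) :
    logPhi k ω = ∑ i ∈ Finset.range k, Complex.log (1 - verb ω i) := by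
  induction k with
  | zero => simp [logPhi, Phi_zero]
  | succ k ih =>
    rw [logPhi_succ h h1 hk, Finset.sum_range_succ, ih (Nat.le_of_succ_le hk)]

end Verblunsky

/-! ### Trigonometric moments and the Vandermonde determinant -/

section Moments

variable {n : ℕ} {ω : (Fin n → ℝ) × (Fin n → ℝ)}

/-- The trigonometric moments `∑ⱼ πⱼ e^{ikθⱼ}`. -/
def moment (ω : (Fin n → ℝ) × (Fin n → ℝ)) (k : ℕ) : ℂ :=
  ∑ j, (ω.2 j : ℂ) * circlePoint (ω.1 j) ^ k

/-- The pairing `⟨1, z Φ_k⟩` computed from the coefficients of `Φ_k`, and from the Szegő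
recursion. As `Φ_k` is monic and depends only on `c_1, …, c_k`, the moment `c_{k+1}` is an affine
function of `γ_k` when the lower ones are given. -/
theorem sum_coeff_mul_moment (h : IsGeneric ω) {k : ℕ} (hk : k < n) :
    ∑ i ∈ Finset.range (k + 1), (Phi k ω).coeff i * moment ω (i + 1) =
      verb ω k * phase (verb ω) k * nrm ω (Phi k ω) := by
  have h1 : ip ω 1 (X * Phi k ω) =
      ∑ i ∈ Finset.range (k + 1), (Phi k ω).coeff i * moment ω (i + 1) := by
    simp only [ip, moment, Finset.mul_sum]
    rw [Finset.sum_comm]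
    refine Finset.sum_congr rfl fun j _ => ?_
    rw [eval_mul, eval_X, eval_eq_sum_range (p := Phi k ω), natDegree_Phi]
    simp only [eval_one, map_one, one_mul, Finset.mul_sum]
    exact Finset.sum_congr rfl fun i _ => by ring
  rw [← h1, verb_mul_phase h hk]
  have hs : X * Phi k ω = Phi (k + 1) ω + C (-(Phi (k + 1) ω).coeff 0) * starPoly k (Phi k ω) := by
    linear_combination -(Phi_succ_szego h hk)
  have h2 := ip_X_pow_starPoly (ω := ω) (Nat.zero_le k) (natDegree_Phi (ω := ω) k).le
  rw [pow_zero, Nat.sub_zero, ip_Phi_of_natDegree_le h hk.le (by simp)] at h2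
  rw [hs, ip_add_right, ip_C_mul_right, h2, ip_Phi_eq_zero h hk]
  · simp
  · rw [degree_one]; exact_mod_cast Nat.succ_pos k

/-- The Gram matrix of `Φ_0, …, Φ_{n-1}` is diagonal, and the matrix of their values at the nodes
has the Vandermonde determinant, since they are monic. -/
theorem norm_sq_vandermonde_mul_prod (h : IsGeneric ω) :
    ‖∏ i, ∏ j ∈ Finset.Ioi i, (circlePoint (ω.1 j) - circlePoint (ω.1 i))‖ ^ 2 * ∏ j, ω.2 j =
      ∏ k ∈ Finset.range n, nrm ω (Phi k ω) := by
  set z : Fin n → ℂ := fun j => circlePoint (ω.1 j) with hz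
  set A : Matrix (Fin n) (Fin n) ℂ := Matrix.of fun i j => (Phi j ω).eval (z i) with hA
  have hdet : A.det = ∏ i, ∏ j ∈ Finset.Ioi i, (z j - z i) := by
    rw [← Matrix.det_vandermonde, Matrix.det_eval_matrixOfPolynomials_eq_det_vandermonde z
      (fun k => Phi k ω) (fun k => natDegree_Phi k) (fun k => Phi_monic k)]
  have hmul : A.conjTranspose * (Matrix.diagonal fun j => (ω.2 j : ℂ)) * A =
      Matrix.diagonal fun k : Fin n => (nrm ω (Phi k ω) : ℂ) := by
    ext k l
    have h1 : (A.conjTranspose * (Matrix.diagonal fun j => (ω.2 j : ℂ)) * A) k l =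
        ip ω (Phi k ω) (Phi l ω) := by
      rw [Matrix.mul_apply]
      refine Finset.sum_congr rfl fun j _ => ?_
      rw [Matrix.mul_diagonal, Matrix.conjTranspose_apply, hA, Matrix.of_apply, Matrix.of_apply,
        RCLike.star_def]
      ring
    rw [h1]
    rcases eq_or_ne k l with rfl | hkl
    · rw [Matrix.diagonal_apply_eq, ip_self]
    · rw [Matrix.diagonal_apply_ne _ hkl]
      rcases lt_or_gt_of_ne hkl with hlt | hlt
      · exact ip_Phi_eq_zero h l.2.le (degree_le_natDegree.trans_lt
          (by rw [natDegree_Phi]; exact_mod_cast hlt))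
      · rw [← ip_conj_symm, ip_Phi_eq_zero h k.2.le (degree_le_natDegree.trans_lt
          (by rw [natDegree_Phi]; exact_mod_cast hlt)), map_zero]
  have h2 := congrArg Matrix.det hmul
  rw [Matrix.det_mul, Matrix.det_mul, Matrix.det_conjTranspose, Matrix.det_diagonal,
    Matrix.det_diagonal, hdet, RCLike.star_def] at h2
  rw [Finset.prod_range fun k => nrm ω (Phi k ω)]
  set D := ∏ i, ∏ j ∈ Finset.Ioi i, (z j - z i)
  have h3 : conj D * D = ((‖D‖ ^ 2 : ℝ) : ℂ) := by
    rw [Complex.conj_mul', Complex.ofReal_pow]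
  have h4 : ((‖D‖ ^ 2 * ∏ j, ω.2 j : ℝ) : ℂ) = ((∏ k : Fin n, nrm ω (Phi k ω) : ℝ) : ℂ) := by
    push_cast at h3 ⊢
    linear_combination h2 - (∏ j, (ω.2 j : ℂ)) * h3
  exact_mod_cast h4

/-- The derivative of the node polynomial at the node `e^{iθⱼ}`. -/
def nodeDeriv (θ : Fin n → ℝ) (j : Fin n) : ℂ :=
  ∏ i ∈ Finset.univ.erase j, (circlePoint (θ j) - circlePoint (θ i))

theorem nodeDeriv_ne_zero {θ : Fin n → ℝ} (hinj : Function.Injective fun j => circlePoint (θ j))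
    (j : Fin n) : nodeDeriv θ j ≠ 0 :=
  Finset.prod_ne_zero_iff.2 fun _ hi =>
    sub_ne_zero.2 fun h => (Finset.ne_of_mem_erase hi) (hinj h).symm

end Moments

section Last

variable {m : ℕ} {ω : (Fin (m + 1) → ℝ) × (Fin (m + 1) → ℝ)}

/-- The values of `Φ_{n-1}` at the nodes, by pairing it with a Lagrange polynomial. -/
theorem weight_mul_eval_Phi (h : IsGeneric ω) (j : Fin (m + 1)) :
    (ω.2 j : ℂ) * (conj (nodeDeriv ω.1 j) * (Phi m ω).eval (circlePoint (ω.1 j))) =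
      nrm ω (Phi m ω) := by
  set q : ℂ[X] := ∏ i ∈ Finset.univ.erase j, (X - C (circlePoint (ω.1 i))) with hq
  have hmon : q.Monic := monic_prod_of_monic _ _ fun _ _ => monic_X_sub_C _
  have hdeg : q.natDegree = m := by
    rw [hq, natDegree_prod_of_monic _ _ fun _ _ => monic_X_sub_C _]; simp
  have h1 := ip_Phi_of_natDegree_le h (Nat.le_succ m) hdeg.le
  have h2 : q.coeff m = 1 := by rw [← hdeg]; exact hmon.coeff_natDegree
  rw [h2, map_one, one_mul] at h1
  rw [← h1, ip, Finset.sum_eq_single j]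
  · rw [hq, nodeDeriv, eval_prod]; simp
  · intro i _ hij
    have : q.eval (circlePoint (ω.1 i)) = 0 := by
      rw [hq, eval_prod]
      exact Finset.prod_eq_zero (Finset.mem_erase.2 ⟨hij, Finset.mem_univ i⟩) (by simp)
    rw [this]; simp
  · simp

/-- The leading coefficient of the Lagrange interpolation of `Φ_{n-1}` at the nodes. -/
theorem sum_eval_Phi_div (h : IsGeneric ω) :
    ∑ j, (Phi m ω).eval (circlePoint (ω.1 j)) / nodeDeriv ω.1 j = 1 := by
  have h1 := Lagrange.leadingCoeff_eq_sum (s := Finset.univ)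
    (v := fun j => circlePoint (ω.1 j)) (P := Phi m ω) h.inj.injOn
    (by rw [degree_eq_natDegree (Phi_ne_zero m), natDegree_Phi]; simp)
  rw [(Phi_monic m).leadingCoeff] at h1
  exact h1.symm

/-- The last coefficient is unimodular, and is given by the product of the nodes, as `Φ_n` is the
node polynomial. -/
theorem verb_mul_phase_last (h : IsGeneric ω) :
    verb ω m * phase (verb ω) m = (-1) ^ m * ∏ j, circlePoint (ω.1 j) := by
  rw [verb_mul_phase h (Nat.lt_succ_self m), Phi_eq_nodePoly h, nodePoly, coeff_zero_prod]
  simp [Finset.prod_neg, pow_succ]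

/-- The moments up to order `n - 1` and the product of the nodes determine the node
polynomial. -/
theorem nodePoly_eq_of_moment_eq {ω' : (Fin (m + 1) → ℝ) × (Fin (m + 1) → ℝ)} (h : IsGeneric ω)
    (hmom : ∀ k ≤ m, moment ω k = moment ω' k)
    (hprod : ∏ j, circlePoint (ω.1 j) = ∏ j, circlePoint (ω'.1 j)) :
    nodePoly ω.1 = nodePoly ω'.1 := by
  have hX : ∀ (ν : (Fin (m + 1) → ℝ) × (Fin (m + 1) → ℝ)) (i : ℕ) (P : ℂ[X]),
      P.natDegree ≤ m + 1 → ip ν (X ^ i) P = ∑ l ∈ Finset.range (m + 2), P.coeff l *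
        (if i ≤ l then moment ν (l - i) else conj (moment ν (i - l))) := by
    intro ν i P hP
    have hterm : ∀ l, (if i ≤ l then moment ν (l - i) else conj (moment ν (i - l))) =
        ∑ j, (ν.2 j : ℂ) * (conj (circlePoint (ν.1 j)) ^ i * circlePoint (ν.1 j) ^ l) := by
      intro l
      split_ifs with hil
      · obtain ⟨p, rfl⟩ := Nat.exists_eq_add_of_le hil
        refine Finset.sum_congr rfl fun j _ => ?_
        rw [Nat.add_sub_cancel_left, pow_add, ← mul_assoc (_ ^ i), ← mul_pow, mul_comm (conj _),
          circlePoint_mul_conj, one_pow, one_mul]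
      · obtain ⟨p, rfl⟩ := Nat.exists_eq_add_of_le (not_le.1 hil).le
        rw [moment, map_sum]
        refine Finset.sum_congr rfl fun j _ => ?_
        rw [Nat.add_sub_cancel_left, pow_add, mul_right_comm, ← mul_pow, mul_comm (conj _),
          circlePoint_mul_conj, one_pow, one_mul, map_mul, map_pow, Complex.conj_ofReal]
    simp only [hterm, ip, Finset.mul_sum]
    rw [Finset.sum_comm]
    refine Finset.sum_congr rfl fun j _ => ?_
    rw [eval_eq_sum_range' (p := P) (n := m + 2) (by lia), eval_pow, eval_X, map_pow,
      Finset.mul_sum,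
      Finset.mul_sum]
    exact Finset.sum_congr rfl fun l _ => by ring
  have hz : ∀ (ν : (Fin (m + 1) → ℝ) × (Fin (m + 1) → ℝ)) (i : ℕ),
      ip ν (X ^ i) (nodePoly ν.1) = 0 := fun ν i =>
    Finset.sum_eq_zero fun j _ => by rw [eval_nodePoly_node]; ring
  have hd : ∀ θ : Fin (m + 1) → ℝ, (nodePoly θ).natDegree = m + 1 := natDegree_nodePoly
  have hcoeff : ∀ θ : Fin (m + 1) → ℝ, (nodePoly θ).coeff 0 =
      (-1) ^ (m + 1) * ∏ j, circlePoint (θ j) := by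
    intro θ
    rw [nodePoly, coeff_zero_prod]
    simp [Finset.prod_neg]
  have hdeg := degree_sub_lt_of_monic (nodePoly_monic ω.1) (nodePoly_monic ω'.1) (hd _) (hd _)
  rw [← sub_eq_zero]
  refine eq_zero_of_ip_X_pow h (Nat.le_succ m) (k := m)
    (natDegree_le_of_degree_le (Order.le_of_lt_succ (by exact_mod_cast hdeg))) ?_ ?_
  · rw [coeff_sub, hcoeff, hcoeff, hprod, sub_self]
  · intro i hi him
    rw [ip_sub_right, hz, zero_sub, neg_eq_zero, ← hz ω' i, hX ω i _ (hd _).le,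
      hX ω' i _ (hd _).le]
    refine Finset.sum_congr rfl fun l hl => ?_
    have hl' := Finset.mem_range.1 hl
    rw [hmom _ (by lia), hmom _ (by lia)]

end Last

/-! ### The Jacobian of the moment map -/

section Vandermonde

theorem prod_erase_eq_prod_sq {n : ℕ} (z : Fin n → ℂ) :
    ∏ l, ‖∏ i ∈ Finset.univ.erase l, (z l - z i)‖ = ‖(Matrix.vandermonde z).det‖ ^ 2 := by
  have h1 : ∀ l : Fin n, ‖∏ i ∈ Finset.univ.erase l, (z l - z i)‖ =
      (∏ i ∈ Finset.Ioi l, ‖z i - z l‖) * ∏ i ∈ Finset.Iio l, ‖z l - z i‖ := by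
    intro l
    have : Finset.univ.erase l = Finset.Ioi l ∪ Finset.Iio l := by
      ext i; simp [lt_or_lt_iff_ne, eq_comm]
    rw [norm_prod, this, Finset.prod_union]
    · congr 1
      exact Finset.prod_congr rfl fun i _ => norm_sub_rev _ _
    · rw [Finset.disjoint_left]
      intro i hi hi'
      exact lt_asymm (Finset.mem_Ioi.1 hi) (Finset.mem_Iio.1 hi')
  simp only [h1]
  rw [Finset.prod_mul_distrib, Matrix.det_vandermonde, norm_prod, sq]
  simp only [norm_prod]
  congr 1
  exact Finset.prod_comm' (by simp)

/-- Subtraction of the last row from the other rows of a Vandermonde matrix. -/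
theorem norm_det_sub_last {m : ℕ} (z : Fin (m + 1) → ℂ) :
    ‖(Matrix.of fun a b : Fin m =>
        z b.castSucc ^ ((a : ℕ) + 1) - z (Fin.last m) ^ ((a : ℕ) + 1)).det‖ =
      ‖(Matrix.vandermonde z).det‖ := by
  set M : Matrix (Fin (m + 1)) (Fin (m + 1)) ℂ := Matrix.of fun i j =>
    if i = Fin.last m then z i ^ (j : ℕ) else z i ^ (j : ℕ) - z (Fin.last m) ^ (j : ℕ) with hM
  have h1 : (Matrix.vandermonde z).det = M.det := by
    refine Matrix.det_eq_of_forall_row_eq_smul_add_const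
      (fun i => if i = Fin.last m then 0 else 1) (Fin.last m) (by simp) fun i j => ?_
    rw [Matrix.vandermonde_apply, hM, Matrix.of_apply, Matrix.of_apply]
    by_cases hi : i = Fin.last m <;> simp [hi]
  rw [h1, Matrix.det_succ_column_zero, Finset.sum_eq_single (Fin.last m)]
  · rw [norm_mul, norm_mul, norm_pow, norm_neg, norm_one, one_pow, hM, Matrix.of_apply,
      if_pos rfl, ← Matrix.det_transpose]
    simp only [Fin.val_zero, pow_zero, norm_one, one_mul]
    congr 2
    ext a b
    have : a.castSucc ≠ Fin.last m := Fin.castSucc_ne_last a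
    simp [this]
  · intro i _ hi
    rw [hM, Matrix.of_apply, if_neg hi]; simp
  · simp

theorem norm_det_vandermonde_succ {m : ℕ} (z : Fin (m + 1) → ℂ) :
    ‖(Matrix.vandermonde z).det‖ = ‖∏ i ∈ Finset.univ.erase 0, (z 0 - z i)‖ *
      ‖(Matrix.vandermonde fun i : Fin m => z i.succ).det‖ := by
  have h1 : Finset.univ.erase (0 : Fin (m + 1)) = Finset.univ.map (Fin.succEmb m) := by
    ext i; simp [Fin.exists_succ_eq]
  rw [Matrix.det_vandermonde, Fin.prod_univ_succ, norm_mul, h1, Matrix.det_vandermonde]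
  congr 1
  · rw [norm_prod, norm_prod, Finset.prod_map, ← Finset.prod_map Finset.univ (Fin.succEmb m)
      (fun i => ‖z 0 - z i‖), ← h1]
    refine Finset.prod_congr ?_ fun i _ => norm_sub_rev _ _
    ext i; simp
  · congr 1
    refine Finset.prod_congr rfl fun i _ => ?_
    rw [Fin.prod_Ioi_succ]

end Vandermonde

section Jacobian

variable {m : ℕ}

/-- The coordinates on the set of configurations: the `n` angles and the first `n - 1` weights. -/
abbrev Coord (m : ℕ) : Type := Fin (m + 1) ⊕ Fin m → ℝ

/-- The configuration with given angles and given first `n - 1` weights. -/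
def config (θ : Fin (m + 1) → ℝ) (p : Fin m → ℝ) : (Fin (m + 1) → ℝ) × (Fin (m + 1) → ℝ) :=
  (θ, Fin.snoc (α := fun _ => ℝ) p (1 - ∑ i, p i))

/-- The configuration of given coordinates. -/
def conf (x : Coord m) : (Fin (m + 1) → ℝ) × (Fin (m + 1) → ℝ) :=
  config (fun j => x (Sum.inl j)) fun a => x (Sum.inr a)

theorem conf_snd_castSucc (x : Coord m) (a : Fin m) : (conf x).2 a.castSucc = x (Sum.inr a) := by
  simp [conf, config]

theorem conf_snd_last (x : Coord m) : (conf x).2 (Fin.last m) = 1 - ∑ a, x (Sum.inr a) := by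
  simp [conf, config]

/-- The sum of the angles, and the imaginary and real parts of the moments of order
`1, …, n - 1`. -/
def momentMap (x : Coord m) : Coord m :=
  Sum.elim (Fin.cons (∑ j, x (Sum.inl j)) fun a : Fin m => (moment (conf x) (a + 1)).im)
    fun a => (moment (conf x) (a + 1)).re

/-- The derivative of the weights. -/
def weightDeriv (j : Fin (m + 1)) : Coord m →L[ℝ] ℝ :=
  Fin.lastCases (-∑ a : Fin m, ContinuousLinearMap.proj (Sum.inr a))
    (fun a => ContinuousLinearMap.proj (Sum.inr a)) j

theorem hasFDerivAt_weight (x : Coord m) (j : Fin (m + 1)) :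
    HasFDerivAt (fun x : Coord m => (conf x).2 j) (weightDeriv j) x := by
  induction j using Fin.lastCases with
  | last =>
    simp only [conf_snd_last, weightDeriv, Fin.lastCases_last]
    refine HasFDerivAt.const_sub (c := (1 : ℝ)) ?_
    exact HasFDerivAt.fun_sum fun a _ => hasFDerivAt_apply (Sum.inr a) x
  | cast a =>
    simp only [conf_snd_castSucc, weightDeriv, Fin.lastCases_castSucc]
    exact hasFDerivAt_apply (Sum.inr a) x

theorem hasDerivAt_circlePoint_pow (k : ℕ) (θ : ℝ) :
    HasDerivAt (fun θ => circlePoint θ ^ k) (k * Complex.I * circlePoint θ ^ k) θ := by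
  have h1 : HasDerivAt (fun θ : ℝ => Complex.exp (θ * (k * Complex.I)))
      (Complex.exp (θ * (k * Complex.I)) * (1 * (k * Complex.I))) θ :=
    ((Complex.ofRealCLM.hasDerivAt (x := θ)).mul_const _).cexp
  have h2 : ∀ θ : ℝ, Complex.exp (θ * (k * Complex.I)) = circlePoint θ ^ k := fun θ => by
    rw [circlePoint, ← Complex.exp_nat_mul]; ring_nf
  simp only [h2] at h1
  convert h1 using 1
  ring

/-- The derivative of the moment of order `k`. -/
def momentDeriv (x : Coord m) (k : ℕ) : Coord m →L[ℝ] ℂ :=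
  ∑ j, (((conf x).2 j : ℂ) •
    (ContinuousLinearMap.proj (R := ℝ) (φ := fun _ => ℝ) (Sum.inl j)).smulRight
      (k * Complex.I * circlePoint (x (Sum.inl j)) ^ k) +
    (weightDeriv j).smulRight (circlePoint (x (Sum.inl j)) ^ k))

theorem hasFDerivAt_moment (x : Coord m) (k : ℕ) :
    HasFDerivAt (fun x : Coord m => moment (conf x) k) (momentDeriv x k) x := by
  refine HasFDerivAt.fun_sum fun j _ => ?_
  have h1 := (Complex.ofRealCLM.hasFDerivAt.comp x (hasFDerivAt_weight x j))
  have h2 := (hasDerivAt_circlePoint_pow k (x (Sum.inl j))).hasFDerivAt.comp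
    (g := fun θ => circlePoint θ ^ k) (f := fun x : Coord m => x (Sum.inl j)) x
    (hasFDerivAt_apply (Sum.inl j) x)
  refine (h1.mul h2).congr_fderiv ?_
  ext v
  simpa using mul_comm _ _

/-- The derivative of the moment map. -/
def momentMapDeriv (x : Coord m) : Coord m →L[ℝ] Coord m :=
  ContinuousLinearMap.pi (Sum.elim (Fin.cons (∑ j, ContinuousLinearMap.proj (Sum.inl j))
    fun a : Fin m => Complex.imCLM.comp (momentDeriv x (a + 1)))
    fun a => Complex.reCLM.comp (momentDeriv x (a + 1)))

theorem hasFDerivAt_momentMap (x : Coord m) : HasFDerivAt momentMap (momentMapDeriv x) x := by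
  rw [hasFDerivAt_pi']
  rintro (j | a)
  · induction j using Fin.cases with
    | zero =>
      have hj : ∀ j, HasFDerivAt (fun x : Coord m => x (Sum.inl j))
          (ContinuousLinearMap.proj (R := ℝ) (φ := fun _ => ℝ) (Sum.inl j)) x :=
        fun j => hasFDerivAt_apply (Sum.inl j) x
      refine (HasFDerivAt.fun_sum (u := Finset.univ) fun j _ => hj j).congr_fderiv ?_
      ext v
      simp [momentMapDeriv]
    | succ a =>
      exact Complex.imCLM.hasFDerivAt.comp x (hasFDerivAt_moment x (a + 1))
  · exact Complex.reCLM.hasFDerivAt.comp x (hasFDerivAt_moment x (a + 1))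

theorem momentDeriv_single_inl (x : Coord m) (k : ℕ) (j : Fin (m + 1)) :
    momentDeriv x k (Pi.single (Sum.inl j) 1) =
      (conf x).2 j * (k * Complex.I * circlePoint (x (Sum.inl j)) ^ k) := by
  have h1 : ∀ i : Fin (m + 1), weightDeriv i (Pi.single (Sum.inl j) 1 : Coord m) = 0 := by
    intro i
    induction i using Fin.lastCases <;> simp [weightDeriv]
  simp [momentDeriv, h1, Pi.single_apply]

theorem momentDeriv_single_inr (x : Coord m) (k : ℕ) (b : Fin m) :
    momentDeriv x k (Pi.single (Sum.inr b) 1) =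
      circlePoint (x (Sum.inl b.castSucc)) ^ k - circlePoint (x (Sum.inl (Fin.last m))) ^ k := by
  rw [momentDeriv, _root_.sum_apply, Fin.sum_univ_castSucc]
  simp [weightDeriv, Pi.single_apply, sub_eq_add_neg]

end Jacobian

section Determinant

variable {m : ℕ}

theorem eval_derivative_nodePoly {n : ℕ} (θ : Fin n → ℝ) (j : Fin n) :
    (nodePoly θ).derivative.eval (circlePoint (θ j)) = nodeDeriv θ j := by
  have := Lagrange.eval_nodal_derivative_eval_node_eq (s := Finset.univ)
    (v := fun j => circlePoint (θ j)) (Finset.mem_univ j)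
  rw [Lagrange.eval_nodal] at this
  exact this

theorem circlePoint_zpow_neg (θ : ℝ) (k : ℕ) :
    circlePoint θ ^ (-(k : ℤ)) = conj (circlePoint θ) ^ k := by
  rw [conj_circlePoint, zpow_neg, zpow_natCast, inv_pow]

/-- Reordering of the coefficients of `z^{-(a+1)} N(z)` by sign of the exponent. -/
theorem sum_neg_add_sum_pos {e : ℕ → ℂ} (he : ∀ l, m + 1 < l → e l = 0) {F : ℤ → ℂ} (hF : F 0 = 0)
    (a : Fin m) :
    (∑ c : Fin m, (if c ≤ a then e (a - c) else 0) * F (-((c : ℕ) + 1 : ℕ))) +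
      ∑ c : Fin m, e (a + c + 2) * F ((c : ℕ) + 1 : ℕ) =
    ∑ l ∈ Finset.range (m + 2), e l * F (l - ((a : ℕ) + 1 : ℕ)) := by
  obtain ⟨a, ha⟩ := a
  have h1 : ∑ l ∈ Finset.range (m + 2), e l * F (l - (a + 1 : ℕ)) =
      ∑ l ∈ Finset.range (a + 2 + m), e l * F (l - (a + 1 : ℕ)) := by
    refine Finset.sum_subset (fun l hl => ?_) fun l _ hl => ?_
    · simp only [Finset.mem_range] at *; lia
    · rw [he l (by simp only [Finset.mem_range] at *; lia), zero_mul]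
  rw [h1, Finset.sum_range_add, Finset.sum_range_succ]
  have h2 : F (((a + 1 : ℕ) : ℤ) - (a + 1 : ℕ)) = 0 := by rw [sub_self, hF]
  rw [h2, mul_zero, add_zero]
  congr 1
  · rw [← Finset.sum_range_reflect]
    have h3 : ∀ c : Fin m, (if c ≤ ⟨a, ha⟩ then e (a - c) else 0) * F (-((c : ℕ) + 1 : ℕ)) =
        (fun c : ℕ => if c ≤ a then e (a - c) * F (-(c + 1 : ℕ)) else 0) c := by
      intro c
      by_cases hc : (c : ℕ) ≤ a
      · have : c ≤ ⟨a, ha⟩ := hc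
        simp [hc, this]
      · have : ¬ c ≤ ⟨a, ha⟩ := hc
        simp [hc, this]
    simp only [h3]
    rw [Fin.sum_univ_eq_sum_range
        (fun c : ℕ => if c ≤ a then e (a - c) * F (-(c + 1 : ℕ)) else 0) m,
      ← Finset.sum_filter]
    refine Finset.sum_congr ?_ fun c hc => ?_
    · ext c; simp only [Finset.mem_filter, Finset.mem_range]; lia
    · have hc' := Finset.mem_range.1 hc
      have h4 : a + 1 - 1 - c = a - c := by lia
      rw [h4]
      congr 2
      rw [Nat.cast_sub (by lia)]
      push_cast
      ring
  · rw [Fin.sum_univ_eq_sum_range (fun c => e (a + c + 2) * F ((c + 1 : ℕ) : ℤ)) m]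
    refine Finset.sum_congr rfl fun c _ => ?_
    congr 2
    · ring
    · push_cast; ring

variable {x : Coord m}

/-- The angular block of the Jacobian matrix in the rows `z^{-(a+1)} N(z)`, where `N` is the node
polynomial. -/
def angleBlock (x : Coord m) : Matrix (Fin (m + 1)) (Fin (m + 1)) ℂ :=
  Matrix.of fun i j => Fin.cases 1 (fun a : Fin m => (conf x).2 j * (Complex.I *
    (nodeDeriv (conf x).1 j * (circlePoint (x (Sum.inl j)))⁻¹ ^ (a : ℕ)))) i

/-- The vector `y_j = Φ_{n-1}(z_j) / N'(z_j)`, with `N` the node polynomial, is mapped by the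
block to the first basis vector, by interpolation and orthogonality. Cramer's rule then gives the
determinant from a minor, which is a Vandermonde determinant up to factors. -/
theorem norm_det_angleBlock (h : IsGeneric (conf x)) :
    ‖(angleBlock x).det‖ * nrm (conf x) (Phi m (conf x)) = (∏ j, (conf x).2 j) *
      ‖(Matrix.vandermonde fun j => circlePoint (x (Sum.inl j))).det‖ ^ 3 := by
  set ω := conf x with hω
  set z : Fin (m + 1) → ℂ := fun j => circlePoint (x (Sum.inl j)) with hz
  have hzω : ∀ j, circlePoint (ω.1 j) = z j := fun j => rfl
  set V := ‖(Matrix.vandermonde z).det‖ with hV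
  set V' := ‖(Matrix.vandermonde fun i : Fin m => z i.succ).det‖ with hV'
  set y : Fin (m + 1) → ℂ := fun j => (Phi m ω).eval (z j) / nodeDeriv ω.1 j with hy
  have hnd := nodeDeriv_ne_zero (θ := ω.1) h.inj
  have hcol : (fun k => ∑ j, y j • angleBlock x k j) = fun k => if k = 0 then 1 else 0 := by
    ext k
    induction k using Fin.cases with
    | zero =>
      simp only [angleBlock, Matrix.of_apply, Fin.cases_zero, smul_eq_mul, mul_one, if_true]
      exact sum_eval_Phi_div h
    | succ a =>
      simp only [angleBlock, Matrix.of_apply, Fin.cases_succ, smul_eq_mul, Fin.succ_ne_zero,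
        if_false]
      have h1 : ip ω (X ^ (a : ℕ)) (Phi m ω) = 0 :=
        ip_Phi_eq_zero h (Nat.le_succ m) (by rw [degree_X_pow]; exact_mod_cast a.2)
      rw [← mul_zero Complex.I, ← h1, ip, Finset.mul_sum]
      refine Finset.sum_congr rfl fun j _ => ?_
      rw [eval_pow, eval_X, map_pow, conj_circlePoint]
      simp only [hy]
      have := hnd j
      change (Phi m ω).eval (z j) / nodeDeriv ω.1 j * ((ω.2 j : ℂ) * (Complex.I *
        (nodeDeriv ω.1 j * (z j)⁻¹ ^ (a : ℕ)))) =
        Complex.I * ((ω.2 j : ℂ) * ((z j)⁻¹ ^ (a : ℕ) * (Phi m ω).eval (z j)))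
      rw [div_mul_eq_mul_div, div_eq_iff this]
      ring
  have hdet := Matrix.det_updateCol_sum (angleBlock x) 0 y
  rw [hcol, Matrix.det_succ_column_zero, Finset.sum_eq_single 0] at hdet
  rotate_left
  · intro i _ hi
    simp [hi]
  · simp
  have hminor : (((angleBlock x).updateCol 0 fun k => if k = 0 then 1 else 0).submatrix
      (Fin.succAbove 0) Fin.succ).det =
      (∏ j : Fin m, (ω.2 j.succ * (Complex.I * nodeDeriv ω.1 j.succ))) *
      (Matrix.vandermonde fun i : Fin m => conj (z i.succ)).det := by
    rw [← Matrix.det_transpose (Matrix.vandermonde _), ← Matrix.det_mul_row]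
    congr 1
    ext a b
    simp only [Matrix.submatrix_apply, Fin.zero_succAbove, Matrix.of_apply,
      Matrix.transpose_apply, Matrix.vandermonde_apply]
    rw [Matrix.updateCol_ne (Fin.succ_ne_zero b), angleBlock, Matrix.of_apply, Fin.cases_succ,
      hz, conj_circlePoint]
    ring
  have hVc : ‖(Matrix.vandermonde fun i : Fin m => conj (z i.succ)).det‖ = V' := by
    rw [hV', Matrix.det_vandermonde, Matrix.det_vandermonde]
    simp only [norm_prod, ← map_sub, RCLike.norm_conj]
  have hn := congrArg norm hdet
  rw [hminor] at hn
  simp only [Fin.val_zero, pow_zero, one_mul, Matrix.updateCol_self, if_true, norm_mul, hVc,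
    smul_eq_mul, norm_prod, Complex.norm_I, Complex.norm_real, one_mul] at hn
  have hwn : ∀ j, ‖ω.2 j‖ = ω.2 j := fun j => Real.norm_of_nonneg (h.pos j).le
  simp only [hwn, Finset.prod_mul_distrib] at hn
  have hy0 : ω.2 0 * (‖nodeDeriv ω.1 0‖ * ‖(Phi m ω).eval (z 0)‖) = nrm ω (Phi m ω) := by
    have h2 := congrArg norm (weight_mul_eval_Phi h 0)
    have h3 := (nrm_Phi_pos h (Nat.lt_succ_self m)).le
    rwa [norm_mul, norm_mul, RCLike.norm_conj, Complex.norm_real, Complex.norm_real, hwn,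
      Real.norm_of_nonneg h3] at h2
  have hprod := prod_erase_eq_prod_sq z
  have hVs := norm_det_vandermonde_succ z
  rw [Fin.prod_univ_succ] at hprod
  have hnd0 : ‖nodeDeriv ω.1 0‖ ≠ 0 := norm_ne_zero_iff.2 (hnd 0)
  have hd0 : ‖∏ i ∈ Finset.univ.erase 0, (z 0 - z i)‖ = ‖nodeDeriv ω.1 0‖ := rfl
  have hdS : ∏ i : Fin m, ‖∏ l ∈ Finset.univ.erase i.succ, (z i.succ - z l)‖ =
    ∏ i : Fin m, ‖nodeDeriv ω.1 i.succ‖ := rfl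
  rw [hd0, hdS, ← hV] at hprod
  rw [hd0, ← hV, ← hV'] at hVs
  rw [hy, norm_div] at hn
  rw [Fin.prod_univ_succ, ← hy0]
  set d0 := ‖nodeDeriv ω.1 0‖
  set W := ∏ j : Fin m, ω.2 j.succ
  set D := ∏ i : Fin m, ‖nodeDeriv ω.1 i.succ‖
  set f := ‖(Phi m ω).eval (z 0)‖
  have hn' : f * ‖(angleBlock x).det‖ = W * D * V' * d0 := by
    field_simp at hn
    linarith
  calc ‖(angleBlock x).det‖ * (ω.2 0 * (d0 * f))
      = ω.2 0 * d0 * (f * ‖(angleBlock x).det‖) := by ring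
    _ = ω.2 0 * W * (d0 * D) * (d0 * V') := by rw [hn']; ring
    _ = ω.2 0 * W * V ^ 3 := by rw [hprod, ← hVs]; ring

/-- The Jacobian matrix in the complex rows `(∑ θ, conj c_k | c_k)`: angular columns of the
conjugate rows. -/
def conjAngleBlock (x : Coord m) : Matrix (Fin (m + 1)) (Fin (m + 1)) ℂ :=
  Matrix.of fun i j => Fin.cases 1 (fun a : Fin m => conj (((conf x).2 j : ℂ) *
    (((a + 1 : ℕ) : ℂ) * Complex.I * circlePoint (x (Sum.inl j)) ^ ((a : ℕ) + 1)))) i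

/-- The Jacobian matrix in complex rows: angular columns of the rows `c_k`. -/
def angleBlockPos (x : Coord m) : Matrix (Fin m) (Fin (m + 1)) ℂ :=
  Matrix.of fun a j => ((conf x).2 j : ℂ) *
    (((a + 1 : ℕ) : ℂ) * Complex.I * circlePoint (x (Sum.inl j)) ^ ((a : ℕ) + 1))

/-- The Jacobian matrix in complex rows: weight columns of the rows `c_k`. -/
def weightBlock (x : Coord m) : Matrix (Fin m) (Fin m) ℂ :=
  Matrix.of fun a b => circlePoint (x (Sum.inl b.castSucc)) ^ ((a : ℕ) + 1) -
    circlePoint (x (Sum.inl (Fin.last m))) ^ ((a : ℕ) + 1)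

/-- The Jacobian matrix in complex rows: weight columns of the conjugate rows. -/
def conjWeightBlock (x : Coord m) : Matrix (Fin (m + 1)) (Fin m) ℂ :=
  Matrix.of fun i b => Fin.cases 0 (fun a : Fin m => conj (weightBlock x a b)) i

/-- Passing from the real and imaginary parts to `c_k` and `conj c_k` multiplies the determinant
by a number of modulus `2 ^ m`. -/
theorem norm_det_complex_rows (x : Coord m) :
    ‖(Matrix.fromBlocks (conjAngleBlock x) (conjWeightBlock x) (angleBlockPos x)
      (weightBlock x)).det‖ = 2 ^ m * |(momentMapDeriv x).det| := by
  set A : Matrix (Fin (m + 1) ⊕ Fin m) (Fin (m + 1) ⊕ Fin m) ℝ :=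
    LinearMap.toMatrix' (momentMapDeriv x : Coord m →ₗ[ℝ] Coord m) with hA
  have hAij : ∀ i j, A i j = momentMapDeriv x (Pi.single j 1) i := fun i j => by
    rw [hA, LinearMap.toMatrix'_apply]; rfl
  set P11 : Matrix (Fin (m + 1)) (Fin (m + 1)) ℂ :=
    Matrix.diagonal (Fin.cases 1 fun _ => -Complex.I) with hP11
  set P12 : Matrix (Fin (m + 1)) (Fin m) ℂ :=
    Matrix.of fun i b => Fin.cases 0 (fun a : Fin m => if a = b then 1 else 0) i with hP12
  set P21 : Matrix (Fin m) (Fin (m + 1)) ℂ :=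
    Matrix.of fun a j => if a.succ = j then Complex.I else 0 with hP21
  have hdetA : ((A.map Complex.ofRealHom).det : ℂ) = ((momentMapDeriv x).det : ℝ) := by
    have h1 : A.det = (momentMapDeriv x).det := LinearMap.det_toMatrix' _
    rw [← h1]
    exact (RingHom.map_det Complex.ofRealHom A).symm
  have hdetP : (Matrix.fromBlocks P11 P12 P21 1).det = (-2 * Complex.I) ^ m := by
    rw [Matrix.det_fromBlocks_one₂₂]
    have : P11 - P12 * P21 = Matrix.diagonal (Fin.cases 1 fun _ => -2 * Complex.I) := by
      ext i j
      rw [Matrix.sub_apply, Matrix.mul_apply]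
      induction i using Fin.cases with
      | zero => simp [hP11, hP12, Matrix.diagonal_apply]
      | succ a =>
        simp only [hP11, hP12, hP21, Matrix.diagonal_apply, Matrix.of_apply, Fin.cases_succ,
          ite_mul, one_mul, zero_mul, Finset.sum_ite_eq, Finset.mem_univ, if_true]
        split_ifs <;> ring
    rw [this, Matrix.det_diagonal, Fin.prod_univ_succ]
    simp
  have hprod : Matrix.fromBlocks P11 P12 P21 1 * A.map Complex.ofRealHom =
      Matrix.fromBlocks (conjAngleBlock x) (conjWeightBlock x) (angleBlockPos x)
        (weightBlock x) := by
    have hre : ∀ w : ℂ, (w.re : ℂ) + Complex.I * w.im = w := fun w => by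
      rw [mul_comm]; exact Complex.re_add_im w
    have hco : ∀ w : ℂ, -Complex.I * w.im + w.re = conj w := fun w => by
      apply Complex.ext <;> simp
    have hrow : ∀ (a : Fin m) (s : Fin (m + 1) ⊕ Fin m) (i : Fin (m + 1) ⊕ Fin m),
        A (Sum.inl a.succ) s = (momentDeriv x (a + 1) (Pi.single s 1)).im ∧
        A (Sum.inr a) s = (momentDeriv x (a + 1) (Pi.single s 1)).re := by
      intro a s i
      rw [hAij, hAij]
      exact ⟨rfl, rfl⟩
    have hrow0 : ∀ s,
        A (Sum.inl 0) s = ∑ j : Fin (m + 1), (Pi.single s 1 : Coord m) (Sum.inl j) := by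
      intro s
      rw [hAij]
      simp [momentMapDeriv]
    ext i s
    rw [Matrix.mul_apply, Fintype.sum_sum_type]
    rcases i with i | a
    · induction i using Fin.cases with
      | zero =>
        have h0 : ∀ j : Fin (m + 1), P11 0 j = if j = 0 then 1 else 0 := by
          intro j
          rw [hP11, Matrix.diagonal_apply]
          simp [eq_comm]
        rcases s with s | b
        · simp [h0, hP12, hrow0, conjAngleBlock, Pi.single_apply]
        · simp [h0, hP12, hrow0, conjWeightBlock]
      | succ a =>
        have h0 : ∀ j : Fin (m + 1), P11 a.succ j = if j = a.succ then -Complex.I else 0 := by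
          intro j
          rw [hP11, Matrix.diagonal_apply]
          simp [eq_comm]
        have h1 : (∑ j : Fin (m + 1), P11 a.succ j * A.map Complex.ofRealHom (Sum.inl j) s) +
            ∑ b : Fin m, P12 a.succ b * A.map Complex.ofRealHom (Sum.inr b) s =
            conj (momentDeriv x (a + 1) (Pi.single s 1)) := by
          rw [← hco, ← (hrow a s s).1, ← (hrow a s s).2]
          simp [h0, hP12]
        simp only [Matrix.fromBlocks_apply₁₁, Matrix.fromBlocks_apply₁₂, h1]
        rcases s with s | b
        · rw [momentDeriv_single_inl]; rfl
        · rw [momentDeriv_single_inr]; rfl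
    · have h1 : (∑ j : Fin (m + 1), P21 a j * A.map Complex.ofRealHom (Sum.inl j) s) +
            ∑ b : Fin m,
              (1 : Matrix (Fin m) (Fin m) ℂ) a b * A.map Complex.ofRealHom (Sum.inr b) s =
            momentDeriv x (a + 1) (Pi.single s 1) := by
        rw [← hre (momentDeriv x (a + 1) (Pi.single s 1)), ← (hrow a s s).1, ← (hrow a s s).2]
        simp [hP21, Matrix.one_apply, add_comm]
      simp only [Matrix.fromBlocks_apply₂₁, Matrix.fromBlocks_apply₂₂, h1]
      rcases s with s | b
      · rw [momentDeriv_single_inl]; rfl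
      · rw [momentDeriv_single_inr]; rfl
  rw [← hprod, Matrix.det_mul, hdetP, hdetA, norm_mul, norm_pow, norm_mul, norm_neg,
    Complex.norm_I, Complex.norm_real, Real.norm_eq_abs]
  simp

/-- Replacing the rows `conj c_k` by those of the functions `z^{-k} N(z)`, which vanish at the
nodes, makes the Jacobian matrix block triangular. -/
theorem norm_det_complex_rows_eq (x : Coord m) :
    ‖(Matrix.fromBlocks (conjAngleBlock x) (conjWeightBlock x) (angleBlockPos x)
      (weightBlock x)).det‖ = ‖(angleBlock x).det‖ * ‖(weightBlock x).det‖ := by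
  set θ := (conf x).1 with hθ
  set N := nodePoly θ with hN
  set e : ℕ → ℂ := fun l => N.coeff l with he
  have he0 : ∀ l, m + 1 < l → e l = 0 := fun l hl =>
    coeff_eq_zero_of_natDegree_lt (by rw [hN, natDegree_nodePoly]; exact hl)
  set Q11 : Matrix (Fin (m + 1)) (Fin (m + 1)) ℂ := Matrix.of fun i j =>
    Fin.cases (if j = 0 then 1 else 0)
      (fun a : Fin m => Fin.cases 0 (fun b : Fin m => if b ≤ a then e (a - b) else 0) j) i with hQ11
  set Q12 : Matrix (Fin (m + 1)) (Fin m) ℂ := Matrix.of fun i b =>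
    Fin.cases 0 (fun a : Fin m => e (a + b + 2)) i with hQ12
  have hsum : ∀ j, ∑ l ∈ Finset.range (m + 2), e l * circlePoint (θ j) ^ l = 0 := by
    intro j
    rw [← eval_nodePoly_node θ j, eval_eq_sum_range, natDegree_nodePoly]
  have hsum' : ∀ j, ∑ l ∈ Finset.range (m + 2), e l * (l * circlePoint (θ j) ^ l) =
      circlePoint (θ j) * nodeDeriv θ j := by
    intro j
    rw [← eval_derivative_nodePoly, derivative_eval, sum_over_range' _ (fun _ => by simp) (m + 2)
      (by rw [natDegree_nodePoly]; lia), Finset.mul_sum]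
    refine Finset.sum_congr rfl fun l _ => ?_
    rcases l with _ | l
    · simp
    · simp only [he, hN, Nat.add_sub_cancel, pow_succ]; ring
  have hzp : ∀ (j : Fin (m + 1)) (l k : ℕ), circlePoint (θ j) ^ ((l : ℤ) - (k : ℤ)) =
      circlePoint (θ j) ^ l * (circlePoint (θ j))⁻¹ ^ k := fun j l k => by
    rw [zpow_sub₀ (circlePoint_ne_zero _), zpow_natCast, zpow_natCast, inv_pow, div_eq_mul_inv]
  have hzero : Q11 * conjWeightBlock x + Q12 * weightBlock x = 0 := by
    ext i b
    rw [Matrix.add_apply, Matrix.mul_apply, Matrix.mul_apply, Fin.sum_univ_succ, Matrix.zero_apply]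
    induction i using Fin.cases with
    | zero => simp [hQ11, hQ12, conjWeightBlock]
    | succ a =>
      set F : ℤ → ℂ := fun k => circlePoint (θ b.castSucc) ^ k - circlePoint (θ (Fin.last m)) ^ k
      have hF := sum_neg_add_sum_pos he0 (F := F) (by simp [F]) a
      have hF' : ∑ l ∈ Finset.range (m + 2), e l * F (l - ((a : ℕ) + 1 : ℕ)) = 0 := by
        simp only [F, hzp, mul_sub, ← mul_assoc]
        rw [Finset.sum_sub_distrib, ← Finset.sum_mul, ← Finset.sum_mul, hsum, hsum]
        simp
      rw [hF'] at hF
      rw [← hF]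
      simp only [hQ11, hQ12, conjWeightBlock, weightBlock, Matrix.of_apply, Fin.cases_succ,
        Fin.cases_zero, zero_mul, zero_add, F, circlePoint_zpow_neg, zpow_natCast, map_sub, map_pow]
      rfl
  have hangle : Q11 * conjAngleBlock x + Q12 * angleBlockPos x = angleBlock x := by
    ext i j
    rw [Matrix.add_apply, Matrix.mul_apply, Matrix.mul_apply, Fin.sum_univ_succ]
    induction i using Fin.cases with
    | zero => simp [hQ11, hQ12, conjAngleBlock, angleBlock]
    | succ a =>
      set F : ℤ → ℂ := fun k => (conf x).2 j * (k * Complex.I * circlePoint (θ j) ^ k)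
      have hF := sum_neg_add_sum_pos he0 (F := F) (by simp [F]) a
      have hF' : ∑ l ∈ Finset.range (m + 2), e l * F (l - ((a : ℕ) + 1 : ℕ)) =
          angleBlock x a.succ j := by
        have h1 : ∀ l : ℕ, e l * F (l - ((a : ℕ) + 1 : ℕ)) =
            ((conf x).2 j * Complex.I * (circlePoint (θ j))⁻¹ ^ ((a : ℕ) + 1)) *
              (e l * (l * circlePoint (θ j) ^ l)) -
            ((a : ℕ) + 1) * ((conf x).2 j * Complex.I * (circlePoint (θ j))⁻¹ ^ ((a : ℕ) + 1)) *
              (e l * circlePoint (θ j) ^ l) := by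
          intro l
          simp only [F, hzp]
          push_cast
          ring
        simp only [h1]
        rw [Finset.sum_sub_distrib, ← Finset.mul_sum, ← Finset.mul_sum, hsum, hsum', mul_zero,
          sub_zero, angleBlock, Matrix.of_apply, Fin.cases_succ, pow_succ]
        have h2 : (circlePoint (θ j))⁻¹ * circlePoint (θ j) = 1 :=
          inv_mul_cancel₀ (circlePoint_ne_zero _)
        change _ = (conf x).2 j * (Complex.I *
          (nodeDeriv θ j * (circlePoint (θ j))⁻¹ ^ (a : ℕ)))
        linear_combination ((conf x).2 j * Complex.I * (circlePoint (θ j))⁻¹ ^ (a : ℕ) *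
          nodeDeriv θ j) * h2
      rw [← hF', ← hF]
      simp only [hQ11, hQ12, conjAngleBlock, angleBlockPos, Matrix.of_apply, Fin.cases_succ,
        Fin.cases_zero, zero_mul, zero_add, F, circlePoint_zpow_neg, zpow_natCast, map_mul, map_pow,
        Complex.conj_ofReal, Complex.conj_I, Complex.conj_natCast]
      congr 1
      refine Finset.sum_congr rfl fun c _ => ?_
      congr 2
      push_cast
      ring_nf
      rfl
  have hprod : Matrix.fromBlocks Q11 Q12 0 1 * Matrix.fromBlocks (conjAngleBlock x)
      (conjWeightBlock x) (angleBlockPos x) (weightBlock x) =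
      Matrix.fromBlocks (angleBlock x) 0 (angleBlockPos x) (weightBlock x) := by
    rw [Matrix.fromBlocks_multiply, hzero, hangle]
    simp
  have hQdet : ‖Q11.det‖ = 1 := by
    rw [Matrix.det_of_isLowerTriangular, Fin.prod_univ_succ]
    · have : ‖e 0‖ = 1 := by
        simp only [he, hN, nodePoly, coeff_zero_prod, norm_prod]
        simp [norm_circlePoint]
      simp [hQ11, this]
    · intro i j hij
      have hij' : i < j := hij
      induction i using Fin.cases with
      | zero =>
        simp only [hQ11, Matrix.of_apply, Fin.cases_zero]
        rw [if_neg hij'.ne']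
      | succ a =>
        induction j using Fin.cases with
        | zero => simp [hQ11]
        | succ b =>
          simp only [hQ11, Matrix.of_apply, Fin.cases_succ]
          rw [if_neg (not_le.2 (Fin.succ_lt_succ_iff.1 hij'))]
  have hd := congrArg (fun M => ‖Matrix.det M‖) hprod
  simp only [Matrix.det_mul, Matrix.det_fromBlocks_zero₁₂, Matrix.det_fromBlocks_zero₂₁,
    Matrix.det_one, mul_one, norm_mul, hQdet, one_mul] at hd
  exact hd

/-- The Jacobian of the moment map. -/
theorem abs_det_momentMapDeriv (h : IsGeneric (conf x)) :
    2 ^ m * |(momentMapDeriv x).det| =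
      ‖∏ i, ∏ j ∈ Finset.Ioi i, (circlePoint ((conf x).1 j) - circlePoint ((conf x).1 i))‖ ^ 2 *
        ∏ k ∈ Finset.range m, nrm (conf x) (Phi k (conf x)) := by
  have h1 := norm_det_angleBlock h
  have h2 := norm_sq_vandermonde_mul_prod h
  have h3 : ‖(weightBlock x).det‖ = _ := norm_det_sub_last fun j => circlePoint (x (Sum.inl j))
  have hpos := nrm_Phi_pos h (Nat.lt_succ_self m)
  rw [← norm_det_complex_rows, norm_det_complex_rows_eq, h3]
  rw [Finset.prod_range_succ] at h2
  have hV : ∏ i, ∏ j ∈ Finset.Ioi i, (circlePoint ((conf x).1 j) - circlePoint ((conf x).1 i)) =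
      (Matrix.vandermonde fun j => circlePoint (x (Sum.inl j))).det := by
    rw [Matrix.det_vandermonde]; rfl
  rw [hV] at h2 ⊢
  set V := ‖(Matrix.vandermonde fun j => circlePoint (x (Sum.inl j))).det‖
  refine mul_right_cancel₀ hpos.ne' ?_
  linear_combination V * h1 + V ^ 2 * h2

end Determinant

/-! ### The triangular change of variables from the moments to the Verblunsky coefficients -/

section Triangular

/-- The extension by zero of a finite sequence. -/
def extendZero {m : ℕ} (γ : Fin m → ℂ) (i : ℕ) : ℂ := if h : i < m then γ ⟨i, h⟩ else 0

/-- The monic orthogonal polynomials with given deformed Verblunsky coefficients. -/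
def szego (g : ℕ → ℂ) : ℕ → ℂ[X]
  | 0 => 1
  | k + 1 => X * szego g k - C (g k * phase g k) * starPoly k (szego g k)

/-- The square of the norm of the `k`-th monic orthogonal polynomial. -/
def normProd (g : ℕ → ℂ) (k : ℕ) : ℝ := ∏ i ∈ Finset.range k, (1 - ‖g i‖ ^ 2)

theorem phase_congr {g g' : ℕ → ℂ} {k : ℕ} (h : ∀ i < k, g i = g' i) : phase g k = phase g' k := by
  have : ∏ i ∈ Finset.range k, (1 - g i) = ∏ i ∈ Finset.range k, (1 - g' i) :=
    Finset.prod_congr rfl fun i hi => by rw [h i (Finset.mem_range.1 hi)]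
  rw [phase, phase, this]

theorem normProd_congr {g g' : ℕ → ℂ} {k : ℕ} (h : ∀ i < k, g i = g' i) :
    normProd g k = normProd g' k :=
  Finset.prod_congr rfl fun i hi => by rw [h i (Finset.mem_range.1 hi)]

theorem szego_congr {g g' : ℕ → ℂ} {k : ℕ} (h : ∀ i < k, g i = g' i) : szego g k = szego g' k := by
  induction k with
  | zero => rfl
  | succ k ih =>
    have h' : ∀ i < k, g i = g' i := fun i hi => h i (hi.trans k.lt_succ_self)
    rw [szego, szego, ih h', phase_congr h', h k k.lt_succ_self]

theorem szego_verb {n : ℕ} {ω : (Fin n → ℝ) × (Fin n → ℝ)} (h : IsGeneric ω) {k : ℕ} (hk : k ≤ n) :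
    szego (verb ω) k = Phi k ω := by
  induction k with
  | zero => rw [Phi_zero]; rfl
  | succ k ih => rw [szego, ih (Nat.le_of_succ_le hk), Phi_succ_eq h hk]

theorem normProd_pos {g : ℕ → ℂ} {k : ℕ} (h : ∀ i < k, ‖g i‖ < 1) : 0 < normProd g k :=
  Finset.prod_pos fun i hi => by
    have := h i (Finset.mem_range.1 hi)
    nlinarith [norm_nonneg (g i)]

theorem natDegree_szego_le (g : ℕ → ℂ) (k : ℕ) : (szego g k).natDegree ≤ k := by
  induction k with
  | zero => simp [szego]
  | succ k ih =>
    rw [szego]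
    refine (natDegree_sub_le _ _).trans (max_le ?_ ?_)
    · exact natDegree_mul_le.trans (by rw [natDegree_X]; lia)
    · exact (natDegree_C_mul_le _ _).trans ((natDegree_starPoly ih).trans k.le_succ)

theorem coeff_szego_self (g : ℕ → ℂ) (k : ℕ) : (szego g k).coeff k = 1 := by
  induction k with
  | zero => simp [szego]
  | succ k ih =>
    rw [szego, coeff_sub, coeff_X_mul, ih, coeff_C_mul, coeff_eq_zero_of_natDegree_lt
      (Nat.lt_succ_of_le (natDegree_starPoly (natDegree_szego_le g k))), mul_zero, sub_zero]

theorem extendZero_snoc_of_lt {m : ℕ} (γ : Fin m → ℂ) (y : ℂ) {i : ℕ} (hi : i < m) :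
    extendZero (Fin.snoc (α := fun _ => ℂ) γ y) i = extendZero γ i := by
  rw [extendZero, extendZero, dif_pos hi, dif_pos (hi.trans m.lt_succ_self)]
  exact Fin.snoc_castSucc (α := fun _ => ℂ) (i := ⟨i, hi⟩) ..

theorem extendZero_verb {n : ℕ} (ω : (Fin n → ℝ) × (Fin n → ℝ)) {m i : ℕ} (hi : i < m) :
    extendZero (fun j : Fin m => verb ω j) i = verb ω i := by
  rw [extendZero, dif_pos hi]

/-- The deformed Verblunsky coefficients `γ_0, …, γ_{m-1}` as functions of the moments
`c_1, …, c_m`, by solving the identity `sum_coeff_mul_moment` for `γ_k`. The values are meaningful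
only as long as they lie in the unit disc. -/
def momentsToVerb : (m : ℕ) → (Fin m → ℂ) → Fin m → ℂ
  | 0, _ => Fin.elim0
  | m + 1, c =>
    Fin.snoc (α := fun _ => ℂ) (momentsToVerb m (Fin.init c))
      ((∑ i : Fin (m + 1), (szego (extendZero (momentsToVerb m (Fin.init c))) m).coeff i * c i) /
        (phase (extendZero (momentsToVerb m (Fin.init c))) m *
          normProd (extendZero (momentsToVerb m (Fin.init c))) m))

theorem momentsToVerb_moment {n : ℕ} {ω : (Fin n → ℝ) × (Fin n → ℝ)} (h : IsGeneric ω) {m : ℕ}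
    (hm : m ≤ n) :
    momentsToVerb m (fun i => moment ω (i + 1)) = fun i : Fin m => verb ω i := by
  induction m with
  | zero => ext i; exact i.elim0
  | succ m ih =>
    have hinit : Fin.init (fun i : Fin (m + 1) => moment ω (i + 1)) =
        fun i : Fin m => moment ω (i + 1) := by ext i; rfl
    rw [momentsToVerb, hinit, ih (Nat.le_of_succ_le hm),
      szego_congr (fun i hi => extendZero_verb ω hi),
      phase_congr (fun i hi => extendZero_verb ω hi),
      normProd_congr (fun i hi => extendZero_verb ω hi), szego_verb h (Nat.le_of_succ_le hm)]
    ext i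
    induction i using Fin.lastCases with
    | cast i => rw [Fin.snoc_castSucc]; rfl
    | last =>
      rw [Fin.snoc_last, Fin.sum_univ_eq_sum_range (fun i => (Phi m ω).coeff i * moment ω (i + 1)),
        sum_coeff_mul_moment h hm, normProd, ← nrm_Phi_eq h (Nat.le_of_succ_le hm), mul_assoc]
      refine mul_div_cancel_right₀ _ (mul_ne_zero ?_ ?_)
      · rw [← norm_ne_zero_iff, norm_phase]
        · exact one_ne_zero
        · intro i hi h1
          have := norm_verb_lt_one h (k := i) (by lia)
          rw [h1, norm_one] at this
          exact lt_irrefl _ this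
      · exact_mod_cast (nrm_Phi_pos h hm).ne'

theorem measurable_extendZero {m : ℕ} (i : ℕ) :
    Measurable fun γ : Fin m → ℂ => extendZero γ i := by
  unfold extendZero
  split_ifs with h
  · exact measurable_pi_apply _
  · exact measurable_const

theorem measurable_phase {m : ℕ} (k : ℕ) :
    Measurable fun γ : Fin m → ℂ => phase (extendZero γ) k := by
  have h1 : Measurable fun γ : Fin m → ℂ => ∏ i ∈ Finset.range k, (1 - extendZero γ i) :=
    Finset.measurable_fun_prod _ fun i _ => (measurable_extendZero i).const_sub 1
  exact h1.div (Complex.continuous_conj.measurable.comp h1)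

theorem measurable_normProd {m : ℕ} (k : ℕ) :
    Measurable fun γ : Fin m → ℂ => normProd (extendZero γ) k :=
  Finset.measurable_fun_prod _ fun i _ => ((measurable_extendZero i).norm.pow_const 2).const_sub 1

theorem measurable_coeff_szego {m : ℕ} (k i : ℕ) :
    Measurable fun γ : Fin m → ℂ => (szego (extendZero γ) k).coeff i := by
  induction k generalizing i with
  | zero => exact measurable_const
  | succ k ih =>
    simp only [szego, coeff_sub, coeff_C_mul, starPoly, coeff_reflect, coeff_map]
    refine Measurable.sub ?_ (((measurable_extendZero k).mul (measurable_phase k)).mul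
      (Complex.continuous_conj.measurable.comp (ih _)))
    rcases i with _ | i
    · simp
    · simpa only [coeff_X_mul] using ih i

theorem measurable_snoc {α : Type*} [MeasurableSpace α] {m : ℕ} {f : α → Fin m → ℂ} {g : α → ℂ}
    (hf : Measurable f) (hg : Measurable g) :
    Measurable fun a => Fin.snoc (α := fun _ => ℂ) (f a) (g a) := by
  refine measurable_pi_iff.2 fun i => ?_
  induction i using Fin.lastCases with
  | last => simpa using hg
  | cast i =>
    simp only [Fin.snoc_castSucc]
    exact (measurable_pi_apply i).comp hf

theorem measurable_momentsToVerb (m : ℕ) : Measurable (momentsToVerb m) := by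
  induction m with
  | zero => exact measurable_const
  | succ m ih =>
    have hinit : Measurable fun c : Fin (m + 1) → ℂ => Fin.init (α := fun _ => ℂ) c :=
      measurable_pi_iff.2 fun i => measurable_pi_apply _
    have h1 := ih.comp hinit
    refine measurable_snoc h1 (Measurable.div ?_ ?_)
    · exact Finset.measurable_fun_sum _ fun i _ =>
        ((measurable_coeff_szego m i).comp h1).mul (measurable_pi_apply i)
    · exact ((measurable_phase m).comp h1).mul
        (Complex.measurable_ofReal.comp ((measurable_normProd m).comp h1))

/-- The open polydisc. -/
def polydisc (m : ℕ) : Set (Fin m → ℂ) := {γ | ∀ i, ‖γ i‖ < 1}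

theorem measurableSet_polydisc (m : ℕ) : MeasurableSet (polydisc m) := by
  have : polydisc m = ⋂ i, {γ | ‖γ i‖ < 1} := by ext; simp [polydisc]
  rw [this]
  exact MeasurableSet.iInter fun i => measurableSet_lt (measurable_pi_apply i).norm measurable_const

theorem snoc_mem_polydisc {m : ℕ} {γ : Fin m → ℂ} {y : ℂ} :
    Fin.snoc (α := fun _ => ℂ) γ y ∈ polydisc (m + 1) ↔ γ ∈ polydisc m ∧ ‖y‖ < 1 := by
  constructor
  · intro h
    exact ⟨fun i => by simpa using h i.castSucc, by simpa using h (Fin.last m)⟩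
  · rintro ⟨h1, h2⟩ i
    induction i using Fin.lastCases with
    | last => simpa using h2
    | cast i => simpa using h1 i

theorem norm_extendZero_lt_one {m : ℕ} {γ : Fin m → ℂ} (h : γ ∈ polydisc m) (i : ℕ) :
    ‖extendZero γ i‖ < 1 := by
  unfold extendZero
  split_ifs with hi
  · exact h _
  · simp

theorem lintegral_snoc {E : Type*} [MeasureSpace E] [SigmaFinite (volume : Measure E)] {m : ℕ}
    {f : (Fin (m + 1) → E) → ℝ≥0∞} (hf : Measurable f) :
    ∫⁻ c, f c = ∫⁻ c : Fin m → E, ∫⁻ x, f (Fin.snoc (α := fun _ => E) c x) := by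
  have h1 := (volume_preserving_piFinSuccAbove (fun _ : Fin (m + 1) => E) (Fin.last m)).symm
  have hm : Measurable fun q : E × (Fin m → E) =>
      f ((MeasurableEquiv.piFinSuccAbove (fun _ => E) (Fin.last m)).symm q) :=
    hf.comp (MeasurableEquiv.measurable _)
  rw [← h1.lintegral_comp hf, Measure.volume_eq_prod, lintegral_prod_symm _ hm.aemeasurable]
  refine lintegral_congr fun c => lintegral_congr fun x => ?_
  congr 1
  exact Fin.insertNth_last' x c

/-- Affine changes of variables in the complex plane. -/
theorem lintegral_comp_add_div {a : ℂ} (ha : a ≠ 0) (b : ℂ) {f : ℂ → ℝ≥0∞} (hf : Measurable f) :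
    ∫⁻ x, f ((b + x) / a) = ∫⁻ y, f y * ENNReal.ofReal (‖a‖ ^ 2) := by
  have hadd : ∫⁻ x, f ((b + x) / a) = ∫⁻ x, f (x / a) := by
    rw [lintegral_add_left_eq_self (fun x => f (x / a)) b]
  set L : ℂ →ₗ[ℝ] ℂ := LinearMap.mulLeft ℝ a⁻¹ with hL
  have hdet : LinearMap.det L = (‖a‖ ^ 2)⁻¹ := by
    have h1 := Algebra.norm_complex_apply a⁻¹
    rw [Complex.normSq_eq_norm_sq, norm_inv, inv_pow] at h1
    exact h1
  have hn : ‖a‖ ≠ 0 := norm_ne_zero_iff.2 ha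
  have hmap := Measure.map_linearMap_addHaar_eq_smul_addHaar (volume : Measure ℂ) (f := L)
    (by rw [hdet]; positivity)
  have hLm : Measurable L := by
    have : Continuous fun x : ℂ => a⁻¹ * x := by fun_prop
    exact this.measurable
  rw [hadd]
  calc ∫⁻ x, f (x / a) = ∫⁻ x, f (L x) := by
        refine lintegral_congr fun x => ?_
        rw [hL, LinearMap.mulLeft_apply, div_eq_inv_mul]
    _ = ∫⁻ y, f y ∂(Measure.map L volume) := (lintegral_map hf hLm).symm
    _ = _ := by
      rw [hmap, lintegral_smul_measure, hdet, inv_inv, abs_of_nonneg (by positivity), smul_eq_mul,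
        ← lintegral_const_mul _ hf]
      exact lintegral_congr fun y => mul_comm _ _

/-- The change of variables from the moments to the deformed Verblunsky coefficients. The map is
triangular: given the previous moments, the last coefficient is an affine function of the last
moment, whose slope has modulus `1 / normProd`; as a map of the plane it has the square of that as
Jacobian. -/
theorem setLIntegral_momentsToVerb (m : ℕ) {G : (Fin m → ℂ) → ℝ≥0∞} (hG : Measurable G) :
    ∫⁻ c in momentsToVerb m ⁻¹' polydisc m, G (momentsToVerb m c) =
      ∫⁻ γ in polydisc m,
        G γ * ENNReal.ofReal (∏ k ∈ Finset.range m, normProd (extendZero γ) k ^ 2) := by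
  induction m with
  | zero =>
    have h1 : (momentsToVerb 0 ⁻¹' polydisc 0) = Set.univ := by
      ext c; simp [polydisc]
    have h2 : polydisc 0 = Set.univ := by ext c; simp [polydisc]
    rw [h1, h2]
    refine lintegral_congr fun c => ?_
    rw [Subsingleton.elim (momentsToVerb 0 c) c]
    simp
  | succ m ih =>
    have hpre : MeasurableSet (momentsToVerb (m + 1) ⁻¹' polydisc (m + 1)) :=
      measurable_momentsToVerb _ (measurableSet_polydisc _)
    have hW : Measurable fun γ : Fin (m + 1) → ℂ =>
        ENNReal.ofReal (∏ k ∈ Finset.range (m + 1), normProd (extendZero γ) k ^ 2) :=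
      (Finset.measurable_fun_prod _ fun k _ => (measurable_normProd k).pow_const 2).ennreal_ofReal
    set G' : (Fin m → ℂ) → ℝ≥0∞ := fun γ => (∫⁻ y in {y : ℂ | ‖y‖ < 1},
      G (Fin.snoc (α := fun _ => ℂ) γ y)) * ENNReal.ofReal (normProd (extendZero γ) m ^ 2) with hG'
    have hdisc : MeasurableSet {y : ℂ | ‖y‖ < 1} :=
      measurableSet_lt measurable_norm measurable_const
    have hGs : Measurable fun q : (Fin m → ℂ) × ℂ => G (Fin.snoc (α := fun _ => ℂ) q.1 q.2) :=
      hG.comp (measurable_snoc measurable_fst measurable_snd)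
    have hG'm : Measurable G' :=
      (Measurable.lintegral_prod_right' hGs).mul
        (((measurable_normProd m).pow_const 2).ennreal_ofReal)
    have hcomp : Measurable fun c => G (momentsToVerb (m + 1) c) :=
      hG.comp (measurable_momentsToVerb _)
    have hGW : Measurable fun γ => G γ *
        ENNReal.ofReal (∏ k ∈ Finset.range (m + 1), normProd (extendZero γ) k ^ 2) := hG.mul hW
    rw [← lintegral_indicator hpre, lintegral_snoc (hcomp.indicator hpre),
      ← lintegral_indicator (measurableSet_polydisc _), lintegral_snoc
      (hGW.indicator (measurableSet_polydisc _))]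
    have hleft : ∀ c : Fin m → ℂ, ∫⁻ x, (momentsToVerb (m + 1) ⁻¹' polydisc (m + 1)).indicator
        (fun c => G (momentsToVerb (m + 1) c)) (Fin.snoc (α := fun _ => ℂ) c x) =
        (momentsToVerb m ⁻¹' polydisc m).indicator (fun c => G' (momentsToVerb m c)) c := by
      intro c
      set γ := momentsToVerb m c with hγ
      set a : ℂ := phase (extendZero γ) m * normProd (extendZero γ) m with ha
      set b : ℂ := ∑ i : Fin m, (szego (extendZero γ) m).coeff i * c i with hb
      have hval : ∀ x, momentsToVerb (m + 1) (Fin.snoc (α := fun _ => ℂ) c x) =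
          Fin.snoc (α := fun _ => ℂ) γ ((b + x) / a) := by
        intro x
        rw [momentsToVerb, Fin.init_snoc, Fin.sum_univ_castSucc]
        simp only [Fin.snoc_castSucc, Fin.snoc_last, Fin.val_castSucc, Fin.val_last,
          coeff_szego_self, one_mul]
        rfl
      by_cases hc : γ ∈ polydisc m
      · have hc' : c ∈ momentsToVerb m ⁻¹' polydisc m := hc
        have hlt := norm_extendZero_lt_one hc
        have hph : ‖phase (extendZero γ) m‖ = 1 := norm_phase fun i _ h1 => by
          have := hlt i
          rw [h1, norm_one] at this
          exact lt_irrefl _ this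
        have hnp := normProd_pos (k := m) fun i _ => hlt i
        have hna : ‖a‖ = normProd (extendZero γ) m := by
          rw [ha, norm_mul, hph, one_mul, Complex.norm_real, Real.norm_of_nonneg hnp.le]
        have ha0 : a ≠ 0 := norm_ne_zero_iff.1 (by rw [hna]; exact hnp.ne')
        rw [Set.indicator_of_mem hc']
        have h1 : ∀ x, (momentsToVerb (m + 1) ⁻¹' polydisc (m + 1)).indicator
            (fun c => G (momentsToVerb (m + 1) c)) (Fin.snoc (α := fun _ => ℂ) c x) =
            {y : ℂ | ‖y‖ < 1}.indicator (fun y => G (Fin.snoc (α := fun _ => ℂ) γ y))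
              ((b + x) / a) := by
          intro x
          simp only [Set.indicator, Set.mem_preimage, hval, snoc_mem_polydisc, hc, true_and,
            Set.mem_ofPred_eq]
        simp only [h1]
        have hm1 : Measurable fun y => G (Fin.snoc (α := fun _ => ℂ) γ y) :=
          hG.comp (measurable_snoc measurable_const measurable_id)
        rw [lintegral_comp_add_div ha0 b (hm1.indicator hdisc), hna,
          lintegral_mul_const _ (hm1.indicator hdisc), lintegral_indicator hdisc]
      · have hc' : c ∉ momentsToVerb m ⁻¹' polydisc m := hc
        rw [Set.indicator_of_notMem hc']
        have h1 : ∀ x, (momentsToVerb (m + 1) ⁻¹' polydisc (m + 1)).indicator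
            (fun c => G (momentsToVerb (m + 1) c)) (Fin.snoc (α := fun _ => ℂ) c x) = 0 := by
          intro x
          refine Set.indicator_of_notMem (fun h => hc ?_) _
          rw [Set.mem_preimage, hval, snoc_mem_polydisc] at h
          exact h.1
        simp only [h1, lintegral_zero]
    have hright : ∀ γ : Fin m → ℂ, ∫⁻ y, (polydisc (m + 1)).indicator
        (fun γ => G γ *
          ENNReal.ofReal (∏ k ∈ Finset.range (m + 1), normProd (extendZero γ) k ^ 2))
          (Fin.snoc (α := fun _ => ℂ) γ y) =
        (polydisc m).indicator (fun γ => G' γ *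
          ENNReal.ofReal (∏ k ∈ Finset.range m, normProd (extendZero γ) k ^ 2)) γ := by
      intro γ
      have hm1 : Measurable fun y => G (Fin.snoc (α := fun _ => ℂ) γ y) :=
        hG.comp (measurable_snoc measurable_const measurable_id)
      have h1 : ∀ y, (polydisc (m + 1)).indicator (fun γ => G γ *
          ENNReal.ofReal (∏ k ∈ Finset.range (m + 1), normProd (extendZero γ) k ^ 2))
          (Fin.snoc (α := fun _ => ℂ) γ y) = {y : ℂ | ‖y‖ < 1}.indicator
            (fun y => G (Fin.snoc (α := fun _ => ℂ) γ y)) y * (polydisc m).indicator (fun γ =>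
          ENNReal.ofReal (normProd (extendZero γ) m ^ 2) *
          ENNReal.ofReal (∏ k ∈ Finset.range m, normProd (extendZero γ) k ^ 2)) γ := by
        intro y
        by_cases hc : γ ∈ polydisc m <;> by_cases hy : ‖y‖ < 1
        · simp only [Set.indicator, snoc_mem_polydisc, hc, hy, and_self, if_true,
            Set.mem_ofPred_eq]
          congr 1
          have hk : ∀ k ≤ m, normProd (extendZero (Fin.snoc (α := fun _ => ℂ) γ y)) k =
              normProd (extendZero γ) k := fun k hk =>
            normProd_congr fun i hi => extendZero_snoc_of_lt γ y (hi.trans_le hk)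
          rw [Finset.prod_range_succ, hk m le_rfl, mul_comm,
            ENNReal.ofReal_mul (by positivity)]
          congr 2
          exact Finset.prod_congr rfl fun k hkm => by rw [hk k (Finset.mem_range.1 hkm).le]
        all_goals simp [Set.indicator, snoc_mem_polydisc, hc, hy]
      simp only [h1]
      rw [lintegral_mul_const _ (hm1.indicator hdisc), lintegral_indicator hdisc]
      by_cases hc : γ ∈ polydisc m
      · rw [Set.indicator_of_mem hc, Set.indicator_of_mem hc, hG', mul_assoc]
      · rw [Set.indicator_of_notMem hc, Set.indicator_of_notMem hc, mul_zero]
    simp only [hleft, hright]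
    rw [lintegral_indicator (measurable_momentsToVerb _ (measurableSet_polydisc _)),
      lintegral_indicator (measurableSet_polydisc _)]
    exact ih hG'm

end Triangular

/-! ### The image of the configurations under the moment map -/

section Sector

variable {m : ℕ}

theorem circlePoint_add_int_mul (θ : ℝ) (r : ℤ) :
    circlePoint (θ + r * (2 * Real.pi)) = circlePoint θ := by
  rw [circlePoint, circlePoint, Complex.exp_eq_exp_iff_exists_int]
  exact ⟨r, by push_cast; ring⟩

theorem circlePoint_injOn : Set.InjOn circlePoint (Set.Ico 0 (2 * Real.pi)) := by
  intro a ha b hb hab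
  obtain ⟨r, hr⟩ := Complex.exp_eq_exp_iff_exists_int.1 hab
  have h1 : a = b + r * (2 * Real.pi) := by
    have : ((a : ℂ)) = ((b + r * (2 * Real.pi) : ℝ) : ℂ) := by
      have h2 : (a : ℂ) * Complex.I = (b + r * (2 * Real.pi)) * Complex.I := by
        rw [hr]; ring
      push_cast
      exact mul_right_cancel₀ Complex.I_ne_zero h2
    exact_mod_cast this
  have hpi := Real.pi_pos
  have h2 : (r : ℝ) < 1 := by
    by_contra h
    nlinarith [ha.1, ha.2, hb.1, hb.2, not_lt.1 h]
  have h3 : (-1 : ℝ) < r := by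
    by_contra h
    nlinarith [ha.1, ha.2, hb.1, hb.2, not_lt.1 h]
  have h4 : r = 0 := by
    have h2' : r < 1 := by exact_mod_cast h2
    have h3' : -1 < r := by exact_mod_cast h3
    lia
  rw [h1, h4]; simp

theorem circlePoint_sum {ι : Type*} (s : Finset ι) (θ : ι → ℝ) :
    circlePoint (∑ j ∈ s, θ j) = ∏ j ∈ s, circlePoint (θ j) := by
  simp only [circlePoint]
  rw [← Complex.exp_sum, Complex.ofReal_sum, Finset.sum_mul]

theorem isGeneric_config {θ : Fin (m + 1) → ℝ} {p : Fin m → ℝ} (hinj : Function.Injective θ)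
    (hθ : ∀ j, θ j ∈ Set.Ico 0 (2 * Real.pi)) (hp : ∀ a, 0 < p a) (hsum : ∑ a, p a < 1) :
    IsGeneric (config θ p) where
  inj := fun i j hij => hinj (circlePoint_injOn (hθ i) (hθ j) hij)
  pos := by
    intro j
    induction j using Fin.lastCases with
    | last => simpa [config] using hsum
    | cast a => simpa [config] using hp a
  sum_eq_one := by
    rw [Fin.sum_univ_castSucc]; simp [config]

/-- The configurations whose angles are distinct and in a prescribed order. -/
def sector (m : ℕ) (σ : Equiv.Perm (Fin (m + 1))) : Set (Coord m) :=
  {x | StrictMono (fun j => x (Sum.inl (σ j))) ∧ (∀ j, x (Sum.inl j) ∈ Set.Ico 0 (2 * Real.pi)) ∧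
    (∀ a, 0 < x (Sum.inr a)) ∧ ∑ a, x (Sum.inr a) < 1}

theorem isGeneric_of_mem_sector {σ : Equiv.Perm (Fin (m + 1))} {x : Coord m} (hx : x ∈ sector m σ) :
    IsGeneric (conf x) := by
  refine isGeneric_config (fun i j hij => ?_) hx.2.1 hx.2.2.1 hx.2.2.2
  have := hx.1.injective (a₁ := σ.symm i) (a₂ := σ.symm j) (by simpa using hij)
  simpa using this

theorem measurableSet_sector (σ : Equiv.Perm (Fin (m + 1))) : MeasurableSet (sector m σ) := by
  have : sector m σ = (⋂ i, ⋂ j, ⋂ (_ : i < j), {x | x (Sum.inl (σ i)) < x (Sum.inl (σ j))}) ∩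
      ((⋂ j, (fun x => x (Sum.inl j)) ⁻¹' Set.Ico 0 (2 * Real.pi)) ∩
      ((⋂ a, {x | 0 < x (Sum.inr a)}) ∩ {x | ∑ a, x (Sum.inr a) < 1})) := by
    ext x
    simp [sector, StrictMono]
  rw [this]
  refine MeasurableSet.inter (MeasurableSet.iInter fun i => MeasurableSet.iInter fun j =>
    MeasurableSet.iInter fun _ => measurableSet_lt (measurable_pi_apply _) (measurable_pi_apply _))
    (MeasurableSet.inter (MeasurableSet.iInter fun j => measurable_pi_apply _ measurableSet_Ico)
    (MeasurableSet.inter (MeasurableSet.iInter fun a =>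
      measurableSet_lt measurable_const (measurable_pi_apply _))
      (measurableSet_lt (Finset.measurable_fun_sum _ fun a _ => measurable_pi_apply _)
        measurable_const)))

/-- In a sector, a configuration is determined by its moments and the product of its nodes. -/
theorem eq_of_moment_eq {σ : Equiv.Perm (Fin (m + 1))} {x x' : Coord m} (hx : x ∈ sector m σ)
    (hx' : x' ∈ sector m σ)
    (hmom : ∀ a : Fin m, moment (conf x) (a + 1) = moment (conf x') (a + 1))
    (hprod : ∏ j, circlePoint (x (Sum.inl j)) = ∏ j, circlePoint (x' (Sum.inl j))) : x = x' := by
  have hg := isGeneric_of_mem_sector hx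
  have hg' := isGeneric_of_mem_sector hx'
  have hmom' : ∀ k ≤ m, moment (conf x) k = moment (conf x') k := by
    intro k hk
    rcases k with _ | k
    · have h0 : ∀ y : Coord m, IsGeneric (conf y) → moment (conf y) 0 = 1 := by
        intro y hy
        simp only [moment, pow_zero, mul_one]
        exact_mod_cast hy.sum_eq_one
      rw [h0 x hg, h0 x' hg']
    · exact hmom ⟨k, hk⟩
  have hN := nodePoly_eq_of_moment_eq hg hmom' hprod
  have hsub : ∀ y y' : Coord m, y ∈ sector m σ → y' ∈ sector m σ →
      nodePoly (conf y).1 = nodePoly (conf y').1 →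
      Set.range (fun j => y (Sum.inl (σ j))) ⊆ Set.range (fun j => y' (Sum.inl (σ j))) := by
    rintro y y' hy hy' hyy _ ⟨j, rfl⟩
    have h1 := eval_nodePoly_node (conf y).1 (σ j)
    rw [hyy, nodePoly, eval_prod, Finset.prod_eq_zero_iff] at h1
    obtain ⟨i, -, hi⟩ := h1
    rw [eval_sub, eval_X, eval_C, sub_eq_zero] at hi
    have h2 := circlePoint_injOn (hy.2.1 (σ j)) (hy'.2.1 i) hi
    exact ⟨σ.symm i, by simp [h2]⟩
  have hθ : ∀ j, x (Sum.inl j) = x' (Sum.inl j) := by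
    have h1 := (StrictMono.range_inj hx.1 hx'.1).1
      (Set.Subset.antisymm (hsub x x' hx hx' hN) (hsub x' x hx' hx hN.symm))
    intro j
    simpa using congrFun h1 (σ.symm j)
  have hw : ∀ j, (conf x).2 j = (conf x').2 j := by
    have h1 := Matrix.eq_zero_of_forall_pow_sum_mul_pow_eq_zero
      (f := fun j => circlePoint (x (Sum.inl j)))
      (v := fun j => (((conf x).2 j : ℂ) - (conf x').2 j)) hg.inj (by
        intro k
        have h2 := hmom' k (Nat.lt_succ_iff.1 k.2)
        rw [← sub_eq_zero, moment, moment, ← Finset.sum_sub_distrib] at h2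
        rw [← h2]
        refine Finset.sum_congr rfl fun j _ => ?_
        have : (conf x').1 j = x (Sum.inl j) := (hθ j).symm
        rw [this, sub_mul]
        rfl)
    intro j
    have h2 := congrFun h1 j
    simp only [Pi.zero_apply, sub_eq_zero] at h2
    exact_mod_cast h2
  ext i
  rcases i with j | a
  · exact hθ j
  · rw [← conf_snd_castSucc x, ← conf_snd_castSucc x', hw]

/-- The complex moments from their real and imaginary parts, and the sum of the angles. -/
def splitCoord (y : Coord m) : (Fin m → ℂ) × ℝ :=
  (fun a => ⟨y (Sum.inr a), y (Sum.inl a.succ)⟩, y (Sum.inl 0))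

theorem measurePreserving_splitCoord :
    MeasurePreserving (splitCoord (m := m)) volume volume := by
  have h1 := volume_measurePreserving_sumPiEquivProdPi (fun _ : Fin (m + 1) ⊕ Fin m => ℝ)
  have h2 := (volume_preserving_piFinSuccAbove (fun _ : Fin (m + 1) => ℝ) 0).prod
    (MeasurePreserving.id (volume : Measure (Fin m → ℝ)))
  have h3 := measurePreserving_prodAssoc (volume : Measure ℝ) (volume : Measure (Fin m → ℝ))
    (volume : Measure (Fin m → ℝ))
  have h4 := (MeasurePreserving.id (volume : Measure ℝ)).prod (Measure.measurePreserving_swap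
    (μ := (volume : Measure (Fin m → ℝ))) (ν := (volume : Measure (Fin m → ℝ))))
  have h5 := (volume_measurePreserving_arrowProdEquivProdArrow ℝ ℝ (Fin m)).symm
  have h6 := volume_preserving_pi (fun _ : Fin m => Complex.volume_preserving_equiv_real_prod.symm)
  have h7 := (Measure.measurePreserving_swap (μ := (volume : Measure ℝ))
    (ν := (volume : Measure ((Fin m → ℝ) × (Fin m → ℝ)))))
  have h8 := (h6.comp h5).prod (MeasurePreserving.id (volume : Measure ℝ))
  exact h8.comp (h7.comp (h4.comp (h3.comp (h2.comp h1))))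

/-- Integration over a sector through the moment map. The image lies in the set of moments for
which the Verblunsky coefficients are in the unit disc. Only this inclusion is used, hence the
inequality. -/
theorem lintegral_sector_le (σ : Equiv.Perm (Fin (m + 1))) {g : (Fin m → ℂ) × ℂ → ℝ≥0∞}
    (hg : Measurable g) :
    ∫⁻ x in sector m σ, ENNReal.ofReal |(momentMapDeriv x).det| *
        g (fun a => moment (conf x) (a + 1), circlePoint (∑ j, x (Sum.inl j))) ≤
      ∫⁻ c in momentsToVerb m ⁻¹' polydisc m, ∫⁻ φ in Set.Ico 0 (2 * Real.pi),
        g (c, circlePoint φ) := by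
  set ρ : ℝ := 2 * Real.pi with hρ
  have hρ0 : 0 < ρ := by positivity
  -- The sum of the angles is known from the product of the nodes only modulo `2π`: the sector is
  -- cut along the multiples of `2π`, and each piece is translated back to `[0, 2π)`.
  set S : ℤ → Set (Coord m) := fun r => sector m σ ∩
    {x | ∑ j, x (Sum.inl j) ∈ Set.Ico (r * ρ) ((r + 1) * ρ)} with hS
  set f : ℤ → Coord m → Coord m := fun r x => momentMap x - Pi.single (Sum.inl 0) (r * ρ) with hf
  have hSm : ∀ r, MeasurableSet (S r) := fun r => (measurableSet_sector σ).inter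
    ((Finset.measurable_fun_sum Finset.univ fun (j : Fin (m + 1)) _ =>
      measurable_pi_apply (Sum.inl j)) measurableSet_Ico)
  have hSU : sector m σ = ⋃ r, S r := by
    ext x
    simp only [hS, Set.mem_iUnion, Set.mem_inter_iff, exists_and_left]
    refine ⟨fun hx => ⟨hx, ⌊(∑ j, x (Sum.inl j)) / ρ⌋, ?_, ?_⟩, fun hx => hx.1⟩
    · rw [← le_div_iff₀ hρ0]; exact Int.floor_le _
    · rw [← div_lt_iff₀ hρ0]; exact Int.lt_floor_add_one _
  have hSd : Pairwise (Function.onFun Disjoint S) := by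
    intro r s hrs
    rw [Function.onFun, Set.disjoint_left]
    rintro x ⟨-, h1⟩ ⟨-, h2⟩
    have h3 : (r : ℝ) < s + 1 := lt_of_mul_lt_mul_right (h1.1.trans_lt h2.2) hρ0.le
    have h4 : (s : ℝ) < r + 1 := lt_of_mul_lt_mul_right (h2.1.trans_lt h1.2) hρ0.le
    have h3' : r < s + 1 := by exact_mod_cast h3
    have h4' : s < r + 1 := by exact_mod_cast h4
    exact hrs (by lia)
  have hκ : ∀ r x, splitCoord (f r x) =
      (fun a : Fin m => moment (conf x) (a + 1), ∑ j, x (Sum.inl j) - r * ρ) := by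
    intro r x
    refine Prod.ext ?_ ?_
    · funext a
      apply Complex.ext <;> simp [splitCoord, hf, momentMap]
    · simp [splitCoord, hf, momentMap]
  have hcirc : ∀ (t : ℝ) (r : ℤ), circlePoint (t - r * ρ) = circlePoint t := by
    intro t r
    rw [← circlePoint_add_int_mul _ r, sub_add_cancel]
  have hinj : ∀ r s x x', x ∈ S r → x' ∈ S s → f r x = f s x' → x = x' := by
    intro r s x x' hx hx' hxx
    have h1 := congrArg splitCoord hxx
    rw [hκ, hκ, Prod.mk.injEq] at h1
    refine eq_of_moment_eq hx.1 hx'.1 (fun a => congrFun h1.1 a) ?_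
    have h2 := congrArg circlePoint h1.2
    rwa [hcirc, hcirc, circlePoint_sum, circlePoint_sum] at h2
  have hder : ∀ r, ∀ x ∈ S r, HasFDerivWithinAt (f r) (momentMapDeriv x) (S r) x := fun r x _ =>
    ((hasFDerivAt_momentMap x).sub_const _).hasFDerivWithinAt
  have hinjr : ∀ r, Set.InjOn (f r) (S r) := fun r x hx x' hx' h => hinj r r x x' hx hx' h
  have himg : ∀ r, MeasurableSet (f r '' S r) := fun r =>
    measurable_image_of_fderivWithin (hSm r) (hder r) (hinjr r)
  have hdisj : Pairwise (Function.onFun Disjoint fun r => f r '' S r) := by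
    intro r s hrs
    rw [Function.onFun, Set.disjoint_left]
    rintro _ ⟨x, hx, rfl⟩ ⟨x', hx', hxx⟩
    have h1 := hinj s r x' x hx' hx hxx
    subst h1
    exact Set.disjoint_left.1 (hSd hrs) hx hx'
  set K : Set ((Fin m → ℂ) × ℝ) := (momentsToVerb m ⁻¹' polydisc m) ×ˢ Set.Ico 0 ρ with hK
  have hKm : MeasurableSet K :=
    (measurable_momentsToVerb m (measurableSet_polydisc m)).prod measurableSet_Ico
  have hsub : (⋃ r, f r '' S r) ⊆ splitCoord ⁻¹' K := by
    refine Set.iUnion_subset fun r => ?_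
    rintro _ ⟨x, hx, rfl⟩
    have hgen := isGeneric_of_mem_sector hx.1
    rw [Set.mem_preimage, hκ]
    refine ⟨?_, ?_, ?_⟩
    · simp only [Set.mem_preimage]
      rw [momentsToVerb_moment hgen (Nat.le_succ m)]
      exact fun i => norm_verb_lt_one hgen (by have := i.2; lia)
    · simpa using hx.2.1
    · have := hx.2.2
      simp only
      linarith
  set h : (Fin m → ℂ) × ℝ → ℝ≥0∞ := fun q => g (q.1, circlePoint q.2) with hh
  have hcm : Measurable circlePoint := by
    unfold circlePoint; fun_prop
  have hhm : Measurable h := hg.comp (measurable_fst.prodMk (hcm.comp measurable_snd))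
  calc ∫⁻ x in sector m σ, ENNReal.ofReal |(momentMapDeriv x).det| *
        g (fun a => moment (conf x) (a + 1), circlePoint (∑ j, x (Sum.inl j)))
      = ∑' r, ∫⁻ x in S r, ENNReal.ofReal |(momentMapDeriv x).det| *
        g (fun a => moment (conf x) (a + 1), circlePoint (∑ j, x (Sum.inl j))) := by
        conv_lhs => rw [hSU]
        rw [lintegral_iUnion hSm hSd]
    _ = ∑' r, ∫⁻ y in f r '' S r, h (splitCoord y) := by
        refine tsum_congr fun r => ?_
        rw [lintegral_image_eq_lintegral_abs_det_fderiv_mul volume (hSm r) (hder r) (hinjr r)]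
        refine lintegral_congr fun x => ?_
        rw [hκ, hh]
        simp only [hcirc]
    _ = ∫⁻ y in ⋃ r, f r '' S r, h (splitCoord y) := (lintegral_iUnion himg hdisj _).symm
    _ ≤ ∫⁻ y in splitCoord ⁻¹' K, h (splitCoord y) := lintegral_mono_set hsub
    _ = ∫⁻ q in K, h q := measurePreserving_splitCoord.setLIntegral_comp_preimage hKm hhm
    _ = _ := by
        rw [hK, Measure.volume_eq_prod, ← Measure.prod_restrict, lintegral_prod _ hhm.aemeasurable]

end Sector

/-! ### Integrals over the circle, the disc and the simplex -/

section Integrals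

theorem continuous_circlePoint : Continuous circlePoint := by
  unfold circlePoint; fun_prop

theorem circlePoint_add (a b : ℝ) : circlePoint (a + b) = circlePoint a * circlePoint b := by
  rw [circlePoint, circlePoint, circlePoint, ← Complex.exp_add]; push_cast; ring_nf

theorem circlePoint_periodic : Function.Periodic circlePoint (2 * Real.pi) := fun θ => by
  simpa using circlePoint_add_int_mul θ 1

theorem setLIntegral_periodic {f : ℝ → ℝ≥0∞} (hf : Function.Periodic f (2 * Real.pi)) (t s : ℝ) :
    ∫⁻ x in Set.Ioc t (t + 2 * Real.pi), f x = ∫⁻ x in Set.Ioc s (s + 2 * Real.pi), f x := by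
  have : VAddInvariantMeasure (AddSubgroup.zmultiples (2 * Real.pi)) ℝ volume :=
    ⟨fun c s _ => measure_preimage_add _ _ _⟩
  exact IsAddFundamentalDomain.setLIntegral_eq (G := AddSubgroup.zmultiples (2 * Real.pi))
    (isAddFundamentalDomain_Ioc Real.two_pi_pos t) (isAddFundamentalDomain_Ioc Real.two_pi_pos s) _
    hf.map_vadd_zmultiples

/-- Rotation invariance of the arc length. -/
theorem setLIntegral_circle_rotate {u : ℂ} (hu : ‖u‖ = 1) (f : ℂ → ℝ≥0∞) :
    ∫⁻ φ in Set.Ico 0 (2 * Real.pi), f (u * circlePoint φ) =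
      ∫⁻ φ in Set.Ico 0 (2 * Real.pi), f (circlePoint φ) := by
  obtain ⟨α, hα⟩ : ∃ α : ℝ, u = circlePoint α := ⟨u.arg, by
    have := Complex.norm_mul_exp_arg_mul_I u
    rw [hu] at this
    rw [Complex.ofReal_one, one_mul] at this
    exact this.symm⟩
  simp only [hα, ← circlePoint_add]
  have hper : Function.Periodic (fun φ => f (circlePoint φ)) (2 * Real.pi) := fun φ => by
    simp only [circlePoint_periodic φ]
  have h1 : ∀ a : ℝ, ∫⁻ φ in Set.Ico 0 (2 * Real.pi), f (circlePoint (a + φ)) =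
      ∫⁻ φ in Set.Ioc a (a + 2 * Real.pi), f (circlePoint φ) := by
    intro a
    rw [setLIntegral_congr Ico_ae_eq_Ioc]
    have h2 := (measurePreserving_add_left (volume : Measure ℝ) a).setLIntegral_comp_preimage_emb
      (measurableEmbedding_addLeft a) (fun φ => f (circlePoint φ)) (Set.Ioc a (a + 2 * Real.pi))
    rw [← h2]
    congr 2
    simp
  have h2 := h1 0
  simp only [zero_add] at h2
  have h3 := setLIntegral_periodic hper α 0
  rw [zero_add] at h3
  rw [h1, h2, h3]

/-- The integral of a product of functions of the separate coordinates. -/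
theorem lintegral_prod_eq_prod_lintegral {E : Type*} [MeasureSpace E]
    [SigmaFinite (volume : Measure E)] {m : ℕ} (f : Fin m → E → ℝ≥0∞)
    (hf : ∀ i, Measurable (f i)) : ∫⁻ x : Fin m → E, ∏ i, f i (x i) = ∏ i, ∫⁻ y, f i y := by
  induction m with
  | zero => simp [volume_pi]
  | succ m ih =>
    have hm : Measurable fun x : Fin (m + 1) → E => ∏ i, f i (x i) :=
      Finset.measurable_fun_prod _ fun i _ => (hf i).comp (measurable_pi_apply i)
    have hm' : Measurable fun x : Fin m → E => ∏ i, f i.castSucc (x i) :=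
      Finset.measurable_fun_prod _ fun i _ => (hf i.castSucc).comp (measurable_pi_apply i)
    rw [lintegral_snoc hm, Fin.prod_univ_castSucc, ← ih (fun i => f i.castSucc) fun i => hf _]
    simp only [Fin.prod_univ_castSucc, Fin.snoc_castSucc, Fin.snoc_last]
    rw [← lintegral_mul_const _ hm']
    exact lintegral_congr fun c => lintegral_const_mul _ (hf _)

/-- Polar coordinates in the unit disc. -/
theorem setLIntegral_disc {w : ℝ → ℝ} (hwm : Measurable w)
    {h : ℂ → ℝ≥0∞} (hh : Measurable h) :
    ∫⁻ z in {z : ℂ | ‖z‖ < 1}, ENNReal.ofReal (w ‖z‖) * h z =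
      ∫⁻ r in Set.Ioo (0 : ℝ) 1, ENNReal.ofReal (r * w r) *
        ∫⁻ φ in Set.Ico 0 (2 * Real.pi), h (r * circlePoint φ) := by
  have hdisc : MeasurableSet {y : ℂ | ‖y‖ < 1} := measurableSet_lt measurable_norm measurable_const
  have hpi := Real.pi_pos
  set F : ℂ → ℝ≥0∞ := {z : ℂ | ‖z‖ < 1}.indicator fun z => ENNReal.ofReal (w ‖z‖) * h z with hF
  have hFm : Measurable F :=
    ((hwm.comp measurable_norm).ennreal_ofReal.mul hh).indicator hdisc
  have hsymm : ∀ p : ℝ × ℝ, Complex.polarCoord.symm p = p.1 * circlePoint p.2 := by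
    intro p
    rw [Complex.polarCoord_symm_apply, circlePoint, Complex.exp_mul_I]
    simp
  have hm2 : Measurable fun p : ℝ × ℝ => ENNReal.ofReal p.1 * F (p.1 * circlePoint p.2) :=
    measurable_fst.ennreal_ofReal.mul (hFm.comp ((Complex.measurable_ofReal.comp measurable_fst).mul
      (continuous_circlePoint.measurable.comp measurable_snd)))
  rw [← lintegral_indicator hdisc, ← Complex.lintegral_comp_polarCoord_symm]
  simp only [hsymm, smul_eq_mul]
  have htarget : polarCoord.target = Set.Ioi (0 : ℝ) ×ˢ Set.Ioo (-Real.pi) Real.pi := rfl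
  rw [htarget, Measure.volume_eq_prod, ← Measure.prod_restrict, lintegral_prod _ hm2.aemeasurable,
    ← lintegral_indicator measurableSet_Ioi, ← lintegral_indicator measurableSet_Ioo]
  refine lintegral_congr fun r => ?_
  by_cases hr : r ∈ Set.Ioo (0 : ℝ) 1
  · rw [Set.indicator_of_mem hr, Set.indicator_of_mem (show r ∈ Set.Ioi (0 : ℝ) from hr.1)]
    have hn : ∀ φ, ‖(r : ℂ) * circlePoint φ‖ = r := fun φ => by
      rw [norm_mul, norm_circlePoint, mul_one, Complex.norm_real, Real.norm_of_nonneg hr.1.le]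
    have hFr : ∀ φ, ENNReal.ofReal r * F (r * circlePoint φ) =
        ENNReal.ofReal (r * w r) * h (r * circlePoint φ) := by
      intro φ
      have hmem : (r : ℂ) * circlePoint φ ∈ {z : ℂ | ‖z‖ < 1} := by
        rw [Set.mem_ofPred_eq, hn]; exact hr.2
      rw [hF, Set.indicator_of_mem hmem, hn, ENNReal.ofReal_mul hr.1.le, mul_assoc]
    have hper : Function.Periodic (fun φ => h (r * circlePoint φ)) (2 * Real.pi) := fun φ => by
      simp only [circlePoint_periodic φ]
    have h3 := setLIntegral_periodic hper (-Real.pi) 0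
    simp only [hFr]
    have hm : Measurable fun φ : ℝ => h (r * circlePoint φ) :=
      hh.comp (continuous_circlePoint.measurable.const_mul _)
    rw [lintegral_const_mul _ hm,
      setLIntegral_congr Ioo_ae_eq_Ioc, setLIntegral_congr Ico_ae_eq_Ioc]
    rw [zero_add, show -Real.pi + 2 * Real.pi = Real.pi by ring] at h3
    rw [h3]
  · rw [Set.indicator_of_notMem hr]
    by_cases hr0 : r ∈ Set.Ioi (0 : ℝ)
    · rw [Set.indicator_of_mem hr0]
      have hFr : ∀ φ, F (r * circlePoint φ) = 0 := by
        intro φ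
        refine Set.indicator_of_notMem (fun hmem => hr ⟨hr0, ?_⟩) _
        rw [Set.mem_ofPred_eq, norm_mul, norm_circlePoint, mul_one, Complex.norm_real,
          Real.norm_of_nonneg (le_of_lt hr0)] at hmem
        exact hmem
      simp [hFr]
    · rw [Set.indicator_of_notMem hr0]

/-- The radial Beta integrals. -/
theorem integral_radial (l : ℝ) (hl : 0 < l) (k : ℕ) :
    IntegrableOn (fun r : ℝ => r ^ (2 * k + 1) * (1 - r ^ 2) ^ (l - 1)) (Set.Ioo 0 1) ∧
    ∫ r in Set.Ioo (0 : ℝ) 1, r ^ (2 * k + 1) * (1 - r ^ 2) ^ (l - 1) =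
      k.factorial / (2 * ∏ i ∈ Finset.range (k + 1), (l + i)) := by
  have hpos : ∀ r ∈ Set.Ioo (0 : ℝ) 1, 0 < 1 - r ^ 2 := fun r hr => by nlinarith [hr.1, hr.2]
  have hbase : ∀ r : ℝ, HasDerivAt (fun r : ℝ => 1 - r ^ 2) (-(2 * r)) r := fun r => by
    simpa using (hasDerivAt_pow 2 r).const_sub 1
  have hpow : ∀ r ∈ Set.Ioo (0 : ℝ) 1, HasDerivAt (fun r : ℝ => (1 - r ^ 2) ^ l)
      (-(2 * r) * l * (1 - r ^ 2) ^ (l - 1)) r := fun r hr =>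
    (hbase r).rpow_const (Or.inl (hpos r hr).ne')
  have hcont : Continuous fun r : ℝ => (1 - r ^ 2) ^ l :=
    Continuous.rpow_const (by fun_prop) fun _ => Or.inr hl.le
  have hint0 : IntegrableOn (fun r : ℝ => r * (1 - r ^ 2) ^ (l - 1)) (Set.Ioc 0 1) ∧
      ∫ r in (0 : ℝ)..1, r * (1 - r ^ 2) ^ (l - 1) = 1 / (2 * l) := by
    have hd : ∀ r ∈ Set.Ioo (0 : ℝ) 1, HasDerivAt (fun r : ℝ => -(1 - r ^ 2) ^ l / (2 * l))
        (r * (1 - r ^ 2) ^ (l - 1)) r := fun r hr => by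
      refine ((hpow r hr).neg.div_const (2 * l)).congr_deriv ?_
      field_simp
    have hc : ContinuousOn (fun r : ℝ => -(1 - r ^ 2) ^ l / (2 * l)) (Set.Icc 0 1) :=
      (hcont.neg.div_const _).continuousOn
    have hi := intervalIntegral.integrableOn_deriv_of_nonneg hc hd fun r hr =>
      mul_nonneg hr.1.le (Real.rpow_nonneg (hpos r hr).le _)
    refine ⟨hi, ?_⟩
    rw [intervalIntegral.integral_eq_sub_of_hasDerivAt_of_le zero_le_one hc hd
      ((intervalIntegrable_iff_integrableOn_Ioc_of_le zero_le_one).2 hi)]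
    simp [Real.zero_rpow hl.ne']
    ring
  have hmain : ∀ k : ℕ, IntegrableOn (fun r : ℝ => r ^ (2 * k + 1) * (1 - r ^ 2) ^ (l - 1))
      (Set.Ioc 0 1) := by
    intro k
    refine Integrable.mono' hint0.1 ?_ ?_
    · refine Measurable.aestronglyMeasurable ?_
      fun_prop
    · refine (ae_restrict_iff' measurableSet_Ioc).2 (Filter.Eventually.of_forall fun r hr => ?_)
      have h1 : 0 ≤ 1 - r ^ 2 := by nlinarith [hr.1, hr.2]
      have h2 : (0 : ℝ) ≤ (1 - r ^ 2) ^ (l - 1) := Real.rpow_nonneg h1 _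
      rw [Real.norm_of_nonneg (mul_nonneg (pow_nonneg hr.1.le _) h2)]
      refine mul_le_mul_of_nonneg_right ?_ h2
      exact pow_le_of_le_one hr.1.le hr.2 (by lia)
  refine ⟨(hmain k).mono_set Set.Ioo_subset_Ioc_self, ?_⟩
  rw [← integral_Ioc_eq_integral_Ioo, ← intervalIntegral.integral_of_le zero_le_one]
  induction k with
  | zero => simpa using hint0.2
  | succ k ih =>
    have hi1 := (intervalIntegrable_iff_integrableOn_Ioc_of_le zero_le_one).2 (hmain k)
    have hi2 := (intervalIntegrable_iff_integrableOn_Ioc_of_le zero_le_one).2 (hmain (k + 1))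
    have hd : ∀ r ∈ Set.Ioo (0 : ℝ) 1, HasDerivAt (fun r : ℝ => r ^ (2 * k + 2) * (1 - r ^ 2) ^ l)
        ((2 * k + 2) * (r ^ (2 * k + 1) * (1 - r ^ 2) ^ (l - 1)) -
          (2 * k + 2 + 2 * l) * (r ^ (2 * (k + 1) + 1) * (1 - r ^ 2) ^ (l - 1))) r := fun r hr => by
      refine ((hasDerivAt_pow (2 * k + 2) r).mul (hpow r hr)).congr_deriv ?_
      have h1 : (1 - r ^ 2) ^ l = (1 - r ^ 2) ^ (l - 1) * (1 - r ^ 2) := by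
        rw [← Real.rpow_add_one (hpos r hr).ne', sub_add_cancel]
      rw [h1, show 2 * k + 2 - 1 = 2 * k + 1 by lia, show 2 * (k + 1) + 1 = 2 * k + 1 + 2 by ring,
        show 2 * k + 2 = 2 * k + 1 + 1 by ring]
      push_cast
      ring
    have h0 := intervalIntegral.integral_eq_sub_of_hasDerivAt_of_le zero_le_one
      (((continuous_pow (2 * k + 2)).mul hcont).continuousOn) hd
      ((hi1.const_mul _).sub (hi2.const_mul _))
    rw [intervalIntegral.integral_sub (hi1.const_mul _) (hi2.const_mul _),
      intervalIntegral.integral_const_mul, intervalIntegral.integral_const_mul, ih] at h0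
    simp only [Pi.mul_apply, one_pow, sub_self, Real.zero_rpow hl.ne', mul_zero, ne_eq,
      Nat.add_eq_zero_iff,
      OfNat.ofNat_ne_zero, and_false, not_false_eq_true, zero_pow, zero_mul] at h0
    have hP : 0 < ∏ i ∈ Finset.range (k + 1), (l + i) :=
      Finset.prod_pos fun i _ => by positivity
    rw [Finset.prod_range_succ, Nat.factorial_succ]
    have hlk : 0 < l + (k + 1 : ℕ) := by positivity
    rw [eq_div_iff (by positivity)]
    have h1 : (2 * (k : ℝ) + 2) * (k.factorial / (2 * ∏ i ∈ Finset.range (k + 1), (l + i))) =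
        (2 * k + 2 + 2 * l) * ∫ r in (0 : ℝ)..1, r ^ (2 * (k + 1) + 1) * (1 - r ^ 2) ^ (l - 1) := by
      linarith
    rw [mul_div_assoc', div_eq_iff (by positivity)] at h1
    push_cast
    linear_combination (-1 / 2) * h1

theorem setLIntegral_radial {l : ℝ} (hl : 0 < l) (k : ℕ) :
    ∫⁻ r in Set.Ioo (0 : ℝ) 1, ENNReal.ofReal (r ^ (2 * k + 1) * (1 - r ^ 2) ^ (l - 1)) =
      ENNReal.ofReal (k.factorial / (2 * ∏ i ∈ Finset.range (k + 1), (l + i))) := by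
  obtain ⟨h1, h2⟩ := integral_radial l hl k
  rw [← h2, ofReal_integral_eq_lintegral_ofReal h1]
  refine (ae_restrict_iff' measurableSet_Ioo).2 (Filter.Eventually.of_forall fun r hr => ?_)
  have : 0 ≤ 1 - r ^ 2 := by nlinarith [hr.1, hr.2]
  exact mul_nonneg (pow_nonneg hr.1.le _) (Real.rpow_nonneg this _)

theorem setLIntegral_disc_one (k : ℕ) :
    ∫⁻ z in {z : ℂ | ‖z‖ < 1}, ENNReal.ofReal ((1 - ‖z‖ ^ 2) ^ k) =
      ENNReal.ofReal (Real.pi / (k + 1)) := by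
  have h1 := setLIntegral_disc (w := fun r => (1 - r ^ 2) ^ k) (by fun_prop) (h := fun _ => 1)
    measurable_const
  have h2 := setLIntegral_radial (l := k + 1) (by positivity) 0
  simp only [mul_one, add_sub_cancel_right, Real.rpow_natCast, mul_zero, zero_add, pow_one] at h1 h2
  rw [h1, lintegral_mul_const' _ _ (by simp [ENNReal.mul_eq_top]), h2]
  simp only [lintegral_const, Measure.restrict_apply MeasurableSet.univ, Set.univ_inter,
    Real.volume_Ico, one_mul, sub_zero]
  rw [← ENNReal.ofReal_mul (by positivity)]
  congr 1
  have : (k : ℝ) + 1 ≠ 0 := by positivity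
  simp
  field_simp

theorem integral_circlePoint_pow (a b : ℕ) :
    ∫ θ in Set.Ico 0 (2 * Real.pi), circlePoint θ ^ a * conj (circlePoint θ) ^ b =
      if a = b then 2 * (Real.pi : ℂ) else 0 := by
  have hpi := Real.pi_pos
  rw [integral_Ico_eq_integral_Ioo, ← integral_Ioc_eq_integral_Ioo,
    ← intervalIntegral.integral_of_le (by positivity)]
  split_ifs with hab
  · subst hab
    simp [← mul_pow, circlePoint_mul_conj]
  · have h1 : ∀ θ : ℝ, circlePoint θ ^ a * conj (circlePoint θ) ^ b =
        Complex.exp (((a : ℂ) - b) * Complex.I * θ) := by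
      intro θ
      rw [conj_circlePoint, circlePoint, ← Complex.exp_neg, ← Complex.exp_nat_mul,
        ← Complex.exp_nat_mul, ← Complex.exp_add]
      ring_nf
    have hc : ((a : ℂ) - b) * Complex.I ≠ 0 :=
      mul_ne_zero (sub_ne_zero.2 (by exact_mod_cast hab)) Complex.I_ne_zero
    simp only [h1]
    rw [integral_exp_mul_complex hc]
    have h2 : Complex.exp (((a : ℂ) - b) * Complex.I * ((2 * Real.pi : ℝ) : ℂ)) = 1 := by
      rw [Complex.exp_eq_one_iff]
      exact ⟨(a : ℤ) - b, by push_cast; ring⟩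
    rw [h2]; simp

/-- The norm of the Vandermonde determinant: the normalization constant for `β = 2`. -/
theorem setLIntegral_vandermonde (n : ℕ) :
    ∫⁻ θ in Set.univ.pi fun _ : Fin n => Set.Ico 0 (2 * Real.pi),
      ENNReal.ofReal (‖∏ i, ∏ j ∈ Finset.Ioi i, (circlePoint (θ j) - circlePoint (θ i))‖ ^ 2) =
      ENNReal.ofReal (n.factorial * (2 * Real.pi) ^ n) := by
  set B : Set (Fin n → ℝ) := Set.univ.pi fun _ => Set.Ico 0 (2 * Real.pi) with hB
  have hBr : (volume : Measure (Fin n → ℝ)).restrict B =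
      Measure.pi fun _ => (volume : Measure ℝ).restrict (Set.Ico 0 (2 * Real.pi)) := by
    rw [hB, volume_pi, Measure.restrict_pi_pi]
  have hterm : ∀ σ τ : Equiv.Perm (Fin n), ∫ θ in B,
      ∏ j, (circlePoint (θ j) ^ (σ j : ℕ) * conj (circlePoint (θ j)) ^ (τ j : ℕ)) =
      if σ = τ then ((2 * Real.pi : ℂ)) ^ n else 0 := by
    intro σ τ
    rw [hBr, integral_fintype_prod_eq_prod (fun j θ =>
      circlePoint θ ^ (σ j : ℕ) * conj (circlePoint θ) ^ (τ j : ℕ))]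
    simp only [integral_circlePoint_pow]
    split_ifs with h
    · subst h; simp
    · obtain ⟨j, hj⟩ : ∃ j, σ j ≠ τ j := by
        by_contra hcon
        push Not at hcon
        exact h (Equiv.ext hcon)
      exact Finset.prod_eq_zero (Finset.mem_univ j) (if_neg fun h' => hj (Fin.ext h'))
  have hfin : IsFiniteMeasure ((volume : Measure (Fin n → ℝ)).restrict B) := by
    rw [hBr]; infer_instance
  have hint : ∀ σ τ : Equiv.Perm (Fin n), Integrable (fun θ : Fin n → ℝ =>
      ∏ j, (circlePoint (θ j) ^ (σ j : ℕ) * conj (circlePoint (θ j)) ^ (τ j : ℕ)))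
      ((volume : Measure (Fin n → ℝ)).restrict B) := by
    intro σ τ
    refine Integrable.of_bound (C := 1) (Continuous.aestronglyMeasurable ?_)
      (Filter.Eventually.of_forall fun θ => ?_)
    · have := continuous_circlePoint
      fun_prop
    · rw [norm_prod]
      simp [norm_circlePoint]
  have hexp : ∀ θ : Fin n → ℝ,
      ((‖∏ i, ∏ j ∈ Finset.Ioi i, (circlePoint (θ j) - circlePoint (θ i))‖ ^ 2 : ℝ) : ℂ) =
      ∑ σ : Equiv.Perm (Fin n), ∑ τ : Equiv.Perm (Fin n),
        ((Equiv.Perm.sign σ : ℤ) : ℂ) * ((Equiv.Perm.sign τ : ℤ) : ℂ) *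
        ∏ j, (circlePoint (θ j) ^ (σ j : ℕ) * conj (circlePoint (θ j)) ^ (τ j : ℕ)) := by
    intro θ
    rw [← Matrix.det_vandermonde fun j => circlePoint (θ j), Complex.ofReal_pow,
      ← Complex.mul_conj', ← Matrix.det_transpose, Matrix.det_apply', map_sum,
      Finset.sum_mul_sum]
    refine Finset.sum_congr rfl fun σ _ => Finset.sum_congr rfl fun τ _ => ?_
    simp only [map_mul, map_prod, Matrix.transpose_apply, Matrix.vandermonde_apply, map_pow,
      Finset.prod_mul_distrib, map_intCast]
    ring
  have hInt : ∫ θ in B,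
      ((‖∏ i, ∏ j ∈ Finset.Ioi i, (circlePoint (θ j) - circlePoint (θ i))‖ ^ 2 : ℝ) : ℂ) =
      ((n.factorial * (2 * Real.pi) ^ n : ℝ) : ℂ) := by
    simp only [hexp]
    rw [integral_finsetSum _ fun σ _ => integrable_finsetSum _ fun τ _ =>
      (hint σ τ).const_mul _]
    have : ∀ σ : Equiv.Perm (Fin n), ∫ θ in B, ∑ τ : Equiv.Perm (Fin n),
        ((Equiv.Perm.sign σ : ℤ) : ℂ) * ((Equiv.Perm.sign τ : ℤ) : ℂ) *
        ∏ j, (circlePoint (θ j) ^ (σ j : ℕ) * conj (circlePoint (θ j)) ^ (τ j : ℕ)) =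
        (2 * Real.pi : ℂ) ^ n := by
      intro σ
      rw [integral_finsetSum _ fun τ _ => (hint σ τ).const_mul _]
      simp only [integral_const_mul, hterm]
      rw [Finset.sum_eq_single σ]
      · rw [if_pos rfl, ← Int.cast_mul, ← Units.val_mul, Int.units_mul_self]; simp
      · intro τ _ hτ
        rw [if_neg hτ.symm, mul_zero]
      · simp
    simp only [this]
    simp [Fintype.card_perm]
  have hInt' := (integral_complex_ofReal (μ := volume.restrict B)
    (f := fun θ => ‖∏ i, ∏ j ∈ Finset.Ioi i,
      (circlePoint (θ j) - circlePoint (θ i))‖ ^ 2)).symm.trans hInt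
  rw [← Complex.ofReal_inj.1 hInt', ofReal_integral_eq_lintegral_ofReal]
  · refine Integrable.of_bound (C := (∏ i : Fin n, ∏ j ∈ Finset.Ioi i, (2 : ℝ)) ^ 2)
      (Continuous.aestronglyMeasurable ?_) (Filter.Eventually.of_forall fun θ => ?_)
    · have := continuous_circlePoint
      fun_prop
    · rw [norm_pow, norm_norm, norm_prod]
      refine pow_le_pow_left₀ (Finset.prod_nonneg fun _ _ => norm_nonneg _)
        (Finset.prod_le_prod (fun _ _ => norm_nonneg _) fun i _ => ?_) 2
      rw [norm_prod]
      refine Finset.prod_le_prod (fun _ _ => norm_nonneg _) fun j _ => ?_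
      refine (norm_sub_le _ _).trans ?_
      rw [norm_circlePoint, norm_circlePoint]; norm_num
  · exact Filter.Eventually.of_forall fun θ => by positivity

/-- Iterated integrals over the simplex of size `t`; the volume is the case `k = 0`. -/
theorem setLIntegral_simplex (m k : ℕ) {t : ℝ} (ht : 0 < t) :
    ∫⁻ p in {p : Fin m → ℝ | (∀ i, 0 < p i) ∧ ∑ i, p i < t},
      ENNReal.ofReal ((t - ∑ i, p i) ^ k / k.factorial) =
      ENNReal.ofReal (t ^ (m + k) / (m + k).factorial) := by
  have hms : ∀ m : ℕ, MeasurableSet {p : Fin m → ℝ | (∀ i, 0 < p i) ∧ ∑ i, p i < t} := fun m => by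
    have h1 : MeasurableSet {p : Fin m → ℝ | ∀ i, 0 < p i} := by
      rw [Set.ofPred_forall]
      exact MeasurableSet.iInter fun i =>
        measurableSet_lt measurable_const (measurable_pi_apply i)
    exact h1.inter (measurableSet_lt
      (Finset.measurable_fun_sum _ fun i _ => measurable_pi_apply i) measurable_const)
  induction m generalizing k with
  | zero => simp [ht, volume_pi]
  | succ m ih =>
    rw [← lintegral_indicator (hms _)]
    have hm : Measurable ({p : Fin (m + 1) → ℝ | (∀ i, 0 < p i) ∧ ∑ i, p i < t}.indicator
        fun p => ENNReal.ofReal ((t - ∑ i, p i) ^ k / k.factorial)) :=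
      Measurable.indicator (by fun_prop) (hms _)
    rw [lintegral_snoc hm, show m + 1 + k = m + (k + 1) by ring, ← ih,
      ← lintegral_indicator (hms _)]
    refine lintegral_congr fun c => ?_
    by_cases hc : c ∈ {p : Fin m → ℝ | (∀ i, 0 < p i) ∧ ∑ i, p i < t}
    · rw [Set.indicator_of_mem hc]
      set s := t - ∑ i, c i with hs
      have hs0 : 0 < s := sub_pos.2 hc.2
      have h1 : ∀ y : ℝ, ({p : Fin (m + 1) → ℝ | (∀ i, 0 < p i) ∧ ∑ i, p i < t}.indicator
          (fun p => ENNReal.ofReal ((t - ∑ i, p i) ^ k / k.factorial)) (Fin.snoc c y)) =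
          (Set.Ioo 0 s).indicator (fun y => ENNReal.ofReal ((s - y) ^ k / k.factorial)) y := by
        intro y
        simp only [Set.indicator_apply, Set.mem_ofPred_eq, Fin.sum_univ_castSucc,
          Fin.snoc_castSucc, Fin.snoc_last, Set.mem_Ioo, Fin.forall_fin_succ']
        have h2 : (((∀ i, 0 < c i) ∧ 0 < y) ∧ ∑ i, c i + y < t) ↔ (0 < y ∧ y < s) :=
          ⟨fun h => ⟨h.1.2, by rw [hs]; linarith [h.2]⟩,
            fun h => ⟨⟨hc.1, h.1⟩, by have := h.2; rw [hs] at this; linarith⟩⟩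
        have h3 : t - (∑ i, c i + y) = s - y := by rw [hs]; ring
        simp only [h2, h3]
      simp only [h1]
      rw [lintegral_indicator measurableSet_Ioo, ← ofReal_integral_eq_lintegral_ofReal]
      · congr 1
        rw [← integral_Ioc_eq_integral_Ioo, ← intervalIntegral.integral_of_le hs0.le,
          intervalIntegral.integral_div,
          intervalIntegral.integral_comp_sub_left (fun y => y ^ k) s, integral_pow]
        simp only [sub_self, sub_zero, ne_eq, Nat.add_eq_zero_iff, one_ne_zero, and_false,
          not_false_eq_true, zero_pow, Nat.factorial_succ]
        push_cast
        have : (k : ℝ) + 1 ≠ 0 := by positivity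
        field_simp
      · have hcont : Continuous fun y : ℝ => (s - y) ^ k / k.factorial := by fun_prop
        exact (hcont.integrableOn_Icc (a := 0) (b := s)).mono_set Set.Ioo_subset_Icc_self
      · refine (ae_restrict_iff' measurableSet_Ioo).2 (Filter.Eventually.of_forall fun y hy => ?_)
        exact div_nonneg (pow_nonneg (by linarith [hy.2]) _) (Nat.cast_nonneg _)
    · rw [Set.indicator_of_notMem hc]
      have h1 : ∀ y : ℝ, ({p : Fin (m + 1) → ℝ | (∀ i, 0 < p i) ∧ ∑ i, p i < t}.indicator
          (fun p => ENNReal.ofReal ((t - ∑ i, p i) ^ k / k.factorial)) (Fin.snoc c y)) = 0 := by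
        intro y
        refine Set.indicator_of_notMem (fun h => hc ?_) _
        simp only [Set.mem_ofPred_eq, Fin.sum_univ_castSucc,
          Fin.snoc_castSucc, Fin.snoc_last, Fin.forall_fin_succ'] at h
        exact ⟨h.1.1, by linarith [h.2, h.1.2]⟩
      simp [h1]

theorem volume_simplex (m : ℕ) :
    volume {p : Fin m → ℝ | (∀ i, 0 < p i) ∧ ∑ i, p i < 1} =
      ENNReal.ofReal (1 / m.factorial) := by
  have := setLIntegral_simplex m 0 one_pos
  simpa using this

end Integrals

/-! ### The law of the deformed Verblunsky coefficients for `β = 2` and uniform weights -/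

section Law

variable {m : ℕ}

/-- The cube of the angles. -/
def angleBox (n : ℕ) : Set (Fin n → ℝ) := Set.univ.pi fun _ : Fin n => Set.Ico 0 (2 * Real.pi)

/-- The simplex of the first `m` weights. -/
def simplex (m : ℕ) : Set (Fin m → ℝ) := {x | (∀ i, 0 < x i) ∧ ∑ i, x i < 1}

/-- The square of the modulus of the Vandermonde determinant of the nodes. -/
def vdmSq {n : ℕ} (θ : Fin n → ℝ) : ℝ :=
  ‖∏ i, ∏ j ∈ Finset.Ioi i, (circlePoint (θ j) - circlePoint (θ i))‖ ^ 2

theorem measurableSet_angleBox (n : ℕ) : MeasurableSet (angleBox n) :=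
  MeasurableSet.univ_pi fun _ => measurableSet_Ico

theorem measurableSet_simplex (m : ℕ) : MeasurableSet (simplex m) := by
  have h1 : MeasurableSet {p : Fin m → ℝ | ∀ i, 0 < p i} := by
    rw [Set.ofPred_forall]
    exact MeasurableSet.iInter fun i => measurableSet_lt measurable_const (measurable_pi_apply i)
  exact h1.inter (measurableSet_lt
    (Finset.measurable_fun_sum _ fun i _ => measurable_pi_apply i) measurable_const)

theorem continuous_vdmSq {n : ℕ} : Continuous (vdmSq (n := n)) := by
  have := continuous_circlePoint
  unfold vdmSq
  fun_prop

/-- The Vandermonde determinant vanishes when two angles coincide. -/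
theorem prod_circlePoint_sub_eq_zero {n : ℕ} {θ : Fin n → ℝ} (hinj : ¬ Function.Injective θ) :
    ∏ i, ∏ j ∈ Finset.Ioi i, (circlePoint (θ j) - circlePoint (θ i)) = 0 := by
  simp only [Function.Injective, not_forall] at hinj
  obtain ⟨i, j, hij, hne⟩ : ∃ i j, θ i = θ j ∧ i < j := by
    obtain ⟨i, j, h1, h2⟩ := hinj
    rcases lt_or_gt_of_ne h2 with h3 | h3
    · exact ⟨i, j, h1, h3⟩
    · exact ⟨j, i, h1.symm, h3⟩
  exact Finset.prod_eq_zero (Finset.mem_univ i)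
    (Finset.prod_eq_zero (Finset.mem_Ioi.2 hne) (by rw [hij, sub_self]))

/-- The configurations in coordinates. -/
def coordBox (m : ℕ) : Set (Coord m) :=
  {x | (fun j => x (Sum.inl j)) ∈ angleBox (m + 1) ∧ (fun a => x (Sum.inr a)) ∈ simplex m}

theorem setLIntegral_coordBox {H : Coord m → ℝ≥0∞} (hH : Measurable H) :
    ∫⁻ x in coordBox m, H x =
      ∫⁻ θ in angleBox (m + 1), ∫⁻ p in simplex m, H (Sum.elim θ p) := by
  have h1 := (volume_measurePreserving_sumPiEquivProdPi
    (fun _ : Fin (m + 1) ⊕ Fin m => ℝ)).symm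
  have hK : MeasurableSet (angleBox (m + 1) ×ˢ simplex m) :=
    (measurableSet_angleBox _).prod (measurableSet_simplex _)
  have hpre : coordBox m = (MeasurableEquiv.sumPiEquivProdPi
      (fun _ : Fin (m + 1) ⊕ Fin m => ℝ)) ⁻¹' (angleBox (m + 1) ×ˢ simplex m) := rfl
  have hB : MeasurableSet (coordBox m) := by
    rw [hpre]; exact MeasurableEquiv.measurable _ hK
  rw [← h1.setLIntegral_comp_preimage hB hH, hpre, ← Set.preimage_comp]
  have h2 : (MeasurableEquiv.sumPiEquivProdPi (fun _ : Fin (m + 1) ⊕ Fin m => ℝ)) ∘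
      (MeasurableEquiv.sumPiEquivProdPi (fun _ : Fin (m + 1) ⊕ Fin m => ℝ)).symm = id := by
    ext x <;> simp
  have hm : Measurable fun q => H ((MeasurableEquiv.sumPiEquivProdPi
      (fun _ : Fin (m + 1) ⊕ Fin m => ℝ)).symm q) := hH.comp (MeasurableEquiv.measurable _)
  rw [h2, Set.preimage_id, Measure.volume_eq_prod, ← Measure.prod_restrict,
    lintegral_prod _ hm.aemeasurable]
  rfl

/-- The deformed Verblunsky coefficients as functions of the moments and of the product of the
nodes. -/
def verbMap (q : (Fin m → ℂ) × ℂ) : (Fin m → ℂ) × ℂ :=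
  (momentsToVerb m q.1, (-1) ^ m * q.2 / phase (extendZero (momentsToVerb m q.1)) m)

theorem measurable_verbMap : Measurable (verbMap (m := m)) := by
  have h1 := (measurable_momentsToVerb m).comp
    (measurable_fst : Measurable (Prod.fst : (Fin m → ℂ) × ℂ → _))
  exact h1.prodMk ((measurable_const.mul measurable_snd).div ((measurable_phase m).comp h1))

/-- The moments and the product of the nodes of a configuration. -/
def momentPair (x : Coord m) : (Fin m → ℂ) × ℂ :=
  (fun a => moment (conf x) (a + 1), circlePoint (∑ j, x (Sum.inl j)))

theorem measurable_momentPair : Measurable (momentPair (m := m)) := by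
  have hc := continuous_circlePoint.measurable
  refine Measurable.prodMk (measurable_pi_iff.2 fun a => ?_)
    (hc.comp (Finset.measurable_fun_sum _ fun j _ => measurable_pi_apply _))
  unfold moment
  refine Finset.measurable_fun_sum _ fun j _ => Measurable.mul ?_
    ((hc.comp (measurable_pi_apply (Sum.inl j))).pow_const _)
  refine Complex.measurable_ofReal.comp ?_
  induction j using Fin.lastCases with
  | last =>
    simp only [conf_snd_last]
    exact Measurable.const_sub
      (Finset.measurable_fun_sum Finset.univ fun a _ => measurable_pi_apply (Sum.inr a)) 1
  | cast j =>
    simp only [conf_snd_castSucc]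
    exact measurable_pi_apply _

/-- The map `verbMap` recovers the deformed Verblunsky coefficients of a configuration. -/
theorem verbMap_momentPair {x : Coord m} (h : IsGeneric (conf x)) :
    verbMap (momentPair x) = (fun i : Fin m => verb (conf x) i, verb (conf x) m) := by
  have h1 : momentsToVerb m (momentPair x).1 = fun i : Fin m => verb (conf x) i :=
    momentsToVerb_moment h (Nat.le_succ m)
  rw [verbMap, h1]
  refine Prod.ext rfl ?_
  simp only
  rw [phase_congr (fun i hi => extendZero_verb (conf x) hi), div_eq_iff, verb_mul_phase_last h]
  · rw [momentPair, circlePoint_sum]; rfl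
  · rw [← norm_ne_zero_iff, norm_phase]
    · exact one_ne_zero
    · intro i hi h1
      have := norm_verb_lt_one h (k := i) (by lia)
      rw [h1, norm_one] at this
      exact lt_irrefl _ this

/-- The Jacobian of the moment map is `|Δ|² ∏ normProd / 2 ^ m`, and that of the map from the
coefficients to the moments is `∏ normProd²`; this leaves one power of each `normProd`. The last
coordinate is the product of the nodes up to a phase, which is removed by rotation invariance. -/
theorem setLIntegral_sector_verbMap_le (σ : Equiv.Perm (Fin (m + 1))) {F : (Fin m → ℂ) × ℂ → ℝ≥0∞}
    (hF : Measurable F) :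
    ∫⁻ x in sector m σ, ENNReal.ofReal (vdmSq fun j => x (Sum.inl j)) * F (verbMap (momentPair x)) ≤
      2 ^ m * ∫⁻ γ in polydisc m, ENNReal.ofReal (∏ k ∈ Finset.range m, normProd (extendZero γ) k) *
        ∫⁻ φ in Set.Ico 0 (2 * Real.pi), F (γ, circlePoint φ) := by
  set W : (Fin m → ℂ) → ℝ := fun γ => ∏ k ∈ Finset.range m, normProd (extendZero γ) k with hW
  have hWm : Measurable W := Finset.measurable_fun_prod _ fun k _ => measurable_normProd k
  have hWpos : ∀ γ ∈ polydisc m, 0 < W γ := fun γ hγ =>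
    Finset.prod_pos fun k _ => normProd_pos fun i _ => norm_extendZero_lt_one hγ i
  set g : (Fin m → ℂ) × ℂ → ℝ≥0∞ := fun q =>
    ENNReal.ofReal (2 ^ m / W (verbMap q).1) * F (verbMap q) with hg
  have hgm : Measurable g := ((measurable_const.div
    (hWm.comp (measurable_fst.comp measurable_verbMap))).ennreal_ofReal).mul
      (hF.comp measurable_verbMap)
  have h1 := lintegral_sector_le σ hgm
  refine (le_of_eq ?_).trans (h1.trans (le_of_eq ?_))
  · refine setLIntegral_congr_fun (measurableSet_sector σ) fun x hx => ?_
    have hgen := isGeneric_of_mem_sector hx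
    have h2 := abs_det_momentMapDeriv hgen
    have h3 : (verbMap (momentPair x)).1 = fun i : Fin m => verb (conf x) i := by
      rw [verbMap_momentPair hgen]
    have h4 : W (verbMap (momentPair x)).1 =
        ∏ k ∈ Finset.range m, nrm (conf x) (Phi k (conf x)) := by
      rw [h3]
      refine Finset.prod_congr rfl fun k hk => ?_
      have hk' := Finset.mem_range.1 hk
      rw [nrm_Phi_eq hgen (by lia)]
      exact normProd_congr fun i hi => extendZero_verb _ (hi.trans hk')
    have h5 : 0 < W (verbMap (momentPair x)).1 := by
      refine hWpos _ ?_
      rw [h3]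
      exact fun i => norm_verb_lt_one hgen (by have := i.2; lia)
    show _ = ENNReal.ofReal |(momentMapDeriv x).det| * g (momentPair x)
    rw [hg]
    simp only
    rw [← mul_assoc, ← ENNReal.ofReal_mul (abs_nonneg _)]
    congr 2
    rw [← h4] at h2
    rw [mul_div_assoc', eq_div_iff h5.ne', mul_comm _ ((2 : ℝ) ^ m), h2]
    rfl
  · set G : (Fin m → ℂ) → ℝ≥0∞ := fun γ => ENNReal.ofReal (2 ^ m / W γ) *
      ∫⁻ φ in Set.Ico 0 (2 * Real.pi), F (γ, circlePoint φ) with hG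
    have hFc : Measurable fun q : (Fin m → ℂ) × ℝ => F (q.1, circlePoint q.2) :=
      hF.comp (measurable_fst.prodMk (continuous_circlePoint.measurable.comp measurable_snd))
    have hGm : Measurable G :=
      ((measurable_const.div hWm).ennreal_ofReal).mul hFc.lintegral_prod_right'
    have h6 := setLIntegral_momentsToVerb m hGm
    have h7 : ∀ c ∈ momentsToVerb m ⁻¹' polydisc m,
        ∫⁻ φ in Set.Ico 0 (2 * Real.pi), g (c, circlePoint φ) = G (momentsToVerb m c) := by
      intro c hc
      set γ := momentsToVerb m c with hγ
      have hph : ‖phase (extendZero γ) m‖ = 1 := norm_phase fun i _ h1 => by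
        have := norm_extendZero_lt_one hc i
        rw [h1, norm_one] at this
        exact lt_irrefl _ this
      have hu : ‖(-1) ^ m / phase (extendZero γ) m‖ = 1 := by simp [hph]
      rw [hG]
      simp only
      rw [← setLIntegral_circle_rotate hu fun ζ => F (γ, ζ),
        ← lintegral_const_mul' _ _ ENNReal.ofReal_ne_top]
      refine lintegral_congr fun φ => ?_
      simp only [hg, verbMap, ← hγ]
      rw [div_mul_eq_mul_div]
    rw [setLIntegral_congr_fun (measurable_momentsToVerb m (measurableSet_polydisc m)) h7, h6,
      ← lintegral_const_mul' _ _ (by simp)]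
    refine setLIntegral_congr_fun (measurableSet_polydisc m) fun γ hγ => ?_
    have hw := hWpos γ hγ
    have h8 : ENNReal.ofReal (∏ k ∈ Finset.range m, normProd (extendZero γ) k ^ 2) =
        ENNReal.ofReal (W γ ^ 2) := by rw [Finset.prod_pow]
    have h9 : (2 : ℝ≥0∞) ^ m = ENNReal.ofReal (2 ^ m) := by
      rw [ENNReal.ofReal_pow (by norm_num)]; simp
    simp only [hG, h8]
    rw [h9, mul_right_comm, ← ENNReal.ofReal_mul (by positivity), ← mul_assoc,
      ← ENNReal.ofReal_mul (by positivity)]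
    congr 2
    field_simp
    rfl

/-- Summation over the orderings of the angles. -/
theorem setLIntegral_coordBox_verbMap_le {F : (Fin m → ℂ) × ℂ → ℝ≥0∞} (hF : Measurable F) :
    ∫⁻ x in coordBox m,
        ENNReal.ofReal (vdmSq fun j => x (Sum.inl j)) * F (verbMap (momentPair x)) ≤
      (m + 1).factorial * (2 ^ m * ∫⁻ γ in polydisc m,
        ENNReal.ofReal (∏ k ∈ Finset.range m, normProd (extendZero γ) k) *
          ∫⁻ φ in Set.Ico 0 (2 * Real.pi), F (γ, circlePoint φ)) := by
  set H : Coord m → ℝ≥0∞ := fun x =>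
    ENNReal.ofReal (vdmSq fun j => x (Sum.inl j)) * F (verbMap (momentPair x)) with hH
  have hHm : Measurable H := by
    refine Measurable.mul ?_ (hF.comp (measurable_verbMap.comp measurable_momentPair))
    exact (continuous_vdmSq.measurable.comp
      (measurable_pi_iff.2 fun j => measurable_pi_apply _)).ennreal_ofReal
  have hB : MeasurableSet (coordBox m) :=
    ((measurable_pi_iff.2 fun j => measurable_pi_apply _ :
      Measurable fun (x : Coord m) j => x (Sum.inl j)) (measurableSet_angleBox _)).inter
    ((measurable_pi_iff.2 fun j => measurable_pi_apply _ :
      Measurable fun (x : Coord m) j => x (Sum.inr j)) (measurableSet_simplex _))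
  calc ∫⁻ x in coordBox m, H x = ∫⁻ x, (coordBox m).indicator H x := (lintegral_indicator hB _).symm
    _ ≤ ∫⁻ x, ∑ σ : Equiv.Perm (Fin (m + 1)), (sector m σ).indicator H x := by
        refine lintegral_mono fun x => ?_
        by_cases hx : x ∈ coordBox m
        · rw [Set.indicator_of_mem hx]
          by_cases hinj : Function.Injective fun j => x (Sum.inl j)
          · set σ := Tuple.sort fun j => x (Sum.inl j)
            have hmono : StrictMono fun j => x (Sum.inl (σ j)) :=
              (Tuple.monotone_sort fun j => x (Sum.inl j)).strictMono_of_injective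
                (hinj.comp σ.injective)
            have hmem : x ∈ sector m σ :=
              ⟨hmono, fun j => hx.1 j (Set.mem_univ j), hx.2.1, hx.2.2⟩
            calc H x = (sector m σ).indicator H x := (Set.indicator_of_mem hmem _).symm
              _ ≤ _ := Finset.single_le_sum (f := fun σ => (sector m σ).indicator H x)
                (fun _ _ => zero_le) (Finset.mem_univ σ)
          · have h0 : H x = 0 := by
              have : vdmSq (fun j => x (Sum.inl j)) = 0 := by
                rw [vdmSq, prod_circlePoint_sub_eq_zero hinj]
                simp
              simp only [hH]
              rw [this]; simp
            rw [h0]; exact zero_le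
        · rw [Set.indicator_of_notMem hx]; exact zero_le
    _ = ∑ σ : Equiv.Perm (Fin (m + 1)), ∫⁻ x in sector m σ, H x := by
        rw [lintegral_finsetSum _ fun σ _ => hHm.indicator (measurableSet_sector σ)]
        exact Finset.sum_congr rfl fun σ _ => lintegral_indicator (measurableSet_sector σ) _
    _ ≤ ∑ σ : Equiv.Perm (Fin (m + 1)), _ :=
        Finset.sum_le_sum fun σ _ => setLIntegral_sector_verbMap_le σ hF
    _ = _ := by simp [Fintype.card_perm]

theorem prod_range_normProd (g : ℕ → ℂ) (m : ℕ) : ∏ k ∈ Finset.range m, normProd g k =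
    ∏ j ∈ Finset.range m, (1 - ‖g j‖ ^ 2) ^ (m - 1 - j) := by
  induction m with
  | zero => rfl
  | succ m ih =>
    rw [Finset.prod_range_succ, ih, Finset.prod_range_succ, normProd, ← Finset.prod_mul_distrib,
      show m + 1 - 1 - m = 0 by lia, pow_zero, mul_one]
    refine Finset.prod_congr rfl fun j hj => ?_
    have := Finset.mem_range.1 hj
    rw [← pow_succ, show m - 1 - j + 1 = m + 1 - 1 - j by lia]

theorem prod_normProd (γ : Fin m → ℂ) : ∏ k ∈ Finset.range m, normProd (extendZero γ) k =
    ∏ j : Fin m, (1 - ‖γ j‖ ^ 2) ^ (m - 1 - j) := by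
  rw [prod_range_normProd, Finset.prod_range]
  refine Finset.prod_congr rfl fun j _ => ?_
  rw [extendZero, dif_pos j.2]

theorem setLIntegral_polydisc (f : Fin m → ℂ → ℝ≥0∞) (hf : ∀ i, Measurable (f i)) :
    ∫⁻ γ in polydisc m, ∏ i, f i (γ i) = ∏ i, ∫⁻ z in {z : ℂ | ‖z‖ < 1}, f i z := by
  have hdisc : MeasurableSet {y : ℂ | ‖y‖ < 1} := measurableSet_lt measurable_norm measurable_const
  rw [← lintegral_indicator (measurableSet_polydisc m)]
  simp only [← lintegral_indicator hdisc]
  rw [← lintegral_prod_eq_prod_lintegral _ fun i => (hf i).indicator hdisc]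
  refine lintegral_congr fun γ => ?_
  by_cases hγ : γ ∈ polydisc m
  · rw [Set.indicator_of_mem hγ]
    exact Finset.prod_congr rfl fun i _ => (Set.indicator_of_mem (show γ i ∈ _ from hγ i) _).symm
  · rw [Set.indicator_of_notMem hγ]
    obtain ⟨i, hi⟩ : ∃ i, ¬ ‖γ i‖ < 1 := by simpa [polydisc] using hγ
    exact (Finset.prod_eq_zero (Finset.mem_univ i)
      (Set.indicator_of_notMem (s := {z : ℂ | ‖z‖ < 1}) hi _)).symm

/-- The total mass on the side of the configurations. -/
theorem setLIntegral_coordBox_vdmSq :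
    ∫⁻ x in coordBox m, ENNReal.ofReal (vdmSq fun j => x (Sum.inl j)) =
      ENNReal.ofReal ((m + 1).factorial * (2 * Real.pi) ^ (m + 1) * (1 / m.factorial)) := by
  have hm : Measurable fun x : Coord m => ENNReal.ofReal (vdmSq fun j => x (Sum.inl j)) :=
    (continuous_vdmSq.measurable.comp
      (measurable_pi_iff.2 fun j => measurable_pi_apply _)).ennreal_ofReal
  rw [setLIntegral_coordBox hm]
  simp only [Sum.elim_inl, lintegral_const, Measure.restrict_apply MeasurableSet.univ,
    Set.univ_inter]
  have hv : volume (simplex m) = ENNReal.ofReal (1 / m.factorial) := volume_simplex m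
  rw [hv, lintegral_mul_const' _ _ ENNReal.ofReal_ne_top, ENNReal.ofReal_mul (by positivity)]
  congr 1
  exact setLIntegral_vandermonde (m + 1)

/-- The total mass on the side of the coefficients; it is the same as for the configurations. -/
theorem setLIntegral_polydisc_normProd :
    ((m + 1).factorial : ℝ≥0∞) * (2 ^ m * ∫⁻ γ in polydisc m,
        ENNReal.ofReal (∏ k ∈ Finset.range m, normProd (extendZero γ) k) *
          ∫⁻ _ in Set.Ico 0 (2 * Real.pi), 1) =
      ENNReal.ofReal ((m + 1).factorial * (2 * Real.pi) ^ (m + 1) * (1 / m.factorial)) := by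
  have h1 : ∀ γ ∈ polydisc m,
      ENNReal.ofReal (∏ k ∈ Finset.range m, normProd (extendZero γ) k) *
        ∫⁻ _ in Set.Ico 0 (2 * Real.pi), 1 =
      (∏ j : Fin m, ENNReal.ofReal ((1 - ‖γ j‖ ^ 2) ^ (m - 1 - j))) *
        ENNReal.ofReal (2 * Real.pi) := by
    intro γ hγ
    rw [prod_normProd, ENNReal.ofReal_prod_of_nonneg]
    · simp
    · intro j _
      refine pow_nonneg ?_ _
      have := hγ j
      nlinarith [norm_nonneg (γ j)]
  rw [setLIntegral_congr_fun (measurableSet_polydisc m) h1,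
    lintegral_mul_const' _ _ ENNReal.ofReal_ne_top,
    setLIntegral_polydisc (fun j z => ENNReal.ofReal ((1 - ‖z‖ ^ 2) ^ (m - 1 - (j : ℕ))))
      fun j => by fun_prop]
  simp only [setLIntegral_disc_one]
  have hpi := Real.pi_pos
  have h2 : ∏ j : Fin m, Real.pi / (((m - 1 - j : ℕ) : ℝ) + 1) = Real.pi ^ m / m.factorial := by
    rw [Finset.prod_div_distrib, Finset.prod_const, Finset.card_fin]
    congr 1
    rw [← Finset.prod_range (fun j => ((m - 1 - j : ℕ) : ℝ) + 1),
      Finset.prod_range_reflect (fun j => (j : ℝ) + 1)]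
    rw [← Finset.prod_range_add_one_eq_factorial]
    push_cast
    rfl
  rw [← ENNReal.ofReal_prod_of_nonneg fun j _ => by positivity, h2,
    ← ENNReal.ofReal_mul (by positivity), ← ENNReal.ofReal_natCast,
    show (2 : ℝ≥0∞) ^ m = ENNReal.ofReal (2 ^ m) by rw [ENNReal.ofReal_pow (by norm_num)]; simp,
    ← ENNReal.ofReal_mul (by positivity), ← ENNReal.ofReal_mul (by positivity)]
  congr 1
  rw [mul_pow, pow_succ, pow_succ]
  ring

/-- For `β = 2` and uniform weights, the deformed Verblunsky coefficients are independent. Of the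
two sides, the first is at most the second by the change of variables, and both have the same finite
value at the constant function `1`. -/
theorem setLIntegral_coordBox_verbMap {F : (Fin m → ℂ) × ℂ → ℝ≥0∞} (hF : Measurable F) :
    ∫⁻ x in coordBox m,
        ENNReal.ofReal (vdmSq fun j => x (Sum.inl j)) * F (verbMap (momentPair x)) =
      (m + 1).factorial * (2 ^ m * ∫⁻ γ in polydisc m,
        ENNReal.ofReal (∏ k ∈ Finset.range m, normProd (extendZero γ) k) *
          ∫⁻ φ in Set.Ico 0 (2 * Real.pi), F (γ, circlePoint φ)) := by
  have hV : Measurable fun x : Coord m => verbMap (momentPair x) :=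
    measurable_verbMap.comp measurable_momentPair
  have hd1 : Measurable fun x : Coord m => ENNReal.ofReal (vdmSq fun j => x (Sum.inl j)) :=
    (continuous_vdmSq.measurable.comp
      (measurable_pi_iff.2 fun j => measurable_pi_apply _)).ennreal_ofReal
  have hd2 : Measurable fun γ : Fin m → ℂ =>
      ENNReal.ofReal (∏ k ∈ Finset.range m, normProd (extendZero γ) k) :=
    (Finset.measurable_fun_prod _ fun k _ => measurable_normProd k).ennreal_ofReal
  have hcm : Measurable fun q : (Fin m → ℂ) × ℝ => (q.1, circlePoint q.2) :=
    measurable_fst.prodMk (continuous_circlePoint.measurable.comp measurable_snd)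
  set ν₁ : Measure ((Fin m → ℂ) × ℂ) := ((volume.restrict (coordBox m)).withDensity
    fun x => ENNReal.ofReal (vdmSq fun j => x (Sum.inl j))).map fun x => verbMap (momentPair x)
    with hν₁
  set ν₂ : Measure ((Fin m → ℂ) × ℂ) := (((m + 1).factorial : ℝ≥0∞) * 2 ^ m) •
    (((volume.restrict (polydisc m)).withDensity fun γ =>
      ENNReal.ofReal (∏ k ∈ Finset.range m, normProd (extendZero γ) k)).prod
      (volume.restrict (Set.Ico 0 (2 * Real.pi)))).map fun q => (q.1, circlePoint q.2) with hν₂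
  have h1 : ∀ F : (Fin m → ℂ) × ℂ → ℝ≥0∞, Measurable F → ∫⁻ y, F y ∂ν₁ = ∫⁻ x in coordBox m,
        ENNReal.ofReal (vdmSq fun j => x (Sum.inl j)) * F (verbMap (momentPair x)) := by
    intro F hF
    have hFV : Measurable fun x : Coord m => F (verbMap (momentPair x)) := hF.comp hV
    rw [hν₁, lintegral_map hF hV, lintegral_withDensity_eq_lintegral_mul _ hd1 hFV]
    rfl
  have h2 : ∀ F : (Fin m → ℂ) × ℂ → ℝ≥0∞, Measurable F → ∫⁻ y, F y ∂ν₂ =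
      (m + 1).factorial * (2 ^ m * ∫⁻ γ in polydisc m,
        ENNReal.ofReal (∏ k ∈ Finset.range m, normProd (extendZero γ) k) *
          ∫⁻ φ in Set.Ico 0 (2 * Real.pi), F (γ, circlePoint φ)) := by
    intro F hF
    have hm : Measurable fun q : (Fin m → ℂ) × ℝ => F (q.1, circlePoint q.2) := hF.comp hcm
    rw [hν₂, lintegral_smul_measure, lintegral_map hF hcm, lintegral_prod _ hm.aemeasurable,
      lintegral_withDensity_eq_lintegral_mul _ hd2 hm.lintegral_prod_right', smul_eq_mul, mul_assoc]
    rfl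
  rw [← h1 F hF, ← h2 F hF]
  have hu1 : ν₁ Set.univ =
      ENNReal.ofReal ((m + 1).factorial * (2 * Real.pi) ^ (m + 1) * (1 / m.factorial)) := by
    rw [← lintegral_one, h1 (fun _ => 1) measurable_const, ← setLIntegral_coordBox_vdmSq]
    simp
  have hu2 : ν₂ Set.univ =
      ENNReal.ofReal ((m + 1).factorial * (2 * Real.pi) ^ (m + 1) * (1 / m.factorial)) := by
    rw [← lintegral_one, h2 (fun _ => 1) measurable_const, ← setLIntegral_polydisc_normProd]
  have hfin : IsFiniteMeasure ν₂ := ⟨by rw [hu2]; exact ENNReal.ofReal_lt_top⟩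
  have hfin : IsFiniteMeasure ν₁ := ⟨by rw [hu1]; exact ENNReal.ofReal_lt_top⟩
  have hle : ν₁ ≤ ν₂ := by
    refine Measure.le_iff.2 fun s hs => ?_
    have hs1 : Measurable (s.indicator (1 : (Fin m → ℂ) × ℂ → ℝ≥0∞)) := measurable_one.indicator hs
    rw [← lintegral_indicator_one hs, ← lintegral_indicator_one hs, h1 _ hs1, h2 _ hs1]
    exact setLIntegral_coordBox_verbMap_le hs1
  rw [Measure.eq_of_le_of_measure_univ_eq hle (hu1.trans hu2.symm)]

/-- The law of the deformed Verblunsky coefficients in product form. -/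
theorem setLIntegral_prod_verb (h : ℕ → ℂ → ℝ≥0∞) (hh : ∀ j, Measurable (h j)) :
    ∫⁻ θ in angleBox (m + 1), ∫⁻ p in simplex m, ENNReal.ofReal (vdmSq θ) *
        ∏ j ∈ Finset.range (m + 1), h j (verb (config θ p) j) =
      (m + 1).factorial * 2 ^ m *
        ((∏ j ∈ Finset.range m, ∫⁻ z in {z : ℂ | ‖z‖ < 1},
          ENNReal.ofReal ((1 - ‖z‖ ^ 2) ^ (m - 1 - j)) * h j z) *
          ∫⁻ φ in Set.Ico 0 (2 * Real.pi), h m (circlePoint φ)) := by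
  set F : (Fin m → ℂ) × ℂ → ℝ≥0∞ := fun q => (∏ j : Fin m, h j (q.1 j)) * h m q.2 with hF
  have hFm : Measurable F := by
    have h1 : Measurable fun q : (Fin m → ℂ) × ℂ => ∏ j : Fin m, h j (q.1 j) :=
      Finset.measurable_fun_prod _ fun j _ => (hh j).comp
        ((measurable_pi_apply j).comp measurable_fst)
    have h2 : Measurable fun q : (Fin m → ℂ) × ℂ => h m q.2 := (hh m).comp measurable_snd
    exact h1.mul h2
  have h1 := setLIntegral_coordBox_verbMap hFm
  have hHm : Measurable fun x : Coord m =>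
      ENNReal.ofReal (vdmSq fun j => x (Sum.inl j)) * F (verbMap (momentPair x)) := by
    refine Measurable.mul ?_ (hFm.comp (measurable_verbMap.comp measurable_momentPair))
    exact (continuous_vdmSq.measurable.comp
      (measurable_pi_iff.2 fun j => measurable_pi_apply _)).ennreal_ofReal
  rw [setLIntegral_coordBox hHm] at h1
  have h2 : ∀ θ ∈ angleBox (m + 1), ∀ p ∈ simplex m, ENNReal.ofReal (vdmSq θ) *
        ∏ j ∈ Finset.range (m + 1), h j (verb (config θ p) j) =
      ENNReal.ofReal (vdmSq θ) * F (verbMap (momentPair (Sum.elim θ p))) := by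
    intro θ hθ p hp
    by_cases hinj : Function.Injective θ
    · have hgen : IsGeneric (conf (Sum.elim θ p)) :=
        isGeneric_config hinj (fun j => hθ j (Set.mem_univ j)) hp.1 hp.2
      rw [verbMap_momentPair hgen, Finset.prod_range_succ, Finset.prod_range]
      rfl
    · have h0 : vdmSq θ = 0 := by
        rw [vdmSq, prod_circlePoint_sub_eq_zero hinj]
        simp
      rw [h0]; simp
  rw [setLIntegral_congr_fun (measurableSet_angleBox _) fun θ hθ =>
    setLIntegral_congr_fun (measurableSet_simplex _) fun p hp => h2 θ hθ p hp]
  refine h1.trans ?_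
  rw [mul_assoc]
  congr 2
  have h3 : ∀ γ ∈ polydisc m,
      ENNReal.ofReal (∏ k ∈ Finset.range m, normProd (extendZero γ) k) *
        ∫⁻ φ in Set.Ico 0 (2 * Real.pi), F (γ, circlePoint φ) =
      (∏ j : Fin m, ENNReal.ofReal ((1 - ‖γ j‖ ^ 2) ^ (m - 1 - j)) * h j (γ j)) *
        ∫⁻ φ in Set.Ico 0 (2 * Real.pi), h m (circlePoint φ) := by
    intro γ hγ
    have hm : Measurable fun φ => h m (circlePoint φ) :=
      (hh m).comp continuous_circlePoint.measurable
    simp only [hF]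
    rw [lintegral_const_mul _ hm, prod_normProd, ENNReal.ofReal_prod_of_nonneg,
      Finset.prod_mul_distrib, mul_assoc]
    intro j _
    refine pow_nonneg ?_ _
    have := hγ j
    nlinarith [norm_nonneg (γ j)]
  have hm' : Measurable fun γ : Fin m → ℂ =>
      ∏ j : Fin m, ENNReal.ofReal ((1 - ‖γ j‖ ^ 2) ^ (m - 1 - (j : ℕ))) * h j (γ j) :=
    Finset.measurable_fun_prod _ fun j _ => Measurable.mul
      (((measurable_pi_apply j).norm.pow_const 2).const_sub 1 |>.pow_const _).ennreal_ofReal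
      ((hh j).comp (measurable_pi_apply j))
  rw [setLIntegral_congr_fun (measurableSet_polydisc m) h3, lintegral_mul_const _ hm',
    setLIntegral_polydisc (fun j z => ENNReal.ofReal ((1 - ‖z‖ ^ 2) ^ (m - 1 - (j : ℕ))) * h j z)
      fun j => Measurable.mul (by fun_prop) (hh j), Finset.prod_range]

end Law

/-! ### The law of the deformed Verblunsky coefficients under the circular Jacobi ensemble -/

section CircularJacobiLaw

/-- The scalar product for arbitrary weights, negative ones being truncated. It makes the
orthogonal polynomials measurable functions of the configuration, without exceptional set. -/
theorem innerL2_spectralMeasure_eq {n : ℕ} (ω : (Fin n → ℝ) × (Fin n → ℝ)) (P Q : ℂ[X]) :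
    innerL2 (spectralMeasure ω) P Q = ∑ j, ((max (ω.2 j) 0 : ℝ) : ℂ) *
      (conj (P.eval (circlePoint (ω.1 j))) * Q.eval (circlePoint (ω.1 j))) := by
  unfold innerL2 spectralMeasure
  rw [integral_finsetSum_measure]
  · refine Finset.sum_congr rfl fun j _ => ?_
    rw [integral_smul_measure, integral_dirac, ENNReal.toReal_ofReal']
    simp
  · intro j _
    exact (integrable_dirac (by simp [enorm_mul, ENNReal.mul_lt_top_iff])).smul_measure (by simp)

theorem measurable_eval_Phi {n : ℕ} (k : ℕ) {z : (Fin n → ℝ) × (Fin n → ℝ) → ℂ}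
    (hz : Measurable z) :
    Measurable fun ω : (Fin n → ℝ) × (Fin n → ℝ) => (Phi k ω).eval (z ω) := by
  induction k using Nat.strong_induction_on generalizing z with
  | _ k ih =>
    have hnode : ∀ i : Fin n, Measurable fun ω : (Fin n → ℝ) × (Fin n → ℝ) =>
        circlePoint (ω.1 i) := fun i =>
      continuous_circlePoint.measurable.comp ((measurable_pi_apply i).comp measurable_fst)
    have hwt : ∀ i : Fin n, Measurable fun ω : (Fin n → ℝ) × (Fin n → ℝ) =>
        ((max (ω.2 i) 0 : ℝ) : ℂ) := fun i => Complex.measurable_ofReal.comp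
      (((measurable_pi_apply i).comp measurable_snd).max measurable_const)
    have hconj : ∀ j < k, ∀ i : Fin n, Measurable fun ω : (Fin n → ℝ) × (Fin n → ℝ) =>
        conj ((Phi j ω).eval (circlePoint (ω.1 i))) := fun j hj i =>
      Complex.continuous_conj.measurable.comp (ih j hj (hnode i))
    have h1 : ∀ ω : (Fin n → ℝ) × (Fin n → ℝ), (Phi k ω).eval (z ω) = z ω ^ k - ∑ j : Fin k,
        innerL2 (spectralMeasure ω) (Phi j ω) (X ^ k) /
          innerL2 (spectralMeasure ω) (Phi j ω) (Phi j ω) * (Phi j ω).eval (z ω) := by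
      intro ω
      rw [Phi, monicOP, eval_sub, eval_finsetSum]
      simp [Phi]
    simp only [h1, innerL2_spectralMeasure_eq, eval_pow, eval_X]
    refine (hz.pow_const k).sub (Finset.measurable_fun_sum _ fun j _ => ?_)
    refine Measurable.mul (Measurable.div ?_ ?_) (ih j j.2 hz)
    · exact Finset.measurable_fun_sum _ fun i _ =>
        (hwt i).mul ((hconj j j.2 i).mul ((hnode i).pow_const k))
    · exact Finset.measurable_fun_sum _ fun i _ =>
        (hwt i).mul ((hconj j j.2 i).mul (ih j j.2 (hnode i)))

theorem measurable_verb {n : ℕ} (k : ℕ) :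
    Measurable fun ω : (Fin n → ℝ) × (Fin n → ℝ) => verb ω k :=
  ((measurable_eval_Phi (k + 1) measurable_const).div
    (measurable_eval_Phi k measurable_const)).const_sub 1

/-- The factor `|(1 - z)^{conj δ}|²`. -/
def tilt (δ z : ℂ) : ℝ := Real.exp (2 * (conj δ * Complex.log (1 - z)).re)

theorem tilt_pos (δ z : ℂ) : 0 < tilt δ z := Real.exp_pos _

theorem tilt_add (δ ε z : ℂ) : tilt (δ + ε) z = tilt δ z * tilt ε z := by
  rw [tilt, tilt, tilt, ← Real.exp_add, map_add, add_mul, Complex.add_re, mul_add]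

theorem measurable_tilt (δ : ℂ) : Measurable (tilt δ) := by
  have : Measurable fun z : ℂ => Complex.log (1 - z) :=
    Complex.measurable_log.comp (measurable_id.const_sub 1)
  exact Real.measurable_exp.comp
    ((Complex.measurable_re.comp (this.const_mul (conj δ))).const_mul 2)

/-- The factors of the density of the angles are the function `tilt` at the nodes. -/
theorem re_mul_cpow_eq_tilt (δ : ℂ) {θ : ℝ} (h : circlePoint θ ≠ 1) :
    ((1 - circlePoint (-θ)) ^ δ * (1 - circlePoint θ) ^ (conj δ)).re = tilt δ (circlePoint θ) := by
  have h0 : 1 - circlePoint θ ≠ 0 := sub_ne_zero.2 h.symm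
  have hslit := one_sub_mem_slitPlane (norm_circlePoint θ).le h
  have hc : 1 - circlePoint (-θ) = conj (1 - circlePoint θ) := by
    rw [map_sub, map_one, conj_circlePoint, circlePoint, circlePoint, ← Complex.exp_neg]
    push_cast
    rw [neg_mul]
  have hc0 : conj (1 - circlePoint θ) ≠ 0 := (_root_.map_ne_zero _).2 h0
  rw [hc, Complex.cpow_def_of_ne_zero hc0, Complex.cpow_def_of_ne_zero h0, ← Complex.exp_add,
    Complex.log_conj _ (Complex.mem_slitPlane_iff_arg.1 hslit).1]
  have h1 : conj (Complex.log (1 - circlePoint θ)) * δ + Complex.log (1 - circlePoint θ) * conj δ =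
      ((2 * (conj δ * Complex.log (1 - circlePoint θ)).re : ℝ) : ℂ) := by
    rw [← Complex.add_conj, map_mul, Complex.conj_conj]
    ring
  rw [h1, ← Complex.ofReal_exp, Complex.ofReal_re, tilt]

/-- For `k = n`, the zeros are the nodes. -/
theorem logPhi_card {n : ℕ} {ω : (Fin n → ℝ) × (Fin n → ℝ)} (h : IsGeneric ω) :
    logPhi n ω = ∑ j, Complex.log (1 - circlePoint (ω.1 j)) := by
  have hr : (nodePoly ω.1).roots = Finset.univ.val.map fun j => circlePoint (ω.1 j) := by
    have := roots_multiset_prod_X_sub_C (Finset.univ.val.map fun j => circlePoint (ω.1 j))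
    rw [Multiset.map_map] at this
    exact this
  rw [logPhi, Phi_eq_nodePoly h, hr, Multiset.map_map]
  rfl

/-- Both sides are the exponential of `2 Re (conj δ * log Φ_n(1))`. -/
theorem prod_tilt_eq {n : ℕ} {ω : (Fin n → ℝ) × (Fin n → ℝ)} (h : IsGeneric ω)
    (h1 : ∀ j, circlePoint (ω.1 j) ≠ 1) (δ : ℂ) :
    ∏ j, tilt δ (circlePoint (ω.1 j)) = ∏ j ∈ Finset.range n, tilt δ (verb ω j) := by
  have := logPhi_card h
  rw [logPhi_eq_sum h h1 le_rfl] at this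
  simp only [tilt]
  rw [← Real.exp_sum, ← Real.exp_sum, ← Finset.mul_sum, ← Finset.mul_sum, ← Complex.re_sum,
    ← Complex.re_sum, ← Finset.mul_sum, ← Finset.mul_sum, this]

/-- The density of the symmetric Dirichlet law in the first `m` coordinates. -/
def dirichletDensity (a : ℝ) {m : ℕ} (x : Fin m → ℝ) : ℝ :=
  (∏ i, x i ^ (a - 1)) * (1 - ∑ i, x i) ^ (a - 1)

/-- The density of the `j`-th coefficient, with respect to its law for `β = 2`. -/
def verbDensity (b : ℝ) (δ : ℂ) (m j : ℕ) (z : ℂ) : ℝ :=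
  (1 - ‖z‖ ^ 2) ^ (((m - j : ℕ) : ℝ) * (b - 1)) * tilt δ z

variable {m : ℕ} {β : ℝ} {δ : ℂ}

/-- The density factorizes over the deformed Verblunsky coefficients: with `Δ` the Vandermonde
determinant, the powers of `Δ` and of the weights are `|Δ|² (|Δ|² ∏ π_j)^{β/2 - 1}`, where
`|Δ|² ∏ π_j = ∏ (1 - |γ_j|²)^{n-1-j}`, and the rest is a function of `log Φ_n(1) = ∑ log (1 - γ_j)`.
-/
theorem angleDensity_mul_dirichletDensity (β : ℝ) (δ : ℂ) {θ : Fin (m + 1) → ℝ} {p : Fin m → ℝ}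
    (h : IsGeneric (config θ p)) (h1 : ∀ j, circlePoint (θ j) ≠ 1) :
    angleDensity β δ θ * dirichletDensity (β / 2) p =
      vdmSq θ * ∏ j ∈ Finset.range (m + 1), verbDensity (β / 2) δ m j (verb (config θ p) j) := by
  set ω := config θ p with hω
  set D : ℂ := ∏ i, ∏ j ∈ Finset.Ioi i, (circlePoint (θ j) - circlePoint (θ i)) with hD
  have hD0 : 0 < ‖D‖ := by
    rw [norm_pos_iff, hD]
    refine Finset.prod_ne_zero_iff.2 fun i _ => Finset.prod_ne_zero_iff.2 fun j hj => ?_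
    exact sub_ne_zero.2 fun hij => (Finset.mem_Ioi.1 hj).ne' (h.inj hij)
  have hv : vdmSq θ = ‖D‖ ^ 2 := rfl
  have hnn : ∀ j ∈ Finset.range (m + 1), 0 ≤ 1 - ‖verb ω j‖ ^ 2 := by
    intro j hj
    have hj' := Finset.mem_range.1 hj
    rcases lt_or_eq_of_le (Nat.lt_succ_iff.1 hj') with hlt | heq
    · have := norm_verb_lt_one h (k := j) (by lia)
      nlinarith [norm_nonneg (verb ω j)]
    · have h2 := norm_verb h hj'
      have h3 := norm_coeff_zero_le_one h hj'
      rw [← h2] at h3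
      nlinarith [norm_nonneg (verb ω j)]
  have h2 := norm_sq_vandermonde_mul_prod h
  have h3 : ∏ k ∈ Finset.range (m + 1), nrm ω (Phi k ω) =
      ∏ j ∈ Finset.range (m + 1), (1 - ‖verb ω j‖ ^ 2) ^ (m - j) := by
    have := prod_range_normProd (verb ω) (m + 1)
    rw [Nat.add_sub_cancel] at this
    rw [← this]
    refine Finset.prod_congr rfl fun k hk => ?_
    rw [nrm_Phi_eq h (Finset.mem_range.1 hk).le]; rfl
  have h4 : ‖D‖ ^ 2 * ∏ j, ω.2 j = ∏ j ∈ Finset.range (m + 1), (1 - ‖verb ω j‖ ^ 2) ^ (m - j) := by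
    rw [← h3]; exact h2
  have h5 : dirichletDensity (β / 2) p = (∏ j, ω.2 j) ^ (β / 2 - 1) := by
    rw [← Real.finsetProd_rpow _ _ fun j _ => (h.pos j).le, Fin.prod_univ_castSucc,
      dirichletDensity]
    simp [hω, config]
  have h6 : ∏ j, ((1 - circlePoint (-θ j)) ^ δ * (1 - circlePoint (θ j)) ^ (conj δ)).re =
      ∏ j ∈ Finset.range (m + 1), tilt δ (verb ω j) := by
    rw [← prod_tilt_eq h h1]
    exact Finset.prod_congr rfl fun j _ => re_mul_cpow_eq_tilt δ (h1 j)
  have h7 : ‖D‖ ^ β = ‖D‖ ^ 2 * (‖D‖ ^ 2) ^ (β / 2 - 1) := by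
    rw [← Real.rpow_natCast, ← Real.rpow_mul hD0.le, ← Real.rpow_add hD0]
    congr 1
    push_cast
    ring
  have hw : 0 < ∏ j, ω.2 j := Finset.prod_pos fun j _ => h.pos j
  have h8 : (‖D‖ ^ 2) ^ (β / 2 - 1) * (∏ j, ω.2 j) ^ (β / 2 - 1) =
      ∏ j ∈ Finset.range (m + 1), (1 - ‖verb ω j‖ ^ 2) ^ (((m - j : ℕ) : ℝ) * (β / 2 - 1)) := by
    rw [← Real.mul_rpow (by positivity) hw.le, h4,
      ← Real.finsetProd_rpow _ _ fun j hj => pow_nonneg (hnn j hj) _]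
    refine Finset.prod_congr rfl fun j hj => ?_
    rw [Real.rpow_mul (hnn j hj), Real.rpow_natCast]
  rw [angleDensity, h6, h5, hv]
  simp only [verbDensity]
  rw [Finset.prod_mul_distrib, ← h8, ← hD, h7]
  ring

theorem measurable_angleDensity {n : ℕ} : Measurable fun θ : Fin n → ℝ => angleDensity β δ θ := by
  have hc := continuous_circlePoint.measurable
  have h1 : ∀ j : Fin n, Measurable fun θ : Fin n → ℝ => circlePoint (θ j) := fun j =>
    hc.comp (measurable_pi_apply j)
  have h2 : ∀ j : Fin n, Measurable fun θ : Fin n → ℝ => circlePoint (-θ j) := fun j =>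
    hc.comp (measurable_pi_apply j).neg
  refine Measurable.mul ?_ (Finset.measurable_fun_prod _ fun j _ => Complex.measurable_re.comp ?_)
  · refine Measurable.pow_const (Measurable.norm ?_) _
    exact Finset.measurable_fun_prod _ fun i _ => Finset.measurable_fun_prod _ fun j _ =>
      (h1 j).sub (h1 i)
  · exact (((h2 j).const_sub 1).pow_const δ).mul (((h1 j).const_sub 1).pow_const (conj δ))

theorem measurable_dirichletDensity {a : ℝ} :
    Measurable fun x : Fin m → ℝ => dirichletDensity a x := by
  have h1 : Measurable fun x : Fin m → ℝ => ∏ i, x i ^ (a - 1) :=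
    Finset.measurable_fun_prod _ fun i _ => (measurable_pi_apply i).pow_const _
  have h2 : Measurable fun x : Fin m → ℝ => (1 - ∑ i, x i) ^ (a - 1) :=
    Measurable.pow_const (Measurable.const_sub
      (Finset.measurable_fun_sum Finset.univ fun i _ => measurable_pi_apply i) 1) _
  exact h1.mul h2

theorem measurable_snoc_one_sub_sum : Measurable fun p : Fin m → ℝ =>
    Fin.snoc (α := fun _ => ℝ) p (1 - ∑ i, p i) := by
  refine measurable_pi_iff.2 fun i => ?_
  induction i using Fin.lastCases with
  | last =>
    simp only [Fin.snoc_last]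
    exact Measurable.const_sub
      (Finset.measurable_fun_sum Finset.univ fun i _ => measurable_pi_apply i) 1
  | cast i =>
    simp only [Fin.snoc_castSucc]
    exact measurable_pi_apply i

theorem measurable_config : Measurable fun q : (Fin (m + 1) → ℝ) × (Fin m → ℝ) =>
    config q.1 q.2 :=
  measurable_fst.prodMk (measurable_snoc_one_sub_sum.comp measurable_snd)

/-- The integral of a function against the unnormalized circular Jacobi law. -/
def cjIntegral (β : ℝ) (δ : ℂ) (m : ℕ)
    (H : (Fin (m + 1) → ℝ) × (Fin (m + 1) → ℝ) → ℝ≥0∞) : ℝ≥0∞ :=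
  ∫⁻ θ in angleBox (m + 1), ∫⁻ p in simplex m, ENNReal.ofReal (angleDensity β δ θ) *
    ENNReal.ofReal (dirichletDensity (β / 2) p) * H (config θ p)

/-- The normalization constant of the angles. -/
def angleMass (β : ℝ) (δ : ℂ) (n : ℕ) : ℝ≥0∞ :=
  ∫⁻ θ in angleBox n, ENNReal.ofReal (angleDensity β δ θ)

/-- The normalization constant of the weights. -/
def dirichletMass (a : ℝ) (m : ℕ) : ℝ≥0∞ :=
  ∫⁻ p in simplex m, ENNReal.ofReal (dirichletDensity a p)

theorem cjIntegral_one : cjIntegral β δ m (fun _ => 1) =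
    angleMass β δ (m + 1) * dirichletMass (β / 2) m := by
  have h1 : Measurable fun θ : Fin (m + 1) → ℝ => ENNReal.ofReal (angleDensity β δ θ) :=
    measurable_angleDensity.ennreal_ofReal
  simp only [cjIntegral, mul_one]
  simp only [lintegral_const_mul' _ _ ENNReal.ofReal_ne_top]
  rw [lintegral_mul_const _ h1]
  rfl

/-- Integrals against the circular Jacobi law, in terms of the densities. -/
theorem lintegral_cjLaw {H : (Fin (m + 1) → ℝ) × (Fin (m + 1) → ℝ) → ℝ≥0∞} (hH : Measurable H) :
    ∫⁻ ω, H ω ∂(cjLaw β δ (m + 1)) =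
      (angleMass β δ (m + 1))⁻¹ * ((dirichletMass (β / 2) m)⁻¹ * cjIntegral β δ m H) := by
  have hd1 : Measurable fun θ : Fin (m + 1) → ℝ => ENNReal.ofReal (angleDensity β δ θ) :=
    measurable_angleDensity.ennreal_ofReal
  have hd2 : Measurable fun p : Fin m → ℝ => ENNReal.ofReal (dirichletDensity (β / 2) p) :=
    measurable_dirichletDensity.ennreal_ofReal
  have hs : Measurable fun p : Fin m → ℝ => Fin.snoc (α := fun _ => ℝ) p (1 - ∑ i, p i) :=
    measurable_snoc_one_sub_sum
  have hA : angleLaw β δ (m + 1) = (angleMass β δ (m + 1))⁻¹ •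
      ((volume.restrict (angleBox (m + 1))).withDensity
        fun θ => ENNReal.ofReal (angleDensity β δ θ)) := by
    rw [angleLaw, normalize, withDensity_apply _ MeasurableSet.univ, Measure.restrict_univ]
    rfl
  have hB : dirichletLaw (β / 2) (m + 1) = ((dirichletMass (β / 2) m)⁻¹ •
      ((volume.restrict (simplex m)).withDensity
        fun p => ENNReal.ofReal (dirichletDensity (β / 2) p))).map
        fun p => Fin.snoc (α := fun _ => ℝ) p (1 - ∑ i, p i) := by
    rw [dirichletLaw, normalize, withDensity_apply _ MeasurableSet.univ, Measure.restrict_univ]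
    rfl
  have hconf : Measurable fun q : (Fin (m + 1) → ℝ) × (Fin m → ℝ) => H (config q.1 q.2) :=
    hH.comp measurable_config
  have hm : Measurable fun q : (Fin (m + 1) → ℝ) × (Fin m → ℝ) =>
      ENNReal.ofReal (dirichletDensity (β / 2) q.2) * H (config q.1 q.2) :=
    (hd2.comp measurable_snd).mul hconf
  have hinner : ∀ θ, ∫⁻ w, H (θ, w) ∂(dirichletLaw (β / 2) (m + 1)) =
      (dirichletMass (β / 2) m)⁻¹ * ∫⁻ p in simplex m,
        ENNReal.ofReal (dirichletDensity (β / 2) p) * H (config θ p) := by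
    intro θ
    have hHθ : Measurable fun w => H (θ, w) := hH.comp measurable_prodMk_left
    have hcθ : Measurable fun p : Fin m → ℝ => H (config θ p) := hHθ.comp hs
    rw [hB, lintegral_map hHθ hs, lintegral_smul_measure, smul_eq_mul]
    congr 1
    exact lintegral_withDensity_eq_lintegral_mul _ hd2 hcθ
  have hsf : SFinite (dirichletLaw (β / 2) (m + 1)) := by rw [hB]; infer_instance
  rw [cjLaw, lintegral_prod _ hH.aemeasurable]
  simp only [hinner]
  have hm2 : Measurable fun θ : Fin (m + 1) → ℝ => (dirichletMass (β / 2) m)⁻¹ *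
      ∫⁻ p in simplex m, ENNReal.ofReal (dirichletDensity (β / 2) p) * H (config θ p) :=
    (hm.lintegral_prod_right' (ν := volume.restrict (simplex m))).const_mul _
  rw [hA, lintegral_smul_measure, smul_eq_mul]
  congr 1
  rw [lintegral_withDensity_eq_lintegral_mul _ hd1 hm2, cjIntegral]
  simp only [mul_assoc, Pi.mul_apply]
  have hm3 : Measurable fun θ : Fin (m + 1) → ℝ => ∫⁻ p in simplex m,
      ENNReal.ofReal (angleDensity β δ θ) *
        (ENNReal.ofReal (dirichletDensity (β / 2) p) * H (config θ p)) := by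
    simp only [lintegral_const_mul' _ _ ENNReal.ofReal_ne_top]
    exact hd1.mul (hm.lintegral_prod_right' (ν := volume.restrict (simplex m)))
  rw [← lintegral_const_mul _ hm3]
  refine lintegral_congr fun θ => ?_
  rw [lintegral_const_mul' _ _ ENNReal.ofReal_ne_top]
  ring

/-- The unnormalized law of a coefficient: on the unit disc with weight
`(1 - |z|²)^{l - 1} |(1 - z)^{conj δ}|²` if `l > 0`, and on the circle with weight
`|(1 - z)^{conj δ}|²` if `l = 0`. -/
def verbIntegral (l : ℝ) (δ : ℂ) (h : ℂ → ℝ≥0∞) : ℝ≥0∞ :=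
  if l = 0 then ∫⁻ φ in Set.Ico 0 (2 * Real.pi),
    ENNReal.ofReal (tilt δ (circlePoint φ)) * h (circlePoint φ)
  else ∫⁻ z in {z : ℂ | ‖z‖ < 1}, ENNReal.ofReal ((1 - ‖z‖ ^ 2) ^ (l - 1) * tilt δ z) * h z

theorem ae_circlePoint_ne_one (n : ℕ) : ∀ᵐ θ ∂(volume.restrict (angleBox n)),
    ∀ j, circlePoint (θ j) ≠ 1 := by
  have h1 : ∀ j : Fin n, ∀ᵐ θ : Fin n → ℝ, θ j ≠ 0 := fun j =>
    Measure.ae_eval_ne (fun _ => volume) j 0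
  filter_upwards [ae_restrict_of_ae (ae_all_iff.2 h1),
    ae_restrict_mem (measurableSet_angleBox n)] with θ hθ hbox j hj
  have h0 : circlePoint 0 = 1 := by simp [circlePoint]
  exact hθ j
    (circlePoint_injOn (hbox j (Set.mem_univ j)) ⟨le_rfl, by positivity⟩ (hj.trans h0.symm))

theorem measurable_verbDensity {b : ℝ} (j : ℕ) : Measurable (verbDensity b δ m j) :=
  (((measurable_norm.pow_const 2).const_sub 1).pow_const _).mul (measurable_tilt δ)

/-- Product formula for the unnormalized law, from the case `β = 2` and the factorization of the
density. -/
theorem cjIntegral_prod_verb (hβ : 0 < β) (h : ℕ → ℂ → ℝ≥0∞) (hh : ∀ j, Measurable (h j)) :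
    cjIntegral β δ m (fun ω => ∏ j ∈ Finset.range (m + 1), h j (verb ω j)) =
      (m + 1).factorial * 2 ^ m *
        ∏ j ∈ Finset.range (m + 1), verbIntegral (β / 2 * (m - j : ℕ)) δ (h j) := by
  have h1 := setLIntegral_prod_verb (m := m)
    (fun j z => ENNReal.ofReal (verbDensity (β / 2) δ m j z) * h j z)
    fun j => (measurable_verbDensity j).ennreal_ofReal.mul (hh j)
  have h2 : cjIntegral β δ m (fun ω => ∏ j ∈ Finset.range (m + 1), h j (verb ω j)) =
      ∫⁻ θ in angleBox (m + 1), ∫⁻ p in simplex m, ENNReal.ofReal (vdmSq θ) *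
        ∏ j ∈ Finset.range (m + 1), (ENNReal.ofReal (verbDensity (β / 2) δ m j
          (verb (config θ p) j)) * h j (verb (config θ p) j)) := by
    refine lintegral_congr_ae ?_
    filter_upwards [ae_circlePoint_ne_one (m + 1),
      ae_restrict_mem (measurableSet_angleBox (m + 1))] with θ hθ hbox
    refine setLIntegral_congr_fun (measurableSet_simplex m) fun p hp => ?_
    by_cases hinj : Function.Injective θ
    · have hgen : IsGeneric (config θ p) :=
        isGeneric_config hinj (fun j => hbox j (Set.mem_univ j)) hp.1 hp.2
      have h3 := angleDensity_mul_dirichletDensity β δ hgen hθ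
      have hnn : 0 ≤ angleDensity β δ θ := by
        refine mul_nonneg (Real.rpow_nonneg (norm_nonneg _) _) (Finset.prod_nonneg fun j _ => ?_)
        rw [re_mul_cpow_eq_tilt δ (hθ j)]
        exact (tilt_pos _ _).le
      have hvnn : 0 ≤ vdmSq θ := sq_nonneg _
      rw [Finset.prod_mul_distrib, ← mul_assoc, ← ENNReal.ofReal_mul hnn, h3,
        ENNReal.ofReal_mul hvnn, ENNReal.ofReal_prod_of_nonneg]
      intro j hj
      refine mul_nonneg (Real.rpow_nonneg ?_ _) (tilt_pos _ _).le
      have hj' := Finset.mem_range.1 hj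
      have h4 := norm_coeff_zero_le_one hgen hj'
      rw [← norm_verb hgen hj'] at h4
      nlinarith [norm_nonneg (verb (config θ p) j)]
    · have hz := prod_circlePoint_sub_eq_zero hinj
      have hv : vdmSq θ = 0 := by rw [vdmSq, hz]; simp
      have ha : angleDensity β δ θ = 0 := by
        rw [angleDensity, hz, norm_zero, Real.zero_rpow hβ.ne', zero_mul]
      rw [hv, ha]; simp
  rw [h2, h1, Finset.prod_range_succ (fun j => verbIntegral (β / 2 * (m - j : ℕ)) δ (h j))]
  congr 2
  · refine Finset.prod_congr rfl fun j hj => ?_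
    have hj' := Finset.mem_range.1 hj
    have hmj : (0 : ℝ) < (m - j : ℕ) := by
      have : 0 < m - j := by lia
      exact_mod_cast this
    rw [verbIntegral, if_neg (by positivity)]
    refine setLIntegral_congr_fun (measurableSet_lt measurable_norm measurable_const) fun z hz => ?_
    have hz1 : 0 < 1 - ‖z‖ ^ 2 := by
      have : ‖z‖ < 1 := hz
      nlinarith [norm_nonneg z]
    rw [← mul_assoc, ← ENNReal.ofReal_mul (by positivity), verbDensity, ← mul_assoc,
      ← Real.rpow_natCast, ← Real.rpow_add hz1]
    congr 4
    have h3 : m - j = m - 1 - j + 1 := by lia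
    rw [h3]
    push_cast
    ring
  · rw [verbIntegral, if_pos (by simp)]
    simp [verbDensity]

/-- Exponential tilting of the law of a coefficient shifts the parameter `δ`. -/
theorem verbIntegral_tilt (l : ℝ) (δ ε : ℂ) :
    verbIntegral l δ (fun z => ENNReal.ofReal (tilt ε z)) = verbIntegral l (δ + ε) fun _ => 1 := by
  unfold verbIntegral
  split_ifs
  · refine lintegral_congr fun φ => ?_
    rw [mul_one, tilt_add, ENNReal.ofReal_mul (tilt_pos _ _).le]
  · refine lintegral_congr fun z => ?_
    rw [mul_one, tilt_add, ← mul_assoc, ENNReal.ofReal_mul' (tilt_pos ε z).le]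

/-- Under the circular Jacobi law, the deformed Verblunsky coefficients are independent, and the
law of the `j`-th one is given by `verbIntegral` with `l = β (n - 1 - j) / 2`. -/
theorem lintegral_cjLaw_prod_verb (hβ : 0 < β)
    (hfin : ∀ l : ℝ, 0 ≤ l → verbIntegral l δ (fun _ => 1) ≠ 0 ∧ verbIntegral l δ (fun _ => 1) ≠ ∞)
    (h : ℕ → ℂ → ℝ≥0∞) (hh : ∀ j, Measurable (h j)) :
    ∫⁻ ω, ∏ j ∈ Finset.range (m + 1), h j (verb ω j) ∂(cjLaw β δ (m + 1)) =
      ∏ j ∈ Finset.range (m + 1), verbIntegral (β / 2 * (m - j : ℕ)) δ (h j) /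
        verbIntegral (β / 2 * (m - j : ℕ)) δ (fun _ => 1) := by
  have h1 := cjIntegral_prod_verb (m := m) (δ := δ) hβ (fun _ _ => 1) fun _ => measurable_const
  simp only [Finset.prod_const_one] at h1
  rw [cjIntegral_one] at h1
  set K : ℝ≥0∞ := ((m + 1).factorial : ℝ≥0∞) * 2 ^ m with hK
  set P := ∏ j ∈ Finset.range (m + 1), verbIntegral (β / 2 * (m - j : ℕ)) δ (fun _ => 1) with hP
  have hl : ∀ j : ℕ, 0 ≤ β / 2 * (m - j : ℕ) := fun j => by positivity
  have hK0 : K ≠ 0 := mul_ne_zero (by exact_mod_cast (Nat.factorial_pos _).ne') (by simp)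
  have hKt : K ≠ ∞ := ENNReal.mul_ne_top (by simp) (by simp)
  have hP0 : P ≠ 0 := Finset.prod_ne_zero_iff.2 fun j _ => (hfin _ (hl j)).1
  have hPt : P ≠ ∞ := ENNReal.prod_ne_top fun j _ => (hfin _ (hl j)).2
  set A := angleMass β δ (m + 1)
  set B := dirichletMass (β / 2) m
  have hAB0 : A * B ≠ 0 := by rw [h1]; exact mul_ne_zero hK0 hP0
  have hABt : A * B ≠ ∞ := by rw [h1]; exact ENNReal.mul_ne_top hKt hPt
  have hA0 : A ≠ 0 := left_ne_zero_of_mul hAB0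
  have hB0 : B ≠ 0 := right_ne_zero_of_mul hAB0
  have hAt : A ≠ ∞ := fun h => hABt (by rw [h, ENNReal.top_mul hB0])
  have hBt : B ≠ ∞ := fun h => hABt (by rw [h, ENNReal.mul_top hA0])
  have hHm : Measurable fun ω : (Fin (m + 1) → ℝ) × (Fin (m + 1) → ℝ) =>
      ∏ j ∈ Finset.range (m + 1), h j (verb ω j) :=
    Finset.measurable_fun_prod _ fun j _ => (hh j).comp (measurable_verb j)
  rw [lintegral_cjLaw hHm, cjIntegral_prod_verb hβ h hh, ← mul_assoc,
    ← ENNReal.mul_inv (Or.inl hA0) (Or.inl hAt), h1, ENNReal.mul_inv (Or.inl hK0) (Or.inl hKt)]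
  set Q := ∏ j ∈ Finset.range (m + 1), verbIntegral (β / 2 * (m - j : ℕ)) δ (h j)
  rw [Finset.prod_congr rfl fun j _ => div_eq_mul_inv _ _, Finset.prod_mul_distrib,
    ← ENNReal.prod_inv_distrib fun i _ j _ _ =>
    Or.inl (hfin _ (hl i)).1]
  change K⁻¹ * P⁻¹ * (K * Q) = Q * P⁻¹
  calc K⁻¹ * P⁻¹ * (K * Q) = (K⁻¹ * K) * (Q * P⁻¹) := by ring
    _ = _ := by rw [ENNReal.inv_mul_cancel hK0 hKt, one_mul]

end CircularJacobiLaw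

/-! ### The hypergeometric series of a coefficient -/

section GaussSeries

open Filter Topology

/-- The terms `|binom(conj δ, k)|² k! / ((l + 1) ⋯ (l + k))` of the hypergeometric series
`₂F₁(-δ, -conj δ; l + 1; 1)`. -/
def gaussTerm (l : ℝ) (δ : ℂ) (k : ℕ) : ℝ :=
  ‖Ring.choose (conj δ) k‖ ^ 2 * (k.factorial / ∏ i ∈ Finset.range k, (l + 1 + i))

/-- The value `₂F₁(-δ, -conj δ; l + 1; 1)`. -/
def gaussSum (l : ℝ) (δ : ℂ) : ℝ := ∑' k, gaussTerm l δ k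

variable {l : ℝ} {δ : ℂ}

theorem choose_succ_mul (a : ℂ) (k : ℕ) :
    Ring.choose a (k + 1) * (k + 1) = Ring.choose a k * (a - k) := by
  have h := Ring.choose_smul_choose a (Nat.le_succ k)
  rw [Nat.choose_succ_self_right, Nat.succ_sub le_rfl, Nat.sub_self] at h
  rw [Ring.choose_one_right, nsmul_eq_mul, mul_comm] at h
  simpa using h

theorem gaussTerm_zero : gaussTerm l δ 0 = 1 := by
  simp [gaussTerm]

theorem prod_shift_pos (hl : 0 ≤ l) (k : ℕ) : 0 < ∏ i ∈ Finset.range k, (l + 1 + i) :=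
  Finset.prod_pos fun i _ => by positivity

theorem gaussTerm_nonneg (hl : 0 ≤ l) (k : ℕ) : 0 ≤ gaussTerm l δ k := by
  have := prod_shift_pos hl k
  unfold gaussTerm
  positivity

/-- The ratio of consecutive terms. -/
theorem gaussTerm_succ (hl : 0 ≤ l) (k : ℕ) : (k + 1) * (k + 1 + l) * gaussTerm l δ (k + 1) =
    (k ^ 2 - 2 * k * δ.re + ‖δ‖ ^ 2) * gaussTerm l δ k := by
  have h1 := congrArg (fun z => ‖z‖ ^ 2) (choose_succ_mul (conj δ) k)
  simp only [norm_mul, mul_pow] at h1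
  have h2 : ‖(k : ℂ) + 1‖ ^ 2 = ((k : ℝ) + 1) ^ 2 := by
    rw [show (k : ℂ) + 1 = ((k + 1 : ℝ) : ℂ) by push_cast; ring, Complex.norm_real,
      Real.norm_eq_abs, sq_abs]
  have h3 : ‖conj δ - k‖ ^ 2 = k ^ 2 - 2 * k * δ.re + ‖δ‖ ^ 2 := by
    rw [← Complex.normSq_eq_norm_sq, ← Complex.normSq_eq_norm_sq, Complex.normSq_apply,
      Complex.normSq_apply]
    simp
    ring
  rw [h2, h3] at h1
  have hp := prod_shift_pos hl k
  have hk : 0 < l + 1 + k := by positivity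
  rw [gaussTerm, gaussTerm, Finset.prod_range_succ, Nat.factorial_succ]
  push_cast
  field_simp
  linear_combination (l + 1 + k) * h1

theorem gaussTerm_add_one (hl : 0 ≤ l) (k : ℕ) :
    (l + 1 + k) * gaussTerm (l + 1) δ k = (l + 1) * gaussTerm l δ k := by
  have h1 : (l + 1 + k) * ∏ i ∈ Finset.range k, (l + 1 + i) =
      (l + 1) * ∏ i ∈ Finset.range k, (l + 1 + 1 + i) := by
    rw [mul_comm, ← Finset.prod_range_succ, Finset.prod_range_succ', mul_comm]
    congr 1
    · simp
    · refine Finset.prod_congr rfl fun i _ => ?_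
      push_cast; ring
  have hp := prod_shift_pos hl k
  have hp' := prod_shift_pos (l := l + 1) (by positivity) k
  rw [gaussTerm, gaussTerm]
  field_simp
  linear_combination ‖Ring.choose (conj δ) k‖ ^ 2 * h1

/-- For Raabe's test: `k a_k - (k + 1) a_{k+1}` is `(1 + l + 2 Re δ) a_k` to leading order. -/
theorem gaussTerm_telescope (hl : 0 ≤ l) (k : ℕ) :
    (k * gaussTerm l δ k - (k + 1 : ℕ) * gaussTerm l δ (k + 1)) * (k + 1 + l) =
      (k * (1 + l + 2 * δ.re) - ‖δ‖ ^ 2) * gaussTerm l δ k := by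
  have h := gaussTerm_succ (δ := δ) hl k
  push_cast
  linear_combination -h

/-- By `gaussTerm_telescope` and `1 + l + 2 Re δ > 0`, the sequence `k a_k` is eventually
nonincreasing, and its decrements dominate a multiple of `a_k`. This gives summability; the limit
of `k a_k` then exists, and it must vanish by divergence of the harmonic series. -/
theorem summable_gaussTerm_and_tendsto (hl : 0 ≤ l) (hδ : -1 / 2 < δ.re) :
    Summable (gaussTerm l δ) ∧ Tendsto (fun k : ℕ => k * gaussTerm l δ k) atTop (𝓝 0) := by
  set v : ℕ → ℝ := fun k => k * gaussTerm l δ k with hv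
  set c : ℝ := (1 + l + 2 * δ.re) / 2 with hc
  have hc0 : 0 < c := by rw [hc]; linarith
  have hvnn : ∀ k, 0 ≤ v k := fun k => mul_nonneg (Nat.cast_nonneg _) (gaussTerm_nonneg hl k)
  obtain ⟨K, hK⟩ : ∃ K : ℕ, ‖δ‖ ^ 2 + c * (1 + l) ≤ c * K := by
    obtain ⟨K, hK⟩ := exists_nat_ge ((‖δ‖ ^ 2 + c * (1 + l)) / c)
    exact ⟨K, by rwa [div_le_iff₀' hc0] at hK⟩
  have hstep : ∀ k, K ≤ k → c * gaussTerm l δ k ≤ v k - v (k + 1) := by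
    intro k hk
    have h1 := gaussTerm_telescope (δ := δ) hl k
    have h2 : (0 : ℝ) < k + 1 + l := by positivity
    have h3 : (K : ℝ) ≤ k := by exact_mod_cast hk
    have h4 : c * (k + 1 + l) ≤ k * (1 + l + 2 * δ.re) - ‖δ‖ ^ 2 := by
      have : c * K ≤ c * k := mul_le_mul_of_nonneg_left h3 hc0.le
      have h5 : (k : ℝ) * (1 + l + 2 * δ.re) = 2 * (c * k) := by rw [hc]; ring
      rw [h5]; linarith
    have h5 := mul_le_mul_of_nonneg_right h4 (gaussTerm_nonneg (δ := δ) hl k)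
    rw [← h1] at h5
    refine le_of_mul_le_mul_right ?_ h2
    calc c * gaussTerm l δ k * (k + 1 + l) = c * (k + 1 + l) * gaussTerm l δ k := by ring
      _ ≤ _ := h5
  have hsum : Summable (gaussTerm l δ) := by
    rw [← summable_nat_add_iff K]
    refine summable_of_sum_range_le (c := v K / c) (fun k => gaussTerm_nonneg hl _) fun n => ?_
    rw [le_div_iff₀' hc0, Finset.mul_sum]
    have h1 : ∑ i ∈ Finset.range n, c * gaussTerm l δ (i + K) ≤
        ∑ i ∈ Finset.range n, (v (i + K) - v (i + 1 + K)) :=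
      Finset.sum_le_sum fun i _ => by
        have := hstep (i + K) (Nat.le_add_left _ _)
        rwa [show i + K + 1 = i + 1 + K by ring] at this
    have h2 := Finset.sum_range_sub' (fun i => v (i + K)) n
    rw [h2, zero_add] at h1
    linarith [hvnn (n + K)]
  refine ⟨hsum, ?_⟩
  have hanti : Antitone fun k => v (k + K) := antitone_nat_of_succ_le fun k => by
    have := hstep (k + K) (Nat.le_add_left _ _)
    have h2 := mul_nonneg hc0.le (gaussTerm_nonneg (δ := δ) hl (k + K))
    rw [show k + 1 + K = k + K + 1 by ring]
    linarith
  have hlim := tendsto_atTop_ciInf hanti ⟨0, by rintro _ ⟨k, rfl⟩; exact hvnn _⟩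
  set L := ⨅ k, v (k + K)
  have hlim' : Tendsto v atTop (𝓝 L) := (tendsto_add_atTop_iff_nat K).1 hlim
  have hL0 : 0 ≤ L := ge_of_tendsto' hlim' hvnn
  rcases hL0.eq_or_lt with h0 | hpos
  · rw [h0]; exact hlim'
  · exfalso
    -- a positive limit of `k * gaussTerm l δ k` would make the harmonic series converge
    have h1 : ∀ᶠ k : ℕ in atTop, ‖(1 : ℝ) / k‖ ≤ gaussTerm l δ k * (2 / L) := by
      filter_upwards [hlim'.eventually (lt_mem_nhds (half_lt_self hpos)),
        eventually_gt_atTop 0] with k hk hk0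
      have hk0' : (0 : ℝ) < k := by exact_mod_cast hk0
      rw [Real.norm_of_nonneg (by positivity), mul_div_assoc', div_le_div_iff₀ hk0' hpos]
      have : L / 2 < k * gaussTerm l δ k := hk
      linarith
    exact Real.not_summable_one_div_natCast
      (Summable.of_norm_bounded_eventually_nat (hsum.mul_right _) h1)

theorem one_le_gaussSum (hl : 0 ≤ l) (hδ : -1 / 2 < δ.re) : 1 ≤ gaussSum l δ := by
  have := (summable_gaussTerm_and_tendsto hl hδ).1.le_tsum 0 fun k _ => gaussTerm_nonneg hl k
  rwa [gaussTerm_zero] at this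

/-- The contiguity relation of the hypergeometric series at `1`. -/
theorem gaussSum_recursion (hl : 0 ≤ l) (hδ : -1 / 2 < δ.re) :
    (l + 1) * (l + 1 + 2 * δ.re) * gaussSum l δ = ‖(l : ℂ) + 1 + δ‖ ^ 2 * gaussSum (l + 1) δ := by
  obtain ⟨h1, h2⟩ := summable_gaussTerm_and_tendsto hl hδ
  obtain ⟨h3, -⟩ := summable_gaussTerm_and_tendsto (l := l + 1) (by positivity) hδ
  have hn : ‖(l : ℂ) + 1 + δ‖ ^ 2 = (l + 1) ^ 2 + 2 * (l + 1) * δ.re + ‖δ‖ ^ 2 := by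
    rw [← Complex.normSq_eq_norm_sq, ← Complex.normSq_eq_norm_sq, Complex.normSq_apply,
      Complex.normSq_apply]
    simp
    ring
  have hterm : ∀ k, (l + 1) * (l + 1 + 2 * δ.re) * gaussTerm l δ k -
      ‖(l : ℂ) + 1 + δ‖ ^ 2 * gaussTerm (l + 1) δ k =
      (l + 1) * (k * gaussTerm l δ k) - (l + 1) * ((k + 1 : ℕ) * gaussTerm l δ (k + 1)) := by
    intro k
    have h4 := gaussTerm_telescope (δ := δ) hl k
    have h5 := gaussTerm_add_one (δ := δ) hl k
    have h6 : (l + 1 + k) ≠ 0 := by positivity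
    refine mul_right_cancel₀ h6 ?_
    rw [hn]
    linear_combination (-((l + 1) ^ 2 + 2 * (l + 1) * δ.re + ‖δ‖ ^ 2)) * h5 - (l + 1) * h4
  have hs := (h1.mul_left ((l + 1) * (l + 1 + 2 * δ.re))).hasSum.sub
    (h3.mul_left (‖(l : ℂ) + 1 + δ‖ ^ 2)).hasSum
  have h7 := hs.tendsto_sum_nat
  simp only [hterm, Finset.sum_range_sub' (fun k : ℕ => (l + 1) * (k * gaussTerm l δ k))] at h7
  have h8 : Tendsto (fun n : ℕ => (l + 1) * (((0 : ℕ) : ℝ) * gaussTerm l δ 0) -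
      (l + 1) * (n * gaussTerm l δ n)) atTop (𝓝 0) := by
    simpa using (h2.const_mul (l + 1)).neg
  have h9 := tendsto_nhds_unique h7 h8
  rw [tsum_mul_left, tsum_mul_left] at h9
  exact sub_eq_zero.1 h9

/-- All the terms but the first tend to `0` as `l → ∞`, with domination by the terms at `l`. -/
theorem tendsto_gaussSum (hl : 0 ≤ l) (hδ : -1 / 2 < δ.re) :
    Tendsto (fun N : ℕ => gaussSum (l + N) δ) atTop (𝓝 1) := by
  have h1 := (summable_gaussTerm_and_tendsto hl hδ).1
  have h0 : ∑' k, (if k = 0 then (1 : ℝ) else 0) = 1 := tsum_ite_eq 0 _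
  rw [← h0]
  refine tendsto_tsum_of_dominated_convergence h1 (fun k => ?_) (Eventually.of_forall fun N k => ?_)
  · rcases k with _ | k
    · simp [gaussTerm_zero]
    · rw [if_neg (Nat.succ_ne_zero k)]
      have h2 : Tendsto (fun N : ℕ => ‖Ring.choose (conj δ) (k + 1)‖ ^ 2 *
          (k + 1).factorial * (1 / ((N : ℝ) + 1))) atTop (𝓝 0) := by
        simpa using (tendsto_one_div_add_atTop_nhds_zero_nat (𝕜 := ℝ)).const_mul
          (‖Ring.choose (conj δ) (k + 1)‖ ^ 2 * (k + 1).factorial)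
      refine squeeze_zero (fun N => gaussTerm_nonneg (by positivity) _) (fun N => ?_) h2
      rw [gaussTerm, mul_assoc, div_eq_mul_one_div]
      refine mul_le_mul_of_nonneg_left
        (mul_le_mul_of_nonneg_left ?_ (by positivity)) (by positivity)
      refine one_div_le_one_div_of_le (by positivity) ?_
      rw [Finset.prod_range_succ']
      have h3 : (1 : ℝ) ≤ ∏ i ∈ Finset.range k, (l + N + 1 + (i + 1 : ℕ)) := by
        have h4 := Finset.prod_le_prod (s := Finset.range k) (f := fun _ => (1 : ℝ))
          (g := fun i => l + N + 1 + (i + 1 : ℕ)) (fun _ _ => zero_le_one) fun i _ => by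
            have : (0 : ℝ) ≤ l + N + (i + 1 : ℕ) := by positivity
            linarith
        simpa using h4
      calc (N : ℝ) + 1 ≤ 1 * (l + N + 1 + (0 : ℕ)) := by push_cast; linarith
        _ ≤ _ := mul_le_mul_of_nonneg_right h3 (by positivity)
  · rw [Real.norm_of_nonneg (gaussTerm_nonneg (by positivity) _), gaussTerm, gaussTerm]
    refine mul_le_mul_of_nonneg_left ?_ (by positivity)
    refine div_le_div_of_nonneg_left (by positivity) (prod_shift_pos hl k) ?_
    refine Finset.prod_le_prod (fun i _ => by positivity) fun i _ => ?_
    have : (0 : ℝ) ≤ N := Nat.cast_nonneg _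
    linarith

/-- Gauss's summation formula, as an infinite product: iteration of the contiguity relation. -/
theorem hasSum_log_gaussSum (hl : 0 ≤ l) (hδ : -1 / 2 < δ.re) :
    HasSum (fun i : ℕ => Real.log (1 + ‖δ‖ ^ 2 / ((l + 1 + i) * (l + 1 + i + 2 * δ.re))))
      (Real.log (gaussSum l δ)) := by
  have hpos : ∀ i : ℕ, 0 < (l + 1 + i) * (l + 1 + i + 2 * δ.re) := fun i => by
    have hi : (0 : ℝ) ≤ i := Nat.cast_nonneg _
    exact mul_pos (by positivity) (by linarith)
  have hnn : ∀ i : ℕ, 0 ≤ ‖δ‖ ^ 2 / ((l + 1 + i) * (l + 1 + i + 2 * δ.re)) := fun i =>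
    div_nonneg (by positivity) (hpos i).le
  rw [hasSum_iff_tendsto_nat_of_nonneg fun i => Real.log_nonneg (by linarith [hnn i])]
  have hrec : ∀ N : ℕ, ∑ i ∈ Finset.range N,
      Real.log (1 + ‖δ‖ ^ 2 / ((l + 1 + i) * (l + 1 + i + 2 * δ.re))) =
      Real.log (gaussSum l δ) - Real.log (gaussSum (l + N) δ) := by
    intro N
    induction N with
    | zero => simp
    | succ N ih =>
      have hN : (0 : ℝ) ≤ l + N := by positivity
      have h1 := gaussSum_recursion hN hδ
      have h2 := one_le_gaussSum hN hδ
      have h3 := one_le_gaussSum (l := l + N + 1) (by positivity) hδ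
      have hp := hpos N
      have h4 : 1 + ‖δ‖ ^ 2 / ((l + 1 + N) * (l + 1 + N + 2 * δ.re)) =
          gaussSum (l + N) δ / gaussSum (l + N + 1) δ := by
        rw [eq_div_iff (by positivity)]
        have hn : ‖((l + N : ℝ) : ℂ) + 1 + δ‖ ^ 2 =
            (l + 1 + N) * (l + 1 + N + 2 * δ.re) + ‖δ‖ ^ 2 := by
          rw [← Complex.normSq_eq_norm_sq, ← Complex.normSq_eq_norm_sq, Complex.normSq_apply,
            Complex.normSq_apply]
          simp
          ring
        rw [hn] at h1
        rw [one_add_div hp.ne', div_mul_eq_mul_div, div_eq_iff hp.ne']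
        linear_combination -h1
      rw [Finset.sum_range_succ, ih, h4, Real.log_div (by positivity) (by positivity),
        show l + ((N + 1 : ℕ) : ℝ) = l + N + 1 by push_cast; ring]
      ring
  simp only [hrec]
  have := ((tendsto_gaussSum hl hδ).log one_ne_zero).const_sub (Real.log (gaussSum l δ))
  simpa using this

end GaussSeries

/-! ### The normalization constants of the coefficients -/

section Normalization

open Filter Topology

theorem integral_powerSeries_mul {a : ℕ → ℂ} (ha : Summable fun k => ‖a k‖) {g : ℝ → ℂ}
    (hg : Measurable g) {M : ℝ} (hM : ∀ φ, ‖g φ‖ ≤ M) :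
    HasSum (fun k => a k * ∫ φ in Set.Ico 0 (2 * Real.pi), circlePoint φ ^ k * g φ)
      (∫ φ in Set.Ico 0 (2 * Real.pi), (∑' k, a k * circlePoint φ ^ k) * g φ) := by
  have hb : ∀ k φ, ‖a k * (circlePoint φ ^ k * g φ)‖ ≤ ‖a k‖ * M := fun k φ => by
    rw [norm_mul, norm_mul, norm_pow, norm_circlePoint, one_pow, one_mul]
    exact mul_le_mul_of_nonneg_left (hM φ) (norm_nonneg _)
  have hmeas : ∀ k, Measurable fun φ => a k * (circlePoint φ ^ k * g φ) := fun k =>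
    ((continuous_circlePoint.measurable.pow_const k).mul hg).const_mul _
  have hint : ∀ k, Integrable (fun φ => a k * (circlePoint φ ^ k * g φ))
      (volume.restrict (Set.Ico 0 (2 * Real.pi))) := fun k =>
    Integrable.of_bound (hmeas k).aestronglyMeasurable _ (Eventually.of_forall (hb k))
  have h := hasSum_integral_of_summable_integral_norm hint (by
    refine Summable.of_nonneg_of_le (fun k => integral_nonneg fun φ => norm_nonneg _) (fun k => ?_)
      ((ha.mul_right M).mul_right (2 * Real.pi))
    refine (integral_mono_of_nonneg (Eventually.of_forall fun φ => norm_nonneg _)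
      (integrable_const (‖a k‖ * M)) (Eventually.of_forall (hb k))).trans (le_of_eq ?_)
    rw [integral_const]
    simp [mul_comm, Real.pi_pos.le])
  simp only [integral_const_mul] at h
  have he : ∀ φ, (∑' k, a k * circlePoint φ ^ k) * g φ = ∑' k, a k * (circlePoint φ ^ k * g φ) := by
    intro φ
    rw [← tsum_mul_right]
    exact tsum_congr fun k => by ring
  simp only [he]
  exact h

/-- Parseval's identity on a circle. -/
theorem lintegral_norm_sq_powerSeries {a : ℕ → ℂ} (ha : Summable fun k => ‖a k‖) :
    ∫⁻ φ in Set.Ico 0 (2 * Real.pi), ENNReal.ofReal (‖∑' k, a k * circlePoint φ ^ k‖ ^ 2) =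
      ∑' k, ENNReal.ofReal (2 * Real.pi * ‖a k‖ ^ 2) := by
  set f : ℝ → ℂ := fun φ => ∑' k, a k * circlePoint φ ^ k with hf
  have hb : ∀ k φ, ‖a k * circlePoint φ ^ k‖ ≤ ‖a k‖ := fun k φ => by
    rw [norm_mul, norm_pow, norm_circlePoint, one_pow, mul_one]
  have hfc : Continuous f := continuous_tsum
    (fun k => continuous_const.mul (continuous_circlePoint.pow k)) ha hb
  have hfb : ∀ φ, ‖f φ‖ ≤ ∑' k, ‖a k‖ := fun φ => tsum_of_norm_bounded ha.hasSum fun k => hb k φ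
  have h1 : ∀ l : ℕ, ∫ φ in Set.Ico 0 (2 * Real.pi), f φ * conj (circlePoint φ) ^ l =
      2 * Real.pi * a l := by
    intro l
    have h2 := integral_powerSeries_mul ha (g := fun φ => conj (circlePoint φ) ^ l) (M := 1)
      ((Complex.continuous_conj.measurable.comp continuous_circlePoint.measurable).pow_const l)
      (fun φ => by simp [norm_circlePoint])
    simp only [integral_circlePoint_pow] at h2
    rw [← h2.tsum_eq, tsum_eq_single l fun k hk => by rw [if_neg hk, mul_zero], if_pos rfl]
    ring
  have h3 := integral_powerSeries_mul ha (g := fun φ => conj (f φ))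
    (Complex.continuous_conj.measurable.comp hfc.measurable) (M := ∑' k, ‖a k‖)
    (fun φ => by rw [RCLike.norm_conj]; exact hfb φ)
  have h4 : ∀ k : ℕ, ∫ φ in Set.Ico 0 (2 * Real.pi), circlePoint φ ^ k * conj (f φ) =
      2 * Real.pi * conj (a k) := by
    intro k
    have h5 : ∀ φ, circlePoint φ ^ k * conj (f φ) = conj (f φ * conj (circlePoint φ) ^ k) := by
      intro φ
      rw [map_mul, map_pow, Complex.conj_conj]
      ring
    simp only [h5]
    rw [integral_conj, h1, map_mul, map_mul, Complex.conj_ofReal, map_ofNat]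
  simp only [h4] at h3
  have h5 : HasSum (fun k => 2 * Real.pi * ‖a k‖ ^ 2)
      (∫ φ in Set.Ico 0 (2 * Real.pi), ‖f φ‖ ^ 2) := by
    rw [← Complex.hasSum_ofReal]
    convert h3 using 2 with k
    · push_cast
      rw [← Complex.mul_conj']
      ring
    · rw [← integral_complex_ofReal]
      refine integral_congr_ae (Eventually.of_forall fun φ => ?_)
      simp only
      rw [Complex.mul_conj']
      push_cast
      rfl
  have hpi := Real.pi_pos
  rw [← ENNReal.ofReal_tsum_of_nonneg (fun k => by positivity) h5.summable, h5.tsum_eq,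
    ofReal_integral_eq_lintegral_ofReal]
  · refine Integrable.of_bound (C := (∑' k, ‖a k‖) ^ 2)
      (hfc.norm.pow 2).aestronglyMeasurable (Eventually.of_forall fun φ => ?_)
    rw [norm_pow, norm_norm]
    exact pow_le_pow_left₀ (norm_nonneg _) (hfb φ) 2
  · exact Eventually.of_forall fun φ => by positivity

theorem tilt_eq_norm_cpow (δ : ℂ) {z : ℂ} (hz : z ≠ 1) :
    tilt δ z = ‖(1 - z) ^ (conj δ)‖ ^ 2 := by
  rw [Complex.cpow_def_of_ne_zero (sub_ne_zero.2 hz.symm), Complex.norm_exp, ← Real.exp_nat_mul,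
    tilt]
  congr 1
  rw [mul_comm (conj δ)]
  push_cast
  ring

theorem hasSum_one_sub_cpow (a : ℂ) {z : ℂ} (hz : ‖z‖ < 1) :
    HasSum (fun k => Ring.choose a k * (-1) ^ k * z ^ k) ((1 - z) ^ a) := by
  have h := (Complex.one_add_cpow_hasFPowerSeriesOnBall_zero (a := a)).hasSum (y := -z) (by
    rw [Metric.mem_eball, edist_zero_right, enorm_neg, ← ofReal_norm, ENNReal.ofReal_lt_one]
    exact hz)
  simp only [binomialSeries_apply, zero_add] at h
  rw [← sub_eq_add_neg] at h
  have he : ∀ k, Ring.choose a k • (List.ofFn fun _ : Fin k => -z).prod =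
      Ring.choose a k * (-1) ^ k * z ^ k := by
    intro k
    rw [List.ofFn_const, List.prod_replicate, smul_eq_mul, mul_assoc, ← mul_pow, neg_one_mul]
  simpa only [he] using h

/-- Parseval's identity for the binomial series of `(1 - z)^{conj δ}`. -/
theorem lintegral_circle_tilt (δ : ℂ) {r : ℝ} (hr0 : 0 ≤ r) (hr : r < 1) :
    ∫⁻ φ in Set.Ico 0 (2 * Real.pi), ENNReal.ofReal (tilt δ (r * circlePoint φ)) =
      ∑' k, ENNReal.ofReal (2 * Real.pi * (‖Ring.choose (conj δ) k‖ ^ 2 * r ^ (2 * k))) := by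
  have hn : ∀ φ, ‖(r : ℂ) * circlePoint φ‖ = r := fun φ => by
    rw [norm_mul, norm_circlePoint, mul_one, Complex.norm_real, Real.norm_of_nonneg hr0]
  set a : ℕ → ℂ := fun k => Ring.choose (conj δ) k * (-1) ^ k * (r : ℂ) ^ k with ha
  have hs : Summable fun k => ‖a k‖ := by
    have := (hasSum_one_sub_cpow (conj δ) (z := (r : ℂ)) (by
      rwa [Complex.norm_real, Real.norm_of_nonneg hr0])).summable.norm
    exact this
  have h := lintegral_norm_sq_powerSeries hs
  have h1 : ∀ φ, ‖∑' k, a k * circlePoint φ ^ k‖ ^ 2 = tilt δ (r * circlePoint φ) := by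
    intro φ
    have hlt : ‖(r : ℂ) * circlePoint φ‖ < 1 := by rw [hn]; exact hr
    rw [tilt_eq_norm_cpow _ (fun h1 => by rw [h1, norm_one] at hlt; exact lt_irrefl _ hlt),
      ← (hasSum_one_sub_cpow (conj δ) hlt).tsum_eq]
    congr 2
    refine tsum_congr fun k => ?_
    rw [ha, mul_pow]
    ring
  simp only [h1] at h
  rw [h]
  refine tsum_congr fun k => ?_
  congr 2
  rw [ha]
  simp only [norm_mul, norm_pow, norm_neg, norm_one, one_pow, mul_one, Complex.norm_real,
    Real.norm_of_nonneg hr0]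
  rw [mul_pow, ← pow_mul, mul_comm k 2]

/-- Polar coordinates, Parseval's identity on each circle, and the radial Beta integrals. -/
theorem verbIntegral_of_pos {l : ℝ} (hl : 0 < l) {δ : ℂ} (hδ : -1 / 2 < δ.re) :
    verbIntegral l δ (fun _ => 1) = ENNReal.ofReal (Real.pi / l * gaussSum l δ) := by
  have hpi := Real.pi_pos
  rw [verbIntegral, if_neg hl.ne']
  have h1 := setLIntegral_disc (w := fun r => (1 - r ^ 2) ^ (l - 1)) (by fun_prop)
    (measurable_tilt δ).ennreal_ofReal
  have h2 : ∫⁻ z in {z : ℂ | ‖z‖ < 1}, ENNReal.ofReal ((1 - ‖z‖ ^ 2) ^ (l - 1) * tilt δ z) * 1 =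
      ∫⁻ z in {z : ℂ | ‖z‖ < 1}, ENNReal.ofReal ((1 - ‖z‖ ^ 2) ^ (l - 1)) *
        ENNReal.ofReal (tilt δ z) := by
    refine lintegral_congr fun z => ?_
    rw [mul_one, ENNReal.ofReal_mul' (tilt_pos δ z).le]
  rw [h2, h1]
  have h3 : ∀ r ∈ Set.Ioo (0 : ℝ) 1, ENNReal.ofReal (r * (1 - r ^ 2) ^ (l - 1)) *
      ∫⁻ φ in Set.Ico 0 (2 * Real.pi), ENNReal.ofReal (tilt δ (r * circlePoint φ)) =
      ∑' k, ENNReal.ofReal (2 * Real.pi * ‖Ring.choose (conj δ) k‖ ^ 2) *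
        ENNReal.ofReal (r ^ (2 * k + 1) * (1 - r ^ 2) ^ (l - 1)) := by
    intro r hr
    have hr1 : 0 ≤ 1 - r ^ 2 := by nlinarith [hr.1, hr.2]
    rw [lintegral_circle_tilt δ hr.1.le hr.2, ← ENNReal.tsum_mul_left]
    refine tsum_congr fun k => ?_
    have hr2 := Real.rpow_nonneg hr1 (l - 1)
    rw [← ENNReal.ofReal_mul (mul_nonneg hr.1.le hr2), ← ENNReal.ofReal_mul (by positivity)]
    congr 1
    ring
  rw [setLIntegral_congr_fun measurableSet_Ioo h3, lintegral_tsum fun k => Measurable.aemeasurable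
    (by fun_prop)]
  simp only [lintegral_const_mul' _ _ ENNReal.ofReal_ne_top, setLIntegral_radial hl]
  have hs := (summable_gaussTerm_and_tendsto hl.le hδ).1
  rw [gaussSum, ← tsum_mul_left, ENNReal.ofReal_tsum_of_nonneg
    (fun k => mul_nonneg (by positivity) (gaussTerm_nonneg hl.le k)) (hs.mul_left _)]
  refine tsum_congr fun k => ?_
  rw [← ENNReal.ofReal_mul (by positivity)]
  congr 1
  have hp := prod_shift_pos hl.le k
  have h4 : ∏ i ∈ Finset.range (k + 1), (l + i) = l * ∏ i ∈ Finset.range k, (l + 1 + i) := by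
    rw [Finset.prod_range_succ', mul_comm]
    congr 1
    · simp
    · exact Finset.prod_congr rfl fun i _ => by push_cast; ring
  rw [h4, gaussTerm]
  field_simp

theorem tilt_eq_exp (δ z : ℂ) : tilt δ z =
    Real.exp (2 * (δ.re * Real.log ‖1 - z‖ + δ.im * Complex.arg (1 - z))) := by
  rw [tilt, Complex.mul_re, Complex.log_re, Complex.log_im, Complex.conj_re, Complex.conj_im]
  congr 1
  ring

/-- On the radii, the weight is dominated by its value at the end point. -/
theorem tilt_radial_le (δ : ℂ) {r : ℝ} (hr0 : 0 ≤ r) (hr : r ≤ 1) {z : ℂ} (hz : ‖z‖ = 1)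
    (hz1 : z ≠ 1) :
    tilt δ (r * z) ≤ Real.exp (2 * (|δ.re| * Real.log 2 + 2 * Real.pi * |δ.im|)) *
      (1 + tilt δ z) := by
  have hpos : 0 < ‖1 - z‖ := norm_pos_iff.2 (sub_ne_zero.2 hz1.symm)
  have hrz : ‖(r : ℂ) * z‖ = r := by rw [norm_mul, hz, mul_one, Complex.norm_real,
    Real.norm_of_nonneg hr0]
  have hlow : ‖1 - z‖ ≤ 2 * ‖1 - r * z‖ := by
    have h1 : ‖1 - z‖ ≤ ‖1 - r * z‖ + ‖r * z - z‖ := norm_sub_le_norm_sub_add_norm_sub _ _ _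
    have h2 : ‖(r : ℂ) * z - z‖ = 1 - r := by
      rw [show (r : ℂ) * z - z = ((r - 1 : ℝ) : ℂ) * z by push_cast; ring, norm_mul, hz, mul_one,
        Complex.norm_real, Real.norm_of_nonpos (by linarith)]
      ring
    have h3 : 1 - r ≤ ‖1 - r * z‖ := by
      have := norm_sub_norm_le (1 : ℂ) (r * z)
      rwa [hrz, norm_one] at this
    linarith
  have hpos' : 0 < ‖1 - r * z‖ := by linarith
  have hup : ‖1 - r * z‖ ≤ 2 := by
    have := norm_sub_le (1 : ℂ) (r * z)
    rw [hrz, norm_one] at this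
    linarith
  have ha : ∀ w : ℂ, |δ.im * Complex.arg w| ≤ |δ.im| * Real.pi := fun w => by
    rw [abs_mul]
    exact mul_le_mul_of_nonneg_left (Complex.abs_arg_le_pi w) (abs_nonneg _)
  have ha1 := abs_le.1 (ha (1 - r * z))
  have ha2 := abs_le.1 (ha (1 - z))
  have hl2 : 0 ≤ Real.log 2 := Real.log_nonneg (by norm_num)
  have hE := Real.exp_pos (2 * (|δ.re| * Real.log 2 + 2 * Real.pi * |δ.im|))
  have hd := mul_nonneg (abs_nonneg δ.im) Real.pi_pos.le
  rcases le_or_gt 0 δ.re with h | h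
  · have h1 : tilt δ (r * z) ≤ Real.exp (2 * (|δ.re| * Real.log 2 + 2 * Real.pi * |δ.im|)) := by
      rw [tilt_eq_exp, Real.exp_le_exp, abs_of_nonneg h]
      have := mul_le_mul_of_nonneg_left (Real.log_le_log hpos' hup) h
      nlinarith [ha1.2]
    nlinarith [mul_pos hE (tilt_pos δ z)]
  · have h1 : tilt δ (r * z) ≤
        Real.exp (2 * (|δ.re| * Real.log 2 + 2 * Real.pi * |δ.im|)) * tilt δ z := by
      rw [tilt_eq_exp, tilt_eq_exp, ← Real.exp_add, Real.exp_le_exp, abs_of_neg h]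
      have h2 := Real.log_le_log hpos hlow
      rw [Real.log_mul (by norm_num) hpos'.ne'] at h2
      have := mul_le_mul_of_nonpos_left h2 h.le
      nlinarith [ha1.2, ha2.1]
    nlinarith

/-- On the unit circle, where the binomial series need not converge absolutely, the integral is
the limit of those over smaller circles. Fatou's lemma gives the integrability of the limit, which
dominates the weights on the smaller circles by `tilt_radial_le`. -/
theorem verbIntegral_zero {δ : ℂ} (hδ : -1 / 2 < δ.re) :
    verbIntegral 0 δ (fun _ => 1) = ENNReal.ofReal (2 * Real.pi * gaussSum 0 δ) := by
  have hpi := Real.pi_pos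
  rw [verbIntegral, if_pos rfl]
  simp only [mul_one]
  set r : ℕ → ℝ := fun n => 1 - 1 / ((n : ℝ) + 1) with hr
  have hr0 : ∀ n, 0 ≤ r n := fun n => by
    have : 1 / ((n : ℝ) + 1) ≤ 1 := by
      rw [div_le_one (by positivity)]; linarith [(Nat.cast_nonneg n : (0 : ℝ) ≤ n)]
    simp only [hr]; linarith
  have hr1 : ∀ n, r n < 1 := fun n => by
    have : 0 < 1 / ((n : ℝ) + 1) := by positivity
    simp only [hr]; linarith
  have hrlim : Tendsto r atTop (𝓝 1) := by
    simpa [hr] using (tendsto_one_div_add_atTop_nhds_zero_nat (𝕜 := ℝ)).const_sub 1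
  have hterm : ∀ k, gaussTerm 0 δ k = ‖Ring.choose (conj δ) k‖ ^ 2 := by
    intro k
    have : ∏ i ∈ Finset.range k, ((0 : ℝ) + 1 + i) = k.factorial := by
      rw [← Finset.prod_range_add_one_eq_factorial]
      push_cast
      exact Finset.prod_congr rfl fun i _ => by ring
    rw [gaussTerm, this, div_self (by positivity), mul_one]
  have hs := (summable_gaussTerm_and_tendsto (l := 0) le_rfl hδ).1
  -- the limit of the integrals over smaller circles
  have hS : Tendsto (fun n => ∫⁻ φ in Set.Ico 0 (2 * Real.pi),
      ENNReal.ofReal (tilt δ (r n * circlePoint φ))) atTop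
      (𝓝 (ENNReal.ofReal (2 * Real.pi * gaussSum 0 δ))) := by
    have hb : ∀ n k, ‖gaussTerm 0 δ k * r n ^ (2 * k)‖ ≤ gaussTerm 0 δ k := by
      intro n k
      have h1 := gaussTerm_nonneg (l := 0) (δ := δ) le_rfl k
      rw [Real.norm_of_nonneg (mul_nonneg h1 (pow_nonneg (hr0 n) _))]
      exact mul_le_of_le_one_right h1 (pow_le_one₀ (hr0 n) (hr1 n).le)
    have h1 : Tendsto (fun n => ∑' k, gaussTerm 0 δ k * r n ^ (2 * k)) atTop
        (𝓝 (gaussSum 0 δ)) := by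
      refine tendsto_tsum_of_dominated_convergence hs (fun k => ?_)
        (Eventually.of_forall fun n k => hb n k)
      simpa using (hrlim.pow (2 * k)).const_mul (gaussTerm 0 δ k)
    have h2 : ∀ n, ∫⁻ φ in Set.Ico 0 (2 * Real.pi), ENNReal.ofReal (tilt δ (r n * circlePoint φ)) =
        ENNReal.ofReal (2 * Real.pi * ∑' k, gaussTerm 0 δ k * r n ^ (2 * k)) := by
      intro n
      rw [lintegral_circle_tilt δ (hr0 n) (hr1 n), ← tsum_mul_left, ENNReal.ofReal_tsum_of_nonneg]
      · simp only [hterm]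
      · intro k
        exact mul_nonneg (by positivity)
          (mul_nonneg (gaussTerm_nonneg le_rfl k) (pow_nonneg (hr0 n) _))
      · exact (Summable.of_norm_bounded hs (hb n)).mul_left _
    simp only [h2]
    exact ENNReal.tendsto_ofReal (h1.const_mul _)
  have hne : ∀ᵐ φ ∂(volume.restrict (Set.Ico 0 (2 * Real.pi))), circlePoint φ ≠ 1 := by
    filter_upwards [ae_restrict_of_ae (Measure.ae_ne volume (0 : ℝ)),
      ae_restrict_mem measurableSet_Ico] with φ hφ hmem h1
    have h0 : circlePoint 0 = 1 := by simp [circlePoint]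
    exact hφ (circlePoint_injOn hmem ⟨le_rfl, by positivity⟩ (h1.trans h0.symm))
  have hmeas : ∀ s : ℝ, Measurable fun φ => ENNReal.ofReal (tilt δ (s * circlePoint φ)) := fun s =>
    ((measurable_tilt δ).comp (continuous_circlePoint.measurable.const_mul (s : ℂ))).ennreal_ofReal
  have hpt : ∀ᵐ φ ∂(volume.restrict (Set.Ico 0 (2 * Real.pi))),
      Tendsto (fun n => ENNReal.ofReal (tilt δ (r n * circlePoint φ))) atTop
        (𝓝 (ENNReal.ofReal (tilt δ (circlePoint φ)))) := by
    filter_upwards [hne] with φ hφ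
    refine ENNReal.tendsto_ofReal ?_
    have h1 : Tendsto (fun n => (1 : ℂ) - (r n : ℂ) * circlePoint φ) atTop
        (𝓝 (1 - circlePoint φ)) := by
      have h2 : Tendsto (fun n => ((r n : ℝ) : ℂ)) atTop (𝓝 ((1 : ℝ) : ℂ)) :=
        (Complex.continuous_ofReal.tendsto 1).comp hrlim
      simpa using (h2.mul_const (circlePoint φ)).const_sub 1
    have h3 := (h1.clog (one_sub_mem_slitPlane (norm_circlePoint φ).le hφ)).const_mul (conj δ)
    exact (Real.continuous_exp.tendsto _).comp
      (((Complex.continuous_re.tendsto _).comp h3).const_mul 2)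
  have hfatou : ∫⁻ φ in Set.Ico 0 (2 * Real.pi), ENNReal.ofReal (tilt δ (circlePoint φ)) ≤
      ENNReal.ofReal (2 * Real.pi * gaussSum 0 δ) := by
    calc _ = ∫⁻ φ in Set.Ico 0 (2 * Real.pi),
          liminf (fun n => ENNReal.ofReal (tilt δ (r n * circlePoint φ))) atTop :=
          lintegral_congr_ae (hpt.mono fun φ h => h.liminf_eq.symm)
      _ ≤ liminf (fun n => ∫⁻ φ in Set.Ico 0 (2 * Real.pi),
          ENNReal.ofReal (tilt δ (r n * circlePoint φ))) atTop :=
          lintegral_liminf_le fun n => hmeas (r n)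
      _ = _ := hS.liminf_eq
  set C := Real.exp (2 * (|δ.re| * Real.log 2 + 2 * Real.pi * |δ.im|)) with hC
  have hC0 : 0 < C := Real.exp_pos _
  have hdom := tendsto_lintegral_of_dominated_convergence
    (μ := volume.restrict (Set.Ico 0 (2 * Real.pi)))
    (fun φ => ENNReal.ofReal (C * (1 + tilt δ (circlePoint φ))))
    (fun n => hmeas (r n))
    (fun n => hne.mono fun φ hφ => ENNReal.ofReal_le_ofReal
      (tilt_radial_le δ (hr0 n) (hr1 n).le (norm_circlePoint φ) hφ))
    (by
      have h1 : ∀ φ, ENNReal.ofReal (C * (1 + tilt δ (circlePoint φ))) =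
          ENNReal.ofReal C * (1 + ENNReal.ofReal (tilt δ (circlePoint φ))) := fun φ => by
        rw [ENNReal.ofReal_mul hC0.le, ENNReal.ofReal_add zero_le_one (tilt_pos _ _).le,
          ENNReal.ofReal_one]
      simp only [h1]
      rw [lintegral_const_mul' _ _ ENNReal.ofReal_ne_top, lintegral_add_left measurable_const]
      refine ENNReal.mul_ne_top ENNReal.ofReal_ne_top (ENNReal.add_ne_top.2 ⟨?_, ?_⟩)
      · simp [ENNReal.mul_eq_top]
      · exact (hfatou.trans_lt ENNReal.ofReal_lt_top).ne)
    hpt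
  exact tendsto_nhds_unique hdom hS

theorem verbIntegral_ne_zero_ne_top {δ : ℂ} (hδ : -1 / 2 < δ.re) {l : ℝ} (hl : 0 ≤ l) :
    verbIntegral l δ (fun _ => 1) ≠ 0 ∧ verbIntegral l δ (fun _ => 1) ≠ ∞ := by
  have hpi := Real.pi_pos
  have hS := one_le_gaussSum hl hδ
  rcases hl.eq_or_lt with rfl | hl'
  · rw [verbIntegral_zero hδ]
    exact ⟨(ENNReal.ofReal_pos.2 (by positivity)).ne', ENNReal.ofReal_ne_top⟩
  · rw [verbIntegral_of_pos hl' hδ]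
    exact ⟨(ENNReal.ofReal_pos.2 (by positivity)).ne', ENNReal.ofReal_ne_top⟩

/-- The ratio of two normalization constants with the same `l`. -/
theorem verbIntegral_div {δ ε : ℂ} (hδ : -1 / 2 < δ.re) (hε : -1 / 2 < (δ + ε).re) {l : ℝ}
    (hl : 0 ≤ l) :
    verbIntegral l (δ + ε) (fun _ => 1) / verbIntegral l δ (fun _ => 1) =
      ENNReal.ofReal (gaussSum l (δ + ε) / gaussSum l δ) := by
  have hpi := Real.pi_pos
  have hS := one_le_gaussSum hl hδ
  rcases hl.eq_or_lt with rfl | hl'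
  · rw [verbIntegral_zero hδ, verbIntegral_zero hε, ← ENNReal.ofReal_div_of_pos (by positivity),
      mul_div_mul_left _ _ (by positivity)]
  · rw [verbIntegral_of_pos hl' hδ, verbIntegral_of_pos hl' hε,
      ← ENNReal.ofReal_div_of_pos (by positivity), mul_div_mul_left _ _ (by positivity)]

end Normalization

/-! ### Derivatives of the logarithm of the hypergeometric series -/

section LogDerivative

open Filter Topology

/-- The trigamma function. -/
def trigamma (z : ℂ) : ℂ := ∑' i : ℕ, 1 / (z + i) ^ 2

/-- The difference `ψ(z) - ψ(w)` of two values of the digamma function. -/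
def digammaSub (z w : ℂ) : ℂ := ∑' i : ℕ, (1 / (w + i) - 1 / (z + i))

theorem summable_one_div_add_sq {c : ℝ} (hc : 0 < c) :
    Summable fun i : ℕ => 1 / ((i : ℝ) + c) ^ 2 := by
  have h := (Real.summable_one_div_nat_add_rpow c 2).2 (by norm_num)
  refine h.congr fun i => ?_
  rw [abs_of_pos (by positivity)]
  norm_cast

theorem norm_add_nat_ge {z : ℂ} {c : ℝ} (hz : c ≤ z.re) (i : ℕ) : (i : ℝ) + c ≤ ‖z + i‖ := by
  have h := Complex.re_le_norm (z + i)
  simp only [Complex.add_re, Complex.natCast_re] at h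
  linarith

theorem norm_one_div_add_sq_le {z : ℂ} {c : ℝ} (hc : 0 < c) (hz : c ≤ z.re) (i : ℕ) :
    ‖1 / (z + i) ^ 2‖ ≤ 1 / ((i : ℝ) + c) ^ 2 := by
  rw [norm_div, norm_one, norm_pow]
  exact one_div_le_one_div_of_le (by positivity)
    (pow_le_pow_left₀ (by positivity) (norm_add_nat_ge hz i) 2)

theorem norm_one_div_sub_one_div_le {z w : ℂ} {c : ℝ} (hc : 0 < c) (hz : c ≤ z.re)
    (hw : c ≤ w.re) (i : ℕ) :
    ‖1 / (w + i) - 1 / (z + i)‖ ≤ ‖z - w‖ * (1 / ((i : ℝ) + c) ^ 2) := by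
  have h1 := norm_add_nat_ge hz i
  have h2 := norm_add_nat_ge hw i
  have hi : (0 : ℝ) < i + c := by positivity
  have hz0 : z + i ≠ 0 := norm_pos_iff.1 (hi.trans_le h1)
  have hw0 : w + i ≠ 0 := norm_pos_iff.1 (hi.trans_le h2)
  rw [div_sub_div _ _ hw0 hz0, show 1 * (z + i) - (w + i) * 1 = z - w by ring, norm_div, norm_mul,
    div_eq_mul_one_div]
  refine mul_le_mul_of_nonneg_left (one_div_le_one_div_of_le (by positivity) ?_) (norm_nonneg _)
  rw [sq]
  exact mul_le_mul h2 h1 hi.le (norm_nonneg _)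

theorem summable_trigamma {z : ℂ} (hz : 0 < z.re) : Summable fun i : ℕ => 1 / (z + i) ^ 2 :=
  Summable.of_norm_bounded (summable_one_div_add_sq hz) fun i => norm_one_div_add_sq_le hz le_rfl i

theorem summable_digammaSub {z w : ℂ} (hz : 0 < z.re) (hw : 0 < w.re) :
    Summable fun i : ℕ => 1 / (w + i) - 1 / (z + i) :=
  Summable.of_norm_bounded ((summable_one_div_add_sq (lt_min hz hw)).mul_left _) fun i =>
    norm_one_div_sub_one_div_le (lt_min hz hw) (min_le_left _ _) (min_le_right _ _) i

/-- The first derivative of `log |a + w|² - log a - log (a + 2 Re w)` in the direction `u`. -/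
def logTermDeriv (a : ℝ) (u w : ℂ) : ℝ :=
  2 * (u / (a + w)).re - 2 * u.re / (a + 2 * w.re)

/-- The second derivative of `log |a + w|² - log a - log (a + 2 Re w)` in the direction `u`. -/
def logTermDeriv₂ (a : ℝ) (u w : ℂ) : ℝ :=
  -2 * (u ^ 2 * (1 / (a + w) ^ 2)).re + 4 * u.re ^ 2 * (1 / (a + 2 * w.re) ^ 2)

theorem hasDerivAt_logTerm {a : ℝ} (ha : 0 < a) {δ u : ℂ} {t : ℝ}
    (h : 0 < a + 2 * (δ + t * u).re) :
    HasDerivAt (fun t : ℝ => Real.log (1 + ‖δ + t * u‖ ^ 2 / (a * (a + 2 * (δ + t * u).re))))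
      (logTermDeriv a u (δ + t * u)) t := by
  obtain ⟨d, e⟩ := δ
  obtain ⟨p, q⟩ := u
  have hre : ∀ s : ℝ, ((⟨d, e⟩ : ℂ) + s * ⟨p, q⟩).re = d + s * p := fun s => by simp
  have him : ∀ s : ℝ, ((⟨d, e⟩ : ℂ) + s * ⟨p, q⟩).im = e + s * q := fun s => by simp
  have hsq : ∀ s : ℝ, ‖(⟨d, e⟩ : ℂ) + s * ⟨p, q⟩‖ ^ 2 = (d + s * p) ^ 2 + (e + s * q) ^ 2 := by
    intro s
    rw [← Complex.normSq_eq_norm_sq, Complex.normSq_apply, hre, him]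
    ring
  rw [hre] at h
  have hx : HasDerivAt (fun s : ℝ => d + s * p) p t := by
    simpa using ((hasDerivAt_id t).mul_const p).const_add d
  have hy : HasDerivAt (fun s : ℝ => e + s * q) q t := by
    simpa using ((hasDerivAt_id t).mul_const q).const_add e
  have hnum : HasDerivAt (fun s : ℝ => (d + s * p) ^ 2 + (e + s * q) ^ 2)
      (2 * (d + t * p) * p + 2 * (e + t * q) * q) t := by
    simpa using (hx.fun_pow 2).fun_add (hy.fun_pow 2)
  have hden : HasDerivAt (fun s : ℝ => a * (a + 2 * (d + s * p))) (a * (2 * p)) t :=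
    ((hx.const_mul 2).const_add a).const_mul a
  have hpos : 0 < a * (a + 2 * (d + t * p)) := mul_pos ha h
  have hval : 1 + ((d + t * p) ^ 2 + (e + t * q) ^ 2) / (a * (a + 2 * (d + t * p))) ≠ 0 := by
    positivity
  have hmain := ((hnum.div hden hpos.ne').const_add 1).log hval
  simp only [hre, hsq]
  refine hmain.congr_deriv ?_
  set x := d + t * p with hxd
  set y := e + t * q with hyd
  have hw : (⟨d, e⟩ : ℂ) + t * ⟨p, q⟩ = ⟨x, y⟩ := Complex.ext (hre t) (him t)
  have hS : 0 < (a + x) ^ 2 + y ^ 2 := by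
    have : (a + x) ^ 2 + y ^ 2 = a * (a + 2 * x) + (x ^ 2 + y ^ 2) := by ring
    rw [this]; positivity
  have h' := h.ne'
  have ha' := ha.ne'
  have hval' : 1 + (x ^ 2 + y ^ 2) / (a * (a + 2 * x)) =
      ((a + x) ^ 2 + y ^ 2) / (a * (a + 2 * x)) := by
    rw [one_add_div hpos.ne']
    ring
  have hc : ((⟨p, q⟩ : ℂ) / (a + ⟨x, y⟩)).re =
      (p * (a + x) + q * y) / ((a + x) ^ 2 + y ^ 2) := by
    rw [Complex.div_re, Complex.normSq_apply]
    simp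
    rw [← add_div]
    congr 1
    ring
  rw [hw, logTermDeriv, hc]
  simp only [Pi.div_apply]
  rw [hval']
  have hS' := hS.ne'
  field_simp
  ring

theorem hasDerivAt_logTermDeriv {a : ℝ} {δ u : ℂ} {t : ℝ}
    (h1 : (a : ℂ) + (δ + t * u) ≠ 0) (h : a + 2 * (δ + t * u).re ≠ 0) :
    HasDerivAt (fun t : ℝ => logTermDeriv a u (δ + t * u)) (logTermDeriv₂ a u (δ + t * u)) t := by
  have hw : HasDerivAt (fun s : ℝ => δ + (s : ℂ) * u) u t := by
    simpa using ((hasDerivAt_id t).ofReal_comp.mul_const u).const_add δ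
  have hre : HasDerivAt (fun s : ℝ => (δ + (s : ℂ) * u).re) u.re t :=
    Complex.reCLM.hasFDerivAt.comp_hasDerivAt t hw
  have hq : HasDerivAt (fun s : ℝ => u / (a + (δ + s * u)))
      ((0 * (a + (δ + t * u)) - u * u) / (a + (δ + t * u)) ^ 2) t :=
    (hasDerivAt_const t u).div (hw.const_add (a : ℂ)) h1
  have hqre := Complex.reCLM.hasFDerivAt.comp_hasDerivAt t hq
  have hr : HasDerivAt (fun s : ℝ => 2 * u.re / (a + 2 * (δ + s * u).re))
      ((0 * (a + 2 * (δ + t * u).re) - 2 * u.re * (2 * u.re)) / (a + 2 * (δ + t * u).re) ^ 2) t :=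
    (hasDerivAt_const t (2 * u.re)).div ((hre.const_mul 2).const_add a) h
  refine ((hqre.const_mul 2).sub hr).congr_deriv ?_
  have h2 : (0 * ((a : ℂ) + (δ + t * u)) - u * u) / (a + (δ + t * u)) ^ 2 =
      -(u ^ 2 * (1 / (a + (δ + t * u)) ^ 2)) := by ring
  rw [logTermDeriv₂, h2]
  simp only [Complex.reCLM_apply, Complex.neg_re]
  ring

theorem logTermDeriv_eq (a : ℝ) (u w : ℂ) : logTermDeriv a u w =
    2 * (conj u * (1 / (a + conj w) - 1 / (a + 2 * w.re))).re := by
  have h1 : (u / (a + w)).re = (conj u * (1 / (a + conj w))).re := by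
    rw [← Complex.conj_re (u / (a + w)), map_div₀, map_add, Complex.conj_ofReal, mul_one_div]
  have h2 : (conj u * (1 / ((a : ℂ) + 2 * w.re))).re = u.re / (a + 2 * w.re) := by
    rw [show (a : ℂ) + 2 * w.re = ((a + 2 * w.re : ℝ) : ℂ) by push_cast; ring, mul_one_div,
      Complex.div_ofReal_re, Complex.conj_re]
  rw [mul_sub, Complex.sub_re, h2, ← h1, logTermDeriv]
  ring

variable {l : ℝ} {δ u : ℂ}

/-- Near `δ`, the logarithm of the hypergeometric series is differentiated twice term by term. -/
theorem hasDerivAt_log_gaussSum (hl : 0 ≤ l) (u : ℂ) {τ c : ℝ} (hc : 0 < c)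
    (hc1 : c ≤ 1 / 2)
    (hτ : ∀ t ∈ Set.Ioo (-τ) τ, c - 1 ≤ 2 * (δ + t * u).re) {t : ℝ} (ht : t ∈ Set.Ioo (-τ) τ) :
    HasDerivAt (fun t : ℝ => Real.log (gaussSum l (δ + t * u)))
        (∑' i : ℕ, logTermDeriv (l + 1 + i) u (δ + t * u)) t ∧
      HasDerivAt (fun t : ℝ => ∑' i : ℕ, logTermDeriv (l + 1 + i) u (δ + t * u))
        (∑' i : ℕ, logTermDeriv₂ (l + 1 + i) u (δ + t * u)) t := by
  have hτ0 : 0 < τ := by linarith [ht.1, ht.2]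
  have h0 : (0 : ℝ) ∈ Set.Ioo (-τ) τ := ⟨by linarith, hτ0⟩
  have ha : ∀ i : ℕ, (0 : ℝ) < l + 1 + i := fun i => by positivity
  have hδ : ∀ s ∈ Set.Ioo (-τ) τ, -1 / 2 < (δ + s * u).re := fun s hs => by
    linarith [hτ s hs]
  have hb2 : ∀ i : ℕ, ∀ s ∈ Set.Ioo (-τ) τ, (i : ℝ) + c ≤ l + 1 + i + 2 * (δ + s * u).re :=
    fun i s hs => by linarith [hτ s hs]
  have hb1 : ∀ i : ℕ, ∀ s ∈ Set.Ioo (-τ) τ,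
      (i : ℝ) + c ≤ ‖((l + 1 + i : ℝ) : ℂ) + (δ + s * u)‖ := fun i s hs => by
    have h1 := Complex.re_le_norm (((l + 1 + i : ℝ) : ℂ) + (δ + s * u))
    rw [Complex.add_re, Complex.ofReal_re] at h1
    linarith [hτ s hs]
  have hic : ∀ i : ℕ, (0 : ℝ) < i + c := fun i => by positivity
  have hne1 : ∀ i : ℕ, ∀ s ∈ Set.Ioo (-τ) τ, ((l + 1 + i : ℝ) : ℂ) + (δ + s * u) ≠ 0 :=
    fun i s hs => norm_pos_iff.1 ((hic i).trans_le (hb1 i s hs))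
  set W : ℝ := ‖δ‖ + τ * ‖u‖ with hW
  have hWb : ∀ s ∈ Set.Ioo (-τ) τ, ‖δ + s * u‖ ≤ W := fun s hs => by
    refine (norm_add_le _ _).trans (add_le_add_right ?_ _)
    rw [norm_mul, Complex.norm_real]
    exact mul_le_mul_of_nonneg_right (abs_le.2 ⟨hs.1.le, hs.2.le⟩) (norm_nonneg _)
  have hd1 : ∀ (i : ℕ), ∀ s ∈ Set.Ioo (-τ) τ, ‖logTermDeriv (l + 1 + i) u (δ + s * u)‖ ≤
      2 * ‖u‖ * W * (1 / ((i : ℝ) + c) ^ 2) := by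
    intro i s hs
    set w := δ + s * u with hw
    have h1 := norm_one_div_sub_one_div_le (z := l + 1 + 2 * w.re) (w := l + 1 + conj w) hc
      (by simp only [Complex.add_re, Complex.ofReal_re, Complex.one_re, Complex.mul_re,
            Complex.re_ofNat, Complex.im_ofNat, Complex.ofReal_im]; linarith [hτ s hs])
      (by simp only [Complex.add_re, Complex.ofReal_re, Complex.one_re, Complex.conj_re]
          linarith [hτ s hs]) i
    have h2 : ‖(l : ℂ) + 1 + 2 * w.re - (l + 1 + conj w)‖ = ‖w‖ := by
      congr 1
      apply Complex.ext <;> simp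
      ring
    rw [h2] at h1
    rw [logTermDeriv_eq, Real.norm_eq_abs, abs_mul, abs_two, mul_assoc, mul_assoc]
    refine mul_le_mul_of_nonneg_left ?_ zero_le_two
    refine (Complex.abs_re_le_norm _).trans ?_
    rw [norm_mul, RCLike.norm_conj]
    refine mul_le_mul_of_nonneg_left ?_ (norm_nonneg _)
    have h3 : ((l + 1 + i : ℝ) : ℂ) + conj w = l + 1 + conj w + i := by push_cast; ring
    have h4 : ((l + 1 + i : ℝ) : ℂ) + 2 * w.re = l + 1 + 2 * w.re + i := by push_cast; ring
    rw [h3, h4]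
    exact h1.trans (mul_le_mul_of_nonneg_right (hWb s hs) (by positivity))
  have hd2 : ∀ (i : ℕ), ∀ s ∈ Set.Ioo (-τ) τ, ‖logTermDeriv₂ (l + 1 + i) u (δ + s * u)‖ ≤
      6 * ‖u‖ ^ 2 * (1 / ((i : ℝ) + c) ^ 2) := by
    intro i s hs
    set w := δ + s * u with hw
    have hci := hic i
    have h1 : |(u ^ 2 * (1 / (((l + 1 + i : ℝ) : ℂ) + w) ^ 2)).re| ≤
        ‖u‖ ^ 2 * (1 / ((i : ℝ) + c) ^ 2) := by
      refine (Complex.abs_re_le_norm _).trans ?_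
      rw [norm_mul, norm_pow, norm_div, norm_one, norm_pow]
      exact mul_le_mul_of_nonneg_left (one_div_le_one_div_of_le (by positivity)
        (pow_le_pow_left₀ hci.le (hb1 i s hs) 2)) (by positivity)
    have h2 : |u.re ^ 2 * (1 / (l + 1 + i + 2 * w.re) ^ 2)| ≤
        ‖u‖ ^ 2 * (1 / ((i : ℝ) + c) ^ 2) := by
      rw [abs_of_nonneg (by positivity)]
      refine mul_le_mul (sq_le_sq' ?_ ?_) (one_div_le_one_div_of_le (by positivity)
        (pow_le_pow_left₀ hci.le (hb2 i s hs) 2)) (by positivity) (by positivity)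
      · exact (abs_le.1 (Complex.abs_re_le_norm u)).1
      · exact Complex.re_le_norm u
    rw [logTermDeriv₂, Real.norm_eq_abs]
    have h3 := abs_le.1 h1
    have h4 := abs_le.1 h2
    rw [abs_le]
    constructor <;> linarith [h3.1, h3.2, h4.1, h4.2]
  have hs1 := (summable_one_div_add_sq hc).mul_left (2 * ‖u‖ * W)
  have hs2 := (summable_one_div_add_sq hc).mul_left (6 * ‖u‖ ^ 2)
  constructor
  · have h1 := hasDerivAt_tsum_of_isPreconnected hs1 isOpen_Ioo isPreconnected_Ioo
      (fun i s hs => hasDerivAt_logTerm (ha i) ((hic i).trans_le (hb2 i s hs))) hd1 h0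
      (hasSum_log_gaussSum hl (hδ 0 h0)).summable ht
    refine h1.congr_of_eventuallyEq ?_
    filter_upwards [isOpen_Ioo.mem_nhds ht] with s hs
    exact (hasSum_log_gaussSum hl (hδ s hs)).tsum_eq.symm
  · exact hasDerivAt_tsum_of_isPreconnected hs2 isOpen_Ioo isPreconnected_Ioo
      (fun i s hs => hasDerivAt_logTermDeriv (hne1 i s hs)
        ((hic i).trans_le (hb2 i s hs)).ne') hd2 h0
      (Summable.of_norm_bounded hs1 fun i => hd1 i 0 h0) ht

/-- The first derivative of the logarithm of the hypergeometric series at `δ` in the direction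
`u`. -/
theorem tsum_logTermDeriv (hl : 0 ≤ l) (hδ : -1 / 2 < δ.re) :
    ∑' i : ℕ, logTermDeriv (l + 1 + i) u δ =
      2 * (conj u * digammaSub (l + 1 + 2 * δ.re) (l + 1 + conj δ)).re := by
  have hs := summable_digammaSub (z := l + 1 + 2 * δ.re) (w := l + 1 + conj δ)
    (by simp only [Complex.add_re, Complex.ofReal_re, Complex.one_re, Complex.mul_re,
          Complex.re_ofNat, Complex.im_ofNat, Complex.ofReal_im]; linarith)
    (by simp only [Complex.add_re, Complex.ofReal_re, Complex.one_re, Complex.conj_re]; linarith)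
  rw [digammaSub, ← tsum_mul_left, Complex.re_tsum (hs.mul_left _), ← tsum_mul_left]
  refine tsum_congr fun i => ?_
  rw [logTermDeriv_eq]
  push_cast
  ring_nf

/-- The second derivative of the logarithm of the hypergeometric series at `δ` in the direction
`u`. -/
theorem tsum_logTermDeriv₂ (hl : 0 ≤ l) (hδ : -1 / 2 < δ.re) :
    ∑' i : ℕ, logTermDeriv₂ (l + 1 + i) u δ =
      -2 * (u ^ 2 * trigamma (l + 1 + δ)).re + 4 * u.re ^ 2 * (trigamma (l + 1 + 2 * δ.re)).re := by
  have hs1 := summable_trigamma (z := l + 1 + δ)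
    (by simp only [Complex.add_re, Complex.ofReal_re, Complex.one_re]; linarith)
  have hs2 := summable_trigamma (z := l + 1 + 2 * δ.re)
    (by simp only [Complex.add_re, Complex.ofReal_re, Complex.one_re, Complex.mul_re,
          Complex.re_ofNat, Complex.im_ofNat, Complex.ofReal_im]; linarith)
  have h1 := (Complex.hasSum_re (hs1.mul_left (u ^ 2)).hasSum).mul_left (-2)
  have h2 := (Complex.hasSum_re hs2.hasSum).mul_left (4 * u.re ^ 2)
  rw [tsum_mul_left] at h1
  rw [trigamma, trigamma, ← (h1.add h2).tsum_eq]
  refine tsum_congr fun i => ?_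
  rw [logTermDeriv₂]
  have h3 : (1 / ((l : ℂ) + 1 + 2 * δ.re + i) ^ 2).re = 1 / (l + 1 + i + 2 * δ.re) ^ 2 := by
    rw [show 1 / ((l : ℂ) + 1 + 2 * δ.re + i) ^ 2 = ((1 / (l + 1 + i + 2 * δ.re) ^ 2 : ℝ) : ℂ) by
      push_cast; ring, Complex.ofReal_re]
  rw [h3, show (((l + 1 + i : ℝ) : ℂ) + δ) = l + 1 + δ + i by push_cast; ring]

end LogDerivative

/-! ### The moments of `log Φ_k(1)` -/

section Moments

open Filter Topology ProbabilityTheory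

/-- The first two moments of a random variable from its cumulant generating function. -/
theorem moments_of_cgf {Ω : Type*} [MeasurableSpace Ω] {μ : Measure Ω} [IsProbabilityMeasure μ]
    {X : Ω → ℝ} {τ : ℝ} (hτ : 0 < τ) {K K₁ : ℝ → ℝ} {K₂ : ℝ}
    (hint : ∀ t ∈ Set.Ioo (-τ) τ, Integrable (fun ω => Real.exp (t * X ω)) μ)
    (hcgf : ∀ t ∈ Set.Ioo (-τ) τ, cgf X μ t = K t)
    (hK : ∀ t ∈ Set.Ioo (-τ) τ, HasDerivAt K (K₁ t) t) (hK₁ : HasDerivAt K₁ K₂ 0) :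
    MemLp X 2 μ ∧ ∫ ω, X ω ∂μ = K₁ 0 ∧ Var[X; μ] = K₂ := by
  have h0 : (0 : ℝ) ∈ Set.Ioo (-τ) τ := ⟨by linarith, hτ⟩
  have hmem : (0 : ℝ) ∈ interior (integrableExpSet X μ) :=
    mem_interior.2 ⟨Set.Ioo (-τ) τ, fun t ht => hint t ht, isOpen_Ioo, h0⟩
  have hLp : MemLp X 2 μ := memLp_of_mem_interior_integrableExpSet hmem 2
  have hd : ∀ t ∈ Set.Ioo (-τ) τ, deriv (cgf X μ) t = K₁ t := fun t ht => by
    refine ((hK t ht).congr_of_eventuallyEq ?_).deriv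
    filter_upwards [isOpen_Ioo.mem_nhds ht] with s hs using hcgf s hs
  have hmean : ∫ ω, X ω ∂μ = K₁ 0 := by
    have := deriv_cgf_zero hmem
    rw [hd 0 h0] at this
    simpa using this.symm
  refine ⟨hLp, hmean, ?_⟩
  have h2 := iteratedDeriv_two_cgf_eq_integral hmem
  rw [iteratedDeriv_succ, iteratedDeriv_one, hd 0 h0, ← hmean] at h2
  have h3 : deriv (deriv (cgf X μ)) 0 = K₂ := by
    refine (hK₁.congr_of_eventuallyEq ?_).deriv
    filter_upwards [isOpen_Ioo.mem_nhds h0] with s hs using hd s hs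
  rw [h3] at h2
  rw [variance_eq_integral hLp.aestronglyMeasurable.aemeasurable, h2]
  simp

variable {m : ℕ} {β : ℝ} {δ : ℂ}

theorem isProbabilityMeasure_cjLaw (hβ : 0 < β) (hδ : -1 / 2 < δ.re) :
    IsProbabilityMeasure (cjLaw β δ (m + 1)) := by
  constructor
  have h := lintegral_cjLaw_prod_verb (m := m) hβ (fun l hl => verbIntegral_ne_zero_ne_top hδ hl)
    (fun _ _ => 1) fun _ => measurable_const
  simp only [Finset.prod_const_one, lintegral_one] at h
  rw [h]
  refine Finset.prod_eq_one fun j _ => ?_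
  have := verbIntegral_ne_zero_ne_top hδ (l := β / 2 * (m - j : ℕ)) (by positivity)
  exact ENNReal.div_self this.1 this.2

/-- Almost surely the nodes are distinct and different from `1`, and the weights are positive with
sum `1`. -/
theorem ae_isGeneric (hβ : 0 < β) : ∀ᵐ ω ∂(cjLaw β δ (m + 1)),
    IsGeneric ω ∧ ∀ j, circlePoint (ω.1 j) ≠ 1 := by
  have hc : ∀ j, Measurable fun ω : (Fin (m + 1) → ℝ) × (Fin (m + 1) → ℝ) =>
      circlePoint (ω.1 j) := fun j =>
    continuous_circlePoint.measurable.comp ((measurable_pi_apply j).comp measurable_fst)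
  have hw : ∀ j, Measurable fun ω : (Fin (m + 1) → ℝ) × (Fin (m + 1) → ℝ) => ω.2 j := fun j =>
    (measurable_pi_apply j).comp measurable_snd
  set G : Set ((Fin (m + 1) → ℝ) × (Fin (m + 1) → ℝ)) :=
    {ω | IsGeneric ω ∧ ∀ j, circlePoint (ω.1 j) ≠ 1} with hG
  have hGm : MeasurableSet G := by
    have : G = ((⋂ i, ⋂ j, ⋂ (_ : i ≠ j), {ω | circlePoint (ω.1 i) = circlePoint (ω.1 j)}ᶜ) ∩
        ((⋂ j, {ω | 0 < ω.2 j}) ∩ {ω | ∑ j, ω.2 j = 1})) ∩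
        ⋂ j, {ω | circlePoint (ω.1 j) = 1}ᶜ := by
      ext ω
      simp only [hG, Set.mem_ofPred_eq, Set.mem_inter_iff, Set.mem_iInter, Set.mem_compl_iff]
      refine and_congr_left fun _ => ⟨fun h => ⟨fun i j hij h1 => hij (h.inj h1), h.pos,
        h.sum_eq_one⟩, fun h => ⟨fun i j h1 => ?_, h.2.1, h.2.2⟩⟩
      by_contra hne
      exact h.1 i j hne h1
    rw [this]
    exact
      ((MeasurableSet.iInter fun i => MeasurableSet.iInter fun j => MeasurableSet.iInter fun _ =>
      (measurableSet_eq_fun (hc i) (hc j)).compl).inter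
      ((MeasurableSet.iInter fun j => measurableSet_lt measurable_const (hw j)).inter
      (measurableSet_eq_fun (Finset.measurable_fun_sum _ fun j _ => hw j) measurable_const))).inter
      (MeasurableSet.iInter fun j => (measurableSet_eq_fun (hc j) measurable_const).compl)
  have hind : Measurable (Gᶜ.indicator (1 : (Fin (m + 1) → ℝ) × (Fin (m + 1) → ℝ) → ℝ≥0∞)) :=
    measurable_one.indicator hGm.compl
  have h0 : cjIntegral β δ m (Gᶜ.indicator 1) = 0 := by
    refine (lintegral_congr_ae (g := fun _ => 0) ?_).trans lintegral_zero
    filter_upwards [ae_circlePoint_ne_one (m + 1),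
      ae_restrict_mem (measurableSet_angleBox (m + 1))] with θ hθ hbox
    refine (setLIntegral_congr_fun (g := fun _ => 0) (measurableSet_simplex m)
      fun p hp => ?_).trans lintegral_zero
    by_cases hinj : Function.Injective θ
    · have hgen : config θ p ∈ G :=
        ⟨isGeneric_config hinj (fun j => hbox j (Set.mem_univ j)) hp.1 hp.2, hθ⟩
      simp [hgen]
    · rw [angleDensity, prod_circlePoint_sub_eq_zero hinj, norm_zero, Real.zero_rpow hβ.ne',
        zero_mul]
      simp
  have h1 := lintegral_cjLaw (β := β) (δ := δ) hind
  rw [h0, mul_zero, mul_zero, lintegral_indicator_one hGm.compl] at h1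
  exact h1

theorem ae_logPhi_eq (hβ : 0 < β) {k : ℕ} (hk : k ≤ m + 1) : ∀ᵐ ω ∂(cjLaw β δ (m + 1)),
    logPhi k ω = ∑ j ∈ Finset.range k, Complex.log (1 - verb ω j) :=
  (ae_isGeneric hβ).mono fun _ hω => logPhi_eq_sum hω.1 hω.2 hk

theorem aemeasurable_logPhi (hβ : 0 < β) {k : ℕ} (hk : k ≤ m + 1) :
    AEMeasurable (fun ω => logPhi (n := m + 1) k ω) (cjLaw β δ (m + 1)) := by
  refine ⟨fun ω => ∑ j ∈ Finset.range k, Complex.log (1 - verb ω j), ?_, ae_logPhi_eq hβ hk⟩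
  exact Finset.measurable_fun_sum _ fun j _ =>
    Complex.measurable_log.comp ((measurable_verb j).const_sub 1)

/-- The exponential moments of the real linear functionals of `log Φ_k(1)`: by independence, they
are products of ratios of normalization constants. -/
theorem lintegral_exp_logPhi (hβ : 0 < β) (hδ : -1 / 2 < δ.re) {ε : ℂ}
    (hε : -1 / 2 < (δ + ε).re) {k : ℕ} (hk : k ≤ m + 1) :
    ∫⁻ ω, ENNReal.ofReal (Real.exp (2 * (conj ε * logPhi k ω).re)) ∂(cjLaw β δ (m + 1)) =
      ENNReal.ofReal (∏ j ∈ Finset.range k, gaussSum (β / 2 * (m - j : ℕ)) (δ + ε) /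
        gaussSum (β / 2 * (m - j : ℕ)) δ) := by
  set h : ℕ → ℂ → ℝ≥0∞ := fun j => if j < k then fun z => ENNReal.ofReal (tilt ε z) else fun _ => 1
    with hh
  have hhm : ∀ j, Measurable (h j) := fun j => by
    simp only [hh]
    split_ifs
    · exact (measurable_tilt ε).ennreal_ofReal
    · exact measurable_const
  have hsub : Finset.range k ⊆ Finset.range (m + 1) := Finset.range_mono hk
  have hl : ∀ j : ℕ, 0 ≤ β / 2 * (m - j : ℕ) := fun j => by positivity
  have h1 := lintegral_cjLaw_prod_verb (m := m) hβ
    (fun l hl => verbIntegral_ne_zero_ne_top hδ hl) h hhm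
  have h2 : ∫⁻ ω, ENNReal.ofReal (Real.exp (2 * (conj ε * logPhi k ω).re)) ∂(cjLaw β δ (m + 1)) =
      ∫⁻ ω, ∏ j ∈ Finset.range (m + 1), h j (verb ω j) ∂(cjLaw β δ (m + 1)) := by
    refine lintegral_congr_ae ((ae_logPhi_eq hβ hk).mono fun ω hω => ?_)
    simp only
    rw [hω, ← Finset.prod_subset hsub fun j _ hj => by
      simp only [hh, if_neg (fun h => hj (Finset.mem_range.2 h))], Finset.mul_sum, Complex.re_sum,
      Finset.mul_sum, Real.exp_sum, ENNReal.ofReal_prod_of_nonneg fun _ _ => (Real.exp_pos _).le]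
    refine Finset.prod_congr rfl fun j hj => ?_
    simp only [hh, if_pos (Finset.mem_range.1 hj), tilt]
  rw [h2, h1, ← Finset.prod_subset hsub fun j _ hj => by
    simp only [hh, if_neg (fun h => hj (Finset.mem_range.2 h))]
    have := verbIntegral_ne_zero_ne_top hδ (hl j)
    exact ENNReal.div_self this.1 this.2, ENNReal.ofReal_prod_of_nonneg fun j _ => by
      have h3 := one_le_gaussSum (hl j) hδ
      have h4 := one_le_gaussSum (hl j) hε
      positivity]
  refine Finset.prod_congr rfl fun j hj => ?_
  simp only [hh, if_pos (Finset.mem_range.1 hj)]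
  rw [verbIntegral_tilt, verbIntegral_div hδ hε (hl j)]

/-- The first two moments of the real linear functionals of `log Φ_k(1)`, from the derivatives at
`0` of their cumulant generating functions. -/
theorem moments_re_mul_logPhi (hβ : 0 < β) (hδ : -1 / 2 < δ.re) {k : ℕ} (hk : k ≤ m + 1) (u : ℂ) :
    MemLp (fun ω => 2 * (conj u * logPhi (n := m + 1) k ω).re) 2 (cjLaw β δ (m + 1)) ∧
    ∫ ω, 2 * (conj u * logPhi (n := m + 1) k ω).re ∂(cjLaw β δ (m + 1)) =
      ∑ j ∈ Finset.range k, 2 * (conj u * digammaSub ((β / 2 * (m - j : ℕ) : ℝ) + 1 + 2 * δ.re)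
        ((β / 2 * (m - j : ℕ) : ℝ) + 1 + conj δ)).re ∧
    Var[fun ω => 2 * (conj u * logPhi (n := m + 1) k ω).re; cjLaw β δ (m + 1)] =
      ∑ j ∈ Finset.range k,
        (-2 * (u ^ 2 * trigamma ((β / 2 * (m - j : ℕ) : ℝ) + 1 + δ)).re +
          4 * u.re ^ 2 * (trigamma ((β / 2 * (m - j : ℕ) : ℝ) + 1 + 2 * δ.re)).re) := by
  have hprob := isProbabilityMeasure_cjLaw (m := m) hβ hδ
  -- On the interval `(-τ, τ)`, the real part of `δ + t u` stays above `-1/2` by a fixed margin.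
  set η : ℝ := δ.re + 1 / 2 with hη
  have hη0 : 0 < η := by rw [hη]; linarith
  set τ : ℝ := η / (2 * (‖u‖ + 1)) with hτ
  have hτ0 : 0 < τ := by positivity
  set c : ℝ := min η (1 / 2) with hc
  have hc0 : 0 < c := lt_min hη0 (by norm_num)
  have hτu : τ * ‖u‖ ≤ η / 2 := by
    rw [hτ, div_mul_eq_mul_div, div_le_div_iff₀ (by positivity) two_pos]
    nlinarith [norm_nonneg u]
  have hre : ∀ t ∈ Set.Ioo (-τ) τ, c - 1 ≤ 2 * (δ + t * u).re := fun t ht => by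
    have h1 : |t * u.re| ≤ τ * ‖u‖ := by
      rw [abs_mul]
      exact mul_le_mul (abs_le.2 ⟨ht.1.le, ht.2.le⟩) (Complex.abs_re_le_norm u) (abs_nonneg _)
        hτ0.le
    have h2 : (δ + t * u).re = δ.re + t * u.re := by simp
    have h3 := (abs_le.1 h1).1
    have h4 : c ≤ η := min_le_left _ _
    rw [h2]
    linarith
  have hδt : ∀ t ∈ Set.Ioo (-τ) τ, -1 / 2 < (δ + t * u).re := fun t ht => by
    linarith [hre t ht]
  have h0 : (0 : ℝ) ∈ Set.Ioo (-τ) τ := ⟨by linarith, hτ0⟩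
  have hl : ∀ j : ℕ, 0 ≤ β / 2 * (m - j : ℕ) := fun j => by positivity
  set X : (Fin (m + 1) → ℝ) × (Fin (m + 1) → ℝ) → ℝ :=
    fun ω => 2 * (conj u * logPhi (n := m + 1) k ω).re with hX
  have hXt : ∀ (t : ℝ) ω, t * X ω = 2 * (conj ((t : ℂ) * u) * logPhi k ω).re := by
    intro t ω
    rw [map_mul, Complex.conj_ofReal, mul_assoc, Complex.re_ofReal_mul]
    ring
  have hXm : AEMeasurable X (cjLaw β δ (m + 1)) :=
    (Complex.measurable_re.comp_aemeasurable
      ((aemeasurable_logPhi hβ hk).const_mul (conj u))).const_mul 2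
  have hpos : ∀ t ∈ Set.Ioo (-τ) τ, ∀ j : ℕ, 0 < gaussSum (β / 2 * (m - j : ℕ)) (δ + t * u) :=
    fun t ht j => zero_lt_one.trans_le (one_le_gaussSum (hl j) (hδt t ht))
  have hpos0 : ∀ j : ℕ, 0 < gaussSum (β / 2 * (m - j : ℕ)) δ :=
    fun j => zero_lt_one.trans_le (one_le_gaussSum (hl j) hδ)
  have hlint : ∀ t ∈ Set.Ioo (-τ) τ,
      ∫⁻ ω, ENNReal.ofReal (Real.exp (t * X ω)) ∂(cjLaw β δ (m + 1)) =
      ENNReal.ofReal (∏ j ∈ Finset.range k, gaussSum (β / 2 * (m - j : ℕ)) (δ + t * u) /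
        gaussSum (β / 2 * (m - j : ℕ)) δ) := by
    intro t ht
    simp only [hXt]
    exact lintegral_exp_logPhi hβ hδ (hδt t ht) hk
  have hexpm : ∀ t : ℝ, AEStronglyMeasurable (fun ω => Real.exp (t * X ω)) (cjLaw β δ (m + 1)) :=
    fun t => (Real.measurable_exp.comp_aemeasurable (hXm.const_mul t)).aestronglyMeasurable
  have hmgf : ∀ t ∈ Set.Ioo (-τ) τ, mgf X (cjLaw β δ (m + 1)) t =
      ∏ j ∈ Finset.range k, gaussSum (β / 2 * (m - j : ℕ)) (δ + t * u) /
        gaussSum (β / 2 * (m - j : ℕ)) δ := by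
    intro t ht
    rw [mgf, integral_eq_lintegral_of_nonneg_ae (Eventually.of_forall fun ω => (Real.exp_pos _).le)
      (hexpm t), hlint t ht, ENNReal.toReal_ofReal]
    exact Finset.prod_nonneg fun j _ => (div_pos (hpos t ht j) (hpos0 j)).le
  have hint : ∀ t ∈ Set.Ioo (-τ) τ,
      Integrable (fun ω => Real.exp (t * X ω)) (cjLaw β δ (m + 1)) := by
    intro t ht
    refine ⟨hexpm t, ?_⟩
    rw [hasFiniteIntegral_iff_ofReal (Eventually.of_forall fun ω => (Real.exp_pos _).le),
      hlint t ht]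
    exact ENNReal.ofReal_lt_top
  have hcgf : ∀ t ∈ Set.Ioo (-τ) τ, cgf X (cjLaw β δ (m + 1)) t =
      ∑ j ∈ Finset.range k, (Real.log (gaussSum (β / 2 * (m - j : ℕ)) (δ + t * u)) -
        Real.log (gaussSum (β / 2 * (m - j : ℕ)) δ)) := by
    intro t ht
    rw [cgf, hmgf t ht, Real.log_prod fun j _ => (div_pos (hpos t ht j) (hpos0 j)).ne']
    exact Finset.sum_congr rfl fun j _ => Real.log_div (hpos t ht j).ne' (hpos0 j).ne'
  have hK : ∀ t ∈ Set.Ioo (-τ) τ, HasDerivAt (fun t : ℝ => ∑ j ∈ Finset.range k,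
      (Real.log (gaussSum (β / 2 * (m - j : ℕ)) (δ + t * u)) -
        Real.log (gaussSum (β / 2 * (m - j : ℕ)) δ)))
      (∑ j ∈ Finset.range k, ∑' i : ℕ, logTermDeriv (β / 2 * (m - j : ℕ) + 1 + i) u (δ + t * u))
      t := by
    intro t ht
    refine HasDerivAt.fun_sum fun j _ => ?_
    exact (hasDerivAt_log_gaussSum (hl j) u hc0 (min_le_right _ _) hre ht).1.sub_const _
  have hK₁ : HasDerivAt (fun t : ℝ => ∑ j ∈ Finset.range k,
      ∑' i : ℕ, logTermDeriv (β / 2 * (m - j : ℕ) + 1 + i) u (δ + t * u))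
      (∑ j ∈ Finset.range k,
        ∑' i : ℕ, logTermDeriv₂ (β / 2 * (m - j : ℕ) + 1 + i) u (δ + (0 : ℝ) * u)) 0 :=
    HasDerivAt.fun_sum fun j _ =>
      (hasDerivAt_log_gaussSum (hl j) u hc0 (min_le_right _ _) hre h0).2
  obtain ⟨h1, h2, h3⟩ := moments_of_cgf hτ0 hint hcgf hK hK₁
  refine ⟨h1, h2.trans ?_, h3.trans ?_⟩
  · simp only [Complex.ofReal_zero, zero_mul, add_zero]
    exact Finset.sum_congr rfl fun j _ => tsum_logTermDeriv (hl j) hδ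
  · simp only [Complex.ofReal_zero, zero_mul, add_zero]
    exact Finset.sum_congr rfl fun j _ => tsum_logTermDeriv₂ (hl j) hδ

theorem memLp_logPhi (hβ : 0 < β) (hδ : -1 / 2 < δ.re) {k : ℕ} (hk : k ≤ m + 1) :
    MemLp (fun ω => (logPhi (n := m + 1) k ω).re) 2 (cjLaw β δ (m + 1)) ∧
    MemLp (fun ω => (logPhi (n := m + 1) k ω).im) 2 (cjLaw β δ (m + 1)) ∧
    MemLp (logPhi (n := m + 1) k) 2 (cjLaw β δ (m + 1)) := by
  have h1 := ((moments_re_mul_logPhi hβ hδ hk 1).1).const_mul (1 / 2)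
  have h2 := ((moments_re_mul_logPhi hβ hδ hk Complex.I).1).const_mul (1 / 2)
  have h1' : MemLp (fun ω => (logPhi (n := m + 1) k ω).re) 2 (cjLaw β δ (m + 1)) := by
    convert h1 using 2 with ω
    simp
  have h2' : MemLp (fun ω => (logPhi (n := m + 1) k ω).im) 2 (cjLaw β δ (m + 1)) := by
    convert h2 using 2 with ω
    simp
  exact ⟨h1', h2', memLp_re_im_iff.1 ⟨h1', h2'⟩⟩

/-- The cases `u = 1` and `u = I` of `moments_re_mul_logPhi` give the real and the imaginary part.
-/
theorem integral_logPhi (hβ : 0 < β) (hδ : -1 / 2 < δ.re) {k : ℕ} (hk : k ≤ m + 1) :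
    ∫ ω, logPhi (n := m + 1) k ω ∂(cjLaw β δ (m + 1)) =
      ∑ j ∈ Finset.range k, digammaSub ((β / 2 * (m - j : ℕ) : ℝ) + 1 + 2 * δ.re)
        ((β / 2 * (m - j : ℕ) : ℝ) + 1 + conj δ) := by
  have hprob := isProbabilityMeasure_cjLaw (m := m) hβ hδ
  have hint : Integrable (fun ω => logPhi (n := m + 1) k ω) (cjLaw β δ (m + 1)) :=
    (memLp_logPhi hβ hδ hk).2.2.integrable one_le_two
  have h1 := (moments_re_mul_logPhi hβ hδ hk 1).2.1
  have h2 := (moments_re_mul_logPhi hβ hδ hk Complex.I).2.1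
  simp only [map_one, one_mul, Complex.conj_I, neg_mul, Complex.neg_re, Complex.I_mul_re,
    neg_neg] at h1 h2
  rw [integral_const_mul, ← Finset.mul_sum] at h1 h2
  have h1' := mul_left_cancel₀ two_ne_zero h1
  have h2' := mul_left_cancel₀ two_ne_zero h2
  have e1 : ∫ ω, (logPhi (n := m + 1) k ω).re ∂(cjLaw β δ (m + 1)) = _ := integral_re hint
  have e2 : ∫ ω, (logPhi (n := m + 1) k ω).im ∂(cjLaw β δ (m + 1)) = _ := integral_im hint
  apply Complex.ext
  · rw [Complex.re_sum, ← h1', e1]; rfl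
  · rw [Complex.im_sum, ← h2', e2]; rfl

theorem variance_re_logPhi (hβ : 0 < β) (hδ : -1 / 2 < δ.re) {k : ℕ} (hk : k ≤ m + 1) :
    Var[fun ω => (logPhi (n := m + 1) k ω).re; cjLaw β δ (m + 1)] =
      ∑ j ∈ Finset.range k, ((trigamma ((β / 2 * (m - j : ℕ) : ℝ) + 1 + 2 * δ.re)).re -
        (trigamma ((β / 2 * (m - j : ℕ) : ℝ) + 1 + δ)).re / 2) := by
  have h := (moments_re_mul_logPhi hβ hδ hk 1).2.2
  rw [variance_const_mul] at h
  simp only [map_one, one_mul, one_pow, Complex.one_re] at h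
  have h4 : Var[fun ω => (logPhi (n := m + 1) k ω).re; cjLaw β δ (m + 1)] = (1 / 4) *
    (2 ^ 2 * Var[fun ω => (logPhi (n := m + 1) k ω).re; cjLaw β δ (m + 1)]) := by ring
  rw [h4, h, Finset.mul_sum]
  exact Finset.sum_congr rfl fun j _ => by ring

theorem variance_im_logPhi (hβ : 0 < β) (hδ : -1 / 2 < δ.re) {k : ℕ} (hk : k ≤ m + 1) :
    Var[fun ω => (logPhi (n := m + 1) k ω).im; cjLaw β δ (m + 1)] =
      ∑ j ∈ Finset.range k, (trigamma ((β / 2 * (m - j : ℕ) : ℝ) + 1 + δ)).re / 2 := by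
  have h := (moments_re_mul_logPhi hβ hδ hk Complex.I).2.2
  rw [variance_const_mul] at h
  simp only [Complex.conj_I, neg_mul, Complex.neg_re, Complex.I_mul_re, neg_neg, Complex.I_sq,
    Complex.I_re, one_mul] at h
  have h4 : Var[fun ω => (logPhi (n := m + 1) k ω).im; cjLaw β δ (m + 1)] = (1 / 4) *
    (2 ^ 2 * Var[fun ω => (logPhi (n := m + 1) k ω).im; cjLaw β δ (m + 1)]) := by ring
  rw [h4, h, Finset.mul_sum]
  exact Finset.sum_congr rfl fun j _ => by ring

/-- Polarization, from the directions `u = 1`, `u = I` and `u = 1 + I`. -/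
theorem covariance_re_im_logPhi (hβ : 0 < β) (hδ : -1 / 2 < δ.re) {k : ℕ} (hk : k ≤ m + 1) :
    cov[fun ω => (logPhi (n := m + 1) k ω).re, fun ω => (logPhi (n := m + 1) k ω).im;
      cjLaw β δ (m + 1)] =
      ∑ j ∈ Finset.range k, (trigamma ((β / 2 * (m - j : ℕ) : ℝ) + 1 + δ)).im / 2 := by
  have hprob := isProbabilityMeasure_cjLaw (m := m) hβ hδ
  obtain ⟨hre, him, -⟩ := memLp_logPhi hβ hδ hk
  have h := (moments_re_mul_logPhi hβ hδ hk (1 + Complex.I)).2.2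
  rw [variance_const_mul] at h
  have h1 : (fun ω => (conj (1 + Complex.I) * logPhi (n := m + 1) k ω).re) =
      (fun ω => (logPhi (n := m + 1) k ω).re) + fun ω => (logPhi (n := m + 1) k ω).im := by
    funext ω
    simp
  rw [h1, variance_add hre him, variance_re_logPhi hβ hδ hk, variance_im_logPhi hβ hδ hk] at h
  have h2 : ∀ z : ℂ, ((1 + Complex.I) ^ 2 * z).re = -2 * z.im := fun z => by
    rw [show (1 + Complex.I) ^ 2 = 2 * Complex.I by rw [add_sq, Complex.I_sq]; ring]
    simp
  simp only [h2, Complex.add_re, Complex.one_re, Complex.I_re, add_zero, one_pow,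
    Finset.sum_add_distrib, Finset.sum_sub_distrib, ← Finset.mul_sum, ← Finset.sum_div] at h ⊢
  linarith

end Moments

/-! ### Estimates for the digamma and trigamma functions -/

section Digamma

open Filter Topology

theorem add_natCast_ne_zero {z : ℂ} (hz : 0 < z.re) (i : ℕ) : z + i ≠ 0 := fun h => by
  have := congrArg Complex.re h
  simp only [Complex.add_re, Complex.natCast_re, Complex.zero_re] at this
  have : (0 : ℝ) ≤ i := Nat.cast_nonneg i
  linarith

theorem tendsto_one_div_add_natCast (z : ℂ) :
    Tendsto (fun N : ℕ => 1 / (z + N)) atTop (𝓝 0) := by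
  simp only [one_div]
  refine tendsto_inv₀_cobounded.comp ?_
  refine tendsto_norm_atTop_iff_cobounded.1 ?_
  refine tendsto_atTop_mono (fun N : ℕ => ?_)
    (tendsto_atTop_add_const_right _ (-‖z‖) tendsto_natCast_atTop_atTop)
  have h := norm_sub_norm_le (N : ℂ) (-z)
  rw [norm_neg, Complex.norm_natCast, sub_neg_eq_add, add_comm (N : ℂ)] at h
  linarith

theorem norm_one_div_mul_succ_le {z : ℂ} {c : ℝ} (hc : 0 < c) (hz : c ≤ z.re) (i : ℕ) :
    ‖1 / ((z + i) * (z + i + 1))‖ ≤ 1 / (((i : ℝ) + c) * (i + c + 1)) := by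
  have h1 := norm_add_nat_ge hz i
  have h2 := norm_add_nat_ge (c := c + 1) (z := z + 1) (by simpa using hz) i
  rw [norm_div, norm_one, norm_mul, show z + i + 1 = z + 1 + i by ring]
  refine one_div_le_one_div_of_le (by positivity) (mul_le_mul h1 ?_ (by positivity) (norm_nonneg _))
  linarith

theorem hasSum_one_div_mul_succ {z : ℂ} (hz : 0 < z.re) :
    HasSum (fun i : ℕ => 1 / ((z + i) * (z + i + 1))) (1 / z) := by
  have hs : Summable fun i : ℕ => 1 / ((z + i) * (z + i + 1)) := by
    refine Summable.of_norm_bounded (summable_one_div_add_sq hz) fun i => ?_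
    refine (norm_one_div_mul_succ_le hz le_rfl i).trans
      (one_div_le_one_div_of_le (by positivity) ?_)
    nlinarith [hz, (Nat.cast_nonneg i : (0 : ℝ) ≤ i)]
  rw [hs.hasSum_iff_tendsto_nat]
  have h1 : ∀ N : ℕ, ∑ i ∈ Finset.range N, 1 / ((z + i) * (z + i + 1)) = 1 / z - 1 / (z + N) := by
    intro N
    induction N with
    | zero => simp
    | succ N ih =>
      have h2 := add_natCast_ne_zero hz N
      have h3 := add_natCast_ne_zero hz (N + 1)
      push_cast at h3
      rw [← add_assoc] at h3
      have h4 : z ≠ 0 := by simpa using add_natCast_ne_zero hz 0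
      rw [Finset.sum_range_succ, ih]
      push_cast
      rw [← add_assoc]
      field_simp
      ring
  simp only [h1]
  simpa using (tendsto_one_div_add_natCast z).const_sub (1 / z)

theorem hasSum_real_one_div_mul_succ {r : ℝ} (hr : 0 < r) :
    HasSum (fun i : ℕ => 1 / (((i : ℝ) + r) * (i + r + 1))) (1 / r) := by
  have h := hasSum_one_div_mul_succ (z := (r : ℂ)) (by simpa using hr)
  rw [← Complex.hasSum_ofReal]
  push_cast
  simpa only [add_comm (r : ℂ)] using h

/-- Comparison with the telescoping series of `1 / ((z + i) (z + i + 1))`, of sum `1 / z`. -/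
theorem norm_trigamma_sub_le {z : ℂ} {r : ℝ} (hr : 0 < r) (hz : r ≤ z.re) :
    ‖trigamma z - 1 / z‖ ≤ 1 / r ^ 2 := by
  have hz0 := hr.trans_le hz
  have h1 := (summable_trigamma hz0).hasSum.sub (hasSum_one_div_mul_succ hz0)
  have h2 := (hasSum_real_one_div_mul_succ hr).mul_left (1 / r)
  rw [trigamma, show 1 / r ^ 2 = 1 / r * (1 / r) by ring]
  refine h1.norm_le_of_bounded h2 fun i => ?_
  have e1 := add_natCast_ne_zero hz0 i
  have e2 := add_natCast_ne_zero (z := z + 1) (by simp; linarith) i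
  rw [show z + 1 + i = z + i + 1 by ring] at e2
  rw [show 1 / (z + i) ^ 2 - 1 / ((z + i) * (z + i + 1)) =
    1 / (z + i) * (1 / ((z + i) * (z + i + 1))) by field_simp; ring, norm_mul]
  refine mul_le_mul ?_ (norm_one_div_mul_succ_le hr hz i) (norm_nonneg _) (by positivity)
  rw [norm_div, norm_one]
  refine one_div_le_one_div_of_le hr ?_
  have := norm_add_nat_ge hz i
  linarith [(Nat.cast_nonneg i : (0 : ℝ) ≤ i)]

/-- Comparison with the telescoping series of `(z - w) / ((z + i) (z + i + 1))`. -/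
theorem norm_digammaSub_sub_le {z w : ℂ} {r : ℝ} (hr : 0 < r) (hz : r ≤ z.re) (hw : r ≤ w.re) :
    ‖digammaSub z w - (z - w) / z‖ ≤ ‖z - w‖ * ‖z - w + 1‖ / r ^ 2 := by
  have hz0 := hr.trans_le hz
  have hw0 := hr.trans_le hw
  have h1 := (summable_digammaSub hz0 hw0).hasSum.sub
    ((hasSum_one_div_mul_succ hz0).mul_left (z - w))
  have h2 := (hasSum_real_one_div_mul_succ hr).mul_left (‖z - w‖ * ‖z - w + 1‖ / r)
  rw [digammaSub, show ‖z - w‖ * ‖z - w + 1‖ / r ^ 2 = ‖z - w‖ * ‖z - w + 1‖ / r * (1 / r) by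
    field_simp, ← mul_one_div (z - w)]
  refine h1.norm_le_of_bounded h2 fun i => ?_
  have e1 := add_natCast_ne_zero hz0 i
  have e2 := add_natCast_ne_zero (z := z + 1) (by simp; linarith) i
  have e3 := add_natCast_ne_zero hw0 i
  rw [show z + 1 + i = z + i + 1 by ring] at e2
  rw [show 1 / (w + i) - 1 / (z + i) - (z - w) * (1 / ((z + i) * (z + i + 1))) =
    (z - w) * (z - w + 1) * (1 / (w + i)) * (1 / ((z + i) * (z + i + 1))) by field_simp; ring,
    norm_mul, norm_mul, norm_mul, div_eq_mul_one_div _ r]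
  refine mul_le_mul (mul_le_mul_of_nonneg_left ?_ (by positivity))
    (norm_one_div_mul_succ_le hr hz i) (norm_nonneg _) (by positivity)
  rw [norm_div, norm_one]
  refine one_div_le_one_div_of_le hr ?_
  have := norm_add_nat_ge hw i
  linarith [(Nat.cast_nonneg i : (0 : ℝ) ≤ i)]

/-! ### Expansions of the logarithm -/

theorem log_mul_of_re_pos {z w : ℂ} (hz : 0 < z.re) (hw : 0 < w.re) :
    Complex.log (z * w) = Complex.log z + Complex.log w := by
  have hz0 : z ≠ 0 := by rintro rfl; simp at hz
  have hw0 : w ≠ 0 := by rintro rfl; simp at hw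
  have h1 := abs_lt.1 (Complex.abs_arg_lt_pi_div_two_iff.2 (Or.inl hz))
  have h2 := abs_lt.1 (Complex.abs_arg_lt_pi_div_two_iff.2 (Or.inl hw))
  exact (Complex.log_mul_eq_add_log_iff hz0 hw0).2 ⟨by linarith, by linarith⟩

theorem norm_log_one_add_sub_le {u : ℂ} (hu : ‖u‖ ≤ 1 / 2) :
    ‖Complex.log (1 + u) - u‖ ≤ ‖u‖ ^ 2 := by
  refine (Complex.norm_log_one_add_sub_self_le (by linarith)).trans ?_
  have h : (1 - ‖u‖)⁻¹ ≤ 2 := by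
    rw [inv_le_comm₀ (by linarith) two_pos]
    linarith
  nlinarith [sq_nonneg ‖u‖]

theorem norm_log_one_add_sub_add_le {u : ℂ} (hu : ‖u‖ ≤ 1 / 2) :
    ‖Complex.log (1 + u) - u + u ^ 2 / 2‖ ≤ ‖u‖ ^ 3 := by
  have h1 := Complex.norm_log_sub_logTaylor_le 2 (z := u) (by linarith)
  simp only [Complex.logTaylor_succ, Complex.logTaylor_zero, Pi.add_apply] at h1
  have h : (1 - ‖u‖)⁻¹ ≤ 2 := by
    rw [inv_le_comm₀ (by linarith) two_pos]
    linarith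
  have h0 : 0 ≤ ‖u‖ ^ 3 := by positivity
  norm_num at h1
  have e : Complex.log (1 + u) - (u + -u ^ 2 / 2) = Complex.log (1 + u) - u + u ^ 2 / 2 := by ring
  rw [e] at h1
  refine h1.trans ?_
  nlinarith

theorem log_add_one {z : ℂ} (hz : 0 < z.re) :
    Complex.log (z + 1) = Complex.log z + Complex.log (1 + 1 / z) := by
  have hz0 : z ≠ 0 := by rintro rfl; simp at hz
  rw [← log_mul_of_re_pos hz, mul_add, mul_one, mul_one_div_cancel hz0]
  have : 0 < (1 / z).re := by
    rw [one_div, Complex.inv_re]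
    exact div_pos hz (Complex.normSq_pos.2 hz0)
  simp only [Complex.add_re, Complex.one_re]
  linarith

theorem half_le_norm_one_add {u : ℂ} (hu : ‖u‖ ≤ 1 / 2) : 1 / 2 ≤ ‖1 + u‖ := by
  have := norm_sub_norm_le (1 : ℂ) (-u)
  rw [norm_neg, norm_one, sub_neg_eq_add] at this
  linarith

theorem norm_one_div_le_of_le_re {z : ℂ} {r : ℝ} (hr : 0 < r) (hz : r ≤ z.re) :
    ‖1 / z‖ ≤ 1 / r := by
  rw [norm_div, norm_one]
  exact one_div_le_one_div_of_le hr (hz.trans (Complex.re_le_norm z))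

/-- The first two terms `log z - 1 / (2 z)` of the expansion of the digamma function. -/
def logHalf (z : ℂ) : ℂ := Complex.log z - 1 / (2 * z)

/-- Up to a cubic error, `logHalf` satisfies the functional equation `ψ(z + 1) = ψ(z) + 1 / z`. -/
theorem norm_logHalf_succ_sub_le {z : ℂ} {r : ℝ} (hr : 2 ≤ r) (hz : r ≤ z.re) :
    ‖logHalf (z + 1) - logHalf z - 1 / z‖ ≤ 2 / r ^ 3 := by
  have hr0 : 0 < r := by linarith
  have hz0 : 0 < z.re := by linarith
  have hzn : z ≠ 0 := by rintro rfl; simp at hz0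
  have hz1 : z + 1 ≠ 0 := by simpa using add_natCast_ne_zero hz0 1
  have hur := norm_one_div_le_of_le_re hr0 hz
  set u := 1 / z with hu
  have hu2 : ‖u‖ ≤ 1 / 2 := hur.trans (one_div_le_one_div_of_le two_pos hr)
  have h1u : 1 + u ≠ 0 := norm_pos_iff.1 (lt_of_lt_of_le (by norm_num) (half_le_norm_one_add hu2))
  have key : logHalf (z + 1) - logHalf z - u =
      (Complex.log (1 + u) - u + u ^ 2 / 2) - u ^ 3 * (1 / (2 * (1 + u))) := by
    rw [logHalf, logHalf, log_add_one hz0, ← hu]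
    have e1 : 1 / (2 * (z + 1)) = u / (2 * (1 + u)) := by rw [hu]; field_simp
    have e2 : 1 / (2 * z) = u / 2 := by rw [hu]; field_simp
    rw [e1, e2]
    field_simp
    ring
  rw [key]
  have b1 := norm_log_one_add_sub_add_le hu2
  have b2 : ‖1 / (2 * (1 + u))‖ ≤ 1 := by
    rw [norm_div, norm_one, norm_mul, Complex.norm_two]
    exact div_le_one_of_le₀ (by linarith [half_le_norm_one_add hu2]) (by positivity)
  have b3 : ‖u ^ 3 * (1 / (2 * (1 + u)))‖ ≤ ‖u‖ ^ 3 := by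
    rw [norm_mul, norm_pow]
    exact mul_le_of_le_one_right (by positivity) b2
  have b4 : ‖u‖ ^ 3 ≤ (1 / r) ^ 3 := pow_le_pow_left₀ (norm_nonneg _) hur 3
  refine (norm_sub_le _ _).trans ?_
  rw [show 2 / r ^ 3 = (1 / r) ^ 3 + (1 / r) ^ 3 by ring]
  linarith

theorem tendsto_logHalf_sub (z w : ℂ) :
    Tendsto (fun N : ℕ => logHalf (w + N) - logHalf (z + N)) atTop (𝓝 0) := by
  have h1 : ∀ z : ℂ, Tendsto (fun N : ℕ => Complex.log (1 + z * (1 / (0 + (N : ℂ))))) atTop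
      (𝓝 0) := by
    intro z
    have h2 : Tendsto (fun N : ℕ => 1 + z * (1 / (0 + (N : ℂ)))) atTop (𝓝 1) := by
      simpa using ((tendsto_one_div_add_natCast 0).const_mul z).const_add 1
    have h3 := (continuousAt_clog (x := (1 : ℂ)) (by simp)).tendsto.comp h2
    simpa [Function.comp_def] using h3
  have h4 : ∀ z : ℂ, ∀ᶠ N : ℕ in atTop, logHalf (z + N) =
      (Real.log N : ℂ) + Complex.log (1 + z * (1 / (0 + (N : ℂ)))) - 1 / 2 * (1 / (z + N)) := by
    intro z
    have h5 : ∀ᶠ N : ℕ in atTop, 1 + z * (1 / (0 + (N : ℂ))) ≠ 0 := by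
      have h2 : Tendsto (fun N : ℕ => 1 + z * (1 / (0 + (N : ℂ)))) atTop (𝓝 1) := by
        simpa using ((tendsto_one_div_add_natCast 0).const_mul z).const_add 1
      exact h2.eventually_ne one_ne_zero
    filter_upwards [h5, eventually_gt_atTop 0] with N hN hN0
    have hN' : (0 : ℝ) < N := Nat.cast_pos.2 hN0
    have hNc : (N : ℂ) ≠ 0 := Nat.cast_ne_zero.2 hN0.ne'
    rw [logHalf, ← Complex.log_ofReal_mul hN' hN]
    congr 1
    · congr 1
      rw [zero_add, Complex.ofReal_natCast, mul_add, mul_one, mul_left_comm,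
        mul_one_div_cancel hNc, mul_one, add_comm]
    · rw [one_div_mul_one_div]
  have h6 := (((h1 w).sub ((tendsto_one_div_add_natCast w).const_mul (1 / 2))).sub
    ((h1 z).sub ((tendsto_one_div_add_natCast z).const_mul (1 / 2))))
  simp only [mul_zero, sub_zero] at h6
  refine h6.congr' ?_
  filter_upwards [h4 z, h4 w] with N hz hw
  rw [hz, hw]
  ring

theorem sum_two_div_pow_three_le {r : ℝ} (hr : 2 ≤ r) (N : ℕ) :
    ∑ i ∈ Finset.range N, 2 / (r + i) ^ 3 ≤ 4 / r ^ 2 := by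
  have h1 : ∀ N : ℕ, ∑ i ∈ Finset.range N, 1 / (r + i) ^ 2 ≤ 1 / (r - 1) - 1 / (r - 1 + N) := by
    intro N
    induction N with
    | zero => simp
    | succ N ih =>
      rw [Finset.sum_range_succ]
      have hN : (0 : ℝ) ≤ N := Nat.cast_nonneg N
      have h2 : 1 / (r + N) ^ 2 ≤ 1 / (r - 1 + N) - 1 / (r - 1 + (N + 1 : ℕ)) := by
        have e1 : 0 < r - 1 + N := by linarith
        have e2 : 0 < r + N := by linarith
        rw [show r - 1 + ((N + 1 : ℕ) : ℝ) = r + N by push_cast; ring,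
          div_sub_div _ _ e1.ne' e2.ne']
        rw [div_le_div_iff₀ (by positivity) (by positivity)]
        nlinarith
      linarith
  have h2 : ∑ i ∈ Finset.range N, 1 / (r + i) ^ 2 ≤ 2 / r := by
    refine (h1 N).trans ?_
    have : 0 ≤ 1 / (r - 1 + N) := by
      have : (0 : ℝ) ≤ N := Nat.cast_nonneg N
      exact one_div_nonneg.2 (by linarith)
    have : 1 / (r - 1) ≤ 2 / r := by
      rw [div_le_div_iff₀ (by linarith) (by linarith)]
      linarith
    linarith
  calc ∑ i ∈ Finset.range N, 2 / (r + i) ^ 3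
      ≤ ∑ i ∈ Finset.range N, 2 / r * (1 / (r + i) ^ 2) := by
        refine Finset.sum_le_sum fun i _ => ?_
        have hi : (0 : ℝ) ≤ i := Nat.cast_nonneg i
        rw [div_mul_div_comm, mul_one]
        refine div_le_div_of_nonneg_left zero_le_two (by positivity) ?_
        rw [show (r + i) ^ 3 = (r + i) * (r + i) ^ 2 by ring]
        exact mul_le_mul_of_nonneg_right (by linarith) (by positivity)
    _ = 2 / r * ∑ i ∈ Finset.range N, 1 / (r + i) ^ 2 := by rw [Finset.mul_sum]
    _ ≤ 2 / r * (2 / r) := mul_le_mul_of_nonneg_left h2 (by positivity)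
    _ = 4 / r ^ 2 := by ring

/-- The expansion `ψ(z) = log z - 1 / (2 z) + O(z⁻²)`, for the difference of two values. -/
theorem norm_digammaSub_sub_logHalf_le {z w : ℂ} {r : ℝ} (hr : 2 ≤ r) (hz : r ≤ z.re)
    (hw : r ≤ w.re) : ‖digammaSub z w - (logHalf z - logHalf w)‖ ≤ 8 / r ^ 2 := by
  have hz0 : 0 < z.re := by linarith
  have hw0 : 0 < w.re := by linarith
  have hlim := (summable_digammaSub hz0 hw0).hasSum.tendsto_sum_nat
  have hlim2 : Tendsto (fun N : ℕ => ∑ i ∈ Finset.range N, (1 / (w + i) - 1 / (z + i)) -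
      (logHalf z - logHalf w) - (logHalf (w + N) - logHalf (z + N))) atTop
      (𝓝 (digammaSub z w - (logHalf z - logHalf w))) := by
    have := (hlim.sub_const (logHalf z - logHalf w)).sub (tendsto_logHalf_sub z w)
    rw [sub_zero] at this
    exact this
  refine le_of_tendsto hlim2.norm (Eventually.of_forall fun N => ?_)
  have h1 : ∀ z : ℂ, ∑ i ∈ Finset.range N, (logHalf (z + i + 1) - logHalf (z + i)) =
      logHalf (z + N) - logHalf z := by
    intro z
    have := Finset.sum_range_sub (fun i : ℕ => logHalf (z + i)) N
    simpa [add_assoc] using this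
  have h2 : ∀ z : ℂ, r ≤ z.re →
      ‖∑ i ∈ Finset.range N, (logHalf (z + i + 1) - logHalf (z + i) - 1 / (z + i))‖ ≤
      4 / r ^ 2 := by
    intro z hz
    refine (norm_sum_le _ _).trans ((Finset.sum_le_sum fun i _ => ?_).trans
      (sum_two_div_pow_three_le hr N))
    have hi : (0 : ℝ) ≤ i := Nat.cast_nonneg i
    exact norm_logHalf_succ_sub_le (by linarith) (by simp; linarith)
  have h3 : ∑ i ∈ Finset.range N, (1 / (w + i) - 1 / (z + i)) -
      (logHalf z - logHalf w) - (logHalf (w + N) - logHalf (z + N)) =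
      ∑ i ∈ Finset.range N, (logHalf (z + i + 1) - logHalf (z + i) - 1 / (z + i)) -
      ∑ i ∈ Finset.range N, (logHalf (w + i + 1) - logHalf (w + i) - 1 / (w + i)) := by
    rw [Finset.sum_sub_distrib _ (fun i : ℕ => 1 / (z + i)),
      Finset.sum_sub_distrib (fun i : ℕ => logHalf (z + i + 1) - logHalf (z + i)),
      Finset.sum_sub_distrib (fun i : ℕ => logHalf (w + i + 1) - logHalf (w + i)), h1, h1]
    ring
  rw [h3]
  refine (norm_sub_le _ _).trans ?_
  rw [show 8 / r ^ 2 = 4 / r ^ 2 + 4 / r ^ 2 by ring]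
  exact add_le_add (h2 z hz) (h2 w hw)

end Digamma

/-! ### Sums of digamma and trigamma functions along an arithmetic progression -/

section Progression

open Filter Topology

/-- The telescoping approximation of one term of the mean in the regime of large parameters. -/
theorem norm_logHalf_sub_entropy_le {b κ ρ : ℝ} {x : ℂ} (hb : 0 < b) (hκ : κ = 1 / (2 * b) - 1 / 2)
    (hρ : 2 ≤ ρ) (hbρ : 2 ≤ b * ρ) (hx : ρ ≤ x.re) :
    ‖logHalf (b * x + 1) - Real.log b - ((x + 1) * Complex.log (x + 1) - x * Complex.log x - 1 +
      κ * (Complex.log (x + 1) - Complex.log x))‖ ≤ (2 / b ^ 2 + 2 + |κ|) / ρ ^ 2 := by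
  have hρ0 : 0 < ρ := by linarith
  have hx0 : 0 < x.re := by linarith
  have hxn : x ≠ 0 := by rintro rfl; simp at hx0
  have hbn : (b : ℂ) ≠ 0 := Complex.ofReal_ne_zero.2 hb.ne'
  have hbx : b * ρ ≤ ((b : ℂ) * x).re := by
    rw [Complex.re_ofReal_mul]
    exact mul_le_mul_of_nonneg_left hx hb.le
  have hbx0 : 0 < ((b : ℂ) * x).re := by linarith
  have hu := norm_one_div_le_of_le_re hρ0 hx
  have hv := norm_one_div_le_of_le_re (by linarith) hbx
  have huv : 1 / ((b : ℂ) * x) = 1 / b * (1 / x) := by rw [one_div_mul_one_div]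
  have hbx1 := log_add_one hbx0
  have hx1 := log_add_one hx0
  have hlogb : Complex.log ((b : ℂ) * x) = Real.log b + Complex.log x :=
    Complex.log_ofReal_mul hb hxn
  set u := 1 / x with hu'
  set v := 1 / ((b : ℂ) * x) with hv'
  have hu2 : ‖u‖ ≤ 1 / 2 := hu.trans (one_div_le_one_div_of_le two_pos hρ)
  have hv2 : ‖v‖ ≤ 1 / 2 := hv.trans (one_div_le_one_div_of_le two_pos hbρ)
  have h1v : 1 + v ≠ 0 := norm_pos_iff.1 (lt_of_lt_of_le (by norm_num) (half_le_norm_one_add hv2))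
  have hxu : x = 1 / u := by rw [hu', one_div_one_div]
  have hun : u ≠ 0 := one_div_ne_zero hxn
  have e1 : 1 / (2 * ((b : ℂ) * x + 1)) = v / (2 * (1 + v)) := by
    rw [hv']; field_simp
  have key : logHalf (b * x + 1) - Real.log b - ((x + 1) * Complex.log (x + 1) -
      x * Complex.log x - 1 + κ * (Complex.log (x + 1) - Complex.log x)) =
      (Complex.log (1 + v) - v) + v ^ 2 * (1 / (2 * (1 + v))) -
      (1 + 1 / u) * (Complex.log (1 + u) - u + u ^ 2 / 2) - κ * (Complex.log (1 + u) - u) +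
      u ^ 2 / 2 := by
    rw [logHalf, hbx1, hx1, hlogb, e1, hκ, hxu]
    have e2 : v / (2 * (1 + v)) = v / 2 - v ^ 2 * (1 / (2 * (1 + v))) := by
      field_simp
      ring
    rw [e2, huv]
    push_cast
    field_simp
    ring
  have b1 := norm_log_one_add_sub_le hv2
  have b2 : ‖v ^ 2 * (1 / (2 * (1 + v)))‖ ≤ ‖v‖ ^ 2 := by
    rw [norm_mul, norm_pow]
    refine mul_le_of_le_one_right (by positivity) ?_
    rw [norm_div, norm_one, norm_mul, Complex.norm_two]
    exact div_le_one_of_le₀ (by linarith [half_le_norm_one_add hv2]) (by positivity)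
  have b3 : ‖(1 + 1 / u) * (Complex.log (1 + u) - u + u ^ 2 / 2)‖ ≤ 3 / 2 * ‖u‖ ^ 2 := by
    have hn : 0 < ‖u‖ := norm_pos_iff.2 hun
    have : ‖1 + 1 / u‖ * ‖u‖ ≤ 3 / 2 := by
      rw [← norm_mul, add_mul, one_mul, one_div_mul_cancel hun]
      refine (norm_add_le _ _).trans ?_
      rw [norm_one]
      linarith
    rw [norm_mul]
    calc ‖1 + 1 / u‖ * ‖Complex.log (1 + u) - u + u ^ 2 / 2‖ ≤ ‖1 + 1 / u‖ * ‖u‖ ^ 3 :=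
          mul_le_mul_of_nonneg_left (norm_log_one_add_sub_add_le hu2) (norm_nonneg _)
      _ = ‖1 + 1 / u‖ * ‖u‖ * ‖u‖ ^ 2 := by ring
      _ ≤ 3 / 2 * ‖u‖ ^ 2 := mul_le_mul_of_nonneg_right this (by positivity)
  have b4 : ‖(κ : ℂ) * (Complex.log (1 + u) - u)‖ ≤ |κ| * ‖u‖ ^ 2 := by
    rw [norm_mul, Complex.norm_real, Real.norm_eq_abs]
    exact mul_le_mul_of_nonneg_left (norm_log_one_add_sub_le hu2) (abs_nonneg _)
  have b5 : ‖u ^ 2 / 2‖ = 1 / 2 * ‖u‖ ^ 2 := by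
    rw [norm_div, norm_pow, Complex.norm_two]
    ring
  have b6 : ‖u‖ ^ 2 ≤ (1 / ρ) ^ 2 := pow_le_pow_left₀ (norm_nonneg _) hu 2
  have b7 : ‖v‖ ^ 2 ≤ (1 / (b * ρ)) ^ 2 := pow_le_pow_left₀ (norm_nonneg _) hv 2
  rw [key]
  have n1 := norm_add_le ((Complex.log (1 + v) - v) + v ^ 2 * (1 / (2 * (1 + v))) -
      (1 + 1 / u) * (Complex.log (1 + u) - u + u ^ 2 / 2) - κ * (Complex.log (1 + u) - u))
      (u ^ 2 / 2)
  have n2 := norm_sub_le ((Complex.log (1 + v) - v) + v ^ 2 * (1 / (2 * (1 + v))) -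
      (1 + 1 / u) * (Complex.log (1 + u) - u + u ^ 2 / 2)) (κ * (Complex.log (1 + u) - u))
  have n3 := norm_sub_le ((Complex.log (1 + v) - v) + v ^ 2 * (1 / (2 * (1 + v))))
      ((1 + 1 / u) * (Complex.log (1 + u) - u + u ^ 2 / 2))
  have n4 := norm_add_le (Complex.log (1 + v) - v) (v ^ 2 * (1 / (2 * (1 + v))))
  have b8 : (2 + |κ|) * ‖u‖ ^ 2 ≤ (2 + |κ|) * (1 / ρ) ^ 2 :=
    mul_le_mul_of_nonneg_left b6 (by positivity)
  have e3 : (2 / b ^ 2 + 2 + |κ|) / ρ ^ 2 = 2 * (1 / (b * ρ)) ^ 2 + (2 + |κ|) * (1 / ρ) ^ 2 := by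
    field_simp
    ring
  rw [e3]
  linarith

/-- The telescoping approximation of one term of the covariance in the regime of large parameters.
-/
theorem norm_trigamma_sub_log_le {b ρ : ℝ} {x : ℂ} (hb : 0 < b)
    (hρ : 2 ≤ ρ) (hbρ : 2 ≤ b * ρ) (hx : ρ ≤ x.re) :
    ‖trigamma (b * x + 1) - 1 / b * (Complex.log (x + 1) - Complex.log x)‖ ≤
      (3 / b ^ 2 + 1 / b) / ρ ^ 2 := by
  have hρ0 : 0 < ρ := by linarith
  have hx0 : 0 < x.re := by linarith
  have hxn : x ≠ 0 := by rintro rfl; simp at hx0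
  have hbn : (b : ℂ) ≠ 0 := Complex.ofReal_ne_zero.2 hb.ne'
  have hbx : b * ρ ≤ ((b : ℂ) * x).re := by
    rw [Complex.re_ofReal_mul]
    exact mul_le_mul_of_nonneg_left hx hb.le
  have hu := norm_one_div_le_of_le_re hρ0 hx
  have hv := norm_one_div_le_of_le_re (by linarith) hbx
  have htri := norm_trigamma_sub_le (z := (b : ℂ) * x + 1) (r := b * ρ) (by linarith)
    (by simp only [Complex.add_re, Complex.one_re]; linarith)
  rw [log_add_one hx0, add_sub_cancel_left]
  have huv : 1 / ((b : ℂ) * x) = 1 / b * (1 / x) := by rw [one_div_mul_one_div]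
  set u := 1 / x with hu'
  set v := 1 / ((b : ℂ) * x) with hv'
  have hu2 : ‖u‖ ≤ 1 / 2 := hu.trans (one_div_le_one_div_of_le two_pos hρ)
  have hv2 : ‖v‖ ≤ 1 / 2 := hv.trans (one_div_le_one_div_of_le two_pos hbρ)
  have hv3 := half_le_norm_one_add hv2
  have h1v : 1 + v ≠ 0 := norm_pos_iff.1 (lt_of_lt_of_le (by norm_num) hv3)
  have e1 : 1 / ((b : ℂ) * x + 1) = v - v ^ 2 * (1 / (1 + v)) := by
    have : 1 / ((b : ℂ) * x + 1) = v / (1 + v) := by rw [hv']; field_simp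
    rw [this]
    field_simp
    ring
  have key : trigamma (b * x + 1) - 1 / b * Complex.log (1 + u) =
      (trigamma (b * x + 1) - 1 / ((b : ℂ) * x + 1)) - v ^ 2 * (1 / (1 + v)) -
      1 / b * (Complex.log (1 + u) - u) := by
    rw [e1, mul_sub, ← huv]
    ring
  have b2 : ‖v ^ 2 * (1 / (1 + v))‖ ≤ 2 * ‖v‖ ^ 2 := by
    rw [norm_mul, norm_pow, mul_comm]
    refine mul_le_mul_of_nonneg_right ?_ (by positivity)
    rw [norm_div, norm_one, div_le_iff₀ (by linarith)]
    linarith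
  have b4 : ‖1 / (b : ℂ) * (Complex.log (1 + u) - u)‖ ≤ 1 / b * ‖u‖ ^ 2 := by
    rw [norm_mul, norm_div, norm_one, Complex.norm_real, Real.norm_eq_abs, abs_of_pos hb]
    exact mul_le_mul_of_nonneg_left (norm_log_one_add_sub_le hu2) (by positivity)
  have b6 : 1 / b * ‖u‖ ^ 2 ≤ 1 / b * (1 / ρ) ^ 2 :=
    mul_le_mul_of_nonneg_left (pow_le_pow_left₀ (norm_nonneg _) hu 2) (by positivity)
  have b7 : ‖v‖ ^ 2 ≤ (1 / (b * ρ)) ^ 2 := pow_le_pow_left₀ (norm_nonneg _) hv 2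
  rw [key]
  have n1 := norm_sub_le (trigamma (b * x + 1) - 1 / ((b : ℂ) * x + 1) - v ^ 2 * (1 / (1 + v)))
    (1 / b * (Complex.log (1 + u) - u))
  have n2 := norm_sub_le (trigamma (b * x + 1) - 1 / ((b : ℂ) * x + 1)) (v ^ 2 * (1 / (1 + v)))
  have e3 : (3 / b ^ 2 + 1 / b) / ρ ^ 2 =
      1 / (b * ρ) ^ 2 + 2 * (1 / (b * ρ)) ^ 2 + 1 / b * (1 / ρ) ^ 2 := by
    field_simp
    ring
  rw [e3]
  linarith

/-- If the terms of a sum are close to the decrements of `A`, the sum is close to `A 0 - A k`. -/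
theorem norm_sum_sub_telescope_le {f A : ℕ → ℂ} {ε : ℝ} {k : ℕ}
    (h : ∀ j < k, ‖f j - (A j - A (j + 1))‖ ≤ ε) :
    ‖∑ j ∈ Finset.range k, f j - (A 0 - A k)‖ ≤ k * ε := by
  rw [← Finset.sum_range_sub' A k, ← Finset.sum_sub_distrib]
  refine (norm_sum_le _ _).trans ((Finset.sum_le_card_nsmul _ _ ε fun j hj =>
    h j (Finset.mem_range.1 hj)).trans ?_)
  simp

/-- The points `1 + c - j / n` stay in the right half plane. -/
theorem re_one_add_sub_div (c : ℂ) {n j : ℕ} (hj : j ≤ n) :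
    c.re ≤ (1 + c - ((j / n : ℝ) : ℂ)).re := by
  simp only [Complex.sub_re, Complex.add_re, Complex.one_re, Complex.ofReal_re]
  have : (j : ℝ) / n ≤ 1 := div_le_one_of_le₀ (Nat.cast_le.2 hj) (Nat.cast_nonneg _)
  linarith

variable {b : ℝ} {c : ℂ} {m : ℕ}

/-- The arithmetic progression `m - j + c n`, with `n = m + 1`, is `n (1 + c - s)` at
`s = (j + 1) / n`. -/
theorem progression_eq (c : ℂ) {j : ℕ} (hj : j ≤ m) :
    ((m - j : ℕ) : ℂ) + c * (m + 1 : ℕ) =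
      (m + 1 : ℕ) * (1 + c - (((j + 1 : ℕ) / (m + 1 : ℕ) : ℝ) : ℂ)) := by
  have h : ((m + 1 : ℕ) : ℂ) ≠ 0 := Nat.cast_ne_zero.2 (Nat.succ_ne_zero m)
  rw [Nat.cast_sub hj]
  push_cast at h ⊢
  field_simp
  ring

/-- Addition of `1` to the progression replaces `s = (j + 1) / n` by `s = j / n`. -/
theorem progression_add_one_eq (c : ℂ) {j : ℕ} (hj : j ≤ m) :
    ((m - j : ℕ) : ℂ) + c * (m + 1 : ℕ) + 1 =
      (m + 1 : ℕ) * (1 + c - (((j : ℕ) / (m + 1 : ℕ) : ℝ) : ℂ)) := by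
  have h : ((m + 1 : ℕ) : ℂ) ≠ 0 := Nat.cast_ne_zero.2 (Nat.succ_ne_zero m)
  rw [Nat.cast_sub hj]
  push_cast at h ⊢
  field_simp
  ring

theorem log_natCast_mul {z : ℂ} (hz : 0 < z.re) {n : ℕ} (hn : 0 < n) :
    Complex.log (n * z) = Real.log n + Complex.log z := by
  have hz0 : z ≠ 0 := by rintro rfl; simp at hz
  have := Complex.log_ofReal_mul (r := n) (Nat.cast_pos.2 hn) hz0
  rwa [Complex.ofReal_natCast] at this

theorem re_progression (c : ℂ) (j : ℕ) :
    (m + 1 : ℕ) * c.re ≤ (((m - j : ℕ) : ℂ) + c * (m + 1 : ℕ)).re := by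
  simp only [Complex.add_re, Complex.natCast_re, Complex.mul_re, Complex.natCast_im,
    mul_zero, sub_zero]
  have : (0 : ℝ) ≤ (m - j : ℕ) := Nat.cast_nonneg _
  linarith [mul_comm c.re ((m + 1 : ℕ) : ℝ)]

/-- Each of the at most `n` terms is a difference of consecutive values of `x log x - x + κ log x`,
up to `O(n⁻²)`. -/
theorem norm_sum_logHalf_sub_le {κ : ℝ} (hb : 0 < b) (hκ : κ = 1 / (2 * b) - 1 / 2)
    (hc : 0 < c.re) (h1 : 2 ≤ (m + 1 : ℕ) * c.re) (h2 : 2 ≤ b * ((m + 1 : ℕ) * c.re)) {k : ℕ}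
    (hk : k ≤ m + 1) :
    ‖∑ j ∈ Finset.range k, (logHalf (b * (((m - j : ℕ) : ℂ) + c * (m + 1 : ℕ)) + 1) -
        (Real.log b + Real.log (m + 1 : ℕ))) -
      ((m + 1 : ℕ) * (entropyJ (1 + c) - entropyJ (1 + c - ((k / (m + 1 : ℕ) : ℝ) : ℂ))) +
        κ * (Complex.log (1 + c) - Complex.log (1 + c - ((k / (m + 1 : ℕ) : ℝ) : ℂ))))‖ ≤
      (2 / b ^ 2 + 2 + |κ|) / c.re ^ 2 / (m + 1 : ℕ) := by
  set n := m + 1 with hn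
  have hn0 : 0 < n := Nat.succ_pos m
  have hnR : (0 : ℝ) < n := Nat.cast_pos.2 hn0
  have hnC : (n : ℂ) ≠ 0 := Nat.cast_ne_zero.2 hn0.ne'
  set Z : ℕ → ℂ := fun j => 1 + c - ((j / n : ℝ) : ℂ) with hZ
  set A : ℕ → ℂ := fun j => n * entropyJ (Z j) + κ * Complex.log (Z j) with hA
  have hstep : ∀ j < k, ‖(logHalf (b * (((m - j : ℕ) : ℂ) + c * n) + 1) -
      (Real.log b + Real.log n)) - (A j - A (j + 1))‖ ≤
      (2 / b ^ 2 + 2 + |κ|) / (n * c.re) ^ 2 := by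
    intro j hj
    have hjm : j ≤ m := by omega
    have h := norm_logHalf_sub_entropy_le (κ := κ) (ρ := n * c.re) hb hκ h1 h2
      (re_progression c j)
    have e0 := progression_eq c hjm
    have e1 := progression_add_one_eq c hjm
    rw [e1] at h
    have r0 : 0 < (Z j).re := hc.trans_le (re_one_add_sub_div c (by omega))
    have r1 : 0 < (Z (j + 1)).re := hc.trans_le (re_one_add_sub_div c (by omega))
    have l0 : Complex.log (n * Z j) = Real.log n + Complex.log (Z j) := log_natCast_mul r0 hn0
    have l1 : Complex.log (((m - j : ℕ) : ℂ) + c * n) =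
        Real.log n + Complex.log (Z (j + 1)) := by
      rw [e0]; exact log_natCast_mul r1 hn0
    change ‖logHalf (b * (((m - j : ℕ) : ℂ) + c * n) + 1) - Real.log b -
      (n * Z j * Complex.log (n * Z j) -
        (((m - j : ℕ) : ℂ) + c * n) * Complex.log (((m - j : ℕ) : ℂ) + c * n) - 1 +
        κ * (Complex.log (n * Z j) - Complex.log (((m - j : ℕ) : ℂ) + c * n)))‖ ≤ _ at h
    rw [l0, l1] at h
    refine le_trans (le_of_eq ?_) h
    congr 1
    have e2 : (((m - j : ℕ) : ℂ) + c * n) = n * Z (j + 1) := e0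
    have e3 : (n : ℂ) * Z j - n * Z (j + 1) = 1 := by
      rw [← e2, ← show ((m - j : ℕ) : ℂ) + c * n + 1 = n * Z j from e1]
      ring
    simp only [hA, entropyJ]
    have e4 : (((m - j : ℕ) : ℂ) + c * n) * (Real.log n + Complex.log (Z (j + 1))) =
      n * Z (j + 1) * (Real.log n + Complex.log (Z (j + 1))) := by rw [e2]
    rw [e4]
    linear_combination (Real.log n + 1 : ℂ) * e3
  have hsum := norm_sum_sub_telescope_le hstep
  have e : A 0 - A k = n * (entropyJ (1 + c) - entropyJ (1 + c - ((k / n : ℝ) : ℂ))) +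
        κ * (Complex.log (1 + c) - Complex.log (1 + c - ((k / n : ℝ) : ℂ))) := by
    simp only [hA, hZ, Nat.cast_zero, zero_div, Complex.ofReal_zero, sub_zero]
    ring
  rw [e] at hsum
  refine hsum.trans ?_
  have hkn : (k : ℝ) ≤ n := Nat.cast_le.2 hk
  refine (mul_le_mul_of_nonneg_right hkn (by positivity)).trans (le_of_eq ?_)
  field_simp

/-- Each of the at most `n` terms is a difference of consecutive values of `log x / b`, up to
`O(n⁻²)`. -/
theorem norm_sum_trigamma_sub_le (hb : 0 < b)
    (hc : 0 < c.re) (h1 : 2 ≤ (m + 1 : ℕ) * c.re) (h2 : 2 ≤ b * ((m + 1 : ℕ) * c.re)) {k : ℕ}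
    (hk : k ≤ m + 1) :
    ‖∑ j ∈ Finset.range k, trigamma (b * (((m - j : ℕ) : ℂ) + c * (m + 1 : ℕ)) + 1) -
      1 / b * (Complex.log (1 + c) - Complex.log (1 + c - ((k / (m + 1 : ℕ) : ℝ) : ℂ)))‖ ≤
      (3 / b ^ 2 + 1 / b) / c.re ^ 2 / (m + 1 : ℕ) := by
  set n := m + 1 with hn
  have hn0 : 0 < n := Nat.succ_pos m
  have hnR : (0 : ℝ) < n := Nat.cast_pos.2 hn0
  set Z : ℕ → ℂ := fun j => 1 + c - ((j / n : ℝ) : ℂ) with hZ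
  set A : ℕ → ℂ := fun j => 1 / b * Complex.log (Z j) with hA
  have hstep : ∀ j < k, ‖trigamma (b * (((m - j : ℕ) : ℂ) + c * n) + 1) - (A j - A (j + 1))‖ ≤
      (3 / b ^ 2 + 1 / b) / (n * c.re) ^ 2 := by
    intro j hj
    have hjm : j ≤ m := by omega
    have h := norm_trigamma_sub_log_le (ρ := n * c.re) hb h1 h2 (re_progression c j)
    have e0 := progression_eq c hjm
    have e1 := progression_add_one_eq c hjm
    rw [e1] at h
    have r0 : 0 < (Z j).re := hc.trans_le (re_one_add_sub_div c (by omega))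
    have r1 : 0 < (Z (j + 1)).re := hc.trans_le (re_one_add_sub_div c (by omega))
    have l0 : Complex.log (n * Z j) = Real.log n + Complex.log (Z j) := log_natCast_mul r0 hn0
    have l1 : Complex.log (((m - j : ℕ) : ℂ) + c * n) =
        Real.log n + Complex.log (Z (j + 1)) := by
      rw [e0]; exact log_natCast_mul r1 hn0
    change ‖trigamma (b * (((m - j : ℕ) : ℂ) + c * n) + 1) -
      1 / b * (Complex.log (n * Z j) - Complex.log (((m - j : ℕ) : ℂ) + c * n))‖ ≤ _ at h
    rw [l0, l1] at h
    refine le_trans (le_of_eq ?_) h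
    congr 1
    simp only [hA]
    ring
  have hsum := norm_sum_sub_telescope_le hstep
  have e : A 0 - A k = 1 / b * (Complex.log (1 + c) -
      Complex.log (1 + c - ((k / n : ℝ) : ℂ))) := by
    simp only [hA, hZ, Nat.cast_zero, zero_div, Complex.ofReal_zero, sub_zero]
    ring
  rw [e] at hsum
  refine hsum.trans ?_
  have hkn : (k : ℝ) ≤ n := Nat.cast_le.2 hk
  refine (mul_le_mul_of_nonneg_right hkn (by positivity)).trans (le_of_eq ?_)
  field_simp

end Progression

/-! ### The covariance matrix -/

section Covariance

open Filter Topology ProbabilityTheory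

/-- The covariance matrix of a centered random vector `(ξ, η)` with `𝔼 |ξ + i η|² = S` and
`𝔼 (ξ + i η)² = S - conj T`. -/
def cumulantMatrix (S T : ℂ) : Matrix (Fin 2) (Fin 2) ℝ :=
  !![S.re - T.re / 2, T.im / 2; T.im / 2, T.re / 2]

theorem continuous_cumulantMatrix : Continuous fun p : ℂ × ℂ => cumulantMatrix p.1 p.2 := by
  refine continuous_matrix fun i j => ?_
  fin_cases i <;> fin_cases j <;> simp [cumulantMatrix] <;> fun_prop

theorem smul_cumulantMatrix (a : ℝ) (S T : ℂ) :
    a • cumulantMatrix S T = cumulantMatrix (a * S) (a * T) := by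
  ext i j
  fin_cases i <;> fin_cases j <;> simp [cumulantMatrix] <;> ring

theorem cumulantMatrix_ofReal (x : ℝ) :
    cumulantMatrix x x = (x / 2) • (1 : Matrix (Fin 2) (Fin 2) ℝ) := by
  ext i j
  fin_cases i <;> fin_cases j <;> simp [cumulantMatrix]
  ring

theorem matrixIntegral_cumulantMatrix {S T : ℝ → ℂ} {t : ℝ}
    (hS : IntervalIntegrable S volume 0 t) (hT : IntervalIntegrable T volume 0 t) :
    matrixIntegral (fun s => cumulantMatrix (S s) (T s)) t =
      cumulantMatrix (∫ s in (0 : ℝ)..t, S s) (∫ s in (0 : ℝ)..t, T s) := by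
  have hre : ∀ {f : ℝ → ℂ}, IntervalIntegrable f volume 0 t →
      ∫ s in (0 : ℝ)..t, (f s).re = (∫ s in (0 : ℝ)..t, f s).re := fun hf =>
    Complex.reCLM.intervalIntegral_comp_comm hf
  have him : ∀ {f : ℝ → ℂ}, IntervalIntegrable f volume 0 t →
      ∫ s in (0 : ℝ)..t, (f s).im = (∫ s in (0 : ℝ)..t, f s).im := fun hf =>
    Complex.imCLM.intervalIntegral_comp_comm hf
  have hSre : IntervalIntegrable (fun s => (S s).re) volume 0 t := ⟨hS.1.re, hS.2.re⟩
  have hTre : IntervalIntegrable (fun s => (T s).re) volume 0 t := ⟨hT.1.re, hT.2.re⟩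
  ext i j
  fin_cases i <;> fin_cases j <;>
    simp [matrixIntegral, cumulantMatrix, intervalIntegral.integral_div, hre hT, him hT, hre hS,
      intervalIntegral.integral_sub hSre (hTre.div_const 2)]

variable {β : ℝ} {δ : ℂ} {m : ℕ} {t : ℝ}

theorem floor_mul_le {n : ℕ} (ht : t ≤ 1) : ⌊(n : ℝ) * t⌋₊ ≤ n := by
  have h : (n : ℝ) * t ≤ n := mul_le_of_le_one_right (Nat.cast_nonneg n) ht
  exact (Nat.floor_mono h).trans (Nat.floor_natCast n).le

/-- The covariance matrix of `ζ_n(t)` as a function of two sums of values of the trigamma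
function. -/
theorem covZeta_eq (hβ : 0 < β) (hδ : -1 / 2 < δ.re) (ht : t ≤ 1) :
    covZeta β δ (m + 1) t = cumulantMatrix
      (∑ j ∈ Finset.range ⌊((m + 1 : ℕ) : ℝ) * t⌋₊,
        trigamma ((β / 2 * (m - j : ℕ) : ℝ) + 1 + 2 * δ.re))
      (∑ j ∈ Finset.range ⌊((m + 1 : ℕ) : ℝ) * t⌋₊,
        trigamma ((β / 2 * (m - j : ℕ) : ℝ) + 1 + δ)) := by
  have hprob := isProbabilityMeasure_cjLaw (m := m) hβ hδ
  have hk : ⌊((m + 1 : ℕ) : ℝ) * t⌋₊ ≤ m + 1 := floor_mul_le ht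
  obtain ⟨hre, him, -⟩ := memLp_logPhi hβ hδ hk
  have ire := hre.integrable one_le_two
  have iim := him.integrable one_le_two
  have v1 := variance_re_logPhi hβ hδ hk
  have v2 := variance_im_logPhi hβ hδ hk
  have v3 := covariance_re_im_logPhi hβ hδ hk
  rw [← covariance_self hre.aestronglyMeasurable.aemeasurable] at v1
  rw [← covariance_self him.aestronglyMeasurable.aemeasurable] at v2
  have hcov : ∀ {X Y : (Fin (m + 1) → ℝ) × (Fin (m + 1) → ℝ) → ℝ} (a b : ℝ),
      Integrable X (cjLaw β δ (m + 1)) → Integrable Y (cjLaw β δ (m + 1)) →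
      cov[fun ω => X ω - a, fun ω => Y ω - b; cjLaw β δ (m + 1)] =
        cov[X, Y; cjLaw β δ (m + 1)] := fun a b hX hY => by
    rw [covariance_sub_const_left hX, covariance_sub_const_right hY]
  ext i j
  fin_cases i <;> fin_cases j
  · refine ((hcov (meanLogPhi β δ (m + 1) t).re (meanLogPhi β δ (m + 1) t).re ire ire).trans
      v1).trans ?_
    rw [Finset.sum_sub_distrib, ← Complex.re_sum, ← Finset.sum_div, ← Complex.re_sum]
    rfl
  · refine ((hcov (meanLogPhi β δ (m + 1) t).re (meanLogPhi β δ (m + 1) t).im ire iim).trans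
      v3).trans ?_
    rw [← Finset.sum_div, ← Complex.im_sum]
    rfl
  · rw [covariance_comm] at v3
    refine ((hcov (meanLogPhi β δ (m + 1) t).im (meanLogPhi β δ (m + 1) t).re iim ire).trans
      v3).trans ?_
    rw [← Finset.sum_div, ← Complex.im_sum]
    rfl
  · refine ((hcov (meanLogPhi β δ (m + 1) t).im (meanLogPhi β δ (m + 1) t).im iim iim).trans
      v2).trans ?_
    rw [← Finset.sum_div, ← Complex.re_sum]
    rfl

theorem meanLogPhi_eq (hβ : 0 < β) (hδ : -1 / 2 < δ.re) (ht : t ≤ 1) :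
    meanLogPhi β δ (m + 1) t = ∑ j ∈ Finset.range ⌊((m + 1 : ℕ) : ℝ) * t⌋₊,
      digammaSub ((β / 2 * (m - j : ℕ) : ℝ) + 1 + 2 * δ.re)
        ((β / 2 * (m - j : ℕ) : ℝ) + 1 + conj δ) :=
  integral_logPhi hβ hδ (floor_mul_le ht)

/-- `ξ + i η` has second absolute moment `𝔼 |ξ + i η|² = ∑ ψ'`. -/
theorem lintegral_enorm_logPhi_sub_sq (hβ : 0 < β) (hδ : -1 / 2 < δ.re) {k : ℕ} (hk : k ≤ m + 1) :
    ∫⁻ ω, ‖logPhi (n := m + 1) k ω - ∫ ω', logPhi k ω' ∂(cjLaw β δ (m + 1))‖ₑ ^ 2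
        ∂(cjLaw β δ (m + 1)) =
      ENNReal.ofReal (∑ j ∈ Finset.range k,
        trigamma ((β / 2 * (m - j : ℕ) : ℝ) + 1 + 2 * δ.re)).re := by
  have hprob := isProbabilityMeasure_cjLaw (m := m) hβ hδ
  obtain ⟨hre, him, hLp⟩ := memLp_logPhi hβ hδ hk
  have hint := hLp.integrable one_le_two
  have v1 := variance_re_logPhi hβ hδ hk
  have v2 := variance_im_logPhi hβ hδ hk
  have e1 : ∫ ω, (logPhi (n := m + 1) k ω).re ∂(cjLaw β δ (m + 1)) =
    (∫ ω, logPhi (n := m + 1) k ω ∂(cjLaw β δ (m + 1))).re := integral_re hint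
  have e2 : ∫ ω, (logPhi (n := m + 1) k ω).im ∂(cjLaw β δ (m + 1)) =
    (∫ ω, logPhi (n := m + 1) k ω ∂(cjLaw β δ (m + 1))).im := integral_im hint
  have hsq : ∀ z : ℂ, ‖z‖ₑ ^ 2 = ‖z.re‖ₑ ^ 2 + ‖z.im‖ₑ ^ 2 := fun z => by
    rw [← ofReal_norm, ← ofReal_norm, ← ofReal_norm,
      ← ENNReal.ofReal_pow (norm_nonneg _), ← ENNReal.ofReal_pow (norm_nonneg _),
      ← ENNReal.ofReal_pow (norm_nonneg _), ← ENNReal.ofReal_add (by positivity) (by positivity),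
      ← Complex.normSq_eq_norm_sq, Complex.normSq_apply, Real.norm_eq_abs, Real.norm_eq_abs,
      sq_abs, sq_abs, sq, sq]
  have w1 : evariance (fun ω => (logPhi (n := m + 1) k ω).re) (cjLaw β δ (m + 1)) =
      ENNReal.ofReal (Var[fun ω => (logPhi (n := m + 1) k ω).re; cjLaw β δ (m + 1)]) :=
    (ofReal_variance hre).symm
  have w2 : evariance (fun ω => (logPhi (n := m + 1) k ω).im) (cjLaw β δ (m + 1)) =
      ENNReal.ofReal (Var[fun ω => (logPhi (n := m + 1) k ω).im; cjLaw β δ (m + 1)]) :=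
    (ofReal_variance him).symm
  have hm : AEMeasurable (fun ω => ‖(logPhi (n := m + 1) k ω -
      ∫ ω', logPhi k ω' ∂(cjLaw β δ (m + 1))).re‖ₑ ^ 2) (cjLaw β δ (m + 1)) :=
    ((Complex.measurable_re.comp_aemeasurable
      ((aemeasurable_logPhi hβ hk).sub_const _)).enorm).pow_const 2
  simp only [hsq]
  rw [lintegral_add_left' hm]
  simp only [Complex.sub_re, Complex.sub_im]
  rw [evariance, e1] at w1
  rw [evariance, e2] at w2
  rw [w1, w2, ← ENNReal.ofReal_add (variance_nonneg _ _) (variance_nonneg _ _), v1, v2,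
    ← Finset.sum_add_distrib, Complex.re_sum]
  congr 1
  exact Finset.sum_congr rfl fun j _ => by ring

end Covariance

/-! ### Regularity of the limits -/

section Limits

open Filter Topology

variable {c : ℂ}

theorem one_add_sub_mem_slitPlane {c : ℂ} {s : ℝ} (hs : 0 < (1 + c - s).re) :
    1 + c - (s : ℂ) ∈ Complex.slitPlane := Or.inl hs

theorem hasDerivAt_log_one_add_sub {s : ℝ} (hs : 0 < (1 + c - s).re) :
    HasDerivAt (fun s : ℝ => Complex.log (1 + c - s)) (-(1 / (1 + c - s))) s := by
  have h := ((hasDerivAt_id s).ofReal_comp.const_sub (1 + c)).clog_real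
    (one_add_sub_mem_slitPlane hs)
  refine h.congr_deriv ?_
  simp [neg_div]

theorem hasDerivAt_entropyJ_one_add_sub {s : ℝ} (hs : 0 < (1 + c - s).re) :
    HasDerivAt (fun s : ℝ => entropyJ (1 + c - s)) (-Complex.log (1 + c - s)) s := by
  have hne : 1 + c - (s : ℂ) ≠ 0 := Complex.slitPlane_ne_zero (one_add_sub_mem_slitPlane hs)
  have h0 : HasDerivAt (fun s : ℝ => 1 + c - (s : ℂ)) (-1) s := by
    simpa using (hasDerivAt_id s).ofReal_comp.const_sub (1 + c)
  have h := ((h0.mul (hasDerivAt_log_one_add_sub hs)).sub h0).add_const (1 : ℂ)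
  refine h.congr_deriv ?_
  field_simp
  ring

theorem re_one_add_sub_pos (hc : 0 < c.re) {s : ℝ} (hs : s ∈ Set.Icc (0 : ℝ) 1) :
    0 < (1 + c - s).re := by
  simp only [Complex.sub_re, Complex.add_re, Complex.one_re, Complex.ofReal_re]
  linarith [hs.2]

theorem continuousOn_log_one_add_sub {t : ℝ} (h : ∀ s ∈ Set.Icc 0 t, 0 < (1 + c - (s : ℝ)).re) :
    ContinuousOn (fun s : ℝ => Complex.log (1 + c - s)) (Set.Icc 0 t) := fun s hs =>
  (hasDerivAt_log_one_add_sub (h s hs)).continuousAt.continuousWithinAt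

theorem continuousOn_one_div_one_add_sub {t : ℝ}
    (h : ∀ s ∈ Set.Icc 0 t, 0 < (1 + c - (s : ℝ)).re) :
    ContinuousOn (fun s : ℝ => 1 / (1 + c - s)) (Set.Icc 0 t) := by
  refine ContinuousOn.div continuousOn_const (by fun_prop) fun s hs => ?_
  exact Complex.slitPlane_ne_zero (one_add_sub_mem_slitPlane (h s hs))

theorem intervalIntegrable_one_div_one_add_sub {t : ℝ} (ht : 0 ≤ t)
    (h : ∀ s ∈ Set.Icc 0 t, 0 < (1 + c - (s : ℝ)).re) :
    IntervalIntegrable (fun s : ℝ => 1 / (1 + c - s)) volume 0 t := by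
  refine ContinuousOn.intervalIntegrable ?_
  rw [Set.uIcc_of_le ht]
  exact continuousOn_one_div_one_add_sub h

theorem integral_one_div_one_add_sub {t : ℝ} (ht : 0 ≤ t)
    (h : ∀ s ∈ Set.Icc 0 t, 0 < (1 + c - (s : ℝ)).re) :
    ∫ s in (0 : ℝ)..t, 1 / (1 + c - s) = Complex.log (1 + c) - Complex.log (1 + c - t) := by
  have h1 := intervalIntegral.integral_eq_sub_of_hasDerivAt
    (f := fun s : ℝ => -Complex.log (1 + c - s)) (f' := fun s : ℝ => 1 / (1 + c - s))
    (fun s hs => by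
      rw [Set.uIcc_of_le ht] at hs
      simpa [Pi.neg_def] using (hasDerivAt_log_one_add_sub (h s hs)).neg)
    (intervalIntegrable_one_div_one_add_sub ht h)
  rw [h1]
  simp
  ring

theorem exists_lipschitz_of_hasDerivAt {f f' : ℝ → ℂ}
    (hf : ∀ s ∈ Set.Icc (0 : ℝ) 1, HasDerivAt f (f' s) s)
    (hf' : ContinuousOn f' (Set.Icc (0 : ℝ) 1)) :
    ∃ L, 0 ≤ L ∧ ∀ s ∈ Set.Icc (0 : ℝ) 1, ∀ t ∈ Set.Icc (0 : ℝ) 1, ‖f s - f t‖ ≤ L * |s - t| := by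
  obtain ⟨L, hL⟩ := isCompact_Icc.exists_bound_of_continuousOn hf'
  refine ⟨L, (norm_nonneg _).trans (hL 0 (by simp)), fun s hs t ht => ?_⟩
  exact (convex_Icc (0 : ℝ) 1).norm_image_sub_le_of_norm_hasDerivWithin_le
    (fun x hx => (hf x hx).hasDerivWithinAt) hL ht hs

theorem exists_lipschitz_log (hc : 0 < c.re) :
    ∃ L, 0 ≤ L ∧ ∀ s ∈ Set.Icc (0 : ℝ) 1, ∀ t ∈ Set.Icc (0 : ℝ) 1,
      ‖Complex.log (1 + c - s) - Complex.log (1 + c - t)‖ ≤ L * |s - t| :=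
  exists_lipschitz_of_hasDerivAt
    (fun _ hs => hasDerivAt_log_one_add_sub (re_one_add_sub_pos hc hs))
    (continuousOn_one_div_one_add_sub fun _ hs => re_one_add_sub_pos hc hs).neg

theorem exists_lipschitz_entropyJ (hc : 0 < c.re) :
    ∃ L, 0 ≤ L ∧ ∀ s ∈ Set.Icc (0 : ℝ) 1, ∀ t ∈ Set.Icc (0 : ℝ) 1,
      ‖entropyJ (1 + c - s) - entropyJ (1 + c - t)‖ ≤ L * |s - t| :=
  exists_lipschitz_of_hasDerivAt
    (fun _ hs => hasDerivAt_entropyJ_one_add_sub (re_one_add_sub_pos hc hs))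
    (continuousOn_log_one_add_sub fun _ hs => re_one_add_sub_pos hc hs).neg

variable {d : ℂ}

theorem limF_eq (d : ℂ) (t : ℝ) : limF d t =
    Complex.log (1 + 2 * d.re) - Complex.log (1 + 2 * d.re - t) -
      (Complex.log (1 + conj d) - Complex.log (1 + conj d - t)) := by
  rw [limF, show (1 : ℂ) - t + 2 * d.re = 1 + 2 * d.re - t by ring,
    show (1 : ℂ) - t + conj d = 1 + conj d - t by ring]
  ring

theorem re_two_mul_ofReal_pos (hd : 0 < d.re) : 0 < (2 * (d.re : ℂ)).re := by
  simpa using hd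

theorem re_conj_pos (hd : 0 < d.re) : 0 < (conj d).re := by
  simpa using hd

theorem exists_lipschitz_limF (hd : 0 < d.re) :
    ∃ L, 0 ≤ L ∧ ∀ s ∈ Set.Icc (0 : ℝ) 1, ∀ t ∈ Set.Icc (0 : ℝ) 1,
      ‖limF d s - limF d t‖ ≤ L * |s - t| := by
  obtain ⟨L₁, h1, hL₁⟩ := exists_lipschitz_log (re_two_mul_ofReal_pos hd)
  obtain ⟨L₂, h2, hL₂⟩ := exists_lipschitz_log (re_conj_pos hd)
  refine ⟨L₂ + L₁, by positivity, fun s hs t ht => ?_⟩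
  rw [limF_eq, limF_eq, show ∀ a b c e f g : ℂ, a - b - (c - e) - (a - f - (c - g)) =
    (e - g) - (b - f) by intros; ring, add_mul]
  exact (norm_sub_le _ _).trans (add_le_add (hL₂ s hs t ht) (hL₁ s hs t ht))

theorem exists_lipschitz_limE (hd : 0 < d.re) :
    ∃ L, 0 ≤ L ∧ ∀ s ∈ Set.Icc (0 : ℝ) 1, ∀ t ∈ Set.Icc (0 : ℝ) 1,
      ‖limE d s - limE d t‖ ≤ L * |s - t| := by
  obtain ⟨L₁, h1, hL₁⟩ := exists_lipschitz_entropyJ (re_two_mul_ofReal_pos hd)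
  obtain ⟨L₂, h2, hL₂⟩ := exists_lipschitz_entropyJ (re_conj_pos hd)
  refine ⟨L₂ + L₁, by positivity, fun s hs t ht => ?_⟩
  rw [limE, limE, show ∀ a b c e f g : ℂ, a - b - c + e - (a - f - c + g) =
    (e - g) - (b - f) by intros; ring, add_mul]
  exact (norm_sub_le _ _).trans (add_le_add (hL₂ s hs t ht) (hL₁ s hs t ht))

theorem floor_mul_div_mem_Icc {n : ℕ} (hn : 0 < n) {t : ℝ} (ht : t ∈ Set.Icc (0 : ℝ) 1) :
    (⌊(n : ℝ) * t⌋₊ : ℝ) / n ∈ Set.Icc (0 : ℝ) 1 ∧ |(⌊(n : ℝ) * t⌋₊ : ℝ) / n - t| ≤ 1 / n := by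
  have hn' : (0 : ℝ) < n := Nat.cast_pos.2 hn
  have h1 : (⌊(n : ℝ) * t⌋₊ : ℝ) ≤ n * t := Nat.floor_le (mul_nonneg hn'.le ht.1)
  have h2 := Nat.lt_floor_add_one ((n : ℝ) * t)
  have h3 : (⌊(n : ℝ) * t⌋₊ : ℝ) ≤ n := Nat.cast_le.2 (floor_mul_le ht.2)
  refine ⟨⟨by positivity, div_le_one_of_le₀ h3 hn'.le⟩, ?_⟩
  rw [div_sub' hn'.ne', abs_div, abs_of_pos hn']
  refine div_le_div_of_nonneg_right (abs_le.2 ⟨by linarith, by linarith⟩) hn'.le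

end Limits

/-! ### The regime where the parameter is proportional to the size -/

section Proportional

open Filter Topology ProbabilityTheory

variable {β : ℝ} {d : ℂ} {m : ℕ}

theorem re_proportional (β : ℝ) (d : ℂ) (n : ℕ) :
    (((β / 2 : ℝ) : ℂ) * d * n).re = β / 2 * d.re * n := by
  rw [mul_assoc, Complex.re_ofReal_mul, Complex.mul_re, Complex.natCast_re, Complex.natCast_im]
  ring

theorem neg_half_lt_re_proportional (hβ : 0 < β) (hd : 0 < d.re) (n : ℕ) :
    -1 / 2 < (((β / 2 : ℝ) : ℂ) * d * n).re := by
  rw [re_proportional]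
  have : 0 ≤ β / 2 * d.re * n := by positivity
  linarith

theorem arg_two_re_eq (β : ℝ) (d : ℂ) (n l : ℕ) :
    ((β / 2 * l : ℝ) : ℂ) + 1 + 2 * (((((β / 2 : ℝ) : ℂ) * d * n).re : ℝ) : ℂ) =
      ((β / 2 : ℝ) : ℂ) * (l + 2 * d.re * n) + 1 := by
  rw [re_proportional]
  push_cast
  ring

theorem arg_conj_eq (β : ℝ) (d : ℂ) (n l : ℕ) :
    ((β / 2 * l : ℝ) : ℂ) + 1 + conj (((β / 2 : ℝ) : ℂ) * d * n) =
      ((β / 2 : ℝ) : ℂ) * (l + conj d * n) + 1 := by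
  rw [map_mul, map_mul, Complex.conj_ofReal, Complex.conj_natCast]
  push_cast
  ring

theorem arg_eq (β : ℝ) (d : ℂ) (n l : ℕ) :
    ((β / 2 * l : ℝ) : ℂ) + 1 + ((β / 2 : ℝ) : ℂ) * d * n =
      ((β / 2 : ℝ) : ℂ) * (l + d * n) + 1 := by
  push_cast
  ring

theorem eventually_le_succ_mul {x : ℝ} (hx : 0 < x) (a : ℝ) :
    ∀ᶠ m : ℕ in atTop, a ≤ (m + 1 : ℕ) * x := by
  have h : Tendsto (fun m : ℕ => ((m + 1 : ℕ) : ℝ) * x) atTop atTop :=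
    (tendsto_natCast_atTop_atTop.comp (tendsto_add_atTop_nat 1)).atTop_mul_const hx
  exact h.eventually_ge_atTop a

/-- The mean of `log Φ_k(1)`, uniformly in `k ≤ n`: the sums of `digammaSub` are replaced by sums
of `logHalf`, which telescope. The constants `log b + log n` cancel between the two sums. -/
theorem exists_norm_integral_logPhi_sub_le (hβ : 0 < β) (hd : 0 < d.re) :
    ∃ K, 0 ≤ K ∧ ∀ᶠ m : ℕ in atTop, ∀ k ≤ m + 1,
      ‖∫ ω, logPhi (n := m + 1) k ω ∂(cjLaw β ((β / 2 : ℝ) * d * (m + 1 : ℕ)) (m + 1)) -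
        ((m + 1 : ℕ) * limE d ((k : ℝ) / (m + 1 : ℕ)) +
          ((1 / β - 1 / 2 : ℝ) : ℂ) * limF d ((k : ℝ) / (m + 1 : ℕ)))‖ ≤ K / (m + 1 : ℕ) := by
  set b : ℝ := β / 2 with hb
  have hb0 : 0 < b := by positivity
  set κ : ℝ := 1 / β - 1 / 2 with hκ
  have hκ' : κ = 1 / (2 * b) - 1 / 2 := by rw [hκ, hb]; ring
  have hc1 := re_two_mul_ofReal_pos hd
  have hc2 := re_conj_pos hd
  refine ⟨8 / (b * d.re) ^ 2 + (2 / b ^ 2 + 2 + |κ|) / (2 * (d.re : ℂ)).re ^ 2 +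
    (2 / b ^ 2 + 2 + |κ|) / (conj d).re ^ 2, by positivity, ?_⟩
  filter_upwards [eventually_le_succ_mul hc1 2, eventually_le_succ_mul hc2 2,
    eventually_le_succ_mul (mul_pos hb0 hc1) 2, eventually_le_succ_mul (mul_pos hb0 hc2) 2]
    with m h1 h2 h3 h4 k hk
  rw [← mul_left_comm] at h3 h4
  rw [integral_logPhi hβ (neg_half_lt_re_proportional hβ hd _) hk]
  simp only [← hb]
  have hn : (0 : ℝ) < (m + 1 : ℕ) := Nat.cast_pos.2 (Nat.succ_pos m)
  have e1 := norm_sum_logHalf_sub_le hb0 hκ' hc1 h1 h3 hk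
  have e2 := norm_sum_logHalf_sub_le hb0 hκ' hc2 h2 h4 hk
  set z : ℕ → ℂ := fun j => (b : ℂ) * ((m - j : ℕ) + 2 * d.re * (m + 1 : ℕ)) + 1 with hz
  set w : ℕ → ℂ := fun j => (b : ℂ) * ((m - j : ℕ) + conj d * (m + 1 : ℕ)) + 1 with hw
  have hterm : ∀ j ∈ Finset.range k, digammaSub (((b * (m - j : ℕ) : ℝ) : ℂ) + 1 +
      2 * ((((b : ℂ) * d * (m + 1 : ℕ)).re : ℝ) : ℂ)) (((b * (m - j : ℕ) : ℝ) : ℂ) + 1 +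
      conj ((b : ℂ) * d * (m + 1 : ℕ))) = digammaSub (z j) (w j) := fun j _ => by
    rw [hb, arg_two_re_eq, arg_conj_eq]
  rw [Finset.sum_congr rfl hterm]
  have e3 : ‖∑ j ∈ Finset.range k, (digammaSub (z j) (w j) - (logHalf (z j) - logHalf (w j)))‖ ≤
      8 / (b * d.re) ^ 2 / (m + 1 : ℕ) := by
    have hstep : ∀ j ∈ Finset.range k,
        ‖digammaSub (z j) (w j) - (logHalf (z j) - logHalf (w j))‖ ≤
        8 / (b * ((m + 1 : ℕ) * d.re)) ^ 2 := fun j _ => by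
      have p1 := re_progression (m := m) (2 * (d.re : ℂ)) j
      have p2 := re_progression (m := m) (conj d) j
      have q : (m + 1 : ℕ) * d.re ≤ (m + 1 : ℕ) * (2 * (d.re : ℂ)).re := by
        refine mul_le_mul_of_nonneg_left ?_ hn.le
        simp
        linarith
      refine norm_digammaSub_sub_logHalf_le (by simpa using h4) ?_ ?_
      · simp only [hz, Complex.add_re, Complex.re_ofReal_mul, Complex.one_re]
        simp only [Complex.add_re] at p1
        have := mul_le_mul_of_nonneg_left (q.trans p1) hb0.le
        linarith
      · simp only [hw, Complex.add_re, Complex.re_ofReal_mul, Complex.one_re]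
        simp only [Complex.add_re, Complex.conj_re] at p2
        have := mul_le_mul_of_nonneg_left p2 hb0.le
        linarith
    refine (norm_sum_le _ _).trans ((Finset.sum_le_card_nsmul _ _ _ hstep).trans ?_)
    rw [Finset.card_range, nsmul_eq_mul]
    have hkn : (k : ℝ) ≤ (m + 1 : ℕ) := Nat.cast_le.2 hk
    refine (mul_le_mul_of_nonneg_right hkn (by positivity)).trans (le_of_eq ?_)
    field_simp
  set n : ℂ := ((m + 1 : ℕ) : ℂ) with hnC
  set s : ℂ := (((k : ℝ) / (m + 1 : ℕ) : ℝ) : ℂ) with hs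
  have split : ∑ j ∈ Finset.range k, digammaSub (z j) (w j) -
      (n * limE d ((k : ℝ) / (m + 1 : ℕ)) + κ * limF d ((k : ℝ) / (m + 1 : ℕ))) =
      ∑ j ∈ Finset.range k, (digammaSub (z j) (w j) - (logHalf (z j) - logHalf (w j))) +
      (∑ j ∈ Finset.range k, (logHalf (z j) - (Real.log b + Real.log (m + 1 : ℕ))) -
        (n * (entropyJ (1 + 2 * d.re) - entropyJ (1 + 2 * d.re - s)) +
          κ * (Complex.log (1 + 2 * d.re) - Complex.log (1 + 2 * d.re - s)))) -
      (∑ j ∈ Finset.range k, (logHalf (w j) - (Real.log b + Real.log (m + 1 : ℕ))) -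
        (n * (entropyJ (1 + conj d) - entropyJ (1 + conj d - s)) +
          κ * (Complex.log (1 + conj d) - Complex.log (1 + conj d - s)))) := by
    rw [limF_eq, limE, ← hs]
    simp only [Finset.sum_sub_distrib]
    ring
  rw [split]
  refine (norm_sub_le _ _).trans ((add_le_add ((norm_add_le _ _).trans (add_le_add e3 e1))
    e2).trans (le_of_eq ?_))
  ring

/-- Convergence of the sums of the trigamma function up to `k = ⌊n t⌋`. -/
theorem tendsto_sum_trigamma {b : ℝ} (hb : 0 < b) {c : ℂ} (hc : 0 < c.re) {t : ℝ}
    (ht : t ∈ Set.Icc (0 : ℝ) 1) :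
    Tendsto (fun m : ℕ => ∑ j ∈ Finset.range ⌊((m + 1 : ℕ) : ℝ) * t⌋₊,
      trigamma (b * (((m - j : ℕ) : ℂ) + c * (m + 1 : ℕ)) + 1)) atTop
      (𝓝 (1 / b * (Complex.log (1 + c) - Complex.log (1 + c - t)))) := by
  have h0 : ∀ C : ℝ, Tendsto (fun m : ℕ => C / ((m + 1 : ℕ) : ℝ)) atTop (𝓝 0) := fun C =>
    (tendsto_const_div_atTop_nhds_zero_nat C).comp (tendsto_add_atTop_nat 1)
  have hfl : Tendsto (fun m : ℕ => (⌊((m + 1 : ℕ) : ℝ) * t⌋₊ : ℝ) / (m + 1 : ℕ)) atTop (𝓝 t) := by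
    rw [tendsto_iff_norm_sub_tendsto_zero]
    refine squeeze_zero (fun _ => norm_nonneg _) (fun m => ?_) (h0 1)
    exact (floor_mul_div_mem_Icc (Nat.succ_pos m) ht).2
  have hlog : Tendsto (fun m : ℕ => 1 / (b : ℂ) * (Complex.log (1 + c) -
      Complex.log (1 + c - (((⌊((m + 1 : ℕ) : ℝ) * t⌋₊ : ℝ) / (m + 1 : ℕ) : ℝ) : ℂ)))) atTop
      (𝓝 (1 / b * (Complex.log (1 + c) - Complex.log (1 + c - t)))) :=
    (((hasDerivAt_log_one_add_sub (re_one_add_sub_pos hc ht)).continuousAt.tendsto.comp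
      hfl).const_sub _).const_mul _
  have hdiff : Tendsto (fun m : ℕ => ∑ j ∈ Finset.range ⌊((m + 1 : ℕ) : ℝ) * t⌋₊,
      trigamma (b * (((m - j : ℕ) : ℂ) + c * (m + 1 : ℕ)) + 1) -
      1 / (b : ℂ) * (Complex.log (1 + c) -
      Complex.log (1 + c - (((⌊((m + 1 : ℕ) : ℝ) * t⌋₊ : ℝ) / (m + 1 : ℕ) : ℝ) : ℂ)))) atTop
      (𝓝 0) := by
    refine squeeze_zero_norm' ?_ (h0 ((3 / b ^ 2 + 1 / b) / c.re ^ 2))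
    filter_upwards [eventually_le_succ_mul hc 2, eventually_le_succ_mul (mul_pos hb hc) 2]
      with m h1 h2
    rw [← mul_left_comm] at h2
    exact norm_sum_trigamma_sub_le hb hc h1 h2 (floor_mul_le ht.2)
  simpa using hdiff.add hlog

/-- For `c = 2 Re d`, these sums are the second moments of the fluctuations of `log Φ_k(1)`; they
are bounded uniformly in `k ≤ n`. -/
theorem exists_re_sum_trigamma_le {b : ℝ} (hb : 0 < b) {c : ℂ} (hc : 0 < c.re) :
    ∃ M, 0 ≤ M ∧ ∀ᶠ m : ℕ in atTop, ∀ k ≤ m + 1,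
      (∑ j ∈ Finset.range k, trigamma (b * (((m - j : ℕ) : ℂ) + c * (m + 1 : ℕ)) + 1)).re ≤ M := by
  obtain ⟨L, hL0, hL⟩ := exists_lipschitz_log hc
  refine ⟨(3 / b ^ 2 + 1 / b) / c.re ^ 2 + 1 / b * L, by positivity, ?_⟩
  filter_upwards [eventually_le_succ_mul hc 2, eventually_le_succ_mul (mul_pos hb hc) 2]
    with m h1 h2 k hk
  rw [← mul_left_comm] at h2
  have h3 := norm_sum_trigamma_sub_le hb hc h1 h2 hk
  have hn : (1 : ℝ) ≤ (m + 1 : ℕ) := Nat.one_le_cast.2 (Nat.succ_pos m)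
  have hkn : (k : ℝ) ≤ (m + 1 : ℕ) := Nat.cast_le.2 hk
  have hmem : (k : ℝ) / (m + 1 : ℕ) ∈ Set.Icc (0 : ℝ) 1 :=
    ⟨by positivity, div_le_one_of_le₀ hkn (by linarith)⟩
  have h4 := hL 0 (by simp) _ hmem
  rw [Complex.ofReal_zero, sub_zero, zero_sub, abs_neg, abs_of_nonneg hmem.1] at h4
  have h5 : (3 / b ^ 2 + 1 / b) / c.re ^ 2 / ((m + 1 : ℕ) : ℝ) ≤
      (3 / b ^ 2 + 1 / b) / c.re ^ 2 := div_le_self (by positivity) hn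
  have h6 : ‖1 / (b : ℂ) * (Complex.log (1 + c) -
      Complex.log (1 + c - (((k : ℝ) / (m + 1 : ℕ) : ℝ) : ℂ)))‖ ≤ 1 / b * L := by
    rw [norm_mul, norm_div, norm_one, Complex.norm_real, Real.norm_eq_abs, abs_of_pos hb]
    exact mul_le_mul_of_nonneg_left (h4.trans (mul_le_of_le_one_right hL0 hmem.2)) (by positivity)
  refine (Complex.re_le_norm _).trans ?_
  have h7 := norm_le_norm_sub_add (∑ j ∈ Finset.range k,
    trigamma (b * (((m - j : ℕ) : ℂ) + c * (m + 1 : ℕ)) + 1)) (1 / (b : ℂ) * (Complex.log (1 + c) -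
      Complex.log (1 + c - (((k : ℝ) / (m + 1 : ℕ) : ℝ) : ℂ))))
  linarith

theorem limZ_eq_cumulantMatrix (β : ℝ) (d : ℂ) (t : ℝ) :
    limZ β d t = cumulantMatrix (1 / ((β / 2 : ℝ) : ℂ) * (1 / (1 + 2 * d.re - t)))
      (1 / ((β / 2 : ℝ) : ℂ) * (1 / (1 + d - t))) := by
  have e1 : (1 / (1 + 2 * d.re - t) : ℂ) = ((1 / (1 - t + 2 * d.re) : ℝ) : ℂ) := by
    push_cast; ring
  have e2 : 1 / (2 * (1 - t + d)) = ((1 / 2 : ℝ) : ℂ) * (1 / (1 + d - t)) := by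
    rw [show (1 : ℂ) - t + d = 1 + d - t by ring]
    push_cast
    rw [one_div_mul_one_div]
  have e3 : 1 / ((β / 2 : ℝ) : ℂ) = ((1 / (β / 2) : ℝ) : ℂ) := by push_cast; ring
  rw [e3, ← smul_cumulantMatrix, limZ, cumulantMatrix, e1, e2, Complex.re_ofReal_mul,
    Complex.im_ofReal_mul, Complex.ofReal_re]
  congr 1
  ext i j
  fin_cases i <;> fin_cases j <;> simp <;> ring

theorem matrixIntegral_limZ (β : ℝ) (hd : 0 < d.re) {t : ℝ} (ht : t ∈ Set.Icc (0 : ℝ) 1) :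
    matrixIntegral (limZ β d) t = cumulantMatrix
      (1 / ((β / 2 : ℝ) : ℂ) * (Complex.log (1 + 2 * d.re) - Complex.log (1 + 2 * d.re - t)))
      (1 / ((β / 2 : ℝ) : ℂ) * (Complex.log (1 + d) - Complex.log (1 + d - t))) := by
  have hpos : ∀ c : ℂ, 0 < c.re → ∀ s ∈ Set.Icc 0 t, 0 < (1 + c - (s : ℝ)).re := fun c hc s hs =>
    re_one_add_sub_pos hc ⟨hs.1, hs.2.trans ht.2⟩
  have hc1 := re_two_mul_ofReal_pos hd
  have h := matrixIntegral_cumulantMatrix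
    ((intervalIntegrable_one_div_one_add_sub ht.1 (hpos _ hc1)).const_mul
      (1 / ((β / 2 : ℝ) : ℂ)))
    ((intervalIntegrable_one_div_one_add_sub ht.1 (hpos _ hd)).const_mul (1 / ((β / 2 : ℝ) : ℂ)))
  rw [intervalIntegral.integral_const_mul, intervalIntegral.integral_const_mul,
    integral_one_div_one_add_sub ht.1 (hpos _ hc1), integral_one_div_one_add_sub ht.1 (hpos _ hd)]
    at h
  rw [← h]
  congr 1
  funext s
  exact limZ_eq_cumulantMatrix β d s

theorem tendsto_covZeta_proportional (hβ : 0 < β) (hd : 0 < d.re) {t : ℝ}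
    (ht : t ∈ Set.Icc (0 : ℝ) 1) :
    Tendsto (fun n : ℕ => covZeta β ((β / 2 : ℝ) * d * n) n t) atTop
      (𝓝 (matrixIntegral (limZ β d) t)) := by
  rw [← tendsto_add_atTop_iff_nat 1, matrixIntegral_limZ β hd ht]
  have hb : 0 < β / 2 := by positivity
  have h1 := tendsto_sum_trigamma hb (re_two_mul_ofReal_pos hd) ht
  have h2 := tendsto_sum_trigamma hb hd ht
  refine ((continuous_cumulantMatrix.tendsto _).comp (h1.prodMk_nhds h2)).congr fun m => ?_
  rw [covZeta_eq hβ (neg_half_lt_re_proportional hβ hd _) ht.2]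
  simp only [Function.comp_apply, arg_two_re_eq, arg_eq]

/-- The convergence of the means is uniform on the closed interval `[0, 1]`. -/
theorem tendstoUniformlyOn_meanLogPhi (hβ : 0 < β) (hd : 0 < d.re) :
    TendstoUniformlyOn
      (fun (n : ℕ) (t : ℝ) => meanLogPhi β ((β / 2 : ℝ) * d * n) n t -
        (n : ℂ) * limE d ((⌊(n : ℝ) * t⌋₊ : ℝ) / n))
      (fun t => ((1 / β - 1 / 2 : ℝ) : ℂ) * limF d t) atTop (Set.Icc 0 1) := by
  obtain ⟨K, hK0, hK⟩ := exists_norm_integral_logPhi_sub_le hβ hd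
  obtain ⟨L, hL0, hL⟩ := exists_lipschitz_limF hd
  set κ : ℝ := 1 / β - 1 / 2 with hκ
  rw [Metric.tendstoUniformlyOn_iff]
  intro ε hε
  have hlim : Tendsto (fun n : ℕ => (K + |κ| * L) / (n : ℝ)) atTop (𝓝 0) :=
    tendsto_const_div_atTop_nhds_zero_nat _
  have hK' : ∀ᶠ n : ℕ in atTop, ∀ k ≤ n,
      ‖∫ ω, logPhi (n := n) k ω ∂(cjLaw β ((β / 2 : ℝ) * d * n) n) -
        (n * limE d ((k : ℝ) / n) + (κ : ℂ) * limF d ((k : ℝ) / n))‖ ≤ K / n := by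
    rw [← map_add_atTop_eq_nat 1]
    exact hK
  filter_upwards [hK', hlim.eventually (gt_mem_nhds hε), eventually_gt_atTop 0]
    with n h1 h2 hn t ht
  have h3 := h1 _ (floor_mul_le (n := n) ht.2)
  have hfl := floor_mul_div_mem_Icc hn ht
  have h4 : ‖(κ : ℂ) * limF d ((⌊(n : ℝ) * t⌋₊ : ℝ) / n) - κ * limF d t‖ ≤ |κ| * (L / n) := by
    rw [← mul_sub, norm_mul, Complex.norm_real, Real.norm_eq_abs]
    refine mul_le_mul_of_nonneg_left ?_ (abs_nonneg _)
    refine (hL _ hfl.1 _ ht).trans ?_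
    rw [div_eq_mul_one_div L]
    exact mul_le_mul_of_nonneg_left hfl.2 hL0
  rw [dist_comm, dist_eq_norm]
  refine lt_of_le_of_lt ?_ h2
  rw [meanLogPhi]
  have e : ∀ a b c e : ℂ, a - b - e = (a - (b + c)) + (c - e) := by intros; ring
  rw [e _ _ ((κ : ℂ) * limF d ((⌊(n : ℝ) * t⌋₊ : ℝ) / n)) _]
  refine (norm_add_le _ _).trans ((add_le_add h3 h4).trans (le_of_eq ?_))
  ring

end Proportional

/-! ### Uniform deviations -/

section Deviation

open Filter Topology ProbabilityTheory

variable {β : ℝ} {d : ℂ}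

theorem add_sq_le_four_mul (a b : ℝ≥0∞) : (a + b) ^ 2 ≤ 4 * (a ^ 2 + b ^ 2) := by
  rcases le_total a b with h | h
  · calc (a + b) ^ 2 ≤ (b + b) ^ 2 := by gcongr
      _ = 4 * b ^ 2 := by ring
      _ ≤ 4 * (a ^ 2 + b ^ 2) := by gcongr; exact le_add_self
  · calc (a + b) ^ 2 ≤ (a + a) ^ 2 := by gcongr
      _ = 4 * a ^ 2 := by ring
      _ ≤ 4 * (a ^ 2 + b ^ 2) := by gcongr; exact le_self_add

/-- The deviation from `ℰ_d` at time `t` is the fluctuation of `log Φ_k(1) / n`, for some `k ≤ n`,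
up to a deterministic error `O(1 / n)`. -/
theorem exists_enorm_logPhi_div_sub_le (hβ : 0 < β) (hd : 0 < d.re) :
    ∃ C, 0 ≤ C ∧ ∀ᶠ m : ℕ in atTop, ∀ ω, ∀ t ∈ Set.Icc (0 : ℝ) 1, ∃ k ≤ m + 1,
      ‖logPhi (n := m + 1) ⌊((m + 1 : ℕ) : ℝ) * t⌋₊ ω / ((m + 1 : ℕ) : ℂ) - limE d t‖ₑ ≤
      ‖logPhi (n := m + 1) k ω - ∫ ω', logPhi (n := m + 1) k ω'
        ∂(cjLaw β ((β / 2 : ℝ) * d * (m + 1 : ℕ)) (m + 1))‖ₑ *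
        ENNReal.ofReal (1 / (m + 1 : ℕ)) + ENNReal.ofReal (C / (m + 1 : ℕ)) := by
  obtain ⟨K, hK0, hK⟩ := exists_norm_integral_logPhi_sub_le hβ hd
  obtain ⟨L, hL0, hL⟩ := exists_lipschitz_limF hd
  obtain ⟨L', hL0', hL'⟩ := exists_lipschitz_limE hd
  set κ : ℝ := 1 / β - 1 / 2 with hκ
  refine ⟨K + |κ| * L + L', by positivity, ?_⟩
  filter_upwards [hK] with m hm ω t ht
  have hn : (0 : ℝ) < (m + 1 : ℕ) := Nat.cast_pos.2 (Nat.succ_pos m)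
  have hn1 : (1 : ℝ) ≤ (m + 1 : ℕ) := Nat.one_le_cast.2 (Nat.succ_pos m)
  have hnC : ((m + 1 : ℕ) : ℂ) ≠ 0 := Nat.cast_ne_zero.2 (Nat.succ_ne_zero m)
  have hk := floor_mul_le (n := m + 1) ht.2
  have hfl := floor_mul_div_mem_Icc (Nat.succ_pos m) ht
  refine ⟨_, hk, ?_⟩
  set k := ⌊((m + 1 : ℕ) : ℝ) * t⌋₊
  have h1 := hm k hk
  set E := ∫ ω', logPhi (n := m + 1) k ω' ∂(cjLaw β ((β / 2 : ℝ) * d * (m + 1 : ℕ)) (m + 1))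
  set s : ℝ := (k : ℝ) / (m + 1 : ℕ) with hs
  have hF0 : limF d 0 = 0 := by rw [limF_eq]; simp
  have h2 : ‖(κ : ℂ) * limF d s‖ ≤ |κ| * L := by
    rw [norm_mul, Complex.norm_real, Real.norm_eq_abs]
    refine mul_le_mul_of_nonneg_left ?_ (abs_nonneg _)
    have := hL s hfl.1 0 (by simp)
    rw [hF0, sub_zero, sub_zero, abs_of_nonneg hfl.1.1] at this
    exact this.trans (mul_le_of_le_one_right hL0 hfl.1.2)
  have h3 : ‖limE d s - limE d t‖ ≤ L' / (m + 1 : ℕ) := by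
    rw [div_eq_mul_one_div L']
    exact (hL' s hfl.1 t ht).trans (mul_le_mul_of_nonneg_left hfl.2 hL0')
  have hnorm : ‖(1 / ((m + 1 : ℕ) : ℂ))‖ = 1 / (m + 1 : ℕ) := by
    rw [norm_div, norm_one, Complex.norm_natCast]
  have h4 : logPhi (n := m + 1) k ω / ((m + 1 : ℕ) : ℂ) - limE d t =
      (logPhi k ω - E) * (1 / ((m + 1 : ℕ) : ℂ)) +
      ((E - ((m + 1 : ℕ) * limE d s + κ * limF d s) + κ * limF d s) * (1 / ((m + 1 : ℕ) : ℂ)) +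
        (limE d s - limE d t)) := by
    field_simp
    ring
  rw [h4]
  refine (enorm_add_le _ _).trans (add_le_add (le_of_eq ?_) ?_)
  · rw [enorm_mul, ← ofReal_norm (1 / _), hnorm]
  · rw [← ofReal_norm]
    refine ENNReal.ofReal_le_ofReal ?_
    refine (norm_add_le _ _).trans ((add_le_add ?_ h3).trans (le_of_eq (add_div _ _ _).symm))
    rw [norm_mul, hnorm, mul_one_div]
    refine div_le_div_of_nonneg_right ((norm_add_le _ _).trans (add_le_add ?_ h2)) hn.le
    exact h1.trans (div_le_self hK0 hn1)

/-- A measurable majorant of the squared uniform deviation, with small expectation. It is the sum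
over `k ≤ n` of the squared fluctuations of `log Φ_k(1)`, divided by `n²`, plus the deterministic
error: the `n + 1` second moments are bounded, so no maximal inequality is needed. -/
theorem exists_majorant_supDeviation (hβ : 0 < β) (hd : 0 < d.re) :
    ∃ e : ℕ → ℝ, Tendsto e atTop (𝓝 0) ∧ ∀ᶠ n : ℕ in atTop,
      ∃ G : (Fin n → ℝ) × (Fin n → ℝ) → ℝ≥0∞,
        AEMeasurable G (cjLaw β ((β / 2 : ℝ) * d * n) n) ∧
        (∀ ω, supDeviation d n ω ^ 2 ≤ G ω) ∧
        ∫⁻ ω, G ω ∂(cjLaw β ((β / 2 : ℝ) * d * n) n) ≤ ENNReal.ofReal (e n) := by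
  obtain ⟨C, hC0, hC⟩ := exists_enorm_logPhi_div_sub_le hβ hd
  obtain ⟨M, hM0, hM⟩ := exists_re_sum_trigamma_le (b := β / 2) (by positivity)
    (re_two_mul_ofReal_pos hd)
  refine ⟨fun n => 4 * (2 * M / n + (C / n) ^ 2), ?_, ?_⟩
  · have h1 := tendsto_const_div_atTop_nhds_zero_nat (2 * M)
    have h2 := tendsto_const_div_atTop_nhds_zero_nat C
    simpa using (h1.add (h2.pow 2)).const_mul 4
  rw [← map_add_atTop_eq_nat 1]
  change ∀ᶠ m : ℕ in atTop, ∃ G : (Fin (m + 1) → ℝ) × (Fin (m + 1) → ℝ) → ℝ≥0∞, _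
  filter_upwards [hC, hM] with m h1 h2
  set μ := cjLaw β ((β / 2 : ℝ) * d * (m + 1 : ℕ)) (m + 1) with hμ
  have hδ := neg_half_lt_re_proportional hβ hd (m + 1)
  have hprob : IsProbabilityMeasure μ := isProbabilityMeasure_cjLaw hβ hδ
  have hn : (0 : ℝ) < (m + 1 : ℕ) := Nat.cast_pos.2 (Nat.succ_pos m)
  set r := ENNReal.ofReal (1 / (m + 1 : ℕ)) with hr
  set Y : ℕ → (Fin (m + 1) → ℝ) × (Fin (m + 1) → ℝ) → ℝ≥0∞ := fun k ω =>
    ‖logPhi (n := m + 1) k ω - ∫ ω', logPhi (n := m + 1) k ω' ∂μ‖ₑ ^ 2 with hY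
  have hYm : ∀ k ∈ Finset.range (m + 2), AEMeasurable (Y k) μ := fun k hk =>
    (((aemeasurable_logPhi hβ (Nat.lt_succ_iff.1 (Finset.mem_range.1 hk))).sub_const _).enorm
      ).pow_const 2
  have hSm : AEMeasurable (fun ω => ∑ k ∈ Finset.range (m + 2), Y k ω) μ :=
    Finset.aemeasurable_fun_sum _ hYm
  refine ⟨fun ω => 4 * ((∑ k ∈ Finset.range (m + 2), Y k ω) * r ^ 2 +
    ENNReal.ofReal (C / (m + 1 : ℕ)) ^ 2), ?_, fun ω => ?_, ?_⟩
  · exact ((hSm.mul_const _).add_const _).const_mul _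
  · set G := 4 * ((∑ k ∈ Finset.range (m + 2), Y k ω) * r ^ 2 +
      ENNReal.ofReal (C / (m + 1 : ℕ)) ^ 2) with hG
    have hsup : supDeviation d (m + 1) ω ≤ G ^ (2⁻¹ : ℝ) := by
      refine iSup₂_le fun t ht => ?_
      obtain ⟨k, hk, hkt⟩ := h1 ω t ht
      rw [ENNReal.le_rpow_inv_iff two_pos, ENNReal.rpow_two]
      refine (pow_le_pow_left' hkt 2).trans ((add_sq_le_four_mul _ _).trans ?_)
      rw [hG, mul_pow]
      gcongr
      exact Finset.single_le_sum (f := fun k => Y k ω) (fun _ _ => zero_le)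
        (Finset.mem_range.2 (Nat.lt_succ_of_le hk))
    refine (pow_le_pow_left' hsup 2).trans (le_of_eq ?_)
    rw [← ENNReal.rpow_two, ← ENNReal.rpow_mul, inv_mul_cancel₀ two_ne_zero, ENNReal.rpow_one]
  · have hYi : ∀ k ∈ Finset.range (m + 2), ∫⁻ ω, Y k ω ∂μ ≤ ENNReal.ofReal M := fun k hk => by
      have hk' := Nat.lt_succ_iff.1 (Finset.mem_range.1 hk)
      simp only [hY, hμ]
      rw [lintegral_enorm_logPhi_sub_sq hβ hδ hk']
      refine ENNReal.ofReal_le_ofReal ?_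
      simp only [arg_two_re_eq]
      exact h2 k hk'
    rw [lintegral_const_mul'' _ ((hSm.mul_const _).add_const _),
      lintegral_add_right _ measurable_const, lintegral_const, measure_univ, mul_one,
      lintegral_mul_const'' _ hSm, lintegral_finsetSum' _ hYm]
    have hsum : ∑ k ∈ Finset.range (m + 2), ∫⁻ ω, Y k ω ∂μ ≤
        ENNReal.ofReal ((m + 2 : ℕ) * M) := by
      refine (Finset.sum_le_card_nsmul _ _ _ hYi).trans (le_of_eq ?_)
      rw [Finset.card_range, nsmul_eq_mul, ENNReal.ofReal_mul (Nat.cast_nonneg _),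
        ENNReal.ofReal_natCast]
    calc 4 * ((∑ k ∈ Finset.range (m + 2), ∫⁻ ω, Y k ω ∂μ) * r ^ 2 +
          ENNReal.ofReal (C / (m + 1 : ℕ)) ^ 2)
        ≤ 4 * (ENNReal.ofReal ((m + 2 : ℕ) * M) * r ^ 2 +
          ENNReal.ofReal (C / (m + 1 : ℕ)) ^ 2) := by gcongr
      _ = ENNReal.ofReal (4 * ((m + 2 : ℕ) * M * (1 / (m + 1 : ℕ)) ^ 2 +
          (C / (m + 1 : ℕ)) ^ 2)) := by
        rw [hr, ← ENNReal.ofReal_pow (by positivity), ← ENNReal.ofReal_pow (by positivity),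
          ← ENNReal.ofReal_mul (by positivity), ← ENNReal.ofReal_add (by positivity)
          (by positivity), show (4 : ℝ≥0∞) = ENNReal.ofReal 4 by simp,
          ← ENNReal.ofReal_mul (by positivity)]
      _ ≤ ENNReal.ofReal (4 * (2 * M / (m + 1 : ℕ) + (C / (m + 1 : ℕ)) ^ 2)) := by
        refine ENNReal.ofReal_le_ofReal ?_
        have : ((m + 2 : ℕ) : ℝ) * M * (1 / (m + 1 : ℕ)) ^ 2 ≤ 2 * M / (m + 1 : ℕ) := by
          rw [show ((m + 2 : ℕ) : ℝ) * M * (1 / (m + 1 : ℕ)) ^ 2 =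
            M * ((m + 2 : ℕ) : ℝ) / ((m + 1 : ℕ) * (m + 1 : ℕ)) by field_simp,
            div_le_div_iff₀ (by positivity) hn]
          push_cast
          have h0 : (0 : ℝ) ≤ m := Nat.cast_nonneg m
          nlinarith [mul_nonneg hM0 h0, mul_nonneg hM0 (mul_nonneg h0 h0)]
        linarith

theorem tendsto_lintegral_supDeviation_sq (hβ : 0 < β) (hd : 0 < d.re) :
    Tendsto (fun n : ℕ => ∫⁻ ω, supDeviation d n ω ^ 2 ∂(cjLaw β ((β / 2 : ℝ) * d * n) n))
      atTop (𝓝 0) := by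
  obtain ⟨e, he, h⟩ := exists_majorant_supDeviation hβ hd
  have he' : Tendsto (fun n => ENNReal.ofReal (e n)) atTop (𝓝 0) := by
    simpa using ENNReal.tendsto_ofReal he
  refine tendsto_of_tendsto_of_tendsto_of_le_of_le' tendsto_const_nhds he'
    (Eventually.of_forall fun _ => zero_le) ?_
  filter_upwards [h] with n hn
  obtain ⟨G, -, hG, hi⟩ := hn
  exact (lintegral_mono hG).trans hi

/-- Markov's inequality, applied to the measurable majorant, as `supDeviation` is a supremum over
an uncountable set of times. -/
theorem tendsto_measure_le_supDeviation (hβ : 0 < β) (hd : 0 < d.re) {ε : ℝ≥0∞} (hε : 0 < ε) :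
    Tendsto (fun n : ℕ => cjLaw β ((β / 2 : ℝ) * d * n) n {ω | ε ≤ supDeviation d n ω})
      atTop (𝓝 0) := by
  obtain ⟨e, he, h⟩ := exists_majorant_supDeviation hβ hd
  -- The threshold is replaced by `min ε 1`, since `ε = ∞` is allowed.
  have hmin : min ε 1 ≠ 0 := (lt_min hε one_pos).ne'
  have hmin' : min ε 1 ≠ ⊤ := ne_top_of_le_ne_top ENNReal.one_ne_top (min_le_right _ _)
  have he' : Tendsto (fun n => ENNReal.ofReal (e n) / min ε 1 ^ 2) atTop (𝓝 0) := by
    have := ENNReal.Tendsto.div_const (ENNReal.tendsto_ofReal he) (b := min ε 1 ^ 2)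
      (Or.inr (pow_ne_zero 2 hmin))
    simpa using this
  refine tendsto_of_tendsto_of_tendsto_of_le_of_le' tendsto_const_nhds he'
    (Eventually.of_forall fun _ => zero_le) ?_
  filter_upwards [h] with n hn
  obtain ⟨G, hGm, hG, hi⟩ := hn
  refine (measure_mono fun ω hω => ?_).trans ((meas_ge_le_lintegral_div hGm (pow_ne_zero 2 hmin)
    (ENNReal.pow_ne_top hmin')).trans (ENNReal.div_le_div_right hi _))
  exact (pow_le_pow_left' ((min_le_left ε 1).trans hω) 2).trans (hG ω)

end Deviation

/-! ### The regime of a fixed parameter -/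

section Fixed

open Filter Topology ProbabilityTheory

/-- A sum in decreasing order of the index, as a difference of two partial sums. -/
theorem sum_range_sub_natSub (f : ℕ → ℂ) {m k : ℕ} (hk : k ≤ m + 1) :
    ∑ j ∈ Finset.range k, f (m - j) =
      ∑ x ∈ Finset.range (m + 1), f x - ∑ x ∈ Finset.range (m + 1 - k), f x := by
  induction k with
  | zero => simp
  | succ k ih =>
    rw [Finset.sum_range_succ, ih (by omega), show m + 1 - k = (m - k) + 1 by omega,
      Finset.sum_range_succ _ (m - k), show m + 1 - (k + 1) = m - k by omega]
    ring

/-- Partial sums of a sequence equivalent to `c / x` up to a summable error. -/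
theorem exists_tendsto_sum_sub_log {f : ℕ → ℂ} {c : ℂ}
    (hf : Summable fun x : ℕ => f x - c / ((x : ℂ) + 1)) :
    ∃ C : ℂ, Tendsto (fun n : ℕ => ∑ x ∈ Finset.range n, f x - c * (Real.log n : ℂ)) atTop
      (𝓝 C) := by
  have h1 := hf.hasSum.tendsto_sum_nat
  have h2 := ((Complex.continuous_ofReal.tendsto _).comp Real.tendsto_harmonic_sub_log).const_mul c
  refine ⟨_, (h1.add h2).congr fun n => ?_⟩
  have h3 : ∑ x ∈ Finset.range n, c / ((x : ℂ) + 1) = c * ((harmonic n : ℝ) : ℂ) := by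
    rw [harmonic]
    push_cast
    rw [Finset.mul_sum]
    exact Finset.sum_congr rfl fun x _ => div_eq_mul_inv _ _
  simp only [Function.comp_apply]
  rw [Finset.sum_sub_distrib, h3]
  push_cast
  ring

/-- As `t < 1`, both `n` and `n - ⌊n t⌋` tend to infinity; the constant in the expansion of the
partial sums cancels, and the logarithm of their ratio tends to `log (1 - t)`. -/
theorem tendsto_sum_reverse {f : ℕ → ℂ} {c : ℂ}
    (hf : Summable fun x : ℕ => f x - c / ((x : ℂ) + 1)) {t : ℝ} (ht : t ∈ Set.Ioo (0 : ℝ) 1) :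
    Tendsto (fun m : ℕ => ∑ j ∈ Finset.range ⌊((m + 1 : ℕ) : ℝ) * t⌋₊, f (m - j)) atTop
      (𝓝 (-c * (Real.log (1 - t) : ℂ))) := by
  obtain ⟨C, hC⟩ := exists_tendsto_sum_sub_log hf
  have hn : Tendsto (fun m : ℕ => m + 1) atTop atTop := tendsto_add_atTop_nat 1
  have hratio : Tendsto (fun n : ℕ => ((n - ⌊(n : ℝ) * t⌋₊ : ℕ) : ℝ) / n) atTop (𝓝 (1 - t)) := by
    have h := ((tendsto_nat_floor_mul_div_atTop (R := ℝ) ht.1.le).comp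
      tendsto_natCast_atTop_atTop).const_sub 1
    refine h.congr' ?_
    filter_upwards [eventually_gt_atTop 0] with n hn
    have hn' : (n : ℝ) ≠ 0 := Nat.cast_ne_zero.2 hn.ne'
    rw [Function.comp_apply, Nat.cast_sub (floor_mul_le ht.2.le), sub_div, div_self hn',
      mul_comm (n : ℝ)]
  have ht1 : 0 < 1 - t := sub_pos.2 ht.2
  have hN : Tendsto (fun n : ℕ => n - ⌊(n : ℝ) * t⌋₊) atTop atTop := by
    have h := hratio.pos_mul_atTop ht1 (tendsto_natCast_atTop_atTop (R := ℝ))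
    refine tendsto_natCast_atTop_iff.1 (h.congr' ?_)
    filter_upwards [eventually_gt_atTop 0] with n hn
    exact div_mul_cancel₀ _ (Nat.cast_ne_zero.2 hn.ne')
  have hlog : Tendsto (fun n : ℕ => (Real.log n : ℂ) -
      (Real.log (n - ⌊(n : ℝ) * t⌋₊ : ℕ) : ℂ)) atTop (𝓝 (-(Real.log (1 - t) : ℂ))) := by
    have h := ((Complex.continuous_ofReal.tendsto _).comp
      ((Real.continuousAt_log ht1.ne').tendsto.comp hratio)).neg
    refine h.congr' ?_
    filter_upwards [eventually_gt_atTop 0, hN.eventually (eventually_gt_atTop 0)] with n hn hn1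
    simp only [Function.comp_apply]
    rw [Real.log_div (Nat.cast_ne_zero.2 (Nat.pos_iff_ne_zero.1 hn1))
      (Nat.cast_ne_zero.2 hn.ne')]
    push_cast
    ring
  have hmain : Tendsto (fun n : ℕ => ∑ x ∈ Finset.range n, f x -
      ∑ x ∈ Finset.range (n - ⌊(n : ℝ) * t⌋₊), f x) atTop (𝓝 (-c * (Real.log (1 - t) : ℂ))) := by
    have h := (hC.sub (hC.comp hN)).add (hlog.const_mul c)
    rw [sub_self, zero_add, mul_neg, ← neg_mul] at h
    refine h.congr fun n => ?_
    simp only [Function.comp_apply]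
    ring
  refine (hmain.comp hn).congr fun m => ?_
  rw [sum_range_sub_natSub f (floor_mul_le ht.2.le)]
  rfl

theorem exists_tendsto_sum_reverse_sub_log {f : ℕ → ℂ} {c : ℂ}
    (hf : Summable fun x : ℕ => f x - c / ((x : ℂ) + 1)) :
    ∃ C : ℂ, Tendsto (fun m : ℕ => ∑ j ∈ Finset.range (m + 1), f (m - j) -
      c * (Real.log (m + 1 : ℕ) : ℂ)) atTop (𝓝 C) := by
  obtain ⟨C, hC⟩ := exists_tendsto_sum_sub_log hf
  refine ⟨C, (hC.comp (tendsto_add_atTop_nat 1)).congr fun m => ?_⟩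
  rw [sum_range_sub_natSub f le_rfl, Nat.sub_self, Finset.sum_range_zero, sub_zero]
  rfl

theorem tendsto_sum_reverse_div_log {f : ℕ → ℂ} {c : ℂ}
    (hf : Summable fun x : ℕ => f x - c / ((x : ℂ) + 1)) :
    Tendsto (fun m : ℕ => ((1 / Real.log (m + 1 : ℕ) : ℝ) : ℂ) *
      ∑ j ∈ Finset.range (m + 1), f (m - j)) atTop (𝓝 c) := by
  obtain ⟨C, hC⟩ := exists_tendsto_sum_reverse_sub_log hf
  have hlog : Tendsto (fun m : ℕ => Real.log (m + 1 : ℕ)) atTop atTop :=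
    Real.tendsto_log_atTop.comp (tendsto_natCast_atTop_atTop.comp (tendsto_add_atTop_nat 1))
  have hinv : Tendsto (fun m : ℕ => ((1 / Real.log (m + 1 : ℕ) : ℝ) : ℂ)) atTop (𝓝 0) := by
    have := (Complex.continuous_ofReal.tendsto _).comp (hlog.const_div_atTop 1)
    simpa [Function.comp_def] using this
  have h := (hinv.mul hC).add_const c
  rw [zero_mul, zero_add] at h
  refine h.congr' ?_
  filter_upwards [hlog.eventually_gt_atTop 0] with m hm
  have : (Real.log (m + 1 : ℕ) : ℂ) ≠ 0 := Complex.ofReal_ne_zero.2 hm.ne'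
  push_cast at this ⊢
  field_simp
  ring

variable {b : ℝ} {w : ℂ}

theorem le_re_progression_fixed (b : ℝ) (w : ℂ) (x : ℕ) :
    min b (1 + w.re) * ((x : ℝ) + 1) ≤ (((b * x : ℝ) : ℂ) + 1 + w).re := by
  simp only [Complex.add_re, Complex.ofReal_re, Complex.one_re]
  have h1 := min_le_left b (1 + w.re)
  have h2 := min_le_right b (1 + w.re)
  have h3 : (0 : ℝ) ≤ x := Nat.cast_nonneg x
  nlinarith

theorem summable_const_div_succ_sq (K : ℝ) : Summable fun x : ℕ => K / ((x : ℝ) + 1) ^ 2 := by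
  simpa only [mul_one_div] using (summable_one_div_add_sq one_pos).mul_left K

theorem norm_one_div_progression_sub_le (hb : 0 < b) (hw : -1 < w.re) (x : ℕ) :
    ‖1 / (((b * x : ℝ) : ℂ) + 1 + w) - 1 / b / ((x : ℂ) + 1)‖ ≤
      ‖(b : ℂ) - 1 - w‖ / (b * min b (1 + w.re)) / ((x : ℝ) + 1) ^ 2 := by
  have hr0 : 0 < min b (1 + w.re) := lt_min hb (by linarith)
  have hx : (0 : ℝ) < (x : ℝ) + 1 := by positivity
  have h1 := (le_re_progression_fixed b w x).trans (Complex.re_le_norm _)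
  have h2 : ‖(b : ℂ) * ((x : ℂ) + 1)‖ = b * ((x : ℝ) + 1) := by
    rw [norm_mul, Complex.norm_real, Real.norm_eq_abs, abs_of_pos hb]
    congr 1
    have : ((x : ℂ) + 1) = ((x + 1 : ℕ) : ℂ) := by push_cast; ring
    rw [this, Complex.norm_natCast]
    push_cast
    ring
  have h3 : ((b * x : ℝ) : ℂ) + 1 + w ≠ 0 := norm_pos_iff.1 ((mul_pos hr0 hx).trans_le h1)
  have h4 : (b : ℂ) * ((x : ℂ) + 1) ≠ 0 := norm_pos_iff.1 (h2 ▸ by positivity)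
  rw [div_div, div_sub_div _ _ h3 h4, norm_div, norm_mul, h2,
    show 1 * ((b : ℂ) * ((x : ℂ) + 1)) - (((b * x : ℝ) : ℂ) + 1 + w) * 1 = b - 1 - w by
      push_cast; ring, div_div]
  refine div_le_div_of_nonneg_left (norm_nonneg _) (by positivity) ?_
  calc b * min b (1 + w.re) * ((x : ℝ) + 1) ^ 2
      = min b (1 + w.re) * ((x : ℝ) + 1) * (b * ((x : ℝ) + 1)) := by ring
    _ ≤ _ := mul_le_mul_of_nonneg_right h1 (by positivity)

/-- Along an arithmetic progression of step `b`, `ψ'` is equivalent to `1 / (b x)`, up to a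
summable error. -/
theorem summable_trigamma_progression_sub (hb : 0 < b) (hw : -1 < w.re) :
    Summable fun x : ℕ => trigamma (((b * x : ℝ) : ℂ) + 1 + w) - 1 / b / ((x : ℂ) + 1) := by
  have hr0 : 0 < min b (1 + w.re) := lt_min hb (by linarith)
  refine Summable.of_norm_bounded ((summable_const_div_succ_sq (1 / min b (1 + w.re) ^ 2)).add
    (summable_const_div_succ_sq (‖(b : ℂ) - 1 - w‖ / (b * min b (1 + w.re))))) fun x => ?_
  have h1 := norm_trigamma_sub_le (r := min b (1 + w.re) * ((x : ℝ) + 1))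
    (mul_pos hr0 (by positivity)) (le_re_progression_fixed b w x)
  rw [mul_pow, ← div_div] at h1
  refine (norm_sub_le_norm_sub_add_norm_sub _ _ _).trans
    (add_le_add h1 (norm_one_div_progression_sub_le hb hw x))

/-- Along an arithmetic progression of step `b`, `ψ(z) - ψ(w)` with `z - w = δ` is equivalent to
`δ / (b x)`, up to a summable error. -/
theorem summable_digammaSub_progression_sub {δ : ℂ} (hb : 0 < b) (hδ : -1 / 2 < δ.re) :
    Summable fun x : ℕ => digammaSub (((b * x : ℝ) : ℂ) + 1 + 2 * δ.re)
      (((b * x : ℝ) : ℂ) + 1 + conj δ) - δ / b / ((x : ℂ) + 1) := by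
  have hw1 : -1 < (2 * (δ.re : ℂ)).re := by
    simp only [Complex.mul_re, Complex.re_ofNat, Complex.im_ofNat, Complex.ofReal_re,
      Complex.ofReal_im]
    linarith
  have hw2 : -1 < (conj δ).re := by rw [Complex.conj_re]; linarith
  set r := min (min b (1 + (2 * (δ.re : ℂ)).re)) (min b (1 + (conj δ).re)) with hr
  have hr0 : 0 < r := lt_min (lt_min hb (by linarith)) (lt_min hb (by linarith))
  have hsub : ∀ x : ℕ, (((b * x : ℝ) : ℂ) + 1 + 2 * δ.re) - (((b * x : ℝ) : ℂ) + 1 + conj δ) = δ :=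
    fun x => by
      apply Complex.ext <;> simp
      ring
  refine Summable.of_norm_bounded ((summable_const_div_succ_sq (‖δ‖ * ‖δ + 1‖ / r ^ 2)).add
    ((summable_const_div_succ_sq (‖(b : ℂ) - 1 - 2 * δ.re‖ /
      (b * min b (1 + (2 * (δ.re : ℂ)).re)))).mul_left ‖δ‖)) fun x => ?_
  have hx : (0 : ℝ) < (x : ℝ) + 1 := by positivity
  have h1 := norm_digammaSub_sub_le (r := r * ((x : ℝ) + 1)) (by positivity)
    ((mul_le_mul_of_nonneg_right (min_le_left _ _) hx.le).trans
      (le_re_progression_fixed b (2 * δ.re) x))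
    ((mul_le_mul_of_nonneg_right (min_le_right _ _) hx.le).trans
      (le_re_progression_fixed b (conj δ) x))
  rw [hsub, mul_pow, ← div_div] at h1
  have h2 := mul_le_mul_of_nonneg_left (norm_one_div_progression_sub_le (w := 2 * δ.re) hb hw1 x)
    (norm_nonneg δ)
  rw [← norm_mul, mul_sub, mul_one_div, ← mul_div_assoc, mul_one_div] at h2
  exact (norm_sub_le_norm_sub_add_norm_sub _ _ _).trans (add_le_add h1 h2)

variable {β : ℝ} {δ : ℂ}

theorem floor_mul_one (n : ℕ) : ⌊(n : ℝ) * 1⌋₊ = n := by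
  rw [mul_one, Nat.floor_natCast]

theorem exists_tendsto_meanLogPhi_one (hβ : 0 < β) (hδ : -1 / 2 < δ.re) :
    ∃ C : ℂ, Tendsto
      (fun n : ℕ => meanLogPhi β δ n 1 - δ / ((β / 2 : ℝ) : ℂ) * (Real.log n : ℂ))
      atTop (𝓝 C) := by
  obtain ⟨C, hC⟩ := exists_tendsto_sum_reverse_sub_log
    (summable_digammaSub_progression_sub (b := β / 2) (by positivity) hδ)
  refine ⟨C, (tendsto_add_atTop_iff_nat 1).1 (hC.congr fun m => ?_)⟩
  rw [meanLogPhi_eq hβ hδ le_rfl, floor_mul_one]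

theorem tendsto_meanLogPhi (hβ : 0 < β) (hδ : -1 / 2 < δ.re) {t : ℝ} (ht : t ∈ Set.Ioo (0 : ℝ) 1) :
    Tendsto (fun n : ℕ => meanLogPhi β δ n t) atTop
      (𝓝 (-(δ / ((β / 2 : ℝ) : ℂ)) * (Real.log (1 - t) : ℂ))) := by
  refine (tendsto_add_atTop_iff_nat 1).1 ((tendsto_sum_reverse
    (summable_digammaSub_progression_sub (b := β / 2) (by positivity) hδ) ht).congr fun m => ?_)
  rw [meanLogPhi_eq hβ hδ ht.2.le]

theorem summable_trigamma_pair (hβ : 0 < β) (hδ : -1 / 2 < δ.re) :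
    (Summable fun x : ℕ => trigamma (((β / 2 * x : ℝ) : ℂ) + 1 + 2 * δ.re) -
      1 / ((β / 2 : ℝ) : ℂ) / ((x : ℂ) + 1)) ∧
    Summable fun x : ℕ => trigamma (((β / 2 * x : ℝ) : ℂ) + 1 + δ) -
      1 / ((β / 2 : ℝ) : ℂ) / ((x : ℂ) + 1) := by
  refine ⟨summable_trigamma_progression_sub (by positivity) ?_,
    summable_trigamma_progression_sub (by positivity) (by linarith)⟩
  simp only [Complex.mul_re, Complex.re_ofNat, Complex.im_ofNat, Complex.ofReal_re,
    Complex.ofReal_im]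
  linarith

theorem tendsto_covZeta_one_div_log (hβ : 0 < β) (hδ : -1 / 2 < δ.re) :
    Tendsto (fun n : ℕ => (1 / Real.log n) • covZeta β δ n 1) atTop
      (𝓝 ((1 / β) • (1 : Matrix (Fin 2) (Fin 2) ℝ))) := by
  obtain ⟨hS, hT⟩ := summable_trigamma_pair hβ hδ
  have h := (tendsto_sum_reverse_div_log hS).prodMk_nhds (tendsto_sum_reverse_div_log hT)
  have hlim : cumulantMatrix (1 / ((β / 2 : ℝ) : ℂ)) (1 / ((β / 2 : ℝ) : ℂ)) =
      (1 / β) • (1 : Matrix (Fin 2) (Fin 2) ℝ) := by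
    rw [show 1 / ((β / 2 : ℝ) : ℂ) = ((1 / (β / 2) : ℝ) : ℂ) by push_cast; ring,
      cumulantMatrix_ofReal]
    congr 1
    field_simp
  rw [← hlim]
  refine (tendsto_add_atTop_iff_nat 1).1 (((continuous_cumulantMatrix.tendsto _).comp h).congr
    fun m => ?_)
  rw [covZeta_eq hβ hδ le_rfl, floor_mul_one, smul_cumulantMatrix]
  rfl

theorem matrixIntegral_limZ0 (β : ℝ) {t : ℝ} (ht : t ∈ Set.Ioo (0 : ℝ) 1) :
    matrixIntegral (limZ0 β) t =
      cumulantMatrix (-(1 / ((β / 2 : ℝ) : ℂ)) * (Real.log (1 - t) : ℂ))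
        (-(1 / ((β / 2 : ℝ) : ℂ)) * (Real.log (1 - t) : ℂ)) := by
  have hpos : ∀ s ∈ Set.Icc 0 t, 0 < ((1 : ℂ) + 0 - (s : ℝ)).re := fun s hs => by
    simp only [Complex.sub_re, Complex.add_re, Complex.one_re, Complex.zero_re, Complex.ofReal_re]
    linarith [hs.2, ht.2]
  have hi := (intervalIntegrable_one_div_one_add_sub ht.1.le hpos).const_mul
    (1 / ((β / 2 : ℝ) : ℂ))
  have h := matrixIntegral_cumulantMatrix hi hi
  rw [intervalIntegral.integral_const_mul, integral_one_div_one_add_sub ht.1.le hpos] at h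
  have e1 : 1 / ((β / 2 : ℝ) : ℂ) * (Complex.log (1 + 0) - Complex.log (1 + 0 - t)) =
      -(1 / ((β / 2 : ℝ) : ℂ)) * (Real.log (1 - t) : ℂ) := by
    rw [add_zero, Complex.log_one, Complex.ofReal_log (sub_pos.2 ht.2).le]
    push_cast
    ring
  rw [e1] at h
  rw [← h]
  congr 1
  funext s
  have e2 : 1 / ((β / 2 : ℝ) : ℂ) * (1 / (1 + 0 - (s : ℂ))) =
      ((1 / (β / 2) * (1 / (1 - s)) : ℝ) : ℂ) := by
    push_cast
    ring
  rw [e2, cumulantMatrix_ofReal, limZ0]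
  congr 1
  rw [one_div_mul_one_div, div_div]
  congr 1
  ring

theorem tendsto_covZeta (hβ : 0 < β) (hδ : -1 / 2 < δ.re) {t : ℝ} (ht : t ∈ Set.Ioo (0 : ℝ) 1) :
    Tendsto (fun n : ℕ => covZeta β δ n t) atTop (𝓝 (matrixIntegral (limZ0 β) t)) := by
  obtain ⟨hS, hT⟩ := summable_trigamma_pair hβ hδ
  have h := (tendsto_sum_reverse hS ht).prodMk_nhds (tendsto_sum_reverse hT ht)
  rw [matrixIntegral_limZ0 β ht]
  refine (tendsto_add_atTop_iff_nat 1).1 (((continuous_cumulantMatrix.tendsto _).comp h).congr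
    fun m => ?_)
  rw [covZeta_eq hβ hδ ht.2.le]
  rfl

theorem memLp_logPhi_of_one_le (hβ : 0 < β) (hδ : -1 / 2 < δ.re) {n k : ℕ} (hn : 1 ≤ n)
    (hk : k ≤ n) : MemLp (logPhi (n := n) k) 2 (cjLaw β δ n) := by
  obtain ⟨m, rfl⟩ := Nat.exists_eq_add_of_le' hn
  exact (memLp_logPhi hβ hδ hk).2.2

end Fixed

end CircularJacobi

end

open CircularJacobi MeasureTheory Filter Topology ENNReal in
theorem theorem2p1 (β : ℝ) (hβ : 0 < β) :
    -- first regime: `δ` is fixed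
    (∀ δ : ℂ, -1 / 2 < δ.re →
      -- the moments exist
      (∀ n : ℕ, 1 ≤ n → ∀ k ≤ n, MemLp (logPhi (n := n) k) 2 (cjLaw β δ n)) ∧
      -- the mean at time `1` and at times `t < 1`
      (∃ C : ℂ, Tendsto
        (fun n : ℕ => meanLogPhi β δ n 1 - δ / ((β / 2 : ℝ) : ℂ) * (Real.log n : ℂ))
        atTop (𝓝 C)) ∧
      (∀ t ∈ Set.Ioo (0 : ℝ) 1, Tendsto (fun n : ℕ => meanLogPhi β δ n t) atTop
        (𝓝 (-(δ / ((β / 2 : ℝ) : ℂ)) * (Real.log (1 - t) : ℂ)))) ∧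
      -- the covariance at time `1` and at times `t < 1`
      Tendsto (fun n : ℕ => (1 / Real.log n) • covZeta β δ n 1) atTop
        (𝓝 ((1 / β) • (1 : Matrix (Fin 2) (Fin 2) ℝ))) ∧
      (∀ t ∈ Set.Ioo (0 : ℝ) 1, Tendsto (fun n : ℕ => covZeta β δ n t) atTop
        (𝓝 (matrixIntegral (limZ0 β) t)))) ∧
    -- second regime: `δ = β' d n`
    (∀ d : ℂ, 0 < d.re →
      -- the moments exist
      (∀ n : ℕ, 1 ≤ n → ∀ k ≤ n,
        MemLp (logPhi (n := n) k) 2 (cjLaw β ((β / 2 : ℝ) * d * n) n)) ∧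
      -- the mean, uniformly in time
      TendstoUniformlyOn
        (fun (n : ℕ) (t : ℝ) => meanLogPhi β ((β / 2 : ℝ) * d * n) n t -
          (n : ℂ) * limE d ((⌊(n : ℝ) * t⌋₊ : ℝ) / n))
        (fun t => ((1 / β - 1 / 2 : ℝ) : ℂ) * limF d t) atTop (Set.Ioc 0 1) ∧
      -- the covariance
      (∀ t ∈ Set.Ioc (0 : ℝ) 1, Tendsto
        (fun n : ℕ => covZeta β ((β / 2 : ℝ) * d * n) n t) atTop
        (𝓝 (matrixIntegral (limZ β d) t))) ∧
      -- uniform convergence in `L²`, and in probability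
      Tendsto (fun n : ℕ => ∫⁻ ω, supDeviation d n ω ^ 2 ∂(cjLaw β ((β / 2 : ℝ) * d * n) n))
        atTop (𝓝 0) ∧
      (∀ ε : ℝ≥0∞, 0 < ε → Tendsto
        (fun n : ℕ => cjLaw β ((β / 2 : ℝ) * d * n) n {ω | ε ≤ supDeviation d n ω})
        atTop (𝓝 0))) := by
  refine ⟨fun δ hδ => ⟨fun n hn k hk => memLp_logPhi_of_one_le hβ hδ hn hk,
    exists_tendsto_meanLogPhi_one hβ hδ, fun t ht => tendsto_meanLogPhi hβ hδ ht,
    tendsto_covZeta_one_div_log hβ hδ, fun t ht => tendsto_covZeta hβ hδ ht⟩, fun d hd =>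
    ⟨fun n hn k hk => memLp_logPhi_of_one_le hβ (neg_half_lt_re_proportional hβ hd n) hn hk,
    (tendstoUniformlyOn_meanLogPhi hβ hd).mono Set.Ioc_subset_Icc_self,
    fun t ht => tendsto_covZeta_proportional hβ hd (Set.Ioc_subset_Icc_self ht),
    tendsto_lintegral_supDeviation_sq hβ hd,
    fun ε hε => tendsto_measure_le_supDeviation hβ hd hε⟩⟩
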